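/- Let $d\ge 1$, $m\ge 3$ be integers, $T,h_0\in(0,\infty)$, $H_T=[0,T]\times\mathbb R^d$, and let $\Lambda_1\subset\mathbb R^d\setminus\{0\}$ be finite. **Spaces.** $\mathfrak B^n$ is the set of bounded Borel functions $\psi$ on $H_T$ such that $\psi(t,\cdot)$ is continuous for each $t$ and the generalized derivatives $D^\alpha\psi(t,\cdot)$, $|\alpha|\le n$, are functions bounded on $H_T$; $\|\psi\|_n^2=\sup_{H_T}\sum_{|\alpha|\le n}|D^\alpha\psi|^2$ (the supremum over $x$ is essential); the same notation is used for functions of $x$ only. $|D^k\varphi|^2=\sum_{|\alpha|=k}|D^\alpha\varphi|^2$. **Equations.** For real functions $q_\lambda\ge0$, $p_\lambda$ $(\lambda\in\Lambda_1)$, $c$, $f$ of $(t,x)$ and $g$ of $x$, put $\delta_{h,\lambda}\varphi(x)=h^{-1}(\varphi(x+h\lambda)-\varphi(x))$, $\partial_\lambda=\sum_i\lambda_iD_i$, $$L_h\varphi=\frac1h\sum_{\lambda\in\Lambda_1}q_\lambda\delta_{h,\lambda}\varphi+\sum_{\lambda\in\Lambda_1}p_\lambda\delta_{h,\lambda}\varphi-c\varphi,\qquad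 \mathcal L\varphi=\tfrac12\sum_{\lambda\in\Lambda_1}q_\lambda\partial_\lambda^2\varphi+\sum_{\lambda\in\Lambda_1}p_\lambda\partial_\lambda\varphi-c\varphi,$$ $$\mathcal L^{(i)}\varphi=\tfrac1{(i+1)(i+2)}\sum_{\lambda\in\Lambda_1}q_\lambda\partial_\lambda^{i+2}\varphi+\tfrac1{i+1}\sum_{\lambda\in\Lambda_1}p_\lambda\partial_\lambda^{i+1}\varphi .$$ For $h\in(0,h_0]$ let $u_h$ be the bounded solution on $H_T$ of $u(t,x)=g(x)+\int_0^t(L_hu+f)(s,x)\,ds$. Let $u^{(0)}$ be the bounded continuous solution in $\mathfrak B^2$ of $u(t,x)=g(x)+\int_0^t(\mathcal Lu+f)(s,x)\,ds$ and, for $1\le j\le k$, let $u^{(j)}$ be the bounded continuous solutions of $$u^{(j)}(t,x)=\int_0^t\Big(\mathcal Lu^{(j)}+\sum_{i=1}^j\tbinom ji\mathcal L^{(i)}u^{(j-i)}\Big)(s,x)\,ds ,$$ these equations being understood on $H_T$ in the sense of generalized functions in $x$ for each $t$. Here $u^{(j)}\in\mathfrak B^{m-3j}$ in case (i) below and $u^{(j)}\in\mathfrak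 B^{m-2j}$ in cases (ii), (iii), for $0\le j\le k$. **Further notation.** Fix $\tau_\lambda\ge0$ $(\lambda\in\Lambda_1)$, $\tau_0>0$, $\delta\in(0,1]$, $K\ge1$. Let $\Lambda=\Lambda_1\cup\Lambda_2$ with $\Lambda_2=\{\ell^1,\dots,\ell^d\}$ a set of $d$ further labels. For $\lambda\in\Lambda_1$ let $T_{h,\lambda}\varphi(x)=\varphi(x+h\lambda)$ and $\bar\delta_{h,\lambda}=\tau_\lambda h^{-1}(T_{h,\lambda}-1)$; let $T_{h,\ell^i}=1$, $\bar\delta_{h,\ell^i}=\tau_0D_i$. For $\lambda=(\lambda^1,\lambda^2)\in\Lambda^2$ let $T_{h,\lambda}=T_{h,\lambda^1}T_{h,\lambda^2}$, $\bar\delta_{h,\lambda}=\bar\delta_{h,\lambda^1}\bar\delta_{h,\lambda^2}$. For $\mu\in\Lambda\cup\Lambda^2$ put $$Q_{h,\mu}\varphi=h^{-1}\sum_{\lambda\in\Lambda_1}(\bar\delta_{h,\mu}q_\lambda)\delta_{h,\lambda}\varphi,\qquad L^0_{h,\mu}\varphi=Q_{h,\mu}\varphi+\sum_{\lambda\in\Lambda_1}(\bar\delta_{h,\mu}p_\lambda)\delta_{h,\lambda}\varphi,$$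 $$A_h(\varphi)=2\sum_{\lambda\in\Lambda}(\bar\delta_{h,\lambda}\varphi)L^0_{h,\lambda}T_{h,\lambda}\varphi,\qquad \chi_{h,\lambda}=q_\lambda+hp_\lambda,\qquad \mathcal Q_h(\varphi)=\sum_{\lambda\in\Lambda_1}\chi_{h,\lambda}(\delta_{h,\lambda}\varphi)^2 .$$ $\mathfrak K$ is the set of bounded linear operators $\mathcal K$ on the bounded Borel functions on $\mathbb R^d$ that preserve nonnegativity and satisfy $\mathcal K1\le1$. Put $|\Lambda_1|^2=\sum_{\lambda\in\Lambda_1}|\lambda|^2$, $\|\Lambda_1\|^2=\sum_{\lambda\in\Lambda_1}|\tau_\lambda\lambda|^2$. **Assumptions.** 1. $p_\lambda,q_\lambda,c,f,g\in\mathfrak B^m$ and $\sup_{H_T}\big(\sum_{\lambda\in\Lambda_1}(|D^nq_\lambda|^2+|D^np_\lambda|^2)+|D^nc|^2\big)\le M_n^2$ for $n=0,\dots,m$. 2. $\chi_{h,\lambda}\ge0$ on $H_T$ for all $h\in(0,h_0]$, $\lambda\in\Lambda_1$. 3. $\sum_{\lambda\in\Lambda_1}\lambda q_\lambda=0$ on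 $H_T$. 4. $c\ge c_0$ on $H_T$ with a constant $c_0>0$. 5. For any $h\in(0,h_0]$ and $t\in[0,T]$ there is $\mathcal K\in\mathfrak K$ such that, for all smooth $\varphi$ on $\mathbb R^d$ that are bounded with all derivatives, on $\mathbb R^d$ at time $t$, $$mA_h(\varphi)\le(1-\delta)\sum_{\lambda\in\Lambda}\mathcal Q_h(\bar\delta_{h,\lambda}\varphi)+K\mathcal Q_h(\varphi)+2(1-\delta)c\,\mathcal K\Big(\sum_{\lambda\in\Lambda}|\bar\delta_{h,\lambda}\varphi|^2\Big).$$ 6. For any $h\in(0,h_0]$, $n\in\{1,\dots,m\}$ and $t\in[0,T]$ there is $\mathcal K\in\mathfrak K$ such that, for all such $\varphi$, on $\mathbb R^d$ at time $t$, $$n\sum_{\nu\in\Lambda}A_h(\bar\delta_{h,\nu}\varphi)+n(n-1)\sum_{\lambda\in\Lambda^2}(\bar\delta_{h,\lambda}\varphi)Q_{h,\lambda}T_{h,\lambda}\varphi\le(1-\delta)\sum_{\lambda\in\Lambda^2}\mathcal Q_h(\bar\delta_{h,\lambda}\varphi)+K\sum_{\lambda\in\Lambda}\mathcal Q_h(\bar\delta_{h,\lambda}\varphi)$$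 $$\qquad+2(1-\delta)c\,\mathcal K\Big(\sum_{\lambda\in\Lambda^2}|\bar\delta_{h,\lambda}\varphi|^2\Big)+K\mathcal K\Big(\sum_{\lambda\in\Lambda}|\bar\delta_{h,\lambda}\varphi|^2\Big).$$ Condition (S): $\Lambda_1=-\Lambda_1$ and $q_\lambda=q_{-\lambda}$ on $H_T$ for $\lambda\in\Lambda_1$. **Theorem.** Let Assumptions 1–6 hold, let $k\ge0$, $l\in[0,m]$ be integers, and let one of the following be met: (i) $m\ge3k+3+l$; (ii) $m\ge2k+3+l$ and (S); (iii) $k$ is odd, $m\ge2k+2+l$, (S) holds, and $p_{-\lambda}=-p_\lambda$ on $H_T$ for all $\lambda\in\Lambda_1$. Then $u_h$ $(0<h\le h_0)$ and $u^{(0)},\dots,u^{(k)}$ exist and are unique, $u_h(t,\cdot)$ and $u^{(j)}(t,\cdot)$ are $l$ times continuously differentiable for each $t\in[0,T]$, and there are functions $r_h$ on $H_T$, also $l$ times continuously differentiable in $x$, such that for every multi-index $\alpha$ with $|\alpha|\le l$ the function $D^\alpha u_h$ is continuous on $H_T$ and $$D^\alpha u_h=D^\alpha u^{(0)}+\sum_{1\le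 j\le k}\frac{h^j}{j!}D^\alpha u^{(j)}+h^{k+1}D^\alpha r_h,\qquad |D^\alpha r_h|\le N(\|f\|_m+\|g\|_m)$$ on $H_T$ for all $h\in(0,h_0]$. The constant $N$ depends only on $d,m,\delta,K,\tau_0,c_0,|\Lambda_1|,\|\Lambda_1\|,M_0,\dots,M_m$; in particular it is independent of $T$ and $h$. In case (iii), $u^{(j)}=0$ on $H_T$ for all odd $j\le k$. -/

import Mathlib

open Set MeasureTheory
open scoped ContDiff

namespace FDExpansion

/-- The Euclidean space `ℝ^d`. -/
abbrev Rd (d : ℕ) : Type := EuclideanSpace ℝ (Fin d)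

/-! ### Classical and generalized derivatives -/

/-- The classical partial derivative `D_i φ`. -/
noncomputable def pderiv {d : ℕ} (i : Fin d) (φ : Rd d → ℝ) : Rd d → ℝ :=
  fun x => fderiv ℝ φ x (EuclideanSpace.single i 1)

/-- The classical derivative `D^α φ = D_1^{α_1} ⋯ D_d^{α_d} φ`. -/
noncomputable def multiDeriv {d : ℕ} (α : Fin d → ℕ) (φ : Rd d → ℝ) : Rd d → ℝ :=
  (List.finRange d).foldr (fun i ψ => (pderiv i)^[α i] ψ) φ

/-- The length `|α|` of a multi-index. -/
def order {d : ℕ} (α : Fin d → ℕ) : ℕ := ∑ i, α i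

/-- Test functions, i.e. elements of `C_0^∞(ℝ^d)`. -/
def IsTest {d : ℕ} (η : Rd d → ℝ) : Prop := ContDiff ℝ ∞ η ∧ HasCompactSupport η

/-- The generalized function `D^α φ` is the locally integrable function `w`. -/
def HasWeakDeriv {d : ℕ} (α : Fin d → ℕ) (φ w : Rd d → ℝ) : Prop :=
  LocallyIntegrable w volume ∧
    ∀ η : Rd d → ℝ, IsTest η →
      ∫ x, φ x * multiDeriv α η x = (-1) ^ order α * ∫ x, w x * η x

open Classical in
/-- A representative of the generalized derivative `D^α φ` (zero if `D^α φ` is not a function);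
it is determined up to a null set. -/
noncomputable def weakDeriv {d : ℕ} (α : Fin d → ℕ) (φ : Rd d → ℝ) : Rd d → ℝ :=
  if h : ∃ w, HasWeakDeriv α φ w then h.choose else 0

/-- `|D^k φ(x)|² = ∑_{|α| = k} |D^α φ(x)|²`, with generalized derivatives. -/
noncomputable def derivSq {d : ℕ} (k : ℕ) (φ : Rd d → ℝ) (x : Rd d) : ℝ :=
  ∑ α ∈ Finset.piAntidiag (Finset.univ : Finset (Fin d)) k, (weakDeriv α φ x) ^ 2

/-- `∂_λ^k φ = (∑_i λ_i D_i)^k φ = ∑_{i_1, …, i_k} λ_{i_1} ⋯ λ_{i_k} D_{i_1} ⋯ D_{i_k} φ`, with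
generalized derivatives. The multi-index belonging to `D_{i_1} ⋯ D_{i_k}` counts how often each
coordinate occurs among `i_1, …, i_k`. -/
noncomputable def weakDirDeriv {d : ℕ} (v : Rd d) (k : ℕ) (φ : Rd d → ℝ) (x : Rd d) : ℝ :=
  ∑ ι : Fin k → Fin d, (∏ j, v (ι j)) *
    weakDeriv (fun i => (Finset.univ.filter (fun j => ι j = i)).card) φ x

/-! ### The spaces `𝔅^m` on `H_T = [0,T] × ℝ^d` -/

/-- `ψ ∈ 𝔅^m_T`: `ψ` is a bounded Borel function on `H_T`, `ψ(t,·)` is continuous for every `t`,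
and the generalized derivatives `D^α ψ(t,·)`, `|α| ≤ m`, are functions bounded uniformly in `t`. -/
def MemB {d : ℕ} (T : ℝ) (m : ℕ) (ψ : ℝ → Rd d → ℝ) : Prop :=
  Measurable (fun z : Icc (0 : ℝ) T × Rd d => ψ z.1 z.2) ∧
  (∀ t ∈ Icc (0 : ℝ) T, Continuous (ψ t)) ∧
  ∃ C : ℝ, ∀ t ∈ Icc (0 : ℝ) T, (∀ x, |ψ t x| ≤ C) ∧
    ∀ α : Fin d → ℕ, order α ≤ m →
      ∃ w, HasWeakDeriv α (ψ t) w ∧ ∀ᵐ x, |w x| ≤ C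

/-- The norm `‖ψ‖_m = (sup_{H_T} ∑_{|α| ≤ m} |D^α ψ|²)^{1/2}`, for each `t` the supremum over `x`
being the essential one. -/
noncomputable def normB {d : ℕ} (T : ℝ) (m : ℕ) (ψ : ℝ → Rd d → ℝ) : ℝ :=
  sInf {C : ℝ | 0 ≤ C ∧ ∀ t ∈ Icc (0 : ℝ) T, ∀ᵐ x,
    ∑ k ∈ Finset.range (m + 1), derivSq k (ψ t) x ≤ C ^ 2}

/-! ### The finite difference operators -/

/-- The finite set `Λ₁` and the coefficients `q_λ`, `p_λ`, `c` (functions of `t` and `x`). Only the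
values of `q_λ`, `p_λ` for `λ ∈ Λ₁` are ever used. -/
structure Scheme (d : ℕ) where
  Λ₁ : Finset (Rd d)
  q : Rd d → ℝ → Rd d → ℝ
  p : Rd d → ℝ → Rd d → ℝ
  c : ℝ → Rd d → ℝ

/-- `δ_{h,λ} φ(x) = (φ(x + hλ) - φ(x)) / h`. -/
noncomputable def fdiff {d : ℕ} (h : ℝ) (v : Rd d) (φ : Rd d → ℝ) : Rd d → ℝ :=
  fun x => (φ (x + h • v) - φ x) / h

namespace Scheme

variable {d : ℕ} (S : Scheme d)

/-- `|Λ₁| = (∑_{λ ∈ Λ₁} |λ|²)^{1/2}`. -/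
noncomputable def size : ℝ := √(∑ v ∈ S.Λ₁, ‖v‖ ^ 2)

/-- `‖Λ₁‖ = (∑_{λ ∈ Λ₁} |τ_λ λ|²)^{1/2}`. -/
noncomputable def weightedSize (τ : Rd d → ℝ) : ℝ := √(∑ v ∈ S.Λ₁, ‖τ v • v‖ ^ 2)

/-- `L_h φ = h⁻¹ ∑ q_λ δ_{h,λ} φ + ∑ p_λ δ_{h,λ} φ - c φ` at time `t`. -/
noncomputable def Lh (h t : ℝ) (φ : Rd d → ℝ) (x : Rd d) : ℝ :=
  h⁻¹ * ∑ v ∈ S.Λ₁, S.q v t x * fdiff h v φ x + ∑ v ∈ S.Λ₁, S.p v t x * fdiff h v φ x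
    - S.c t x * φ x

/-- `ℒ φ = ½ ∑_λ q_λ ∑_{i,j} λ_i λ_j D_i D_j φ + ∑_λ p_λ ∑_i λ_i D_i φ - c φ` at time `t`. -/
noncomputable def limitOp (t : ℝ) (φ : Rd d → ℝ) (x : Rd d) : ℝ :=
  1 / 2 * ∑ v ∈ S.Λ₁, S.q v t x * weakDirDeriv v 2 φ x
    + ∑ v ∈ S.Λ₁, S.p v t x * weakDirDeriv v 1 φ x - S.c t x * φ x

/-- `ℒ^{(i)} φ = 1/((i+1)(i+2)) ∑_λ q_λ ∂_λ^{i+2} φ + 1/(i+1) ∑_λ p_λ ∂_λ^{i+1} φ`. -/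
noncomputable def limitOpI (i : ℕ) (t : ℝ) (φ : Rd d → ℝ) (x : Rd d) : ℝ :=
  1 / (((i : ℝ) + 1) * ((i : ℝ) + 2)) * ∑ v ∈ S.Λ₁, S.q v t x * weakDirDeriv v (i + 2) φ x
    + 1 / ((i : ℝ) + 1) * ∑ v ∈ S.Λ₁, S.p v t x * weakDirDeriv v (i + 1) φ x

/-! ### Solutions -/

/-- `u` is a bounded solution on `H_T` of `u(t,x) = g(x) + ∫_0^t (L_h u(s,x) + f(s,x)) ds`. -/
def IsFDSolution (T h : ℝ) (f : ℝ → Rd d → ℝ) (g : Rd d → ℝ) (u : ℝ → Rd d → ℝ) : Prop :=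
  (∃ C : ℝ, ∀ t ∈ Icc (0 : ℝ) T, ∀ x, |u t x| ≤ C) ∧
  ∀ t ∈ Icc (0 : ℝ) T, ∀ x,
    IntervalIntegrable (fun s => S.Lh h s (u s) x + f s x) volume 0 t ∧
    u t x = g x + ∫ s in (0 : ℝ)..t, (S.Lh h s (u s) x + f s x)

/-- `u` is a bounded continuous function on `H_T` of class `𝔅²` that satisfies
`u(t,x) = g(x) + ∫_0^t (ℒ u(s,x) + F(s,x)) ds` on `H_T` in the sense of generalized functions. -/
def IsLimitSolution (T : ℝ) (F : ℝ → Rd d → ℝ) (g : Rd d → ℝ) (u : ℝ → Rd d → ℝ) : Prop :=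
  ContinuousOn (fun z : ℝ × Rd d => u z.1 z.2) (Icc (0 : ℝ) T ×ˢ univ) ∧
  MemB T 2 u ∧
  ∀ t ∈ Icc (0 : ℝ) T, ∀ η : Rd d → ℝ, IsTest η →
    ∫ x, η x * u t x = (∫ x, η x * g x) +
      ∫ s in (0 : ℝ)..t, ∫ x, η x * (S.limitOp s (u s) x + F s x)

/-- The right-hand side `∑_{i=1}^j C(j,i) ℒ^{(i)} u^{(j-i)}` of the equation for `u^{(j)}`. -/
noncomputable def systemRHS (U : ℕ → ℝ → Rd d → ℝ) (j : ℕ) (t : ℝ) (x : Rd d) : ℝ :=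
  ∑ i ∈ Finset.Icc 1 j, (j.choose i : ℝ) * S.limitOpI i t (U (j - i) t) x

/-- `U 0 = u^{(0)}` solves the Cauchy problem `∂_t u = ℒ u + f`, `u(0,·) = g`, and
`U j = u^{(j)}`, `j = 1, …, k`, solve the system
`u^{(j)}(t,x) = ∫_0^t (ℒ u^{(j)} + ∑_{i=1}^j C(j,i) ℒ^{(i)} u^{(j-i)})(s,x) ds`
in the class `u^{(j)} ∈ 𝔅^{m - a j}`. -/
def IsCoefficientSystem (T : ℝ) (f : ℝ → Rd d → ℝ) (g : Rd d → ℝ) (m a k : ℕ)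
    (U : ℕ → ℝ → Rd d → ℝ) : Prop :=
  S.IsLimitSolution T f g (U 0) ∧
  (∀ j ∈ Finset.Icc 1 k, S.IsLimitSolution T (S.systemRHS U j) 0 (U j)) ∧
  ∀ j ≤ k, MemB T (m - a * j) (U j)

/-! ### The assumptions on the data -/

/-- The coefficients and the data are in `𝔅^m`, and for `k = 0, …, m`
`sup_{H_T} (∑_λ (|D^k q_λ|² + |D^k p_λ|²) + |D^k c|²) ≤ M_k²`. -/
def RegularData (T : ℝ) (m : ℕ) (M : Fin (m + 1) → ℝ) (f : ℝ → Rd d → ℝ) (g : Rd d → ℝ) : Prop :=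
  (∀ v ∈ S.Λ₁, MemB T m (S.p v) ∧ MemB T m (S.q v)) ∧
  MemB T m S.c ∧ MemB T m f ∧ MemB T m (fun _ => g) ∧
  ∀ k : Fin (m + 1), ∀ t ∈ Icc (0 : ℝ) T, ∀ᵐ x,
    ∑ v ∈ S.Λ₁, (derivSq k (S.q v t) x + derivSq k (S.p v t) x) + derivSq k (S.c t) x
      ≤ M k ^ 2

/-- `χ_{h,λ} = q_λ + h p_λ`. -/
def chi (h : ℝ) (v : Rd d) (t : ℝ) (x : Rd d) : ℝ := S.q v t x + h * S.p v t x

/-- The symmetry condition (S): `Λ₁ = -Λ₁` and `q_λ = q_{-λ}`. -/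
def Symm (T : ℝ) : Prop :=
  ∀ v ∈ S.Λ₁, -v ∈ S.Λ₁ ∧ ∀ t ∈ Icc (0 : ℝ) T, ∀ x, S.q v t x = S.q (-v) t x

/-- `p_{-λ} = -p_λ` for `λ ∈ Λ₁`. -/
def POdd (T : ℝ) : Prop :=
  ∀ v ∈ S.Λ₁, ∀ t ∈ Icc (0 : ℝ) T, ∀ x, S.p (-v) t x = -S.p v t x

/-! ### The structural conditions

`Λ = Λ₁ ∪ Λ₂` is represented by the finite set `Λ₁ ⊔ {1, …, d}` (disjoint union): the elements
`ℓ^1, …, ℓ^d` of `Λ₂` only serve as labels of the coordinate directions. -/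

/-- `Λ = Λ₁ ∪ Λ₂`. -/
def fullΛ : Finset (Rd d ⊕ Fin d) := S.Λ₁.disjSum Finset.univ

end Scheme

/-- `T_{h,λ} φ(x) = φ(x + hλ)` for `λ ∈ Λ₁`, and `T_{h,ℓ^i} = 1`. -/
def shift {d : ℕ} (h : ℝ) : Rd d ⊕ Fin d → (Rd d → ℝ) → Rd d → ℝ
  | Sum.inl v, φ => fun x => φ (x + h • v)
  | Sum.inr _, φ => φ

/-- `\bar δ_{h,λ} = τ_λ h⁻¹ (T_{h,λ} - 1)` for `λ ∈ Λ₁`, and `\bar δ_{h,ℓ^i} = τ₀ D_i`. -/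
noncomputable def barDelta {d : ℕ} (τ : Rd d → ℝ) (τ₀ h : ℝ) :
    Rd d ⊕ Fin d → (Rd d → ℝ) → Rd d → ℝ
  | Sum.inl v, φ => fun x => τ v * h⁻¹ * (φ (x + h • v) - φ x)
  | Sum.inr i, φ => fun x => τ₀ * pderiv i φ x

/-- Bounded Borel functions, the elements of `B(ℝ^d)`. -/
def IsBddBorel {d : ℕ} (φ : Rd d → ℝ) : Prop := Measurable φ ∧ ∃ C : ℝ, ∀ x, |φ x| ≤ C

/-- The class `𝔎`: (bounded) linear operators of `B(ℝ^d)` into itself that preserve the cone of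
nonnegative functions and satisfy `𝒦 1 ≤ 1`. The values of `𝒦` outside `B(ℝ^d)` are irrelevant, and
boundedness follows from the other properties. -/
structure IsSubMarkov {d : ℕ} (𝒦 : (Rd d → ℝ) → Rd d → ℝ) : Prop where
  maps : ∀ φ, IsBddBorel φ → IsBddBorel (𝒦 φ)
  add : ∀ φ ψ, IsBddBorel φ → IsBddBorel ψ → 𝒦 (φ + ψ) = 𝒦 φ + 𝒦 ψ
  smul : ∀ (a : ℝ) (φ), IsBddBorel φ → 𝒦 (a • φ) = a • 𝒦 φ
  nonneg : ∀ φ, IsBddBorel φ → (∀ x, 0 ≤ φ x) → ∀ x, 0 ≤ 𝒦 φ x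
  one_le : ∀ x, 𝒦 (fun _ => 1) x ≤ 1

/-- Smooth functions that are bounded together with all their derivatives. -/
def IsBddSmooth {d : ℕ} (φ : Rd d → ℝ) : Prop :=
  ContDiff ℝ ∞ φ ∧ ∀ k : ℕ, ∃ C : ℝ, ∀ x, ‖iteratedFDeriv ℝ k φ x‖ ≤ C

namespace Scheme

variable {d : ℕ} (S : Scheme d)

/-- `Q_{h,μ} φ = h⁻¹ ∑_{λ ∈ Λ₁} (\bar δ_{h,μ} q_λ) δ_{h,λ} φ`, where `\bar δ_{h,μ}` is passed as the
operator `D`. -/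
noncomputable def Qmu (h t : ℝ) (D : (Rd d → ℝ) → Rd d → ℝ) (φ : Rd d → ℝ) (x : Rd d) : ℝ :=
  h⁻¹ * ∑ v ∈ S.Λ₁, D (S.q v t) x * fdiff h v φ x

/-- `L⁰_{h,μ} φ = Q_{h,μ} φ + ∑_{λ ∈ Λ₁} (\bar δ_{h,μ} p_λ) δ_{h,λ} φ`. -/
noncomputable def Lmu (h t : ℝ) (D : (Rd d → ℝ) → Rd d → ℝ) (φ : Rd d → ℝ) (x : Rd d) : ℝ :=
  S.Qmu h t D φ x + ∑ v ∈ S.Λ₁, D (S.p v t) x * fdiff h v φ x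

/-- `A_h(φ) = 2 ∑_{λ ∈ Λ} (\bar δ_{h,λ} φ) L⁰_{h,λ} T_{h,λ} φ`. -/
noncomputable def Ah (τ : Rd d → ℝ) (τ₀ h t : ℝ) (φ : Rd d → ℝ) (x : Rd d) : ℝ :=
  2 * ∑ μ ∈ S.fullΛ, barDelta τ τ₀ h μ φ x * S.Lmu h t (barDelta τ τ₀ h μ) (shift h μ φ) x

/-- `𝒬_h(φ) = ∑_{λ ∈ Λ₁} χ_{h,λ} (δ_{h,λ} φ)²`. -/
noncomputable def calQ (h t : ℝ) (φ : Rd d → ℝ) (x : Rd d) : ℝ :=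
  ∑ v ∈ S.Λ₁, S.chi h v t x * (fdiff h v φ x) ^ 2

/-- `∑_{λ ∈ Λ} |\bar δ_{h,λ} φ|²`. -/
noncomputable def gradSq (τ : Rd d → ℝ) (τ₀ h : ℝ) (φ : Rd d → ℝ) : Rd d → ℝ :=
  fun x => ∑ μ ∈ S.fullΛ, (barDelta τ τ₀ h μ φ x) ^ 2

/-- `∑_{λ ∈ Λ²} |\bar δ_{h,λ} φ|²`. -/
noncomputable def hessSq (τ : Rd d → ℝ) (τ₀ h : ℝ) (φ : Rd d → ℝ) : Rd d → ℝ :=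
  fun x => ∑ μ ∈ S.fullΛ, ∑ ν ∈ S.fullΛ, (barDelta τ τ₀ h μ (barDelta τ τ₀ h ν φ) x) ^ 2

/-- The first structural condition: for every `h ∈ (0,h₀]` and `t ∈ [0,T]` there is `𝒦 ∈ 𝔎` with
`m A_h(φ) ≤ (1-δ) ∑_{λ ∈ Λ} 𝒬_h(\bar δ_{h,λ} φ) + K 𝒬_h(φ)
  + 2 (1-δ) c 𝒦(∑_{λ ∈ Λ} |\bar δ_{h,λ} φ|²)` for all smooth `φ`. -/
def Structural₁ (T h₀ δ K : ℝ) (τ : Rd d → ℝ) (τ₀ : ℝ) (m : ℕ) : Prop :=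
  ∀ h ∈ Ioc (0 : ℝ) h₀, ∀ t ∈ Icc (0 : ℝ) T,
    ∃ 𝒦 : (Rd d → ℝ) → Rd d → ℝ, IsSubMarkov 𝒦 ∧ ∀ φ : Rd d → ℝ, IsBddSmooth φ → ∀ x,
      (m : ℝ) * S.Ah τ τ₀ h t φ x ≤
        (1 - δ) * ∑ μ ∈ S.fullΛ, S.calQ h t (barDelta τ τ₀ h μ φ) x
        + K * S.calQ h t φ x
        + 2 * (1 - δ) * S.c t x * 𝒦 (S.gradSq τ τ₀ h φ) x

/-- The second structural condition: for every `h ∈ (0,h₀]`, `n = 1, …, m` and `t ∈ [0,T]` there is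
`𝒦 ∈ 𝔎` with
`n ∑_{ν ∈ Λ} A_h(\bar δ_{h,ν} φ) + n(n-1) ∑_{λ ∈ Λ²} (\bar δ_{h,λ} φ) Q_{h,λ} T_{h,λ} φ
  ≤ (1-δ) ∑_{λ ∈ Λ²} 𝒬_h(\bar δ_{h,λ} φ) + K ∑_{λ ∈ Λ} 𝒬_h(\bar δ_{h,λ} φ)
  + 2 (1-δ) c 𝒦(∑_{λ ∈ Λ²} |\bar δ_{h,λ} φ|²) + K 𝒦(∑_{λ ∈ Λ} |\bar δ_{h,λ} φ|²)`
for all smooth `φ`. -/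
def Structural₂ (T h₀ δ K : ℝ) (τ : Rd d → ℝ) (τ₀ : ℝ) (m : ℕ) : Prop :=
  ∀ h ∈ Ioc (0 : ℝ) h₀, ∀ n ∈ Finset.Icc 1 m, ∀ t ∈ Icc (0 : ℝ) T,
    ∃ 𝒦 : (Rd d → ℝ) → Rd d → ℝ, IsSubMarkov 𝒦 ∧ ∀ φ : Rd d → ℝ, IsBddSmooth φ → ∀ x,
      (n : ℝ) * ∑ ν ∈ S.fullΛ, S.Ah τ τ₀ h t (barDelta τ τ₀ h ν φ) x
        + (n : ℝ) * ((n : ℝ) - 1) * ∑ μ ∈ S.fullΛ, ∑ ν ∈ S.fullΛ,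
            barDelta τ τ₀ h μ (barDelta τ τ₀ h ν φ) x *
              S.Qmu h t (fun ψ => barDelta τ τ₀ h μ (barDelta τ τ₀ h ν ψ))
                (shift h μ (shift h ν φ)) x ≤
        (1 - δ) * ∑ μ ∈ S.fullΛ, ∑ ν ∈ S.fullΛ,
            S.calQ h t (barDelta τ τ₀ h μ (barDelta τ τ₀ h ν φ)) x
        + K * ∑ μ ∈ S.fullΛ, S.calQ h t (barDelta τ τ₀ h μ φ) x
        + 2 * (1 - δ) * S.c t x * 𝒦 (S.hessSq τ τ₀ h φ) x
        + K * 𝒦 (S.gradSq τ τ₀ h φ) x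

end Scheme

end FDExpansion

namespace FDExpansion

open Filter Topology

variable {d : ℕ}

/-! ### Iterated partial derivatives -/

/-- The `i`-th coordinate vector. -/
noncomputable abbrev bvec (i : Fin d) : Rd d := EuclideanSpace.single i 1

/-- The iterated derivative `D_{i_1} ⋯ D_{i_k} φ` along a word `i_1 ⋯ i_k`. -/
noncomputable def pds (w : List (Fin d)) (φ : Rd d → ℝ) : Rd d → ℝ :=
  w.foldr (fun i ψ => pderiv i ψ) φ

@[simp] theorem pds_nil (φ : Rd d → ℝ) : pds [] φ = φ := rfl

theorem pds_cons (i : Fin d) (w : List (Fin d)) (φ : Rd d → ℝ) :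
    pds (i :: w) φ = pderiv i (pds w φ) := rfl

theorem pds_append (w w' : List (Fin d)) (φ : Rd d → ℝ) :
    pds (w ++ w') φ = pds w (pds w' φ) := by simp [pds, List.foldr_append]

theorem pds_concat (i : Fin d) (w : List (Fin d)) (φ : Rd d → ℝ) :
    pds (w ++ [i]) φ = pds w (pderiv i φ) := by rw [pds_append]; rfl

/-- All derivatives of `φ` of order at most `n` are bounded by `C`. -/
def DB (n : ℕ) (C : ℝ) (φ : Rd d → ℝ) : Prop :=
  ∀ w : List (Fin d), w.length ≤ n → ∀ x, |pds w φ x| ≤ C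

/-- Smooth functions all of whose derivatives are bounded. -/
def Sm (φ : Rd d → ℝ) : Prop := ContDiff ℝ ∞ φ ∧ ∀ n, ∃ C, DB n C φ

theorem DB.bound {n : ℕ} {C : ℝ} {φ : Rd d → ℝ} (h : DB n C φ) (x : Rd d) : |φ x| ≤ C :=
  h [] (Nat.zero_le _) x

theorem DB.nonneg {n : ℕ} {C : ℝ} {φ : Rd d → ℝ} (h : DB n C φ) : 0 ≤ C :=
  (abs_nonneg _).trans (h.bound 0)

theorem DB.mono {n n' : ℕ} {C C' : ℝ} {φ : Rd d → ℝ} (h : DB n C φ) (hn : n' ≤ n) (hC : C ≤ C') :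
    DB n' C' φ := fun w hw x => (h w (hw.trans hn) x).trans hC

theorem DB.pderiv {n : ℕ} {C : ℝ} {φ : Rd d → ℝ} (h : DB (n + 1) C φ) (i : Fin d) :
    DB n C (pderiv i φ) := fun w hw x => by
  rw [← pds_concat]; exact h _ (by simpa using hw) x

theorem DB.pds {k n : ℕ} {C : ℝ} {φ : Rd d → ℝ} (h : DB n C φ) (w : List (Fin d))
    (hw : k + w.length ≤ n) : DB k C (pds w φ) := fun w' hw' x => by
  rw [← pds_append]; exact h _ (by simp; omega) x

theorem DB_zero_iff {C : ℝ} {φ : Rd d → ℝ} : DB 0 C φ ↔ ∀ x, |φ x| ≤ C :=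
  ⟨fun h => h.bound, fun h w hw x => by
    rw [List.length_eq_zero_iff.1 (Nat.le_zero.1 hw)]; exact h x⟩

theorem DB_succ_iff {n : ℕ} {C : ℝ} {φ : Rd d → ℝ} :
    DB (n + 1) C φ ↔ (∀ x, |φ x| ≤ C) ∧ ∀ i, DB n C (FDExpansion.pderiv i φ) := by
  refine ⟨fun h => ⟨h.bound, h.pderiv⟩, fun h w hw x => ?_⟩
  rcases List.eq_nil_or_concat w with rfl | ⟨w', i, rfl⟩
  · exact h.1 x
  · rw [List.concat_eq_append, pds_concat]
    exact h.2 i w' (by simpa using hw) x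

/-! ### Smooth functions -/

theorem contDiff_pderiv {n : ℕ∞} {φ : Rd d → ℝ} (h : ContDiff ℝ (n + 1) φ) (i : Fin d) :
    ContDiff ℝ n (pderiv i φ) :=
  (h.fderiv_right le_rfl).clm_apply contDiff_const

theorem contDiff_pderiv_top {φ : Rd d → ℝ} (h : ContDiff ℝ ∞ φ) (i : Fin d) :
    ContDiff ℝ ∞ (pderiv i φ) := contDiff_pderiv (n := ⊤) h i

theorem contDiff_pds_top {φ : Rd d → ℝ} (h : ContDiff ℝ ∞ φ) (w : List (Fin d)) :
    ContDiff ℝ ∞ (pds w φ) := by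
  induction w with
  | nil => exact h
  | cons i w ih => exact contDiff_pderiv_top ih i

theorem differentiable_of_top {φ : Rd d → ℝ} (h : ContDiff ℝ ∞ φ) : Differentiable ℝ φ :=
  h.differentiable (by simp)

theorem pderiv_add {φ ψ : Rd d → ℝ} (hφ : Differentiable ℝ φ) (hψ : Differentiable ℝ ψ)
    (i : Fin d) : pderiv i (fun x => φ x + ψ x) = fun x => pderiv i φ x + pderiv i ψ x := by
  funext x; simp only [pderiv]; rw [fderiv_fun_add (hφ x) (hψ x)]; rfl

theorem pderiv_sub {φ ψ : Rd d → ℝ} (hφ : Differentiable ℝ φ) (hψ : Differentiable ℝ ψ)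
    (i : Fin d) : pderiv i (fun x => φ x - ψ x) = fun x => pderiv i φ x - pderiv i ψ x := by
  funext x; simp only [pderiv]; rw [fderiv_fun_sub (hφ x) (hψ x)]; rfl

theorem pderiv_const_mul {φ : Rd d → ℝ} (hφ : Differentiable ℝ φ) (a : ℝ)
    (i : Fin d) : pderiv i (fun x => a * φ x) = fun x => a * pderiv i φ x := by
  funext x; simp only [pderiv]; rw [fderiv_const_mul (hφ x)]; rfl

theorem pderiv_mul {φ ψ : Rd d → ℝ} (hφ : Differentiable ℝ φ) (hψ : Differentiable ℝ ψ)
    (i : Fin d) :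
    pderiv i (fun x => φ x * ψ x) = fun x => pderiv i φ x * ψ x + φ x * pderiv i ψ x := by
  funext x; simp only [pderiv]; rw [fderiv_fun_mul (hφ x) (hψ x)]; simp; ring

theorem pderiv_translate (φ : Rd d → ℝ) (a : Rd d) (i : Fin d) :
    pderiv i (fun x => φ (x + a)) = fun x => pderiv i φ (x + a) := by
  funext x; simp only [pderiv]; rw [fderiv_comp_add_right]

theorem pderiv_const (a : ℝ) (i : Fin d) : pderiv i (fun _ : Rd d => a) = fun _ => 0 := by
  funext x; simp [pderiv]

theorem pderiv_sum {ι : Type*} (s : Finset ι) {φ : ι → Rd d → ℝ}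
    (hφ : ∀ v ∈ s, Differentiable ℝ (φ v)) (i : Fin d) :
    pderiv i (fun x => ∑ v ∈ s, φ v x) = fun x => ∑ v ∈ s, pderiv i (φ v) x := by
  funext x; simp only [pderiv]; rw [fderiv_fun_sum (fun v hv => hφ v hv x)]; simp

theorem pderiv_comm {φ : Rd d → ℝ} (h : ContDiff ℝ 2 φ) (i j : Fin d) :
    pderiv i (pderiv j φ) = pderiv j (pderiv i φ) := by
  funext x
  have hd : DifferentiableAt ℝ (fderiv ℝ φ) x :=
    ((h.fderiv_right (m := 1) (by norm_num)).differentiable (by norm_num)) x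
  have key : ∀ a b : Fin d, pderiv a (pderiv b φ) x
      = fderiv ℝ (fderiv ℝ φ) x (bvec a) (bvec b) := by
    intro a b
    change fderiv ℝ (fun y => fderiv ℝ φ y (bvec b)) x (bvec a) = _
    rw [fderiv_clm_apply hd (differentiableAt_const _)]
    simp
  have hs := (h.contDiffAt (x := x)).isSymmSndFDerivAt (by simp)
  rw [key, key]; exact hs _ _

theorem pderiv_comm_top {φ : Rd d → ℝ} (h : ContDiff ℝ ∞ φ) (i j : Fin d) :
    pderiv i (pderiv j φ) = pderiv j (pderiv i φ) :=
  pderiv_comm (contDiff_infty.1 h 2) i j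

theorem pds_pderiv {φ : Rd d → ℝ} (h : ContDiff ℝ ∞ φ) (w : List (Fin d)) (i : Fin d) :
    pds w (pderiv i φ) = pderiv i (pds w φ) := by
  induction w with
  | nil => rfl
  | cons j w ih => rw [pds_cons, ih, pds_cons, pderiv_comm_top (contDiff_pds_top h w)]

theorem pds_perm {φ : Rd d → ℝ} (h : ContDiff ℝ ∞ φ) {w w' : List (Fin d)} (hw : w.Perm w') :
    pds w φ = pds w' φ := by
  induction hw with
  | nil => rfl
  | cons i _ ih => rw [pds_cons, pds_cons, ih]
  | swap i j w => simp only [pds_cons]; rw [pderiv_comm_top (contDiff_pds_top h w)]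
  | trans _ _ ih ih' => rw [ih, ih']

theorem pds_add {φ ψ : Rd d → ℝ} (hφ : ContDiff ℝ ∞ φ) (hψ : ContDiff ℝ ∞ ψ)
    (w : List (Fin d)) : pds w (fun x => φ x + ψ x) = fun x => pds w φ x + pds w ψ x := by
  induction w with
  | nil => rfl
  | cons i w ih =>
    rw [pds_cons, ih, pderiv_add (differentiable_of_top (contDiff_pds_top hφ w))
      (differentiable_of_top (contDiff_pds_top hψ w))]; rfl

theorem pds_sub {φ ψ : Rd d → ℝ} (hφ : ContDiff ℝ ∞ φ) (hψ : ContDiff ℝ ∞ ψ)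
    (w : List (Fin d)) : pds w (fun x => φ x - ψ x) = fun x => pds w φ x - pds w ψ x := by
  induction w with
  | nil => rfl
  | cons i w ih =>
    rw [pds_cons, ih, pderiv_sub (differentiable_of_top (contDiff_pds_top hφ w))
      (differentiable_of_top (contDiff_pds_top hψ w))]; rfl

theorem pds_const_mul {φ : Rd d → ℝ} (hφ : ContDiff ℝ ∞ φ) (a : ℝ)
    (w : List (Fin d)) : pds w (fun x => a * φ x) = fun x => a * pds w φ x := by
  induction w with
  | nil => rfl
  | cons i w ih =>
    rw [pds_cons, ih, pderiv_const_mul (differentiable_of_top (contDiff_pds_top hφ w))]; rfl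

theorem pds_translate (φ : Rd d → ℝ) (a : Rd d)
    (w : List (Fin d)) : pds w (fun x => φ (x + a)) = fun x => pds w φ (x + a) := by
  induction w with
  | nil => rfl
  | cons i w ih => rw [pds_cons, ih, pderiv_translate]; rfl

theorem pds_sum {ι : Type*} (s : Finset ι) {φ : ι → Rd d → ℝ}
    (hφ : ∀ v ∈ s, ContDiff ℝ ∞ (φ v)) (w : List (Fin d)) :
    pds w (fun x => ∑ v ∈ s, φ v x) = fun x => ∑ v ∈ s, pds w (φ v) x := by
  induction w with
  | nil => rfl
  | cons i w ih =>
    rw [pds_cons, ih,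
      pderiv_sum s (fun v hv => differentiable_of_top (contDiff_pds_top (hφ v hv) w))]; rfl

theorem pds_zero (w : List (Fin d)) : pds w (fun _ : Rd d => (0 : ℝ)) = fun _ => 0 := by
  induction w with
  | nil => rfl
  | cons i w ih => rw [pds_cons, ih, pderiv_const]

/-! ### Bounds of derivatives of sums, products and translates -/

theorem DB.add {n : ℕ} {C C' : ℝ} {φ ψ : Rd d → ℝ} (h : DB n C φ) (h' : DB n C' ψ)
    (hφ : ContDiff ℝ ∞ φ) (hψ : ContDiff ℝ ∞ ψ) : DB n (C + C') (fun x => φ x + ψ x) :=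
  fun w hw x => by
    rw [pds_add hφ hψ]; exact (abs_add_le _ _).trans (add_le_add (h w hw x) (h' w hw x))

theorem DB.sub {n : ℕ} {C C' : ℝ} {φ ψ : Rd d → ℝ} (h : DB n C φ) (h' : DB n C' ψ)
    (hφ : ContDiff ℝ ∞ φ) (hψ : ContDiff ℝ ∞ ψ) : DB n (C + C') (fun x => φ x - ψ x) :=
  fun w hw x => by
    rw [pds_sub hφ hψ]; exact (abs_sub _ _).trans (add_le_add (h w hw x) (h' w hw x))

theorem DB.const_mul {n : ℕ} {C : ℝ} {φ : Rd d → ℝ} (h : DB n C φ)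
    (hφ : ContDiff ℝ ∞ φ) (a : ℝ) : DB n (|a| * C) (fun x => a * φ x) :=
  fun w hw x => by
    rw [pds_const_mul hφ, abs_mul]
    exact mul_le_mul_of_nonneg_left (h w hw x) (abs_nonneg a)

theorem DB.translate {n : ℕ} {C : ℝ} {φ : Rd d → ℝ} (h : DB n C φ) (a : Rd d) :
    DB n C (fun x => φ (x + a)) :=
  fun w hw x => by rw [pds_translate]; exact h w hw _

theorem DB.sum {ι : Type*} (s : Finset ι) {n : ℕ} {C : ι → ℝ} {φ : ι → Rd d → ℝ}
    (h : ∀ v ∈ s, DB n (C v) (φ v)) (hφ : ∀ v ∈ s, ContDiff ℝ ∞ (φ v)) :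
    DB n (∑ v ∈ s, C v) (fun x => ∑ v ∈ s, φ v x) :=
  fun w hw x => by
    rw [pds_sum s hφ]
    exact (Finset.abs_sum_le_sum_abs _ _).trans (Finset.sum_le_sum fun v hv => h v hv w hw x)

theorem DB.mul {n : ℕ} : ∀ {C C' : ℝ} {φ ψ : Rd d → ℝ}, DB n C φ → DB n C' ψ →
    ContDiff ℝ ∞ φ → ContDiff ℝ ∞ ψ → DB n (2 ^ n * C * C') (fun x => φ x * ψ x) := by
  induction n with
  | zero =>
    intro C C' φ ψ h h' _ _
    rw [DB_zero_iff]; intro x; rw [abs_mul, pow_zero, one_mul]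
    exact mul_le_mul (h.bound x) (h'.bound x) (abs_nonneg _) h.nonneg
  | succ n ih =>
    intro C C' φ ψ h h' hφ hψ
    have hc := mul_nonneg h.nonneg h'.nonneg
    rw [DB_succ_iff]
    refine ⟨fun x => ?_, fun i => ?_⟩
    · rw [abs_mul]
      refine (mul_le_mul (h.bound x) (h'.bound x) (abs_nonneg _) h.nonneg).trans ?_
      have : (1 : ℝ) ≤ 2 ^ (n + 1) := one_le_pow₀ (by norm_num)
      nlinarith
    · rw [pderiv_mul (differentiable_of_top hφ) (differentiable_of_top hψ)]
      have h1 := ih (h.pderiv i) (h'.mono (Nat.le_succ n) le_rfl) (contDiff_pderiv_top hφ i) hψ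
      have h2 := ih (h.mono (Nat.le_succ n) le_rfl) (h'.pderiv i) hφ (contDiff_pderiv_top hψ i)
      refine (h1.add h2 ((contDiff_pderiv_top hφ i).mul hψ)
        (hφ.mul (contDiff_pderiv_top hψ i))).mono le_rfl (le_of_eq (by ring))

theorem Sm.pderiv {φ : Rd d → ℝ} (h : Sm φ) (i : Fin d) : Sm (pderiv i φ) :=
  ⟨contDiff_pderiv_top h.1 i, fun n => (h.2 (n + 1)).imp fun _ hC => hC.pderiv i⟩

theorem Sm.pds {φ : Rd d → ℝ} (h : Sm φ) (w : List (Fin d)) : Sm (pds w φ) := by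
  induction w with
  | nil => exact h
  | cons i w ih => exact ih.pderiv i

theorem Sm.add {φ ψ : Rd d → ℝ} (h : Sm φ) (h' : Sm ψ) : Sm (fun x => φ x + ψ x) :=
  ⟨h.1.add h'.1, fun n => by
    obtain ⟨C, hC⟩ := h.2 n; obtain ⟨C', hC'⟩ := h'.2 n; exact ⟨_, hC.add hC' h.1 h'.1⟩⟩

theorem Sm.sub {φ ψ : Rd d → ℝ} (h : Sm φ) (h' : Sm ψ) : Sm (fun x => φ x - ψ x) :=
  ⟨h.1.sub h'.1, fun n => by
    obtain ⟨C, hC⟩ := h.2 n; obtain ⟨C', hC'⟩ := h'.2 n; exact ⟨_, hC.sub hC' h.1 h'.1⟩⟩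

theorem Sm.mul {φ ψ : Rd d → ℝ} (h : Sm φ) (h' : Sm ψ) : Sm (fun x => φ x * ψ x) :=
  ⟨h.1.mul h'.1, fun n => by
    obtain ⟨C, hC⟩ := h.2 n; obtain ⟨C', hC'⟩ := h'.2 n; exact ⟨_, hC.mul hC' h.1 h'.1⟩⟩

theorem Sm.const_mul {φ : Rd d → ℝ} (h : Sm φ) (a : ℝ) : Sm (fun x => a * φ x) :=
  ⟨contDiff_const.mul h.1, fun n => by
    obtain ⟨C, hC⟩ := h.2 n; exact ⟨_, hC.const_mul h.1 a⟩⟩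

theorem Sm.translate {φ : Rd d → ℝ} (h : Sm φ) (a : Rd d) : Sm (fun x => φ (x + a)) :=
  ⟨h.1.comp (contDiff_id.add contDiff_const), fun n => by
    obtain ⟨C, hC⟩ := h.2 n; exact ⟨_, hC.translate a⟩⟩

theorem Sm.sum {ι : Type*} (s : Finset ι) {φ : ι → Rd d → ℝ} (h : ∀ v ∈ s, Sm (φ v)) :
    Sm (fun x => ∑ v ∈ s, φ v x) :=
  ⟨ContDiff.sum fun v hv => (h v hv).1, fun n => by
    have : ∀ v, ∃ C, v ∈ s → DB n C (φ v) := fun v => by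
      by_cases hv : v ∈ s
      · exact ((h v hv).2 n).imp fun C hC _ => hC
      · exact ⟨0, fun h => (hv h).elim⟩
    choose C hC using this
    exact ⟨_, DB.sum s hC fun v hv => (h v hv).1⟩⟩

theorem DB_const (n : ℕ) (a : ℝ) : DB n |a| (fun _ : Rd d => a) := by
  cases n with
  | zero => rw [DB_zero_iff]; exact fun _ => le_rfl
  | succ n =>
    rw [DB_succ_iff]; refine ⟨fun _ => le_rfl, fun i w _ x => ?_⟩
    rw [pderiv_const, pds_zero]; simp

theorem Sm_const (a : ℝ) : Sm (fun _ : Rd d => a) :=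
  ⟨contDiff_const, fun n => ⟨_, DB_const n a⟩⟩

theorem Sm.bound {φ : Rd d → ℝ} (h : Sm φ) : ∃ C, ∀ x, |φ x| ≤ C :=
  (h.2 0).imp fun _ hC => hC.bound

theorem Sm.differentiable {φ : Rd d → ℝ} (h : Sm φ) : Differentiable ℝ φ :=
  differentiable_of_top h.1

theorem Sm.continuous {φ : Rd d → ℝ} (h : Sm φ) : Continuous φ := h.1.continuous

/-! ### Increments -/

theorem euclid_eq_sum (v : Rd d) : v = ∑ i, v i • bvec i := by
  have := (EuclideanSpace.basisFun (Fin d) ℝ).sum_repr v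
  simpa using this.symm

theorem fderiv_apply_eq (φ : Rd d → ℝ) (x v : Rd d) :
    fderiv ℝ φ x v = ∑ i, v i * pderiv i φ x := by
  conv_lhs => rw [euclid_eq_sum v]
  simp [pderiv]

theorem abs_coord_le (v : Rd d) (i : Fin d) : |v i| ≤ ‖v‖ := by
  simpa using PiLp.norm_apply_le v i

theorem sum_coord_mul_le (v : Rd d) {a : Fin d → ℝ} {C : ℝ} (h : ∀ i, |a i| ≤ C) :
    |∑ i, v i * a i| ≤ d * ‖v‖ * C := by
  calc |∑ i, v i * a i| ≤ ∑ i : Fin d, ‖v‖ * C := by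
        refine (Finset.abs_sum_le_sum_abs _ _).trans (Finset.sum_le_sum fun i _ => ?_)
        rw [abs_mul]
        exact mul_le_mul (abs_coord_le v i) (h i) (abs_nonneg _) (norm_nonneg _)
    _ = d * ‖v‖ * C := by simp; ring

theorem norm_fderiv_le_of_pderiv {φ : Rd d → ℝ} {C : ℝ} (hC : 0 ≤ C) {x : Rd d}
    (h : ∀ i, |pderiv i φ x| ≤ C) : ‖fderiv ℝ φ x‖ ≤ d * C := by
  refine ContinuousLinearMap.opNorm_le_bound _ (by positivity) fun v => ?_
  rw [fderiv_apply_eq, Real.norm_eq_abs]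
  exact (sum_coord_mul_le v h).trans (le_of_eq (by ring))

theorem increment_le {φ : Rd d → ℝ} {C : ℝ} (hC : 0 ≤ C) (hd : Differentiable ℝ φ)
    (h : ∀ i x, |pderiv i φ x| ≤ C) (x y : Rd d) : |φ y - φ x| ≤ d * C * ‖y - x‖ :=
  Convex.norm_image_sub_le_of_norm_fderiv_le (𝕜 := ℝ) (s := univ) (fun z _ => hd z)
    (fun z _ => norm_fderiv_le_of_pderiv hC fun i => h i z) convex_univ (mem_univ x) (mem_univ y)

theorem DB.increment {n : ℕ} {C : ℝ} {φ : Rd d → ℝ} (h : DB (n + 1) C φ)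
    (hd : Differentiable ℝ φ) (x v : Rd d) : |φ (x + v) - φ x| ≤ d * ‖v‖ * C := by
  have := increment_le h.nonneg hd (fun i z => (h.pderiv i).bound z) x (x + v)
  simp only [add_sub_cancel_left] at this
  linarith [mul_right_comm (d : ℝ) C ‖v‖]

/-! ### Relation with the class of smooth functions in the structural conditions -/

theorem fderiv_eq_sum_pderiv (φ : Rd d → ℝ) :
    fderiv ℝ φ = fun x => ∑ i, pderiv i φ x • (EuclideanSpace.proj i : Rd d →L[ℝ] ℝ) := by
  funext x; ext v
  rw [fderiv_apply_eq]
  simp [mul_comm]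

theorem norm_iteratedFDeriv_le_of_sm (k : ℕ) : ∀ {φ : Rd d → ℝ}, Sm φ →
    ∃ C, ∀ x, ‖iteratedFDeriv ℝ k φ x‖ ≤ C := by
  induction k with
  | zero => intro φ h; obtain ⟨C, hC⟩ := h.bound; exact ⟨C, fun x => by simpa using hC x⟩
  | succ k ih =>
    intro φ h
    choose C hC using fun i => ih (h.pderiv i)
    let P : Fin d → (Rd d →L[ℝ] ℝ) := fun i => EuclideanSpace.proj i
    refine ⟨∑ i, ‖(ContinuousLinearMap.toSpanSingleton ℝ (P i))‖ * C i, fun x => ?_⟩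
    rw [← norm_iteratedFDeriv_fderiv, fderiv_eq_sum_pderiv]
    have hcd : ∀ i, ContDiff ℝ k (fun x => pderiv i φ x • P i) := fun i =>
      (contDiff_infty.1 (h.pderiv i).1 k).smul contDiff_const
    have := iteratedFDeriv_sum (𝕜 := ℝ) (i := k) (f := fun i x => pderiv i φ x • P i)
      (u := Finset.univ) (fun i _ => hcd i)
    have e : (fun x => ∑ i, pderiv i φ x • (EuclideanSpace.proj i : Rd d →L[ℝ] ℝ))
        = fun x => ∑ i, pderiv i φ x • P i := rfl
    rw [e, this, Finset.sum_apply]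
    refine (norm_sum_le _ _).trans (Finset.sum_le_sum fun i _ => ?_)
    have e2 : (fun x => pderiv i φ x • P i)
        = (ContinuousLinearMap.toSpanSingleton ℝ (P i)) ∘ pderiv i φ := by
      funext x; simp [ContinuousLinearMap.toSpanSingleton_apply]
    rw [e2]
    refine ((ContinuousLinearMap.toSpanSingleton ℝ (P i)).norm_iteratedFDeriv_comp_left
      (contDiff_infty.1 (h.pderiv i).1 k).contDiffAt le_rfl).trans ?_
    exact mul_le_mul_of_nonneg_left (hC i x) (norm_nonneg _)

theorem Sm.isBddSmooth {φ : Rd d → ℝ} (h : Sm φ) : IsBddSmooth φ :=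
  ⟨h.1, fun k => norm_iteratedFDeriv_le_of_sm k h⟩

theorem contDiff_succ_of_pderiv {n : ℕ} {φ : Rd d → ℝ} (hd : Differentiable ℝ φ)
    (h : ∀ i, ContDiff ℝ n (pderiv i φ)) : ContDiff ℝ (n + 1 : ℕ) φ := by
  push_cast
  rw [contDiff_succ_iff_fderiv]
  refine ⟨hd, by simp, ?_⟩
  rw [fderiv_eq_sum_pderiv]
  exact ContDiff.sum fun i _ => (h i).smul contDiff_const


/-! ### Directional derivatives and Taylor's formula -/

/-- The directional derivative `∂_v φ`. -/
noncomputable def dirD (v : Rd d) (φ : Rd d → ℝ) : Rd d → ℝ := fun x => ∑ i, v i * pderiv i φ x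

theorem dirD_bvec (i : Fin d) (φ : Rd d → ℝ) : dirD (bvec i) φ = pderiv i φ := by
  funext x; simp [dirD, PiLp.single_apply]

theorem Sm.dirD {φ : Rd d → ℝ} (h : Sm φ) (v : Rd d) : Sm (dirD v φ) :=
  Sm.sum _ fun i _ => (h.pderiv i).const_mul (v i)

theorem pds_dirD {φ : Rd d → ℝ} (h : Sm φ) (v : Rd d) (w : List (Fin d)) :
    pds w (dirD v φ) = dirD v (pds w φ) := by
  unfold dirD
  rw [pds_sum _ fun i _ => ((h.pderiv i).const_mul (v i)).1]
  funext x
  refine Finset.sum_congr rfl fun i _ => ?_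
  rw [pds_const_mul (h.pderiv i).1, pds_pderiv h.1]

theorem DB.dirD {n : ℕ} {C : ℝ} {φ : Rd d → ℝ} (h : DB (n + 1) C φ) (hs : Sm φ) (v : Rd d) :
    DB n (d * ‖v‖ * C) (dirD v φ) := fun w hw x => by
  rw [pds_dirD hs]
  exact sum_coord_mul_le v fun i => h (i :: w) (by simpa using hw) x

theorem Sm.dirD_iterate {φ : Rd d → ℝ} (h : Sm φ) (v : Rd d) (k : ℕ) :
    Sm ((FDExpansion.dirD v)^[k] φ) := by
  induction k generalizing φ with
  | zero => exact h
  | succ k ih => exact ih (h.dirD v)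

theorem DB.dirD_iterate {n k : ℕ} {C : ℝ} {φ : Rd d → ℝ} (h : DB (n + k) C φ) (hs : Sm φ)
    (v : Rd d) : DB n ((d * ‖v‖) ^ k * C) ((FDExpansion.dirD v)^[k] φ) := by
  induction k generalizing φ C with
  | zero => simpa using h
  | succ k ih => exact (ih (DB.dirD h hs v) (hs.dirD v)).mono le_rfl (le_of_eq (by ring))

theorem pds_dirD_iterate {φ : Rd d → ℝ} (h : Sm φ) (v : Rd d) (w : List (Fin d)) (k : ℕ) :
    pds w ((dirD v)^[k] φ) = (dirD v)^[k] (pds w φ) := by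
  induction k generalizing φ with
  | zero => rfl
  | succ k ih => rw [Function.iterate_succ_apply, ih (h.dirD v), pds_dirD h]; rfl

/-- The remainder `φ(x + hv) - ∑_{i < N} h^i/i! ∂_v^i φ(x)` of Taylor's formula. -/
noncomputable def taylorRem (N : ℕ) (h : ℝ) (v : Rd d) (φ : Rd d → ℝ) (x : Rd d) : ℝ :=
  φ (x + h • v) - ∑ i ∈ Finset.range N, h ^ i / (i.factorial : ℝ) * (dirD v)^[i] φ x

theorem hasDerivAt_line {φ : Rd d → ℝ} (hd : Differentiable ℝ φ) (x v : Rd d) (s : ℝ) :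
    HasDerivAt (fun s : ℝ => φ (x + s • v)) (dirD v φ (x + s • v)) s := by
  have h1 : HasDerivAt (fun s : ℝ => x + s • v) v s := by
    simpa using ((hasDerivAt_id s).smul_const v).const_add x
  have := (hd (x + s • v)).hasFDerivAt.comp_hasDerivAt s h1
  rw [fderiv_apply_eq] at this
  exact this

theorem hasDerivAt_taylorRem {φ : Rd d → ℝ} (hd : Differentiable ℝ φ) (N : ℕ) (x v : Rd d)
    (s : ℝ) :
    HasDerivAt (fun s : ℝ => taylorRem (N + 1) s v φ x) (taylorRem N s v (dirD v φ) x) s := by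
  unfold taylorRem
  refine (hasDerivAt_line hd x v s).sub ?_
  have e : (fun s : ℝ => ∑ i ∈ Finset.range (N + 1),
      s ^ i / (i.factorial : ℝ) * (dirD v)^[i] φ x) = fun s => (∑ i ∈ Finset.range N,
      s ^ (i + 1) / ((i + 1).factorial : ℝ) * (dirD v)^[i] (dirD v φ) x) + φ x := by
    funext s; rw [Finset.sum_range_succ']; simp
  rw [e]
  refine HasDerivAt.add_const _ (HasDerivAt.fun_sum fun i _ => ?_)
  refine (((hasDerivAt_pow (i + 1) s).div_const ((i + 1).factorial : ℝ)).mul_const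
    ((dirD v)^[i] (dirD v φ) x)).congr_deriv ?_
  rw [Nat.factorial_succ]; push_cast
  have : (i.factorial : ℝ) ≠ 0 := by positivity
  have h2 : (i : ℝ) + 1 ≠ 0 := by positivity
  field_simp

theorem abs_taylorRem_le (N : ℕ) : ∀ {φ : Rd d → ℝ} {C : ℝ}, Sm φ → ∀ (v : Rd d),
    (∀ y, |(dirD v)^[N] φ y| ≤ C) → ∀ {h : ℝ}, 0 ≤ h → ∀ x,
    |taylorRem N h v φ x| ≤ h ^ N / (N.factorial : ℝ) * C := by
  induction N with
  | zero => intro φ C hs v hC h hh x; simpa [taylorRem] using hC (x + h • v)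
  | succ N ih =>
    intro φ C hs v hC h hh x
    have hB : ∀ s : ℝ, HasDerivAt (fun s : ℝ => s ^ (N + 1) / ((N + 1).factorial : ℝ) * C)
        (s ^ N / (N.factorial : ℝ) * C) s := fun s => by
      refine (((hasDerivAt_pow (N + 1) s).div_const
        ((N + 1).factorial : ℝ)).mul_const C).congr_deriv ?_
      rw [Nat.factorial_succ]; push_cast
      have : (N.factorial : ℝ) ≠ 0 := by positivity
      have h2 : (N : ℝ) + 1 ≠ 0 := by positivity
      field_simp
    have := image_norm_le_of_norm_deriv_right_le_deriv_boundary
      (f := fun s : ℝ => taylorRem (N + 1) s v φ x) (a := 0) (b := h)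
      (f' := fun s => taylorRem N s v (dirD v φ) x)
      (fun s _ => (hasDerivAt_taylorRem hs.differentiable N x v s).continuousAt.continuousWithinAt)
      (fun s _ => (hasDerivAt_taylorRem hs.differentiable N x v s).hasDerivWithinAt)
      (by simp [taylorRem, Finset.sum_range_succ']) hB
      (fun s hs' => ih (hs.dirD v) v hC hs'.1 x) (right_mem_Icc.2 hh)
    exact this

theorem Sm.taylorRem {φ : Rd d → ℝ} (hs : Sm φ) (N : ℕ) (h : ℝ) (v : Rd d) :
    Sm (taylorRem N h v φ) :=
  (hs.translate _).sub (Sm.sum _ fun i _ => (hs.dirD_iterate v i).const_mul _)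

theorem DB.taylorRem {l N : ℕ} {C : ℝ} {φ : Rd d → ℝ} (hb : DB (l + N) C φ) (hs : Sm φ) {h : ℝ}
    (hh : 0 ≤ h) (v : Rd d) :
    DB l (h ^ N / (N.factorial : ℝ) * ((d * ‖v‖) ^ N * C)) (taylorRem N h v φ) := fun w hw x => by
  have e : FDExpansion.pds w (FDExpansion.taylorRem N h v φ)
      = FDExpansion.taylorRem N h v (FDExpansion.pds w φ) := by
    unfold FDExpansion.taylorRem
    rw [pds_sub (hs.translate _).1
      (Sm.sum _ fun i _ => (hs.dirD_iterate v i).const_mul _).1, pds_translate,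
      pds_sum _ fun i _ => ((hs.dirD_iterate v i).const_mul _).1]
    funext x
    congr 1
    refine Finset.sum_congr rfl fun i _ => ?_
    rw [pds_const_mul (hs.dirD_iterate v i).1, pds_dirD_iterate hs]
  rw [e]
  refine abs_taylorRem_le N (hs.pds w) v (fun y => ?_) hh x
  exact (DB.dirD_iterate (n := 0) (k := N) (hb.pds w (by omega)) (hs.pds w) v).bound y

/-! ### Interpolation -/

theorem interpolation_one {φ : Rd d → ℝ} {C ε s : ℝ} (hs : Sm φ) (hb : DB 2 C φ)
    (hε : ∀ x, |φ x| ≤ ε) (h0 : 0 < s) (i : Fin d) (x : Rd d) :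
    |pderiv i φ x| ≤ 2 * ε / s + s * C := by
  have h1 := abs_taylorRem_le 2 hs (bvec i) (C := C)
    (fun y => by simpa [dirD_bvec, pds_cons] using hb [i, i] le_rfl y) h0.le x
  simp only [taylorRem, Finset.sum_range_succ, Finset.sum_range_zero] at h1
  simp [dirD_bvec] at h1
  have h2 := abs_le.1 (hε (x + s • bvec i)); have h3 := abs_le.1 (hε x)
  have h1 := abs_le.1 h1
  simp only [bvec] at *
  have hC := hb.nonneg
  have e : 2 * ε / s + s * C = (2 * ε + s ^ 2 * C) / s := by field_simp
  rw [e, le_div_iff₀ h0, ← abs_of_pos h0, ← abs_mul, abs_of_pos h0, abs_le]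
  have : 0 ≤ s ^ 2 * C := by positivity
  constructor <;> linarith

theorem interpolation (n : ℕ) (C : ℝ) : ∀ η : ℝ, 0 < η → ∃ ε, 0 < ε ∧ ∀ φ : Rd d → ℝ, Sm φ →
    DB n C φ → (∀ x, |φ x| ≤ ε) → ∀ w : List (Fin d), w.length < n → ∀ x, |pds w φ x| ≤ η := by
  induction n with
  | zero => intro η hη; exact ⟨1, one_pos, fun φ _ _ _ w hw => absurd hw (Nat.not_lt_zero _)⟩
  | succ n ih =>
    intro η hη
    obtain ⟨ε, hε, H⟩ := ih η hη
    set s := ε / (2 * (|C| + 1)) with hs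
    have hs0 : 0 < s := by positivity
    refine ⟨min η (s * ε / 4), by positivity, fun φ hφ hb hle w hw x => ?_⟩
    rcases List.eq_nil_or_concat w with rfl | ⟨w', i, rfl⟩
    · exact (hle x).trans (min_le_left _ _)
    · rw [List.concat_eq_append] at hw ⊢
      rw [pds_concat]
      have hw' : w'.length < n := by simpa using hw
      refine H _ (hφ.pderiv i) (hb.pderiv i) (fun y => ?_) w' hw' x
      refine (interpolation_one hφ (hb.mono (by omega) (le_abs_self C)) hle hs0 i y).trans ?_
      have h1 : 2 * min η (s * ε / 4) / s ≤ ε / 2 := by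
        rw [div_le_iff₀ hs0]
        linarith [min_le_right η (s * ε / 4)]
      have h2 : s * |C| ≤ ε / 2 := by
        rw [hs, div_mul_eq_mul_div, div_le_div_iff₀ (by positivity) (by norm_num)]
        nlinarith [abs_nonneg C]
      linarith

/-! ### Uniform limits of smooth functions with bounded derivatives -/

/-- `φ` is a uniform limit of smooth functions whose derivatives of order at most `n` are bounded
by `C`. -/
def LB (n : ℕ) (C : ℝ) (φ : Rd d → ℝ) : Prop :=
  ∀ ε : ℝ, 0 < ε → ∃ ψ, Sm ψ ∧ DB n C ψ ∧ ∀ x, |φ x - ψ x| ≤ ε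

theorem DB.lb {n : ℕ} {C : ℝ} {φ : Rd d → ℝ} (h : DB n C φ) (hs : Sm φ) : LB n C φ :=
  fun ε hε => ⟨φ, hs, h, fun x => by simpa using hε.le⟩

theorem LB.mono {n n' : ℕ} {C C' : ℝ} {φ : Rd d → ℝ} (h : LB n C φ) (hn : n' ≤ n) (hC : C ≤ C') :
    LB n' C' φ := fun ε hε => by
  obtain ⟨ψ, h1, h2, h3⟩ := h ε hε; exact ⟨ψ, h1, h2.mono hn hC, h3⟩

theorem LB.nonneg {n : ℕ} {C : ℝ} {φ : Rd d → ℝ} (h : LB n C φ) : 0 ≤ C := by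
  obtain ⟨ψ, _, h2, _⟩ := h 1 one_pos; exact h2.nonneg

theorem LB.of_close {n : ℕ} {C : ℝ} {φ : Rd d → ℝ}
    (h : ∀ ε : ℝ, 0 < ε → ∃ ψ, LB n C ψ ∧ ∀ x, |φ x - ψ x| ≤ ε) : LB n C φ := fun ε hε => by
  obtain ⟨ψ, h1, h2⟩ := h (ε / 2) (by positivity)
  obtain ⟨χ, h3, h4, h5⟩ := h1 (ε / 2) (by positivity)
  refine ⟨χ, h3, h4, fun x => ?_⟩
  have := abs_sub_le (φ x) (ψ x) (χ x)
  linarith [h2 x, h5 x]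

theorem LB.bound {n : ℕ} {C : ℝ} {φ : Rd d → ℝ} (h : LB n C φ) (x : Rd d) : |φ x| ≤ C := by
  refine le_of_forall_pos_le_add fun ε hε => ?_
  obtain ⟨ψ, _, h2, h3⟩ := h ε hε
  have := abs_sub_abs_le_abs_sub (φ x) (ψ x)
  linarith [h3 x, h2.bound x]

theorem LB.increment {n : ℕ} {C : ℝ} {φ : Rd d → ℝ} (h : LB (n + 1) C φ) (x v : Rd d) :
    |φ (x + v) - φ x| ≤ d * ‖v‖ * C := by
  refine le_of_forall_pos_le_add fun ε hε => ?_
  obtain ⟨ψ, h1, h2, h3⟩ := h (ε / 2) (by positivity)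
  have a := abs_le.1 (h3 x); have b := abs_le.1 (h3 (x + v))
  have c := abs_le.1 (h2.increment h1.differentiable x v)
  rw [abs_le]; constructor <;> linarith

theorem LB.continuous {n : ℕ} {C : ℝ} {φ : Rd d → ℝ} (h : LB n C φ) : Continuous φ := by
  choose ψ h1 _ h3 using fun k : ℕ => h (1 / ((k : ℝ) + 1)) (by positivity)
  refine TendstoUniformly.continuous (F := ψ) (p := atTop) ?_
    (Frequently.of_forall fun k => (h1 k).continuous)
  rw [Metric.tendstoUniformly_iff]
  intro ε hε
  filter_upwards [(tendsto_one_div_add_atTop_nhds_zero_nat (𝕜 := ℝ)).eventually_lt_const hε]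
    with k hk x
  exact (h3 k x).trans_lt hk

theorem LB.add {n : ℕ} {C C' : ℝ} {φ ψ : Rd d → ℝ} (h : LB n C φ) (h' : LB n C' ψ) :
    LB n (C + C') (fun x => φ x + ψ x) := fun ε hε => by
  obtain ⟨a, a1, a2, a3⟩ := h (ε / 2) (by positivity)
  obtain ⟨b, b1, b2, b3⟩ := h' (ε / 2) (by positivity)
  refine ⟨_, a1.add b1, a2.add b2 a1.1 b1.1, fun x => ?_⟩
  have := abs_add_le (φ x - a x) (ψ x - b x)
  rw [show φ x + ψ x - (a x + b x) = φ x - a x + (ψ x - b x) by ring]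
  linarith [a3 x, b3 x]

theorem LB.const_mul {n : ℕ} {C : ℝ} {φ : Rd d → ℝ} (h : LB n C φ) (a : ℝ) :
    LB n (|a| * C) (fun x => a * φ x) := fun ε hε => by
  obtain ⟨b, b1, b2, b3⟩ := h (ε / (|a| + 1)) (by positivity)
  refine ⟨_, b1.const_mul a, b2.const_mul b1.1 a, fun x => ?_⟩
  rw [← mul_sub, abs_mul]
  calc |a| * |φ x - b x| ≤ (|a| + 1) * (ε / (|a| + 1)) :=
        mul_le_mul (by linarith) (b3 x) (abs_nonneg _) (by positivity)
    _ = ε := by field_simp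

theorem LB.sub {n : ℕ} {C C' : ℝ} {φ ψ : Rd d → ℝ} (h : LB n C φ) (h' : LB n C' ψ) :
    LB n (C + C') (fun x => φ x - ψ x) := by
  have := h.add (h'.const_mul (-1))
  simpa [sub_eq_add_neg] using this

theorem LB_const (n : ℕ) (a : ℝ) : LB n |a| (fun _ : Rd d => a) := (DB_const n a).lb (Sm_const a)

theorem LB_zero (n : ℕ) : LB n 0 (fun _ : Rd d => (0 : ℝ)) := by simpa using LB_const (d := d) n 0

theorem LB.sum {ι : Type*} (s : Finset ι) {n : ℕ} {C : ι → ℝ} {φ : ι → Rd d → ℝ}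
    (h : ∀ v ∈ s, LB n (C v) (φ v)) : LB n (∑ v ∈ s, C v) (fun x => ∑ v ∈ s, φ v x) := by
  classical
  induction s using Finset.induction_on with
  | empty => simpa using LB_zero n
  | insert a s ha ih =>
    simp only [Finset.sum_insert ha]
    exact (h a (Finset.mem_insert_self _ _)).add
      (ih fun v hv => h v (Finset.mem_insert_of_mem hv))

theorem LB.translate {n : ℕ} {C : ℝ} {φ : Rd d → ℝ} (h : LB n C φ) (a : Rd d) :
    LB n C (fun x => φ (x + a)) := fun ε hε => by
  obtain ⟨b, b1, b2, b3⟩ := h ε hε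
  exact ⟨_, b1.translate a, b2.translate a, fun x => b3 _⟩

theorem LB.mul {n : ℕ} {C C' : ℝ} {φ ψ : Rd d → ℝ} (h : LB n C φ) (h' : LB n C' ψ) :
    LB n (2 ^ n * C * C') (fun x => φ x * ψ x) := fun ε hε => by
  have hC := h.nonneg; have hC' := h'.nonneg
  obtain ⟨a, a1, a2, a3⟩ := h (ε / (2 * (C' + 1))) (by positivity)
  obtain ⟨b, b1, b2, b3⟩ := h' (ε / (2 * (C + 1))) (by positivity)
  refine ⟨_, a1.mul b1, a2.mul b2 a1.1 b1.1, fun x => ?_⟩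
  rw [show φ x * ψ x - a x * b x = (φ x - a x) * ψ x + a x * (ψ x - b x) by ring]
  refine (abs_add_le _ _).trans ?_
  rw [abs_mul, abs_mul]
  have e1 : |φ x - a x| * |ψ x| ≤ ε / (2 * (C' + 1)) * (C' + 1) :=
    mul_le_mul (a3 x) ((h'.bound x).trans (by linarith)) (abs_nonneg _) (by positivity)
  have e2 : |a x| * |ψ x - b x| ≤ (C + 1) * (ε / (2 * (C + 1))) :=
    mul_le_mul ((a2.bound x).trans (by linarith)) (b3 x) (abs_nonneg _) (by positivity)
  have e3 : ε / (2 * (C' + 1)) * (C' + 1) = ε / 2 := by field_simp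
  have e4 : (C + 1) * (ε / (2 * (C + 1))) = ε / 2 := by field_simp
  linarith

theorem LB.exists_seq {n : ℕ} {C : ℝ} {φ : Rd d → ℝ} (h : LB n C φ) :
    ∃ ψ : ℕ → Rd d → ℝ, (∀ k, Sm (ψ k)) ∧ (∀ k, DB n C (ψ k)) ∧ TendstoUniformly ψ φ atTop := by
  choose ψ h1 h2 h3 using fun k : ℕ => h (1 / ((k : ℝ) + 1)) (by positivity)
  refine ⟨ψ, h1, h2, ?_⟩
  rw [Metric.tendstoUniformly_iff]
  intro ε hε
  filter_upwards [(tendsto_one_div_add_atTop_nhds_zero_nat (𝕜 := ℝ)).eventually_lt_const hε]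
    with k hk x
  exact (h3 k x).trans_lt hk

theorem uniformCauchy_pderiv {n : ℕ} {C : ℝ} {φ : Rd d → ℝ} {ψ : ℕ → Rd d → ℝ}
    (hs : ∀ k, Sm (ψ k)) (hb : ∀ k, DB (n + 2) C (ψ k)) (ht : TendstoUniformly ψ φ atTop)
    (i : Fin d) : UniformCauchySeqOn (fun k => pderiv i (ψ k)) atTop univ := by
  rw [Metric.uniformCauchySeqOn_iff]
  intro η hη
  obtain ⟨ε, hε, H⟩ := interpolation (d := d) (n + 2) (C + C) (η / 2) (by positivity)
  obtain ⟨N, hN⟩ := Metric.uniformCauchySeqOn_iff.1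
    (tendstoUniformlyOn_univ.2 ht).uniformCauchySeqOn ε hε
  refine ⟨N, fun k hk l hl x _ => ?_⟩
  have := H _ ((hs k).sub (hs l)) ((hb k).sub (hb l) (hs k).1 (hs l).1)
    (fun y => (hN k hk l hl y (mem_univ y)).le) [i] (by simp) x
  rw [pds_sub (hs k).1 (hs l).1] at this
  exact lt_of_le_of_lt this (by linarith)

theorem differentiable_of_tendsto {n : ℕ} {C : ℝ} {φ : Rd d → ℝ} {ψ : ℕ → Rd d → ℝ}
    (hs : ∀ k, Sm (ψ k)) (hb : ∀ k, DB (n + 2) C (ψ k)) (ht : TendstoUniformly ψ φ atTop) :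
    Differentiable ℝ φ ∧
      ∀ i, TendstoUniformly (fun k => pderiv i (ψ k)) (pderiv i φ) atTop := by
  have hex : ∀ i : Fin d, ∀ x, ∃ y, Tendsto (fun k => pderiv i (ψ k) x) atTop (𝓝 y) := fun i x =>
    cauchySeq_tendsto_of_complete
      ((uniformCauchy_pderiv hs hb ht i).cauchySeq (mem_univ x))
  choose G hG using hex
  have hGu : ∀ i, TendstoUniformly (fun k => pderiv i (ψ k)) (G i) atTop := fun i => by
    rw [← tendstoUniformlyOn_univ]
    exact (uniformCauchy_pderiv hs hb ht i).tendstoUniformlyOn_of_tendsto fun x _ => hG i x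
  let P : Fin d → (Rd d →L[ℝ] ℝ) := fun i => EuclideanSpace.proj i
  have hF : TendstoUniformly (fun k => fderiv ℝ (ψ k)) (fun x => ∑ i, G i x • P i) atTop := by
    rw [Metric.tendstoUniformly_iff]
    intro ε hε
    set δ := ε / (2 * ((∑ i, ‖P i‖) + 1)) with hδ
    have hS : 0 ≤ ∑ i, ‖P i‖ := Finset.sum_nonneg fun i _ => norm_nonneg _
    have hδ0 : 0 < δ := by positivity
    have hall : ∀ᶠ k in atTop, ∀ i x, dist (G i x) (pderiv i (ψ k) x) < δ := by
      rw [eventually_all]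
      exact fun i => Metric.tendstoUniformly_iff.1 (hGu i) δ hδ0
    filter_upwards [hall] with k hk x
    rw [fderiv_eq_sum_pderiv, dist_eq_norm, ← Finset.sum_sub_distrib]
    calc ‖∑ i, (G i x • P i - pderiv i (ψ k) x • P i)‖ ≤ ∑ i, δ * ‖P i‖ := by
          refine (norm_sum_le _ _).trans (Finset.sum_le_sum fun i _ => ?_)
          have e : G i x • P i - pderiv i (ψ k) x • P i = (G i x - pderiv i (ψ k) x) • P i :=
            (sub_smul _ _ _).symm
          rw [e, norm_smul]
          exact mul_le_mul_of_nonneg_right (by simpa [dist_eq_norm] using (hk i x).le)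
            (norm_nonneg _)
      _ = δ * ∑ i, ‖P i‖ := by rw [Finset.mul_sum]
      _ < ε := by
          rw [hδ, div_mul_eq_mul_div, div_lt_iff₀ (by positivity)]
          nlinarith
  have hD : ∀ x, HasFDerivAt φ (∑ i, G i x • P i) x :=
    hasFDerivAt_of_tendstoUniformly hF (fun k x => ((hs k).differentiable x).hasFDerivAt)
      (fun x => ht.tendsto_at x)
  refine ⟨fun x => (hD x).differentiableAt, fun i => ?_⟩
  have : pderiv i φ = G i := by
    funext x
    rw [pderiv, (hD x).fderiv]
    simp [P, PiLp.single_apply]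
  rw [this]; exact hGu i

theorem LB.differentiable {n : ℕ} {C : ℝ} {φ : Rd d → ℝ} (h : LB (n + 2) C φ) :
    Differentiable ℝ φ := by
  obtain ⟨ψ, h1, h2, h3⟩ := h.exists_seq
  exact (differentiable_of_tendsto h1 h2 h3).1

theorem LB.of_tendsto {n : ℕ} {C : ℝ} {φ : Rd d → ℝ} {ψ : ℕ → Rd d → ℝ}
    (hs : ∀ k, LB n C (ψ k)) (ht : TendstoUniformly ψ φ atTop) : LB n C φ :=
  LB.of_close fun ε hε => by
    obtain ⟨k, hk⟩ := (Metric.tendstoUniformly_iff.1 ht ε hε).exists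
    exact ⟨ψ k, hs k, fun x => (hk x).le⟩

theorem LB.pderiv {n : ℕ} {C : ℝ} {φ : Rd d → ℝ} (h : LB (n + 2) C φ) (i : Fin d) :
    LB (n + 1) C (pderiv i φ) := by
  obtain ⟨ψ, h1, h2, h3⟩ := h.exists_seq
  exact LB.of_tendsto (fun k => ((h2 k).pderiv i).lb ((h1 k).pderiv i))
    ((differentiable_of_tendsto h1 h2 h3).2 i)

theorem tendstoUniformly_pds {n : ℕ} {C : ℝ} {φ : Rd d → ℝ} {ψ : ℕ → Rd d → ℝ}
    (hs : ∀ k, Sm (ψ k)) (hb : ∀ k, DB n C (ψ k)) (ht : TendstoUniformly ψ φ atTop)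
    (w : List (Fin d)) (hw : w.length < n) :
    TendstoUniformly (fun k => pds w (ψ k)) (pds w φ) atTop := by
  induction w generalizing n with
  | nil => exact ht
  | cons i w ih =>
    have hw' : w.length + 1 < n := by simpa using hw
    exact (differentiable_of_tendsto (n := n - w.length - 2) (fun k => (hs k).pds w)
      (fun k => (hb k).pds w (by omega)) (ih hb (by omega))).2 i

theorem LB.pds {n k : ℕ} {C : ℝ} {φ : Rd d → ℝ} (h : LB n C φ) (w : List (Fin d))
    (hk : 1 ≤ k) (hw : k + w.length ≤ n) : LB k C (pds w φ) := by
  obtain ⟨ψ, h1, h2, h3⟩ := h.exists_seq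
  exact LB.of_tendsto (fun j => ((h2 j).pds w hw).lb ((h1 j).pds w))
    (tendstoUniformly_pds h1 h2 h3 w (by omega))

theorem LB.contDiff {n : ℕ} : ∀ {C : ℝ} {φ : Rd d → ℝ}, LB (n + 1) C φ → ContDiff ℝ n φ := by
  induction n with
  | zero => intro C φ h; exact contDiff_zero.2 h.continuous
  | succ n ih => intro C φ h; exact contDiff_succ_of_pderiv h.differentiable fun i => ih (h.pderiv i)

/-- Approximation of all derivatives of order less than `n`. -/
theorem LB.exists_close {n : ℕ} {C : ℝ} {φ : Rd d → ℝ} (h : LB n C φ) {η : ℝ} (hη : 0 < η) :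
    ∃ ψ, Sm ψ ∧ DB n C ψ ∧ (∀ x, |φ x - ψ x| ≤ η) ∧
      ∀ w : List (Fin d), w.length < n → ∀ x, |FDExpansion.pds w φ x - FDExpansion.pds w ψ x| ≤ η := by
  obtain ⟨ψ, h1, h2, h3⟩ := h.exists_seq
  have hfin : {w : List (Fin d) | w.length < n}.Finite := List.finite_length_lt _ _
  have hall : ∀ᶠ k in atTop, ∀ w ∈ {w : List (Fin d) | w.length < n}, ∀ x,
      dist (FDExpansion.pds w φ x) (FDExpansion.pds w (ψ k) x) < η := by
    rw [eventually_all_finite hfin]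
    exact fun w hw => Metric.tendstoUniformly_iff.1 (tendstoUniformly_pds h1 h2 h3 w hw) η hη
  obtain ⟨k, hk, hk'⟩ := (hall.and (Metric.tendstoUniformly_iff.1 h3 η hη)).exists
  exact ⟨ψ k, h1 k, h2 k, fun x => (hk' x).le, fun w hw x => (hk w hw x).le⟩

/-- Functions of the class `LB n C` that are uniformly close have uniformly close derivatives of
order less than `n`. -/
theorem LB.close (n : ℕ) (C : ℝ) {η : ℝ} (hη : 0 < η) : ∃ ε, 0 < ε ∧ ∀ φ ψ : Rd d → ℝ, LB n C φ →
    LB n C ψ → (∀ x, |φ x - ψ x| ≤ ε) →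
    ∀ w : List (Fin d), w.length < n → ∀ x,
      |FDExpansion.pds w φ x - FDExpansion.pds w ψ x| ≤ η := by
  obtain ⟨ε, hε, H⟩ := interpolation (d := d) n (C + C) (η / 3) (by positivity)
  refine ⟨ε / 3, by positivity, fun φ ψ hφ hψ hle w hw x => ?_⟩
  obtain ⟨a, a1, a2, a3, a4⟩ := hφ.exists_close (lt_min (show 0 < ε / 3 by positivity)
    (show 0 < η / 3 by positivity))
  obtain ⟨b, b1, b2, b3, b4⟩ := hψ.exists_close (lt_min (show 0 < ε / 3 by positivity)
    (show 0 < η / 3 by positivity))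
  have := H _ (a1.sub b1) (a2.sub b2 a1.1 b1.1) (fun y => by
    have h1 := abs_le.1 ((a3 y).trans (min_le_left _ _))
    have h2 := abs_le.1 ((b3 y).trans (min_le_left _ _))
    have h3 := abs_le.1 (hle y)
    rw [abs_le]; constructor <;> linarith) w hw x
  rw [pds_sub a1.1 b1.1] at this
  have h1 := abs_le.1 ((a4 w hw x).trans (min_le_right _ _))
  have h2 := abs_le.1 ((b4 w hw x).trans (min_le_right _ _))
  have h3 := abs_le.1 this
  rw [abs_le]; constructor <;> linarith

/-! ### Algebra of iterated derivatives of functions of finite smoothness -/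

theorem contDiff_pds {k : ℕ} {φ : Rd d → ℝ} (w : List (Fin d))
    (h : ContDiff ℝ (k + w.length : ℕ) φ) : ContDiff ℝ k (pds w φ) := by
  induction w generalizing k with
  | nil => simpa using h
  | cons i w ih =>
    refine contDiff_pderiv (n := (k : ℕ∞)) (ih (k := k + 1) ?_) i
    convert h using 2
    simp only [List.length_cons]; omega

theorem differentiable_pds {φ : Rd d → ℝ} (w : List (Fin d))
    (h : ContDiff ℝ (w.length + 1 : ℕ) φ) : Differentiable ℝ (pds w φ) :=
  (contDiff_pds (k := 1) w (by rwa [add_comm])).differentiable (by simp)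

theorem pds_add_of_contDiff {φ ψ : Rd d → ℝ} (w : List (Fin d)) (hφ : ContDiff ℝ w.length φ)
    (hψ : ContDiff ℝ w.length ψ) :
    pds w (fun x => φ x + ψ x) = fun x => pds w φ x + pds w ψ x := by
  induction w with
  | nil => rfl
  | cons i w ih =>
    have h1 : ContDiff ℝ w.length φ := hφ.of_le (by exact_mod_cast Nat.le_succ _)
    have h2 : ContDiff ℝ w.length ψ := hψ.of_le (by exact_mod_cast Nat.le_succ _)
    rw [pds_cons, ih h1 h2, pderiv_add (differentiable_pds w hφ) (differentiable_pds w hψ)]; rfl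

theorem pds_const_mul_of_contDiff {φ : Rd d → ℝ} (w : List (Fin d)) (hφ : ContDiff ℝ w.length φ)
    (a : ℝ) : pds w (fun x => a * φ x) = fun x => a * pds w φ x := by
  induction w with
  | nil => rfl
  | cons i w ih =>
    have h1 : ContDiff ℝ w.length φ := hφ.of_le (by exact_mod_cast Nat.le_succ _)
    rw [pds_cons, ih h1, pderiv_const_mul (differentiable_pds w hφ)]; rfl

theorem pds_sum_of_contDiff {ι : Type*} (s : Finset ι) {φ : ι → Rd d → ℝ} (w : List (Fin d))
    (hφ : ∀ v ∈ s, ContDiff ℝ w.length (φ v)) :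
    pds w (fun x => ∑ v ∈ s, φ v x) = fun x => ∑ v ∈ s, pds w (φ v) x := by
  induction w with
  | nil => rfl
  | cons i w ih =>
    rw [pds_cons, ih fun v hv => (hφ v hv).of_le (by exact_mod_cast Nat.le_succ _),
      pderiv_sum s fun v hv => differentiable_pds w (hφ v hv)]; rfl

/-- The top order derivatives of a function of class `LB n C` are bounded by `C` if they exist
classically. -/
theorem LB.pds_bound {n : ℕ} {C : ℝ} {φ : Rd d → ℝ} (h : LB n C φ) (hc : ContDiff ℝ n φ)
    (w : List (Fin d)) (hw : w.length ≤ n) (x : Rd d) : |FDExpansion.pds w φ x| ≤ C := by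
  cases w with
  | nil => exact h.bound x
  | cons i w =>
    have hw' : w.length + 1 ≤ n := by simpa using hw
    have hd : Differentiable ℝ (FDExpansion.pds w φ) :=
      differentiable_pds w (hc.of_le (by exact_mod_cast hw'))
    have hder := hasDerivAt_line hd x (bvec i) 0
    rw [dirD_bvec, zero_smul, add_zero] at hder
    rw [pds_cons]
    refine hder.le_of_lip' (f := fun s : ℝ => FDExpansion.pds w φ (x + s • bvec i)) h.nonneg ?_
    obtain ⟨ψ, h1, h2, h3⟩ := h.exists_seq
    have ht := tendstoUniformly_pds h1 h2 h3 w (by omega)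
    refine Eventually.of_forall fun s => ?_
    have key : ∀ k, |FDExpansion.pds w (ψ k) (x + s • bvec i) - FDExpansion.pds w (ψ k) x|
        ≤ C * |s| := fun k => by
      have := Convex.norm_image_sub_le_of_norm_hasDerivWithin_le (s := (univ : Set ℝ))
        (f := fun s : ℝ => FDExpansion.pds w (ψ k) (x + s • bvec i)) (C := C)
        (fun r _ => (hasDerivAt_line ((h1 k).pds w).differentiable x (bvec i) r).hasDerivWithinAt)
        (fun r _ => by
          rw [dirD_bvec]; exact h2 k (i :: w) hw _) convex_univ (mem_univ 0) (mem_univ s)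
      simpa using this
    have hlim := ((ht.tendsto_at (x + s • bvec i)).sub (ht.tendsto_at x)).abs
    simpa using le_of_tendsto hlim (Eventually.of_forall key)


/-! ### Families of smooth functions depending on a parameter -/

section Parameter

variable {Ω : Type*} [MeasurableSpace Ω]

theorem measurable_pderiv_param {ψ : Ω → Rd d → ℝ} (hm : Measurable (Function.uncurry ψ))
    (hd : ∀ t, Differentiable ℝ (ψ t)) (i : Fin d) :
    Measurable (Function.uncurry fun t => pderiv i (ψ t)) := by
  have hlim : ∀ z : Ω × Rd d, Tendsto (fun k : ℕ => ((k : ℝ) + 1) *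
      (ψ z.1 (z.2 + ((k : ℝ) + 1)⁻¹ • bvec i) - ψ z.1 z.2)) atTop (𝓝 (pderiv i (ψ z.1) z.2)) := by
    intro z
    have h1 := hasDerivAt_line (hd z.1) z.2 (bvec i) 0
    rw [dirD_bvec, zero_smul, add_zero, hasDerivAt_iff_tendsto_slope_zero] at h1
    have h2 : Tendsto (fun k : ℕ => ((k : ℝ) + 1)⁻¹) atTop (𝓝[≠] 0) := by
      refine tendsto_nhdsWithin_iff.2 ⟨?_, Eventually.of_forall fun k => ?_⟩
      · simpa using tendsto_one_div_add_atTop_nhds_zero_nat (𝕜 := ℝ)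
      · have : (k : ℝ) + 1 ≠ 0 := by positivity
        simpa using this
    have := h1.comp h2
    simpa [Function.comp_def] using this
  refine measurable_of_tendsto_metrizable (fun k => ?_) (tendsto_pi_nhds.2 hlim)
  have h1 : Measurable fun z : Ω × Rd d => (z.1, z.2 + ((k : ℝ) + 1)⁻¹ • bvec i) :=
    measurable_fst.prodMk (measurable_snd.add_const _)
  exact ((hm.comp h1).sub hm).const_mul ((k : ℝ) + 1)

theorem differentiable_integral_param {μ : Measure Ω} [IsFiniteMeasure μ] {ψ : Ω → Rd d → ℝ}
    {C : ℝ} (hm : Measurable (Function.uncurry ψ)) (hd : ∀ t, Differentiable ℝ (ψ t))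
    (hb : ∀ t x, |ψ t x| ≤ C) (hb' : ∀ i t x, |pderiv i (ψ t) x| ≤ C) :
    Differentiable ℝ (fun x => ∫ t, ψ t x ∂μ) ∧
      ∀ i, pderiv i (fun x => ∫ t, ψ t x ∂μ) = fun x => ∫ t, pderiv i (ψ t) x ∂μ := by
  have hint : ∀ x, Integrable (fun t => ψ t x) μ := fun x =>
    Integrable.of_bound (hm.comp measurable_prodMk_right).aestronglyMeasurable C
      (Eventually.of_forall fun t => hb t x)
  have hmi : ∀ i x, Measurable fun t => pderiv i (ψ t) x := fun i x =>
    (measurable_pderiv_param hm hd i).comp measurable_prodMk_right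
  have hmF : ∀ x, AEStronglyMeasurable (fun t => fderiv ℝ (ψ t) x) μ := fun x => by
    simp_rw [fderiv_eq_sum_pderiv]
    refine Finset.aestronglyMeasurable_fun_sum _ fun i _ => ?_
    exact (hmi i x).aestronglyMeasurable.smul_const _
  have hC : ∀ t : Ω, 0 ≤ C := fun t => (abs_nonneg _).trans (hb t 0)
  have hD : ∀ x, HasFDerivAt (fun x => ∫ t, ψ t x ∂μ) (∫ t, fderiv ℝ (ψ t) x ∂μ) x := fun x =>
    hasFDerivAt_integral_of_dominated_of_fderiv_le (bound := fun _ => d * C) (s := univ)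
      univ_mem
      (Eventually.of_forall fun y => (hint y).aestronglyMeasurable) (hint x) (hmF x)
      (Eventually.of_forall fun t y _ => norm_fderiv_le_of_pderiv (hC t) fun i => hb' i t y)
      (integrable_const _)
      (Eventually.of_forall fun t y _ => (hd t y).hasFDerivAt)
  refine ⟨fun x => (hD x).differentiableAt, fun i => ?_⟩
  funext x
  have hiF : Integrable (fun t => fderiv ℝ (ψ t) x) μ :=
    Integrable.of_bound (hmF x) (d * C)
      (Eventually.of_forall fun t => norm_fderiv_le_of_pderiv (hC t) fun i => hb' i t x)
  rw [pderiv, (hD x).fderiv, ContinuousLinearMap.integral_apply hiF]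
  rfl

/-- Measurable families of smooth functions with uniformly bounded derivatives. -/
structure STS (ψ : Ω → Rd d → ℝ) : Prop where
  meas : Measurable (Function.uncurry ψ)
  sm : ∀ t, ContDiff ℝ ∞ (ψ t)
  bd : ∀ n, ∃ C, ∀ t, DB n C (ψ t)

variable {ψ φ : Ω → Rd d → ℝ}

theorem STS.slice (h : STS ψ) (t : Ω) : Sm (ψ t) :=
  ⟨h.sm t, fun n => (h.bd n).imp fun _ hC => hC t⟩

theorem STS.measurable_slice (h : STS ψ) (x : Rd d) : Measurable fun t => ψ t x :=
  h.meas.comp measurable_prodMk_right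

theorem STS.bound (h : STS ψ) : ∃ C, ∀ t x, |ψ t x| ≤ C :=
  (h.bd 0).imp fun _ hC t => (hC t).bound

theorem STS.add (h : STS ψ) (h' : STS φ) : STS (fun t x => ψ t x + φ t x) :=
  ⟨h.meas.add h'.meas, fun t => (h.sm t).add (h'.sm t), fun n => by
    obtain ⟨C, hC⟩ := h.bd n; obtain ⟨C', hC'⟩ := h'.bd n
    exact ⟨_, fun t => (hC t).add (hC' t) (h.sm t) (h'.sm t)⟩⟩

theorem STS.sub (h : STS ψ) (h' : STS φ) : STS (fun t x => ψ t x - φ t x) :=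
  ⟨h.meas.sub h'.meas, fun t => (h.sm t).sub (h'.sm t), fun n => by
    obtain ⟨C, hC⟩ := h.bd n; obtain ⟨C', hC'⟩ := h'.bd n
    exact ⟨_, fun t => (hC t).sub (hC' t) (h.sm t) (h'.sm t)⟩⟩

theorem STS.mul (h : STS ψ) (h' : STS φ) : STS (fun t x => ψ t x * φ t x) :=
  ⟨h.meas.mul h'.meas, fun t => (h.sm t).mul (h'.sm t), fun n => by
    obtain ⟨C, hC⟩ := h.bd n; obtain ⟨C', hC'⟩ := h'.bd n
    exact ⟨_, fun t => (hC t).mul (hC' t) (h.sm t) (h'.sm t)⟩⟩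

theorem STS.const_mul (h : STS ψ) (a : ℝ) : STS (fun t x => a * ψ t x) :=
  ⟨h.meas.const_mul a, fun t => contDiff_const.mul (h.sm t), fun n => by
    obtain ⟨C, hC⟩ := h.bd n
    exact ⟨_, fun t => (hC t).const_mul (h.sm t) a⟩⟩

theorem STS.translate (h : STS ψ) (a : Rd d) : STS (fun t x => ψ t (x + a)) :=
  ⟨h.meas.comp (measurable_fst.prodMk (measurable_snd.add_const _)),
    fun t => (h.sm t).comp (contDiff_id.add contDiff_const), fun n => by
      obtain ⟨C, hC⟩ := h.bd n; exact ⟨_, fun t => (hC t).translate a⟩⟩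

theorem STS.pderiv (h : STS ψ) (i : Fin d) : STS (fun t => pderiv i (ψ t)) :=
  ⟨measurable_pderiv_param h.meas (fun t => (h.slice t).differentiable) i,
    fun t => contDiff_pderiv_top (h.sm t) i, fun n => by
      obtain ⟨C, hC⟩ := h.bd (n + 1); exact ⟨_, fun t => (hC t).pderiv i⟩⟩

theorem STS.pds (h : STS ψ) (w : List (Fin d)) : STS (fun t => pds w (ψ t)) := by
  induction w with
  | nil => exact h
  | cons i w ih => exact ih.pderiv i

theorem STS_const {φ : Rd d → ℝ} (h : Sm φ) : STS (fun _ : Ω => φ) :=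
  ⟨h.continuous.measurable.comp measurable_snd, fun _ => h.1, fun n =>
    (h.2 n).imp fun _ hC _ => hC⟩

theorem STS.sum {ι : Type*} (s : Finset ι) {ψ : ι → Ω → Rd d → ℝ} (h : ∀ v ∈ s, STS (ψ v)) :
    STS (fun t x => ∑ v ∈ s, ψ v t x) := by
  classical
  induction s using Finset.induction_on with
  | empty => simpa using STS_const (Sm_const (d := d) 0)
  | insert a s ha ih =>
    simp only [Finset.sum_insert ha]
    exact (h a (Finset.mem_insert_self _ _)).add
      (ih fun v hv => h v (Finset.mem_insert_of_mem hv))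

theorem STS.integral (h : STS ψ) (μ : Measure Ω) [IsFiniteMeasure μ] :
    Sm (fun x => ∫ t, ψ t x ∂μ) ∧
      ∀ w, FDExpansion.pds w (fun x => ∫ t, ψ t x ∂μ) = fun x => ∫ t, FDExpansion.pds w (ψ t) x ∂μ := by
  have key : ∀ {ψ : Ω → Rd d → ℝ}, STS ψ → Differentiable ℝ (fun x => ∫ t, ψ t x ∂μ) ∧
      ∀ i, FDExpansion.pderiv i (fun x => ∫ t, ψ t x ∂μ)
        = fun x => ∫ t, FDExpansion.pderiv i (ψ t) x ∂μ := fun {ψ} h => by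
    obtain ⟨C, hC⟩ := h.bd 1
    exact differentiable_integral_param h.meas (fun t => (h.slice t).differentiable)
      (fun t => (hC t).bound) (fun i t => ((hC t).pderiv (n := 0) i).bound)
  have hpds : ∀ w, FDExpansion.pds w (fun x => ∫ t, ψ t x ∂μ)
      = fun x => ∫ t, FDExpansion.pds w (ψ t) x ∂μ := fun w => by
    induction w with
    | nil => rfl
    | cons i w ih => rw [pds_cons, ih, (key (h.pds w)).2 i]; rfl
  have hcd : ∀ n : ℕ, ∀ {ψ : Ω → Rd d → ℝ}, STS ψ → ContDiff ℝ n (fun x => ∫ t, ψ t x ∂μ) := by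
    intro n
    induction n with
    | zero => intro ψ h; exact contDiff_zero.2 (key h).1.continuous
    | succ n ih =>
      intro ψ h
      refine contDiff_succ_of_pderiv (key h).1 fun i => ?_
      rw [(key h).2 i]; exact ih (h.pderiv i)
  refine ⟨⟨contDiff_infty.2 fun n => hcd n h, fun n => ?_⟩, hpds⟩
  obtain ⟨C, hC⟩ := h.bd n
  refine ⟨C * μ.real univ, fun w hw x => ?_⟩
  rw [hpds]
  exact norm_integral_le_of_norm_le_const (f := fun t => FDExpansion.pds w (ψ t) x) (C := C)
    (Eventually.of_forall fun t => hC t w hw x)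

end Parameter

/-! ### Integration in time -/

/-- The projection of the real line onto `[0,T]`. -/
noncomputable def clampT (T t : ℝ) : ℝ := max 0 (min t T)

theorem clampT_nonneg (T t : ℝ) : 0 ≤ clampT T t := le_max_left _ _

theorem clampT_mem {T : ℝ} (hT : 0 ≤ T) (t : ℝ) : clampT T t ∈ Icc (0 : ℝ) T :=
  ⟨le_max_left _ _, max_le hT (min_le_right _ _)⟩

theorem clampT_of_mem {T t : ℝ} (h : t ∈ Icc (0 : ℝ) T) : clampT T t = t := by
  rw [clampT, min_eq_left h.2, max_eq_right h.1]

theorem continuous_clampT (T : ℝ) : Continuous (clampT T) := by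
  unfold clampT; fun_prop

/-- `∫_0^t ψ(s,·) ds`, frozen outside `[0,T]`. -/
noncomputable def tint (T : ℝ) (ψ : ℝ → Rd d → ℝ) (t : ℝ) (x : Rd d) : ℝ :=
  ∫ s in (0 : ℝ)..(clampT T t), ψ s x

theorem intervalIntegrable_of_bound {f : ℝ → ℝ} {C : ℝ} (hm : Measurable f) (hb : ∀ s, |f s| ≤ C)
    (a b : ℝ) : IntervalIntegrable f volume a b := by
  rw [intervalIntegrable_iff]
  exact Measure.integrableOn_of_bounded (M := C) (by simp) hm.aestronglyMeasurable
    (Eventually.of_forall hb)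

theorem STS.intervalIntegrable {ψ : ℝ → Rd d → ℝ} (h : STS ψ) (x : Rd d) (a b : ℝ) :
    IntervalIntegrable (fun s => ψ s x) volume a b := by
  obtain ⟨C, hC⟩ := h.bound
  exact intervalIntegrable_of_bound (h.measurable_slice x) (fun s => hC s x) a b

theorem tint_eq {T : ℝ} (hT : 0 ≤ T) (ψ : ℝ → Rd d → ℝ) (t : ℝ) :
    tint T ψ t = fun x => ∫ s, ψ s x ∂(volume.restrict (Ioc 0 (clampT T t))) := by
  funext x; rw [tint, intervalIntegral.integral_of_le (clampT_mem hT t).1]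

theorem measurable_tint {T : ℝ} {ψ : ℝ → Rd d → ℝ} (hm : Measurable (Function.uncurry ψ))
    {C : ℝ} (hb : ∀ t x, |ψ t x| ≤ C) : Measurable (Function.uncurry (tint T ψ)) := by
  refine measurable_uncurry_of_continuous_of_measurable (u := tint T ψ) ?_ ?_ |>.comp measurable_id
  · intro x
    have : Continuous fun c : ℝ => ∫ s in (0 : ℝ)..c, ψ s x :=
      intervalIntegral.continuous_primitive (fun a b => intervalIntegrable_of_bound
        (hm.comp measurable_prodMk_right) (fun s => hb s x) a b) 0
    exact this.comp (continuous_clampT T)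
  · intro t
    have : Measurable (fun x : Rd d => ∫ s in Ioc (0 : ℝ) (clampT T t), ψ s x) := by
      have hs : StronglyMeasurable (Function.uncurry fun (x : Rd d) (s : ℝ) => ψ s x) :=
        (hm.comp measurable_swap).stronglyMeasurable
      exact (hs.integral_prod_right (ν := volume.restrict (Ioc (0 : ℝ) (clampT T t)))).measurable
    have e : tint T ψ t = fun x : Rd d => ∫ s in Ioc (0 : ℝ) (clampT T t), ψ s x := by
      funext x; rw [tint, intervalIntegral.integral_of_le (clampT_nonneg T t)]
    rw [e]; exact this

theorem STS.pds_tint {T : ℝ} (hT : 0 ≤ T) {ψ : ℝ → Rd d → ℝ} (h : STS ψ) (w : List (Fin d))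
    (t : ℝ) : FDExpansion.pds w (tint T ψ t) = tint T (fun s => FDExpansion.pds w (ψ s)) t := by
  rw [tint_eq hT, tint_eq hT]; exact (h.integral _).2 w

theorem STS.tint {T : ℝ} (hT : 0 ≤ T) {ψ : ℝ → Rd d → ℝ} (h : STS ψ) : STS (tint T ψ) := by
  obtain ⟨C, hC⟩ := h.bound
  refine ⟨measurable_tint h.meas hC, fun t => ?_, fun n => ?_⟩
  · rw [tint_eq hT]; exact (h.integral _).1.1
  · obtain ⟨C, hC⟩ := h.bd n
    refine ⟨C * T, fun t w hw x => ?_⟩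
    rw [h.pds_tint hT]
    have := intervalIntegral.norm_integral_le_of_norm_le_const (a := 0) (b := clampT T t)
      (f := fun s => FDExpansion.pds w (ψ s) x) (C := C) fun s _ => hC s w hw x
    refine this.trans (mul_le_mul_of_nonneg_left ?_ (hC 0).nonneg)
    rw [sub_zero, abs_of_nonneg (clampT_mem hT t).1]; exact (clampT_mem hT t).2

/-! ### The maximum principle -/

theorem integral_pow_factorial (β M : ℝ) (k : ℕ) (t : ℝ) :
    ∫ r in (0 : ℝ)..t, β * (M * ((β * r) ^ k / (k.factorial : ℝ)))
      = M * ((β * t) ^ (k + 1) / ((k + 1).factorial : ℝ)) := by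
  have hd : ∀ r : ℝ, HasDerivAt (fun r : ℝ => M * ((β * r) ^ (k + 1) / ((k + 1).factorial : ℝ)))
      (β * (M * ((β * r) ^ k / (k.factorial : ℝ)))) r := fun r => by
    have h1 : HasDerivAt (fun r : ℝ => β * r) β r := by simpa using (hasDerivAt_id r).const_mul β
    refine (((h1.pow (k + 1)).div_const _).const_mul M).congr_deriv ?_
    rw [Nat.factorial_succ]; push_cast
    have : (k.factorial : ℝ) ≠ 0 := by positivity
    have h2 : (k : ℝ) + 1 ≠ 0 := by positivity
    field_simp
  rw [intervalIntegral.integral_eq_sub_of_hasDerivAt (fun r _ => hd r)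
    ((by fun_prop : Continuous fun r : ℝ =>
      β * (M * ((β * r) ^ k / (k.factorial : ℝ)))).intervalIntegrable _ _)]
  simp

/-- The maximum principle for finite difference operators, for functions that are absolutely
continuous in time. -/
theorem max_principle {T h β R B : ℝ} {s : Finset (Rd d)} {b : Rd d → ℝ → Rd d → ℝ}
    {a y G : ℝ → Rd d → ℝ}
    (hb : ∀ v ∈ s, ∀ t ∈ Icc (0 : ℝ) T, ∀ x, 0 ≤ b v t x)
    (hβ : ∀ t ∈ Icc (0 : ℝ) T, ∀ x, ∑ v ∈ s, b v t x ≤ β)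
    (ha : ∀ t ∈ Icc (0 : ℝ) T, ∀ x, 0 ≤ a t x)
    (hB : ∀ t ∈ Icc (0 : ℝ) T, ∀ x, y t x ≤ B)
    (hint : ∀ t ∈ Icc (0 : ℝ) T, ∀ x, IntervalIntegrable (fun r => G r x) volume 0 t)
    (hy : ∀ t ∈ Icc (0 : ℝ) T, ∀ x, y t x = y 0 x + ∫ r in (0 : ℝ)..t, G r x)
    (h0 : ∀ x, y 0 x ≤ R)
    (hG : ∀ t ∈ Icc (0 : ℝ) T, ∀ x,
      G t x ≤ ∑ v ∈ s, b v t x * (y t (x + h • v) - y t x) - a t x * (y t x - R)) :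
    ∀ t ∈ Icc (0 : ℝ) T, ∀ x, y t x ≤ R := by
  by_cases hT : (0 : ℝ) ≤ T
  swap
  · intro t ht; exact absurd (ht.1.trans ht.2) hT
  have hβ0 : 0 ≤ β := (Finset.sum_nonneg fun v hv => hb v hv 0 (left_mem_Icc.2 hT) 0).trans
    (hβ 0 (left_mem_Icc.2 hT) 0)
  have key : ∀ k : ℕ, ∀ t ∈ Icc (0 : ℝ) T, ∀ x,
      y t x - R ≤ |B - R| * ((β * t) ^ k / (k.factorial : ℝ)) := by
    intro k
    induction k with
    | zero => intro t ht x; simpa using (sub_le_sub_right (hB t ht x) R).trans (le_abs_self _)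
    | succ k ih =>
      intro t ht x
      have hpos : ∀ r ∈ Icc (0 : ℝ) T, 0 ≤ |B - R| * ((β * r) ^ k / (k.factorial : ℝ)) :=
        fun r hr => mul_nonneg (abs_nonneg _)
          (div_nonneg (pow_nonneg (mul_nonneg hβ0 hr.1) _) (Nat.cast_nonneg _))
      by_cases hle : y t x ≤ R
      · exact (sub_nonpos.2 hle).trans (mul_nonneg (abs_nonneg _)
          (div_nonneg (pow_nonneg (mul_nonneg hβ0 ht.1) _) (Nat.cast_nonneg _)))
      push Not at hle
      have hsub : ∀ r ∈ Icc (0 : ℝ) t, r ∈ Icc (0 : ℝ) T := fun r hr => ⟨hr.1, hr.2.trans ht.2⟩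
      have hcont : ContinuousOn (fun r => y r x) (Icc 0 t) := by
        have h1 : ContinuousOn (fun r => y 0 x + ∫ r in (0 : ℝ)..r, G r x) (Icc 0 t) := by
          refine continuousOn_const.add ?_
          have := intervalIntegral.continuousOn_primitive_interval (μ := volume)
            (f := fun r => G r x) (a := 0) (b := t)
            (by
              have := (intervalIntegrable_iff_integrableOn_Icc_of_le ht.1).1 (hint t ht x)
              rwa [uIcc_of_le ht.1])
          rwa [uIcc_of_le ht.1] at this
        exact h1.congr fun r hr => hy r (hsub r hr) x
      set Z := {r ∈ Icc (0 : ℝ) t | y r x ≤ R} with hZ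
      have hZc : IsCompact Z := by
        refine isCompact_Icc.of_isClosed_subset ?_ (sep_subset _ _)
        exact hcont.preimage_isClosed_of_isClosed isClosed_Icc isClosed_Iic
      have hZn : Z.Nonempty := ⟨0, left_mem_Icc.2 ht.1, h0 x⟩
      obtain ⟨s0, hs0, hmax⟩ := hZc.exists_isGreatest hZn
      have hs0t : s0 ≤ t := hs0.1.2
      have hint' : IntervalIntegrable (fun r => G r x) volume s0 t :=
        (hint s0 (hsub _ hs0.1) x).symm.trans (hint t ht x)
      have hyt : y t x = y s0 x + ∫ r in s0..t, G r x := by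
        rw [hy t ht x, hy s0 (hsub _ hs0.1) x, add_assoc,
          intervalIntegral.integral_add_adjacent_intervals (hint s0 (hsub _ hs0.1) x) hint']
      have hcontM : Continuous fun r : ℝ => β * (|B - R| * ((β * r) ^ k / (k.factorial : ℝ))) := by
        fun_prop
      have h1 : ∫ r in s0..t, G r x
          ≤ ∫ r in s0..t, β * (|B - R| * ((β * r) ^ k / (k.factorial : ℝ))) := by
        refine intervalIntegral.integral_mono_on_of_le_Ioo hs0t hint'
          (hcontM.intervalIntegrable _ _) fun r hr => ?_
        have hrt : r ∈ Icc (0 : ℝ) t := ⟨hs0.1.1.trans hr.1.le, hr.2.le⟩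
        have hrT := hsub r hrt
        have hyr : R < y r x := by
          by_contra hcon
          exact absurd (hmax ⟨hrt, not_lt.1 hcon⟩) (not_le.2 hr.1)
        refine (hG r hrT x).trans ?_
        have e1 : 0 ≤ a r x * (y r x - R) := mul_nonneg (ha r hrT x) (by linarith)
        have e2 : ∑ v ∈ s, b v r x * (y r (x + h • v) - y r x)
            ≤ ∑ v ∈ s, b v r x * (|B - R| * ((β * r) ^ k / (k.factorial : ℝ))) :=
          Finset.sum_le_sum fun v hv => mul_le_mul_of_nonneg_left
            (by linarith [ih r hrT (x + h • v)]) (hb v hv r hrT x)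
        rw [← Finset.sum_mul] at e2
        have e3 := mul_le_mul_of_nonneg_right (hβ r hrT x) (hpos r hrT)
        linarith
      have h2 : ∫ r in s0..t, β * (|B - R| * ((β * r) ^ k / (k.factorial : ℝ)))
          ≤ ∫ r in (0 : ℝ)..t, β * (|B - R| * ((β * r) ^ k / (k.factorial : ℝ))) := by
        refine intervalIntegral.integral_mono_interval hs0.1.1 hs0t le_rfl ?_
          (hcontM.intervalIntegrable _ _)
        filter_upwards [ae_restrict_mem measurableSet_Ioc] with r hr
        exact mul_nonneg hβ0 (hpos r (hsub r ⟨hr.1.le, hr.2⟩))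
      rw [integral_pow_factorial] at h2
      have := hs0.2
      linarith
  intro t ht x
  have hlim : Tendsto (fun k : ℕ => |B - R| * ((β * t) ^ k / (k.factorial : ℝ))) atTop (𝓝 0) := by
    simpa using (FloorSemiring.tendsto_pow_div_factorial_atTop (β * t)).const_mul |B - R|
  have := ge_of_tendsto hlim (Eventually.of_forall fun k => key k t ht x)
  linarith


/-! ### Smooth schemes -/

/-- The jump intensities `h⁻² χ_{h,λ}` of the operator `L_h`. -/
noncomputable def Scheme.rate (S : Scheme d) (h : ℝ) (v : Rd d) (t : ℝ) (x : Rd d) : ℝ :=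
  h⁻¹ ^ 2 * S.chi h v t x

theorem Scheme.Lh_eq (S : Scheme d) {h : ℝ} (hh : h ≠ 0) (t : ℝ) (φ : Rd d → ℝ) (x : Rd d) :
    S.Lh h t φ x = ∑ v ∈ S.Λ₁, S.rate h v t x * (φ (x + h • v) - φ x) - S.c t x * φ x := by
  unfold Scheme.Lh fdiff Scheme.rate Scheme.chi
  rw [Finset.mul_sum, ← Finset.sum_add_distrib]
  congr 1
  refine Finset.sum_congr rfl fun v _ => ?_
  field_simp

theorem Scheme.Lh_sub (S : Scheme d) (h t : ℝ) (φ ψ : Rd d → ℝ) (x : Rd d) :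
    S.Lh h t (fun x => φ x - ψ x) x = S.Lh h t φ x - S.Lh h t ψ x := by
  have e : ∀ v, fdiff h v (fun x => φ x - ψ x) x = fdiff h v φ x - fdiff h v ψ x := fun v => by
    unfold fdiff; ring
  simp only [Scheme.Lh, e, mul_sub, Finset.sum_sub_distrib]
  ring

/-- Schemes with smooth coefficients. -/
structure Scheme.Smooth (S : Scheme d) : Prop where
  q : ∀ v ∈ S.Λ₁, STS (S.q v)
  p : ∀ v ∈ S.Λ₁, STS (S.p v)
  c : STS S.c

variable {S : Scheme d}

theorem Scheme.Smooth.rate (hS : S.Smooth) (h : ℝ) {v : Rd d} (hv : v ∈ S.Λ₁) :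
    STS (S.rate h v) :=
  ((hS.q v hv).add ((hS.p v hv).const_mul h)).const_mul (h⁻¹ ^ 2)

theorem Scheme.Smooth.sts_Lh (hS : S.Smooth) {h : ℝ} (hh : h ≠ 0) {u : ℝ → Rd d → ℝ}
    (hu : STS u) : STS (fun t x => S.Lh h t (u t) x) := by
  simp_rw [S.Lh_eq hh]
  exact (STS.sum _ fun v hv => (hS.rate h hv).mul ((hu.translate _).sub hu)).sub (hS.c.mul hu)

theorem Scheme.Smooth.sm_Lh (hS : S.Smooth) {h : ℝ} (hh : h ≠ 0) {φ : Rd d → ℝ}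
    (hu : Sm φ) (t : ℝ) : Sm (S.Lh h t φ) :=
  (hS.sts_Lh hh (STS_const hu)).slice t

theorem Scheme.Smooth.db_Lh (hS : S.Smooth) {h : ℝ} (hh : h ≠ 0) (n : ℕ) :
    ∃ β, 0 ≤ β ∧ ∀ t φ C, Sm φ → DB n C φ → DB n (β * C) (S.Lh h t φ) := by
  have : ∀ v, ∃ B, v ∈ S.Λ₁ → ∀ t, DB n B (S.rate h v t) := fun v => by
    by_cases hv : v ∈ S.Λ₁
    · exact ((hS.rate h hv).bd n).imp fun B hB _ => hB
    · exact ⟨0, fun h => (hv h).elim⟩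
  choose B hB using this
  obtain ⟨Cc, hCc⟩ := hS.c.bd n
  refine ⟨∑ v ∈ S.Λ₁, 2 ^ n * B v * 2 + 2 ^ n * Cc, ?_, fun t φ C hs hC => ?_⟩
  · have h1 := (hCc 0).nonneg
    have : ∀ v ∈ S.Λ₁, 0 ≤ 2 ^ n * B v * 2 := fun v hv => by
      have := (hB v hv 0).nonneg; positivity
    have := Finset.sum_nonneg this
    positivity
  · have e : S.Lh h t φ = fun x => ∑ v ∈ S.Λ₁, S.rate h v t x * (φ (x + h • v) - φ x)
        - S.c t x * φ x := by funext x; exact S.Lh_eq hh t φ x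
    have hsv : ∀ v ∈ S.Λ₁, Sm (fun x => S.rate h v t x * (φ (x + h • v) - φ x)) := fun v hv =>
      ((hS.rate h hv).slice t).mul ((hs.translate _).sub hs)
    have h1 := DB.sum S.Λ₁ (n := n) (C := fun v => 2 ^ n * B v * (C + C))
      (φ := fun v x => S.rate h v t x * (φ (x + h • v) - φ x))
      (fun v hv => (hB v hv t).mul ((hC.translate _).sub hC (hs.translate _).1 hs.1)
        ((hS.rate h hv).sm t) ((hs.translate _).sub hs).1) (fun v hv => (hsv v hv).1)
    have h2 := (hCc t).mul hC (hS.c.sm t) hs.1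
    rw [e]
    refine (h1.sub h2 (Sm.sum _ hsv).1 ((hS.c.slice t).mul hs).1).mono le_rfl (le_of_eq ?_)
    rw [add_mul, Finset.sum_mul]
    congr 1
    exact Finset.sum_congr rfl fun v _ => by ring

/-! ### Existence of smooth solutions -/

theorem STS.of_uniform_limit {Ω : Type*} [MeasurableSpace Ω] {U : ℕ → Ω → Rd d → ℝ}
    {u : Ω → Rd d → ℝ} (hU : ∀ k, STS (U k)) (hb : ∀ n, ∃ C, ∀ k t, DB n C (U k t))
    (hlim : ∀ t, TendstoUniformly (fun k => U k t) (u t) atTop) : STS u := by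
  have hLB : ∀ n, ∃ C, ∀ t, LB n C (u t) := fun n => by
    obtain ⟨C, hC⟩ := hb n
    exact ⟨C, fun t => LB.of_tendsto (fun k => (hC k t).lb ((hU k).slice t)) (hlim t)⟩
  have hcd : ∀ t, ContDiff ℝ ∞ (u t) := fun t => contDiff_infty.2 fun n => by
    obtain ⟨C, hC⟩ := hLB (n + 1); exact (hC t).contDiff
  refine ⟨?_, hcd, fun n => ?_⟩
  · refine measurable_of_tendsto_metrizable (fun k => (hU k).meas) (tendsto_pi_nhds.2 fun z => ?_)
    exact (hlim z.1).tendsto_at z.2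
  · obtain ⟨C, hC⟩ := hLB n
    exact ⟨C, fun t w hw x => (hC t).pds_bound (contDiff_infty.1 (hcd t) n) w hw x⟩

theorem exists_smooth_solution (hS : S.Smooth) {h T : ℝ} (hh : h ≠ 0) (hT : 0 ≤ T)
    {F : ℝ → Rd d → ℝ} (hF : STS F) {g : Rd d → ℝ} (hg : Sm g) :
    ∃ u : ℝ → Rd d → ℝ, STS u ∧
      ∀ t x, u t x = g x + tint T (fun s x => S.Lh h s (u s) x + F s x) t x := by
  set step : (ℝ → Rd d → ℝ) → ℝ → Rd d → ℝ := fun u t x =>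
    g x + tint T (fun s x => S.Lh h s (u s) x + F s x) t x with hstep
  have hRHS : ∀ {u}, STS u → STS (fun s x => S.Lh h s (u s) x + F s x) := fun hu =>
    (hS.sts_Lh hh hu).add hF
  have hstepS : ∀ {u}, STS u → STS (step u) := fun hu =>
    (STS_const hg).add ((hRHS hu).tint hT)
  set U : ℕ → ℝ → Rd d → ℝ := fun k => step^[k] (fun _ => g) with hU
  have hUsucc : ∀ k, U (k + 1) = step (U k) := fun k => Function.iterate_succ_apply' _ _ _
  have hUS : ∀ k, STS (U k) := fun k => by
    induction k with
    | zero => exact STS_const hg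
    | succ k ih => rw [hUsucc]; exact hstepS ih
  have hUb : ∀ n, ∃ C, ∀ k t, DB n C (U k t) := by
    intro n
    obtain ⟨β, hβ, Hβ⟩ := hS.db_Lh hh n
    obtain ⟨G0, hG0⟩ := hg.2 n
    obtain ⟨F0, hF0⟩ := hF.bd n
    have hF00 := (hF0 0).nonneg
    have hG00 := hG0.nonneg
    have key : ∀ k t, DB n ((G0 + F0) * Real.exp ((β + 1) * clampT T t)) (U k t) := by
      intro k
      induction k with
      | zero =>
        intro t
        refine hG0.mono le_rfl ?_
        have : 1 ≤ Real.exp ((β + 1) * clampT T t) :=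
          Real.one_le_exp (mul_nonneg (by linarith) (clampT_nonneg _ _))
        nlinarith
      | succ k ih =>
        intro t w hw x
        rw [hUsucc]
        simp only [hstep]
        rw [pds_add hg.1 (((hRHS (hUS k)).tint hT).sm t), (hRHS (hUS k)).pds_tint hT]
        have hc := clampT_mem hT t
        have h1 : |tint T (fun s => pds w (fun x => S.Lh h s (U k s) x + F s x)) t x|
            ≤ ∫ s in (0 : ℝ)..clampT T t,
              (β + 1) * ((G0 + F0) * Real.exp ((β + 1) * s)) := by
          refine intervalIntegral.norm_integral_le_of_norm_le (μ := volume)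
            (f := fun s => pds w (fun x => S.Lh h s (U k s) x + F s x) x)
            (g := fun s => (β + 1) * ((G0 + F0) * Real.exp ((β + 1) * s))) hc.1
            (Eventually.of_forall fun s hs => ?_)
            ((by fun_prop : Continuous fun s : ℝ =>
              (β + 1) * ((G0 + F0) * Real.exp ((β + 1) * s))).intervalIntegrable _ _)
          have hs' : clampT T s = s := clampT_of_mem ⟨hs.1.le, hs.2.trans hc.2⟩
          have h2 := ((Hβ s _ _ ((hUS k).slice s) (ih s)).add (hF0 s)
            (hS.sm_Lh hh ((hUS k).slice s) s).1 (hF.sm s)) w hw x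
          rw [hs'] at h2
          refine h2.trans ?_
          have : 1 ≤ Real.exp ((β + 1) * s) :=
            Real.one_le_exp (mul_nonneg (by linarith) hs.1.le)
          nlinarith
        have h3 : ∫ s in (0 : ℝ)..clampT T t, (β + 1) * ((G0 + F0) * Real.exp ((β + 1) * s))
            = (G0 + F0) * Real.exp ((β + 1) * clampT T t) - (G0 + F0) := by
          have hd : ∀ s : ℝ, HasDerivAt (fun s : ℝ => (G0 + F0) * Real.exp ((β + 1) * s))
              ((β + 1) * ((G0 + F0) * Real.exp ((β + 1) * s))) s := fun s => by
            have h1 : HasDerivAt (fun r : ℝ => (β + 1) * r) (β + 1) s := by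
              simpa using (hasDerivAt_id s).const_mul (β + 1)
            exact (h1.exp.const_mul (G0 + F0)).congr_deriv (by ring)
          rw [intervalIntegral.integral_eq_sub_of_hasDerivAt (fun r _ => hd r)
            ((by fun_prop : Continuous fun s : ℝ =>
              (β + 1) * ((G0 + F0) * Real.exp ((β + 1) * s))).intervalIntegrable _ _)]
          simp
        refine (abs_add_le _ _).trans ?_
        linarith [hG0 w hw x]
    refine ⟨(G0 + F0) * Real.exp ((β + 1) * T), fun k t => (key k t).mono le_rfl ?_⟩
    refine mul_le_mul_of_nonneg_left (Real.exp_le_exp.2 ?_) (by positivity)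
    exact mul_le_mul_of_nonneg_left (clampT_mem hT t).2 (by positivity)
  obtain ⟨β, hβ, Hβ⟩ := hS.db_Lh hh 0
  have hLip : ∀ {u v : ℝ → Rd d → ℝ} {e : ℝ → ℝ}, STS u → STS v → Continuous e →
      (∀ t ∈ Icc (0 : ℝ) T, ∀ x, |u t x - v t x| ≤ e t) →
      ∀ t x, |step u t x - step v t x| ≤ ∫ s in (0 : ℝ)..clampT T t, β * e s := by
    intro u v e hu hv he hle t x
    have hc := clampT_mem hT t
    simp only [hstep, tint, add_sub_add_left_eq_sub]
    rw [← intervalIntegral.integral_sub ((hRHS hu).intervalIntegrable x _ _)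
      ((hRHS hv).intervalIntegrable x _ _)]
    refine intervalIntegral.norm_integral_le_of_norm_le (μ := volume)
      (f := fun s => S.Lh h s (u s) x + F s x - (S.Lh h s (v s) x + F s x))
      (g := fun s => β * e s) hc.1
      (Eventually.of_forall fun s hs => ?_) ((continuous_const.mul he).intervalIntegrable _ _)
    have := (Hβ s _ (e s) ((hu.slice s).sub (hv.slice s))
      (DB_zero_iff.2 (hle s ⟨hs.1.le, hs.2.trans hc.2⟩))).bound x
    rw [S.Lh_sub] at this
    rw [add_sub_add_right_eq_sub]; exact this
  obtain ⟨C0, hC0⟩ := hUb 0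
  have hC00 := (hC0 0 0).nonneg
  have hdiff : ∀ k t x, |U (k + 1) t x - U k t x|
      ≤ (2 * C0) * ((β * clampT T t) ^ k / (k.factorial : ℝ)) := by
    intro k
    induction k with
    | zero =>
      intro t x
      have := abs_sub (U 1 t x) (U 0 t x)
      simp only [pow_zero, Nat.factorial_zero, Nat.cast_one, div_one, mul_one, zero_add]
      linarith [(hC0 1 t).bound x, (hC0 0 t).bound x]
    | succ k ih =>
      intro t x
      have e1 : U (k + 1 + 1) t x - U (k + 1) t x = step (U (k + 1)) t x - step (U k) t x := by
        rw [hUsucc (k + 1), hUsucc k]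
      rw [e1, ← integral_pow_factorial]
      refine hLip (e := fun s => (2 * C0) * ((β * s) ^ k / (k.factorial : ℝ)))
        (hUS (k + 1)) (hUS k) (by fun_prop) (fun s hs y => ?_) t x
      have := ih s y
      rwa [clampT_of_mem hs] at this
  set D : ℕ → ℝ := fun k => (2 * C0) * ((β * T) ^ k / (k.factorial : ℝ)) with hD
  have hDs : Summable D := (Real.summable_pow_div_factorial (β * T)).mul_left _
  have hdist : ∀ t x k, dist (U k t x) (U (k + 1) t x) ≤ D k := fun t x k => by
    rw [dist_comm, Real.dist_eq]
    refine (hdiff k t x).trans ?_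
    have := clampT_mem hT t
    have h0 : 0 ≤ β * clampT T t := mul_nonneg hβ this.1
    have h1 : β * clampT T t ≤ β * T := mul_le_mul_of_nonneg_left this.2 hβ
    simp only [hD]
    gcongr
  have hex : ∀ t x, ∃ y, Tendsto (fun k => U k t x) atTop (𝓝 y) := fun t x =>
    cauchySeq_tendsto_of_complete (cauchySeq_of_dist_le_of_summable D (hdist t x) hDs)
  choose u hu using hex
  have hunif : ∀ ε > 0, ∀ᶠ k in atTop, ∀ t x, |U k t x - u t x| < ε := fun ε hε => by
    filter_upwards [(tendsto_sum_nat_add D).eventually_lt_const hε] with k hk t x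
    refine lt_of_le_of_lt ?_ hk
    have := dist_le_tsum_of_dist_le_of_tendsto D (hdist t x) hDs (hu t x) k
    rw [Real.dist_eq] at this
    refine this.trans (le_of_eq (tsum_congr fun i => by rw [add_comm]))
  have huS : STS u := STS.of_uniform_limit hUS hUb fun t => by
    rw [Metric.tendstoUniformly_iff]
    intro ε hε
    filter_upwards [hunif ε hε] with k hk x
    rw [dist_comm]; exact hk t x
  refine ⟨u, huS, fun t x => ?_⟩
  have hstep_lim : Tendsto (fun k => step (U k) t x) atTop (𝓝 (step u t x)) := by
    rw [Metric.tendsto_atTop]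
    intro ε hε
    obtain ⟨k0, hk0⟩ := eventually_atTop.1 (hunif (ε / (β * T + 1)) (by positivity))
    refine ⟨k0, fun k hk => ?_⟩
    have := hLip (e := fun _ => ε / (β * T + 1)) (hUS k) huS continuous_const
      (fun s _ y => (hk0 k hk s y).le) t x
    rw [Real.dist_eq]
    refine this.trans_lt ?_
    rw [intervalIntegral.integral_const, sub_zero, smul_eq_mul]
    have h1 : clampT T t * (β * (ε / (β * T + 1))) ≤ T * (β * (ε / (β * T + 1))) :=
      mul_le_mul_of_nonneg_right (clampT_mem hT t).2 (by positivity)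
    refine h1.trans_lt ?_
    have : T * (β * (ε / (β * T + 1))) = ε * ((β * T) / (β * T + 1)) := by ring
    rw [this]
    have : β * T / (β * T + 1) < 1 := by rw [div_lt_one (by positivity)]; linarith
    nlinarith
  have h2 : Tendsto (fun k => U (k + 1) t x) atTop (𝓝 (u t x)) :=
    (hu t x).comp (tendsto_add_atTop_nat 1)
  simp_rw [hUsucc] at h2
  exact tendsto_nhds_unique h2 hstep_lim


/-! ### The operators `\bar δ_{h,λ}` and `T_{h,λ}` on smooth functions -/

section Operators

variable {τ : Rd d → ℝ} {τ₀ h : ℝ}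

theorem Sm.shift {φ : Rd d → ℝ} (hs : Sm φ) (h : ℝ) (μ : Rd d ⊕ Fin d) : Sm (shift h μ φ) := by
  cases μ with
  | inl v => exact hs.translate _
  | inr i => exact hs

theorem Sm.barDelta {φ : Rd d → ℝ} (hs : Sm φ) (μ : Rd d ⊕ Fin d) : Sm (barDelta τ τ₀ h μ φ) := by
  cases μ with
  | inl v => exact ((hs.translate _).sub hs).const_mul _
  | inr i => exact (hs.pderiv i).const_mul _

theorem Sm.fdiff {φ : Rd d → ℝ} (hs : Sm φ) (h : ℝ) (v : Rd d) : Sm (fdiff h v φ) := by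
  have : FDExpansion.fdiff h v φ = fun x => h⁻¹ * (φ (x + h • v) - φ x) := by
    funext x; rw [FDExpansion.fdiff, div_eq_inv_mul]
  rw [this]; exact ((hs.translate _).sub hs).const_mul _

theorem pderiv_barDelta {φ : Rd d → ℝ} (hs : Sm φ) (i : Fin d) (μ : Rd d ⊕ Fin d) :
    pderiv i (barDelta τ τ₀ h μ φ) = barDelta τ τ₀ h μ (pderiv i φ) := by
  cases μ with
  | inl v =>
    simp only [barDelta]
    rw [pderiv_const_mul ((hs.translate _).sub hs).differentiable,
      pderiv_sub (hs.translate _).differentiable hs.differentiable, pderiv_translate]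
  | inr j =>
    simp only [barDelta]
    rw [pderiv_const_mul (hs.pderiv j).differentiable, pderiv_comm_top hs.1]

theorem pds_barDelta {φ : Rd d → ℝ} (hs : Sm φ) (w : List (Fin d)) (μ : Rd d ⊕ Fin d) :
    pds w (barDelta τ τ₀ h μ φ) = barDelta τ τ₀ h μ (pds w φ) := by
  induction w with
  | nil => rfl
  | cons i w ih => rw [pds_cons, ih, pderiv_barDelta (hs.pds w)]; rfl

theorem barDelta_comm {φ : Rd d → ℝ} (hs : Sm φ) (μ ν : Rd d ⊕ Fin d) :
    barDelta τ τ₀ h μ (barDelta τ τ₀ h ν φ) = barDelta τ τ₀ h ν (barDelta τ τ₀ h μ φ) := by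
  cases μ with
  | inl v =>
    cases ν with
    | inl w =>
      funext x; simp only [barDelta]
      rw [add_right_comm x]; ring
    | inr j =>
      have := pderiv_barDelta (τ := τ) (τ₀ := τ₀) (h := h) hs j (Sum.inl v)
      funext x
      have e := congrFun this x
      simp only [barDelta] at e ⊢
      rw [e]; ring
  | inr i =>
    have := pderiv_barDelta (τ := τ) (τ₀ := τ₀) (h := h) hs i ν
    funext x
    have e := congrFun this x
    cases ν with
    | inl w => simp only [barDelta] at e ⊢; rw [e]; ring
    | inr j => simp only [barDelta] at e ⊢; rw [e]; simp only [pderiv_const_mul (hs.pderiv i).differentiable]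

theorem barDelta_translate (φ : Rd d → ℝ) (a : Rd d) (μ : Rd d ⊕ Fin d) :
    barDelta τ τ₀ h μ (fun x => φ (x + a)) = fun x => barDelta τ τ₀ h μ φ (x + a) := by
  cases μ with
  | inl w => funext x; simp only [barDelta]; rw [add_right_comm x]
  | inr j => funext x; simp only [barDelta]; rw [pderiv_translate]

theorem barDelta_shift (φ : Rd d → ℝ) (μ ν : Rd d ⊕ Fin d) :
    barDelta τ τ₀ h μ (shift h ν φ) = shift h ν (barDelta τ τ₀ h μ φ) := by
  cases ν with
  | inl w => exact barDelta_translate φ _ μ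
  | inr j => rfl

theorem barDelta_add {φ ψ : Rd d → ℝ} (hφ : Sm φ) (hψ : Sm ψ) (μ : Rd d ⊕ Fin d) :
    barDelta τ τ₀ h μ (fun x => φ x + ψ x)
      = fun x => barDelta τ τ₀ h μ φ x + barDelta τ τ₀ h μ ψ x := by
  cases μ with
  | inl w => funext x; simp only [barDelta]; ring
  | inr j => funext x; simp only [barDelta]; rw [pderiv_add hφ.differentiable hψ.differentiable]; ring

theorem barDelta_const_mul {φ : Rd d → ℝ} (hφ : Sm φ) (a : ℝ) (μ : Rd d ⊕ Fin d) :
    barDelta τ τ₀ h μ (fun x => a * φ x) = fun x => a * barDelta τ τ₀ h μ φ x := by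
  cases μ with
  | inl w => funext x; simp only [barDelta]; ring
  | inr j => funext x; simp only [barDelta]; rw [pderiv_const_mul hφ.differentiable]; ring

theorem barDelta_sum {ι : Type*} (s : Finset ι) {φ : ι → Rd d → ℝ} (hφ : ∀ v ∈ s, Sm (φ v))
    (μ : Rd d ⊕ Fin d) :
    barDelta τ τ₀ h μ (fun x => ∑ v ∈ s, φ v x) = fun x => ∑ v ∈ s, barDelta τ τ₀ h μ (φ v) x := by
  cases μ with
  | inl w => funext x; simp only [barDelta]; rw [← Finset.sum_sub_distrib, Finset.mul_sum]
  | inr j =>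
    funext x; simp only [barDelta]
    rw [pderiv_sum s fun v hv => (hφ v hv).differentiable, Finset.mul_sum]

theorem barDelta_mul {φ ψ : Rd d → ℝ} (hφ : Sm φ) (hψ : Sm ψ) (μ : Rd d ⊕ Fin d) :
    barDelta τ τ₀ h μ (fun x => φ x * ψ x)
      = fun x => barDelta τ τ₀ h μ φ x * shift h μ ψ x + φ x * barDelta τ τ₀ h μ ψ x := by
  cases μ with
  | inl w => funext x; simp only [barDelta, shift]; ring
  | inr j =>
    funext x; simp only [barDelta, shift]
    rw [pderiv_mul hφ.differentiable hψ.differentiable]; ring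

theorem barDelta_fdiff {φ : Rd d → ℝ} (hs : Sm φ) (v : Rd d) (μ : Rd d ⊕ Fin d) :
    barDelta τ τ₀ h μ (fdiff h v φ) = fdiff h v (barDelta τ τ₀ h μ φ) := by
  have : fdiff h v φ = fun x => h⁻¹ * (φ (x + h • v) + (-1) * φ x) := by
    funext x; rw [fdiff, div_eq_inv_mul]; ring
  rw [this, barDelta_const_mul ((hs.translate _).add (hs.const_mul _)),
    barDelta_add (hs.translate _) (hs.const_mul _), barDelta_translate, barDelta_const_mul hs]
  funext x; rw [fdiff, div_eq_inv_mul]; ring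

theorem shift_fdiff (φ : Rd d → ℝ) (v : Rd d) (μ : Rd d ⊕ Fin d) :
    shift h μ (fdiff h v φ) = fdiff h v (shift h μ φ) := by
  cases μ with
  | inl w => funext x; simp only [shift, fdiff]; rw [add_right_comm]
  | inr j => rfl

/-- The size of the operator `\bar δ_{h,λ}` on functions with bounded gradient. -/
noncomputable def wt (τ : Rd d → ℝ) (τ₀ : ℝ) : Rd d ⊕ Fin d → ℝ
  | Sum.inl v => d * ‖τ v • v‖
  | Sum.inr _ => |τ₀|

theorem wt_nonneg (μ : Rd d ⊕ Fin d) : 0 ≤ wt τ τ₀ μ := by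
  cases μ <;> simp only [wt] <;> positivity

theorem DB.shift {n : ℕ} {C : ℝ} {φ : Rd d → ℝ} (hb : DB n C φ) (μ : Rd d ⊕ Fin d) :
    DB n C (shift h μ φ) := by
  cases μ with
  | inl v => exact hb.translate _
  | inr i => exact hb

theorem DB.barDelta (hh : 0 < h) {n : ℕ} {C : ℝ} {φ : Rd d → ℝ} (hb : DB (n + 1) C φ) (hs : Sm φ)
    (μ : Rd d ⊕ Fin d) :
    DB n (wt τ τ₀ μ * C) (barDelta τ τ₀ h μ φ) := fun w hw x => by
  rw [pds_barDelta hs]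
  cases μ with
  | inl v =>
    simp only [FDExpansion.barDelta, wt]
    rw [abs_mul, norm_smul, Real.norm_eq_abs, abs_mul, abs_inv, abs_of_pos hh]
    have := (hb.pds (k := 1) w (by omega)).increment (n := 0) (hs.pds w).differentiable x (h • v)
    rw [norm_smul, Real.norm_eq_abs, abs_of_pos hh] at this
    calc |τ v| * h⁻¹ * |FDExpansion.pds w φ (x + h • v) - FDExpansion.pds w φ x|
        ≤ |τ v| * h⁻¹ * (d * (h * ‖v‖) * C) := mul_le_mul_of_nonneg_left this (by positivity)
      _ = d * (|τ v| * ‖v‖) * C := by field_simp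
  | inr i =>
    simp only [FDExpansion.barDelta, wt]
    rw [abs_mul]
    exact mul_le_mul_of_nonneg_left (hb (i :: w) (by simpa using hw) x) (abs_nonneg _)

end Operators

/-! ### Sums over words -/

section Words

variable {L X : Type*} (Λ : Finset L) (D : L → X → X)

/-- `∑ F(D_{λ_n} ⋯ D_{λ_1} x)` over all words `λ_1 ⋯ λ_n` with letters in `Λ`. -/
def wsum : ℕ → (X → ℝ) → X → ℝ
  | 0, F, x => F x
  | n + 1, F, x => ∑ l ∈ Λ, wsum n F (D l x)

variable {Λ D}

theorem wsum_succ' (n : ℕ) (F : X → ℝ) (x : X) :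
    wsum Λ D (n + 1) F x = wsum Λ D n (fun y => ∑ l ∈ Λ, F (D l y)) x := by
  induction n generalizing x with
  | zero => rfl
  | succ n ih =>
    rw [wsum]
    exact Finset.sum_congr rfl fun l _ => ih _

theorem wsum_le {P : X → Prop} (hP : ∀ x, P x → ∀ l ∈ Λ, P (D l x)) {F G : X → ℝ}
    (h : ∀ x, P x → F x ≤ G x) (n : ℕ) {x : X} (hx : P x) : wsum Λ D n F x ≤ wsum Λ D n G x := by
  induction n generalizing x with
  | zero => exact h x hx
  | succ n ih => exact Finset.sum_le_sum fun l hl => ih (hP x hx l hl)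

theorem wsum_add (n : ℕ) (F G : X → ℝ) (x : X) :
    wsum Λ D n (fun y => F y + G y) x = wsum Λ D n F x + wsum Λ D n G x := by
  induction n generalizing x with
  | zero => rfl
  | succ n ih => simp only [wsum, ih, Finset.sum_add_distrib]

theorem wsum_const_mul (n : ℕ) (a : ℝ) (F : X → ℝ) (x : X) :
    wsum Λ D n (fun y => a * F y) x = a * wsum Λ D n F x := by
  induction n generalizing x with
  | zero => rfl
  | succ n ih => simp only [wsum, ih, Finset.mul_sum]

theorem wsum_sub (n : ℕ) (F G : X → ℝ) (x : X) :
    wsum Λ D n (fun y => F y - G y) x = wsum Λ D n F x - wsum Λ D n G x := by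
  induction n generalizing x with
  | zero => rfl
  | succ n ih => simp only [wsum, ih, Finset.sum_sub_distrib]

theorem wsum_sum {ι : Type*} (s : Finset ι) (n : ℕ) (F : ι → X → ℝ) (x : X) :
    wsum Λ D n (fun y => ∑ i ∈ s, F i y) x = ∑ i ∈ s, wsum Λ D n (F i) x := by
  induction n generalizing x with
  | zero => rfl
  | succ n ih => simp only [wsum, ih]; rw [Finset.sum_comm]

theorem wsum_nonneg {F : X → ℝ} (h : ∀ x, 0 ≤ F x) (n : ℕ) (x : X) : 0 ≤ wsum Λ D n F x := by
  induction n generalizing x with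
  | zero => exact h x
  | succ n ih => exact Finset.sum_nonneg fun l _ => ih _

end Words

/-! ### The Leibniz rule for iterated operators -/

section Leibniz

variable (S : Scheme d) (τ : Rd d → ℝ) (τ₀ h : ℝ)

/-- `∑_w F(\bar δ_w φ)` over words `w` of length `n`. -/
noncomputable abbrev bsum (n : ℕ) (F : (Rd d → ℝ) → ℝ) (φ : Rd d → ℝ) : ℝ :=
  wsum S.fullΛ (barDelta τ τ₀ h) n F φ

/-- `∑_w F(\bar δ_w φ, \bar δ_w ψ)` over words `w` of length `n`. -/
noncomputable abbrev bsum₂ (n : ℕ) (F : (Rd d → ℝ) × (Rd d → ℝ) → ℝ) (φ ψ : Rd d → ℝ) : ℝ :=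
  wsum S.fullΛ (fun μ z => (barDelta τ τ₀ h μ z.1, barDelta τ τ₀ h μ z.2)) n F (φ, ψ)

variable (β : (Rd d → ℝ) → (Rd d → Rd d → ℝ) → (Rd d → ℝ) → ℝ)

/-- The sum over words `w` of length `n` of those terms of the Leibniz expansion of
`β(\bar δ_w u, \bar δ_w (a ψ))` in which `k` letters fall on the coefficients `a`. -/
noncomputable def leib : ℕ → ℕ → (Rd d → ℝ) → (Rd d → Rd d → ℝ) → (Rd d → ℝ) → ℝ
  | 0, 0, u, a, ψ => β u a ψ
  | 0, _ + 1, _, _, _ => 0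
  | n + 1, 0, u, a, ψ => ∑ μ ∈ S.fullΛ, leib n 0 (barDelta τ τ₀ h μ u) a (barDelta τ τ₀ h μ ψ)
  | n + 1, k + 1, u, a, ψ => ∑ μ ∈ S.fullΛ,
      (leib n k (barDelta τ τ₀ h μ u) (fun v => barDelta τ τ₀ h μ (a v)) (shift h μ ψ)
        + leib n (k + 1) (barDelta τ τ₀ h μ u) a (barDelta τ τ₀ h μ ψ))

variable {S τ τ₀ h β}

theorem leib_of_lt {n k : ℕ} (hk : n < k) (u : Rd d → ℝ) (a : Rd d → Rd d → ℝ) (ψ : Rd d → ℝ) :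
    leib S τ τ₀ h β n k u a ψ = 0 := by
  induction n generalizing k u a ψ with
  | zero => obtain ⟨k, rfl⟩ : ∃ j, k = j + 1 := ⟨k - 1, by omega⟩; rfl
  | succ n ih =>
    obtain ⟨k, rfl⟩ : ∃ j, k = j + 1 := ⟨k - 1, by omega⟩
    rw [leib]
    refine Finset.sum_eq_zero fun μ _ => ?_
    rw [ih (by omega), ih (by omega), add_zero]

theorem leib_zero_eq (n : ℕ) (u : Rd d → ℝ) (a : Rd d → Rd d → ℝ) (ψ : Rd d → ℝ) :
    leib S τ τ₀ h β n 0 u a ψ = bsum₂ S τ τ₀ h n (fun z => β z.1 a z.2) u ψ := by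
  induction n generalizing u ψ with
  | zero => rfl
  | succ n ih => rw [leib]; exact Finset.sum_congr rfl fun μ _ => ih _ _

theorem bsum₂_diag (n : ℕ) (F : (Rd d → ℝ) × (Rd d → ℝ) → ℝ) (φ : Rd d → ℝ) :
    bsum₂ S τ τ₀ h n F φ φ = bsum S τ τ₀ h n (fun ψ => F (ψ, ψ)) φ := by
  induction n generalizing φ with
  | zero => rfl
  | succ n ih => exact Finset.sum_congr rfl fun μ _ => ih _

theorem bsum₂_sum {ι : Type*} (s : Finset ι) (n : ℕ) (F : ι → (Rd d → ℝ) × (Rd d → ℝ) → ℝ)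
    (φ ψ : Rd d → ℝ) :
    bsum₂ S τ τ₀ h n (fun z => ∑ i ∈ s, F i z) φ ψ = ∑ i ∈ s, bsum₂ S τ τ₀ h n (F i) φ ψ :=
  wsum_sum s n F (φ, ψ)

theorem bsum₂_comm_ops (n : ℕ) (F : (Rd d → ℝ) × (Rd d → ℝ) → ℝ) (μ : Rd d ⊕ Fin d)
    {φ ψ : Rd d → ℝ} (hφ : Sm φ) :
    bsum₂ S τ τ₀ h n F (barDelta τ τ₀ h μ φ) (shift h μ ψ)
      = bsum₂ S τ τ₀ h n (fun z => F (barDelta τ τ₀ h μ z.1, shift h μ z.2)) φ ψ := by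
  induction n generalizing φ ψ with
  | zero => rfl
  | succ n ih =>
    refine Finset.sum_congr rfl fun ν _ => ?_
    have := ih (φ := barDelta τ τ₀ h ν φ) (ψ := barDelta τ τ₀ h ν ψ) (hφ.barDelta ν)
    refine Eq.trans ?_ this
    simp only [bsum₂, barDelta_comm hφ ν μ, barDelta_shift]

theorem leib_one_eq (n : ℕ) {u ψ : Rd d → ℝ} (hu : Sm u) (a : Rd d → Rd d → ℝ) :
    leib S τ τ₀ h β (n + 1) 1 u a ψ = (n + 1) * bsum₂ S τ τ₀ h n (fun z => ∑ μ ∈ S.fullΛ,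
      β (barDelta τ τ₀ h μ z.1) (fun v => barDelta τ τ₀ h μ (a v)) (shift h μ z.2)) u ψ := by
  have hfirst : ∀ (n : ℕ) {u ψ : Rd d → ℝ}, Sm u →
      ∑ μ ∈ S.fullΛ, leib S τ τ₀ h β n 0 (barDelta τ τ₀ h μ u)
      (fun v => barDelta τ τ₀ h μ (a v)) (shift h μ ψ) = bsum₂ S τ τ₀ h n (fun z => ∑ μ ∈ S.fullΛ,
      β (barDelta τ τ₀ h μ z.1) (fun v => barDelta τ τ₀ h μ (a v)) (shift h μ z.2)) u ψ := by
    intro n u ψ hu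
    rw [bsum₂_sum]
    refine Finset.sum_congr rfl fun μ _ => ?_
    rw [leib_zero_eq, bsum₂_comm_ops _ _ _ hu]
  induction n generalizing u ψ with
  | zero =>
    rw [leib, Finset.sum_add_distrib, hfirst 0 hu]
    simp [leib]
  | succ n ih =>
    rw [leib, Finset.sum_add_distrib, hfirst (n + 1) hu,
      Finset.sum_congr rfl fun μ _ => ih (hu.barDelta μ), ← Finset.mul_sum]
    change _ + ((n : ℝ) + 1) * bsum₂ S τ τ₀ h (n + 1) _ u ψ = _
    push_cast; ring

theorem leib_two_eq (n : ℕ) {u ψ : Rd d → ℝ} (hu : Sm u) (a : Rd d → Rd d → ℝ) :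
    2 * leib S τ τ₀ h β (n + 2) 2 u a ψ = (n + 2) * (n + 1) *
      bsum₂ S τ τ₀ h n (fun z => ∑ μ ∈ S.fullΛ, ∑ ν ∈ S.fullΛ,
        β (barDelta τ τ₀ h μ (barDelta τ τ₀ h ν z.1))
          (fun v => barDelta τ τ₀ h μ (barDelta τ τ₀ h ν (a v)))
          (shift h μ (shift h ν z.2))) u ψ := by
  have hfirst : ∀ (n : ℕ) {u ψ : Rd d → ℝ}, Sm u →
      ∑ ν ∈ S.fullΛ, leib S τ τ₀ h β (n + 1) 1 (barDelta τ τ₀ h ν u)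
        (fun v => barDelta τ τ₀ h ν (a v)) (shift h ν ψ) = (n + 1) *
      bsum₂ S τ τ₀ h n (fun z => ∑ μ ∈ S.fullΛ, ∑ ν ∈ S.fullΛ,
        β (barDelta τ τ₀ h μ (barDelta τ τ₀ h ν z.1))
          (fun v => barDelta τ τ₀ h μ (barDelta τ τ₀ h ν (a v)))
          (shift h μ (shift h ν z.2))) u ψ := by
    intro n u ψ hu
    have : (fun z : (Rd d → ℝ) × (Rd d → ℝ) => ∑ μ ∈ S.fullΛ, ∑ ν ∈ S.fullΛ,
        β (barDelta τ τ₀ h μ (barDelta τ τ₀ h ν z.1))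
          (fun v => barDelta τ τ₀ h μ (barDelta τ τ₀ h ν (a v)))
          (shift h μ (shift h ν z.2))) = fun z => ∑ ν ∈ S.fullΛ, ∑ μ ∈ S.fullΛ,
        β (barDelta τ τ₀ h μ (barDelta τ τ₀ h ν z.1))
          (fun v => barDelta τ τ₀ h μ (barDelta τ τ₀ h ν (a v)))
          (shift h μ (shift h ν z.2)) := by
      funext z; exact Finset.sum_comm
    rw [this, bsum₂_sum, Finset.mul_sum]
    refine Finset.sum_congr rfl fun ν _ => ?_
    rw [leib_one_eq n (hu.barDelta ν), bsum₂_comm_ops _ _ _ hu]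
  induction n generalizing u ψ with
  | zero =>
    rw [leib, Finset.sum_add_distrib, hfirst 0 hu]
    rw [Finset.sum_eq_zero (f := fun μ => leib S τ τ₀ h β (0 + 1) (1 + 1) _ a _)
      fun μ _ => leib_of_lt (by norm_num) _ _ _]
    push_cast; ring
  | succ n ih =>
    rw [leib, Finset.sum_add_distrib, mul_add, hfirst (n + 1) hu]
    rw [Finset.mul_sum S.fullΛ, Finset.sum_congr rfl fun μ _ => ih (hu.barDelta μ), ← Finset.mul_sum]
    change _ + ((n : ℝ) + 2) * (n + 1) * bsum₂ S τ τ₀ h (n + 1) _ u ψ = _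
    push_cast; ring

/-- The operator `κ ∑_v a_v G_v`. -/
noncomputable def prodOp (κ : ℝ) (s : Finset (Rd d)) (G : Rd d → (Rd d → ℝ) → Rd d → ℝ)
    (a : Rd d → Rd d → ℝ) (ψ : Rd d → ℝ) (x : Rd d) : ℝ := κ * ∑ v ∈ s, a v x * G v ψ x

/-- The operators `G_v` preserve smoothness and commute with differences and derivatives. -/
structure Admissible (τ : Rd d → ℝ) (τ₀ h : ℝ) (G : Rd d → (Rd d → ℝ) → Rd d → ℝ) : Prop where
  sm : ∀ v φ, Sm φ → Sm (G v φ)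
  barDelta : ∀ v φ μ, Sm φ → barDelta τ τ₀ h μ (G v φ) = G v (barDelta τ τ₀ h μ φ)
  shift : ∀ v φ μ, shift h μ (G v φ) = G v (shift h μ φ)

theorem admissible_fdiff : Admissible τ τ₀ h (fdiff (d := d) h) :=
  ⟨fun v _ hφ => hφ.fdiff h v, fun v _ μ hφ => barDelta_fdiff hφ v μ, fun v φ μ => shift_fdiff φ v μ⟩

theorem admissible_id : Admissible τ τ₀ h (fun (_ : Rd d) φ => φ) :=
  ⟨fun _ _ hφ => hφ, fun _ _ _ _ => rfl, fun _ _ _ => rfl⟩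

variable {κ : ℝ} {s : Finset (Rd d)} {G : Rd d → (Rd d → ℝ) → Rd d → ℝ}

theorem Admissible.sm_prodOp (hG : Admissible τ τ₀ h G) {a : Rd d → Rd d → ℝ}
    (ha : ∀ v ∈ s, Sm (a v)) {ψ : Rd d → ℝ} (hψ : Sm ψ) : Sm (prodOp κ s G a ψ) :=
  (Sm.sum s fun v hv => (ha v hv).mul (hG.sm v ψ hψ)).const_mul κ

theorem Admissible.barDelta_prodOp (hG : Admissible τ τ₀ h G) {a : Rd d → Rd d → ℝ}
    (ha : ∀ v ∈ s, Sm (a v)) {ψ : Rd d → ℝ} (hψ : Sm ψ) (μ : Rd d ⊕ Fin d) :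
    FDExpansion.barDelta τ τ₀ h μ (prodOp κ s G a ψ) = fun x =>
      prodOp κ s G (fun v => FDExpansion.barDelta τ τ₀ h μ (a v)) (FDExpansion.shift h μ ψ) x
        + prodOp κ s G a (FDExpansion.barDelta τ τ₀ h μ ψ) x := by
  unfold prodOp
  rw [barDelta_const_mul (Sm.sum s fun v hv => (ha v hv).mul (hG.sm v ψ hψ)),
    barDelta_sum s fun v hv => (ha v hv).mul (hG.sm v ψ hψ)]
  funext x
  rw [← mul_add, ← Finset.sum_add_distrib]
  congr 1
  refine Finset.sum_congr rfl fun v hv => ?_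
  rw [barDelta_mul (ha v hv) (hG.sm v ψ hψ), hG.shift, hG.barDelta v ψ μ hψ]

theorem bsum₂_mul_add (n : ℕ) (x : Rd d) (u : Rd d → ℝ) {f g : Rd d → ℝ} (hf : Sm f) (hg : Sm g) :
    bsum₂ S τ τ₀ h n (fun z => z.1 x * z.2 x) u (fun y => f y + g y)
      = bsum₂ S τ τ₀ h n (fun z => z.1 x * z.2 x) u f
        + bsum₂ S τ τ₀ h n (fun z => z.1 x * z.2 x) u g := by
  induction n generalizing u f g with
  | zero => exact mul_add _ _ _
  | succ n ih =>
    simp only [bsum₂, wsum] at ih ⊢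
    rw [← Finset.sum_add_distrib]
    refine Finset.sum_congr rfl fun μ _ => ?_
    rw [barDelta_add hf hg]
    exact ih _ (hf.barDelta μ) (hg.barDelta μ)

theorem Admissible.leibniz (hG : Admissible τ τ₀ h G) (n : ℕ) (x : Rd d) (u : Rd d → ℝ)
    {a : Rd d → Rd d → ℝ} (ha : ∀ v ∈ s, Sm (a v)) {ψ : Rd d → ℝ} (hψ : Sm ψ) :
    bsum₂ S τ τ₀ h n (fun z => z.1 x * z.2 x) u (prodOp κ s G a ψ)
      = ∑ k ∈ Finset.range (n + 1),
        leib S τ τ₀ h (fun u a ψ => u x * prodOp κ s G a ψ x) n k u a ψ := by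
  induction n generalizing u a ψ with
  | zero => simp [leib, wsum]
  | succ n ih =>
    have h1 : bsum₂ S τ τ₀ h (n + 1) (fun z => z.1 x * z.2 x) u (prodOp κ s G a ψ)
        = ∑ μ ∈ S.fullΛ, (∑ k ∈ Finset.range (n + 1),
          leib S τ τ₀ h (fun u a ψ => u x * prodOp κ s G a ψ x) n k
            (FDExpansion.barDelta τ τ₀ h μ u) (fun v => FDExpansion.barDelta τ τ₀ h μ (a v))
            (FDExpansion.shift h μ ψ) + ∑ k ∈ Finset.range (n + 1),
          leib S τ τ₀ h (fun u a ψ => u x * prodOp κ s G a ψ x) n k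
            (FDExpansion.barDelta τ τ₀ h μ u) a (FDExpansion.barDelta τ τ₀ h μ ψ)) := by
      refine Finset.sum_congr rfl fun μ _ => ?_
      have e := hG.barDelta_prodOp (κ := κ) ha hψ μ
      have ha' : ∀ v ∈ s, Sm (FDExpansion.barDelta τ τ₀ h μ (a v)) := fun v hv =>
        (ha v hv).barDelta μ
      have h2 := bsum₂_mul_add (S := S) (τ := τ) (τ₀ := τ₀) (h := h) n x
        (FDExpansion.barDelta τ τ₀ h μ u)
        (hG.sm_prodOp (κ := κ) ha' (hψ.shift h μ)) (hG.sm_prodOp (κ := κ) ha (hψ.barDelta (τ := τ) (τ₀ := τ₀) (h := h) μ))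
      rw [ih _ ha' (hψ.shift h μ), ih _ ha (hψ.barDelta μ)] at h2
      rw [← h2]
      simp only [e]
    rw [h1, Finset.sum_range_succ']
    simp only [leib]
    rw [Finset.sum_comm, ← Finset.sum_add_distrib]
    refine Finset.sum_congr rfl fun μ _ => ?_
    rw [Finset.sum_add_distrib, add_assoc]
    congr 1
    rw [← Finset.sum_range_succ' (fun k => leib S τ τ₀ h (fun u a ψ => u x * prodOp κ s G a ψ x) n k
            (FDExpansion.barDelta τ τ₀ h μ u) a (FDExpansion.barDelta τ τ₀ h μ ψ)),
      Finset.sum_range_succ _ (n + 1), leib_of_lt (Nat.lt_succ_self n), add_zero]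

/-! ### Bounds of the lower order terms -/

/-- `∑_w ω_w |\bar δ_w u(x)|` over words `w` of length `n`. -/
noncomputable def absW (S : Scheme d) (τ : Rd d → ℝ) (τ₀ h : ℝ) (x : Rd d) :
    ℕ → (Rd d → ℝ) → ℝ
  | 0, u => |u x|
  | n + 1, u => ∑ μ ∈ S.fullΛ, wt τ τ₀ μ * absW S τ τ₀ h x n (barDelta τ τ₀ h μ u)

theorem absW_nonneg (x : Rd d) (n : ℕ) (u : Rd d → ℝ) : 0 ≤ absW S τ τ₀ h x n u := by
  induction n generalizing u with
  | zero => exact abs_nonneg _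
  | succ n ih => exact Finset.sum_nonneg fun μ _ => mul_nonneg (wt_nonneg μ) (ih _)

/-- `∑_w |\bar δ_w u(x)|²` over words `w` of length `n`. -/
noncomputable def energy (S : Scheme d) (τ : Rd d → ℝ) (τ₀ h : ℝ) (n : ℕ) (u : Rd d → ℝ)
    (x : Rd d) : ℝ := bsum S τ τ₀ h n (fun φ => φ x ^ 2) u

theorem energy_nonneg (n : ℕ) (u : Rd d → ℝ) (x : Rd d) : 0 ≤ energy S τ τ₀ h n u x :=
  wsum_nonneg (fun _ => sq_nonneg _) n u

theorem energy_succ (n : ℕ) (u : Rd d → ℝ) (x : Rd d) :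
    energy S τ τ₀ h (n + 1) u x = ∑ μ ∈ S.fullΛ, energy S τ τ₀ h n (barDelta τ τ₀ h μ u) x := rfl

theorem absW_le (x : Rd d) (n : ℕ) (u : Rd d → ℝ) {H ε : ℝ} (hε : 0 < ε) :
    H * absW S τ τ₀ h x n u ≤ ε * energy S τ τ₀ h n u x
      + H ^ 2 / (4 * ε) * (∑ μ ∈ S.fullΛ, wt τ τ₀ μ ^ 2) ^ n := by
  induction n generalizing u H with
  | zero =>
    simp only [absW, energy, wsum, pow_zero, mul_one]
    have : ε * u x ^ 2 + H ^ 2 / (4 * ε) - H * |u x| = (2 * ε * |u x| - H) ^ 2 / (4 * ε) := by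
      rw [← sq_abs (u x)]; field_simp; ring
    have h2 : 0 ≤ (2 * ε * |u x| - H) ^ 2 / (4 * ε) := by positivity
    linarith
  | succ n ih =>
    have e : H ^ 2 / (4 * ε) * (∑ μ ∈ S.fullΛ, wt τ τ₀ μ ^ 2) ^ (n + 1)
        = ∑ μ ∈ S.fullΛ, (H * wt τ τ₀ μ) ^ 2 / (4 * ε) * (∑ μ ∈ S.fullΛ, wt τ τ₀ μ ^ 2) ^ n := by
      rw [← Finset.sum_mul, ← Finset.sum_div]
      simp only [mul_pow]
      rw [← Finset.mul_sum]; ring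
    rw [energy_succ, absW, Finset.mul_sum, Finset.mul_sum, e, ← Finset.sum_add_distrib]
    refine Finset.sum_le_sum fun μ _ => ?_
    have := ih (barDelta τ τ₀ h μ u) (H := H * wt τ τ₀ μ)
    rw [← mul_assoc]
    exact this

theorem leib_bound (hh : 0 < h) {x : Rd d} {r : ℕ} {κ' : ℝ} {β : (Rd d → ℝ) → (Rd d → Rd d → ℝ) →
      (Rd d → ℝ) → ℝ} {PA : ℕ → ℝ → (Rd d → Rd d → ℝ) → Prop}
    (hPA : ∀ k M a, PA (k + 1) M a → ∀ μ,
      PA k (wt τ τ₀ μ * M) (fun v => barDelta τ τ₀ h μ (a v)))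
    (hβ : ∀ u a ψ M C, PA 0 M a → Sm ψ → DB r C ψ → |β u a ψ| ≤ κ' * M * C * |u x|)
    (n k : ℕ) (hk : k ≤ n) (u : Rd d → ℝ) {a : Rd d → Rd d → ℝ} {ψ : Rd d → ℝ} {M C : ℝ}
    (ha : PA k M a) (hψ : Sm ψ) (hC : DB (n - k + r) C ψ) :
    |leib S τ τ₀ h β n k u a ψ| ≤ n.choose k * (κ' * M * C) * absW S τ τ₀ h x n u := by
  induction n generalizing k u a ψ M C with
  | zero =>
    obtain rfl : k = 0 := by omega
    simpa [leib, absW] using hβ u a ψ M C ha hψ (by simpa using hC)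
  | succ n ih =>
    cases k with
    | zero =>
      rw [leib, absW, Finset.mul_sum]
      refine (Finset.abs_sum_le_sum_abs _ _).trans (Finset.sum_le_sum fun μ _ => ?_)
      have h1 := ih 0 (Nat.zero_le _) (barDelta τ τ₀ h μ u) ha (hψ.barDelta μ)
        (DB.barDelta (τ := τ) (τ₀ := τ₀) hh (hC.mono (by omega) le_rfl) hψ μ)
      refine h1.trans (le_of_eq ?_)
      simp only [Nat.choose_zero_right]; ring
    | succ k =>
      rw [leib, absW, Finset.mul_sum]
      refine (Finset.abs_sum_le_sum_abs _ _).trans (Finset.sum_le_sum fun μ _ => ?_)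
      refine (abs_add_le _ _).trans ?_
      have h1 := ih k (by omega) (barDelta τ τ₀ h μ u) (hPA k M a ha μ) (hψ.shift h μ)
        (DB.shift (hC.mono (by omega) le_rfl) μ)
      have h2 : |leib S τ τ₀ h β n (k + 1) (barDelta τ τ₀ h μ u) a (barDelta τ τ₀ h μ ψ)|
          ≤ n.choose (k + 1) * (κ' * M * (wt τ τ₀ μ * C))
            * absW S τ τ₀ h x n (barDelta τ τ₀ h μ u) := by
        by_cases hkn : k + 1 ≤ n
        · exact ih (k + 1) hkn (barDelta τ τ₀ h μ u) ha (hψ.barDelta μ)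
            (DB.barDelta (τ := τ) (τ₀ := τ₀) hh (hC.mono (by omega) le_rfl) hψ μ)
        · rw [leib_of_lt (by omega), Nat.choose_eq_zero_of_lt (by omega)]; simp
      refine (add_le_add h1 h2).trans (le_of_eq ?_)
      rw [Nat.choose_succ_succ]; push_cast; ring

end Leibniz


/-! ### Evolution of the energies -/

section Evolution

variable {S : Scheme d} {τ : Rd d → ℝ} {τ₀ h T : ℝ}

theorem STS.barDelta {Ω : Type*} [MeasurableSpace Ω] {ψ : Ω → Rd d → ℝ} (hψ : STS ψ)
    (μ : Rd d ⊕ Fin d) : STS (fun t => barDelta τ τ₀ h μ (ψ t)) := by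
  cases μ with
  | inl v => exact ((hψ.translate _).sub hψ).const_mul _
  | inr i => exact (hψ.pderiv i).const_mul _

theorem barDelta_tint (hT : 0 ≤ T) {G : ℝ → Rd d → ℝ} (hG : STS G) (μ : Rd d ⊕ Fin d) (t : ℝ) :
    barDelta τ τ₀ h μ (tint T G t) = tint T (fun s => barDelta τ τ₀ h μ (G s)) t := by
  funext x
  cases μ with
  | inl v =>
    simp only [barDelta, tint]
    rw [← intervalIntegral.integral_sub (hG.intervalIntegrable _ _ _)
      (hG.intervalIntegrable _ _ _), intervalIntegral.integral_const_mul]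
  | inr i =>
    simp only [barDelta]
    have := congrFun (hG.pds_tint hT [i] t) x
    simp only [pds_cons, pds_nil] at this
    rw [this]
    simp only [tint]
    rw [intervalIntegral.integral_const_mul]

theorem barDelta_evolution (hT : 0 ≤ T) {u G : ℝ → Rd d → ℝ} {g : Rd d → ℝ} (hg : Sm g)
    (hG : STS G) (hu : ∀ t x, u t x = g x + tint T G t x) (μ : Rd d ⊕ Fin d) (t : ℝ) (x : Rd d) :
    barDelta τ τ₀ h μ (u t) x
      = barDelta τ τ₀ h μ g x + tint T (fun s => barDelta τ τ₀ h μ (G s)) t x := by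
  have e : u t = fun x => g x + tint T G t x := funext (hu t)
  rw [e, barDelta_add hg ((hG.tint hT).slice t), barDelta_tint hT hG]

theorem sq_evolution {u G : ℝ → Rd d → ℝ} {g : Rd d → ℝ}
    (hG : STS G) (hu : ∀ t x, u t x = g x + tint T G t x) {t : ℝ} (ht : t ∈ Icc (0 : ℝ) T)
    (x : Rd d) :
    u t x ^ 2 = g x ^ 2 + ∫ s in (0 : ℝ)..t, 2 * (u s x * G s x) := by
  set Y : ℝ → ℝ := fun s => g x + ∫ r in (0 : ℝ)..s, G r x with hY
  have hI : IntervalIntegrable (fun r => G r x) volume 0 t := hG.intervalIntegrable x _ _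
  have hac : AbsolutelyContinuousOnInterval Y 0 t := by
    have h1 := hI.absolutelyContinuousOnInterval_intervalIntegral (c := 0) (by simp)
    have h2 : AbsolutelyContinuousOnInterval (fun _ : ℝ => g x) 0 t :=
      (LipschitzWith.const (g x)).lipschitzOnWith.absolutelyContinuousOnInterval
    exact h2.add h1
  have h1 := AbsolutelyContinuousOnInterval.integral_deriv_mul_eq_sub hac hac
  have huY : ∀ s ∈ Icc (0 : ℝ) t, u s x = Y s := fun s hs => by
    rw [hu, tint, clampT_of_mem ⟨hs.1, hs.2.trans ht.2⟩]
  have h2 : ∫ s in (0 : ℝ)..t, deriv Y s * Y s + Y s * deriv Y s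
      = ∫ s in (0 : ℝ)..t, 2 * (u s x * G s x) := by
    refine intervalIntegral.integral_congr_ae ?_
    filter_upwards [hI.ae_hasDerivAt_integral] with s hs hs'
    have hs1 : s ∈ uIcc 0 t := uIoc_subset_uIcc hs'
    have hd : HasDerivAt Y (G s x) s := (hs hs1 0 (by simp)).const_add _
    rw [uIcc_of_le ht.1] at hs1
    rw [hd.deriv, huY s hs1]; ring
  rw [h2] at h1
  rw [h1, huY t ⟨ht.1, le_rfl⟩]
  simp only [hY, intervalIntegral.integral_same]
  ring

theorem energy_evolution (hT : 0 ≤ T) (n : ℕ) {u G : ℝ → Rd d → ℝ} {g : Rd d → ℝ} (hg : Sm g)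
    (huS : STS u) (hG : STS G) (hu : ∀ t x, u t x = g x + tint T G t x) {t : ℝ}
    (ht : t ∈ Icc (0 : ℝ) T) (x : Rd d) :
    IntervalIntegrable (fun s => 2 * bsum₂ S τ τ₀ h n (fun z => z.1 x * z.2 x) (u s) (G s))
      volume 0 t ∧
    energy S τ τ₀ h n (u t) x = energy S τ τ₀ h n g x
      + ∫ s in (0 : ℝ)..t, 2 * bsum₂ S τ τ₀ h n (fun z => z.1 x * z.2 x) (u s) (G s) := by
  induction n generalizing u G g with
  | zero =>
    exact ⟨((huS.mul hG).const_mul 2).intervalIntegrable x 0 t, sq_evolution hG hu ht x⟩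
  | succ n ih =>
    have h1 := fun μ => ih (hg.barDelta (τ := τ) (τ₀ := τ₀) (h := h) μ) (huS.barDelta μ)
      (hG.barDelta μ) (barDelta_evolution hT hg hG hu μ)
    have e : (fun s => 2 * bsum₂ S τ τ₀ h (n + 1) (fun z => z.1 x * z.2 x) (u s) (G s))
        = fun s => ∑ μ ∈ S.fullΛ, 2 * bsum₂ S τ τ₀ h n (fun z => z.1 x * z.2 x)
          (barDelta τ τ₀ h μ (u s)) (barDelta τ τ₀ h μ (G s)) := by
      funext s; rw [← Finset.mul_sum]; rfl
    rw [e]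
    refine ⟨?_, ?_⟩
    · have := IntervalIntegrable.sum (μ := volume) (a := 0) (b := t) S.fullΛ
        (f := fun μ s => 2 * bsum₂ S τ τ₀ h n (fun z => z.1 x * z.2 x)
          (barDelta τ τ₀ h μ (u s)) (barDelta τ τ₀ h μ (G s))) (fun μ _ => (h1 μ).1)
      rwa [show (∑ μ ∈ S.fullΛ, fun s => 2 * bsum₂ S τ τ₀ h n (fun z => z.1 x * z.2 x)
          (barDelta τ τ₀ h μ (u s)) (barDelta τ τ₀ h μ (G s))) = fun s => ∑ μ ∈ S.fullΛ,
          2 * bsum₂ S τ τ₀ h n (fun z => z.1 x * z.2 x)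
          (barDelta τ τ₀ h μ (u s)) (barDelta τ τ₀ h μ (G s)) from by
        funext s; simp only [Finset.sum_apply]] at this
    · rw [intervalIntegral.integral_finsetSum fun μ _ => (h1 μ).1, energy_succ, energy_succ,
        ← Finset.sum_add_distrib]
      exact Finset.sum_congr rfl fun μ _ => (h1 μ).2

end Evolution

/-! ### Vector valued bounds by duality -/

/-- `∑_v b_v a_v` has derivatives up to order `n` bounded by `C` whenever `∑_v b_v² ≤ 1`. -/
def DBv (s : Finset (Rd d)) (n : ℕ) (C : ℝ) (a : Rd d → Rd d → ℝ) : Prop :=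
  ∀ b : Rd d → ℝ, ∑ v ∈ s, b v ^ 2 ≤ 1 → DB n C (fun x => ∑ v ∈ s, b v * a v x)

theorem DBv.eval {s : Finset (Rd d)} {n : ℕ} {C R : ℝ} {a : Rd d → Rd d → ℝ} (ha : DBv s n C a)
    (hR : 0 ≤ R) {b : Rd d → ℝ} (hb : ∑ v ∈ s, b v ^ 2 ≤ R ^ 2) (x : Rd d) :
    |∑ v ∈ s, b v * a v x| ≤ R * C := by
  rcases hR.eq_or_lt with rfl | hR
  · have hz : ∀ v ∈ s, b v = 0 := fun v hv => by
      have h1 := Finset.single_le_sum (f := fun v => b v ^ 2) (fun v _ => sq_nonneg (b v)) hv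
      have h2 : b v ^ 2 ≤ 0 := h1.trans (hb.trans (by simp))
      exact pow_eq_zero_iff (two_ne_zero) |>.1 (le_antisymm h2 (sq_nonneg _))
    rw [Finset.sum_eq_zero fun v hv => by rw [hz v hv, zero_mul]]; simp
  · have h1 : ∑ v ∈ s, (b v / R) ^ 2 ≤ 1 := by
      simp only [div_pow]
      rw [← Finset.sum_div, div_le_one (by positivity)]; exact hb
    have h2 := (ha _ h1).bound x
    have e : ∑ v ∈ s, b v * a v x = R * ∑ v ∈ s, b v / R * a v x := by
      rw [Finset.mul_sum]; refine Finset.sum_congr rfl fun v _ => ?_; field_simp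
    rw [e, abs_mul, abs_of_pos hR]
    exact mul_le_mul_of_nonneg_left h2 hR.le

theorem DBv.barDelta {τ : Rd d → ℝ} {τ₀ h : ℝ} (hh : 0 < h) {s : Finset (Rd d)} {n : ℕ} {C : ℝ}
    {a : Rd d → Rd d → ℝ} (ha : DBv s (n + 1) C a) (hs : ∀ v ∈ s, Sm (a v)) (μ : Rd d ⊕ Fin d) :
    DBv s n (wt τ τ₀ μ * C) (fun v => barDelta τ τ₀ h μ (a v)) := fun b hb => by
  have hsm : ∀ v ∈ s, Sm (fun x => b v * a v x) := fun v hv => (hs v hv).const_mul _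
  have e : (fun x => ∑ v ∈ s, b v * FDExpansion.barDelta τ τ₀ h μ (a v) x)
      = FDExpansion.barDelta τ τ₀ h μ (fun x => ∑ v ∈ s, b v * a v x) := by
    rw [barDelta_sum s hsm]
    funext x
    refine Finset.sum_congr rfl fun v hv => ?_
    rw [barDelta_const_mul (hs v hv)]
  rw [e]
  exact (ha b hb).barDelta hh (Sm.sum _ hsm) μ

theorem sum_norm_pow_le {s : Finset (Rd d)} {A : ℝ} (hA : ∑ v ∈ s, ‖v‖ ^ 2 ≤ A ^ 2) (k : ℕ) :
    ∑ v ∈ s, (‖v‖ ^ (k + 1)) ^ 2 ≤ (|A| ^ (k + 1)) ^ 2 := by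
  have h1 : ∀ v ∈ s, ‖v‖ ≤ |A| := fun v hv => by
    have := Finset.single_le_sum (f := fun v : Rd d => ‖v‖ ^ 2) (fun v _ => sq_nonneg ‖v‖) hv
    exact abs_le_of_sq_le_sq' (by rw [sq_abs]; exact this.trans hA) (abs_nonneg _) |>.2
  calc ∑ v ∈ s, (‖v‖ ^ (k + 1)) ^ 2 ≤ ∑ v ∈ s, (|A| ^ k) ^ 2 * ‖v‖ ^ 2 := by
        refine Finset.sum_le_sum fun v hv => ?_
        rw [pow_succ ‖v‖ k, mul_pow]
        have := h1 v hv
        gcongr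
    _ = (|A| ^ k) ^ 2 * ∑ v ∈ s, ‖v‖ ^ 2 := by rw [Finset.mul_sum]
    _ ≤ (|A| ^ k) ^ 2 * A ^ 2 := by gcongr
    _ = (|A| ^ (k + 1)) ^ 2 := by rw [pow_succ |A|, mul_pow, sq_abs A]

/-! ### Hypotheses on a smooth scheme -/

/-- The terms of the second structural condition that come from the commutators. -/
noncomputable def secondLHS (S : Scheme d) (τ : Rd d → ℝ) (τ₀ h t : ℝ) (n : ℕ) (x : Rd d)
    (φ : Rd d → ℝ) : ℝ :=
  (n : ℝ) * ∑ ν ∈ S.fullΛ, S.Ah τ τ₀ h t (barDelta τ τ₀ h ν φ) x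
    + (n : ℝ) * ((n : ℝ) - 1) * ∑ μ ∈ S.fullΛ, ∑ ν ∈ S.fullΛ,
      barDelta τ τ₀ h μ (barDelta τ τ₀ h ν φ) x *
        S.Qmu h t (fun ψ => barDelta τ τ₀ h μ (barDelta τ τ₀ h ν ψ)) (shift h μ (shift h ν φ)) x

/-- The first structural condition, with the operator `𝒦` replaced by an upper bound. -/
def Sup₁ (S : Scheme d) (τ : Rd d → ℝ) (τ₀ h δ K : ℝ) : Prop :=
  ∀ t φ C x, Sm φ → (∀ y, S.gradSq τ τ₀ h φ y ≤ C) →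
    S.Ah τ τ₀ h t φ x ≤ (1 - δ) * ∑ μ ∈ S.fullΛ, S.calQ h t (barDelta τ τ₀ h μ φ) x
      + K * S.calQ h t φ x + 2 * (1 - δ) * S.c t x * C

/-- The second structural condition, summed over families and with the operator `𝒦` replaced by
upper bounds. -/
def Sup₂ (S : Scheme d) (τ : Rd d → ℝ) (τ₀ h δ K : ℝ) (m : ℕ) : Prop :=
  ∀ n, n + 2 ≤ m → ∀ t φ C₂ C₁ x, Sm φ → (∀ y, energy S τ τ₀ h (n + 2) φ y ≤ C₂) →
    (∀ y, energy S τ τ₀ h (n + 1) φ y ≤ C₁) →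
    bsum S τ τ₀ h n (secondLHS S τ τ₀ h t (n + 2) x) φ
      ≤ (1 - δ) * bsum S τ τ₀ h (n + 2) (fun ψ => S.calQ h t ψ x) φ
        + K * bsum S τ τ₀ h (n + 1) (fun ψ => S.calQ h t ψ x) φ
        + 2 * (1 - δ) * S.c t x * C₂ + K * C₁

/-- The hypotheses of the derivative estimate for a scheme with smooth coefficients at a fixed
mesh size `h`. -/
structure SmoothHyp (S : Scheme d) (τ : Rd d → ℝ) (τ₀ h δ K c₀ A B Mb : ℝ) (m : ℕ) : Prop where
  smooth : S.Smooth
  hpos : 0 < h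
  size : ∑ v ∈ S.Λ₁, ‖v‖ ^ 2 ≤ A ^ 2
  wsize : ∑ v ∈ S.Λ₁, ‖τ v • v‖ ^ 2 ≤ B ^ 2
  q_bd : ∀ t, DBv S.Λ₁ m Mb (fun v => S.q v t)
  p_bd : ∀ t, DBv S.Λ₁ m Mb (fun v => S.p v t)
  c_bd : ∀ t, DB m Mb (S.c t)
  chi_nonneg : ∀ v ∈ S.Λ₁, ∀ t x, 0 ≤ S.chi h v t x
  q_zero : ∀ t x i, ∑ v ∈ S.Λ₁, v i * S.q v t x = 0
  c_le : ∀ t x, c₀ ≤ S.c t x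
  sup₁ : Sup₁ S τ τ₀ h δ K
  sup₂ : Sup₂ S τ τ₀ h δ K m

section Energy

variable {S : Scheme d} {τ : Rd d → ℝ} {τ₀ h δ K c₀ A B Mb : ℝ} {m : ℕ}

theorem calQ_nonneg (hχ : ∀ v ∈ S.Λ₁, ∀ t x, 0 ≤ S.chi h v t x) (t : ℝ) (φ : Rd d → ℝ) (x : Rd d) :
    0 ≤ S.calQ h t φ x :=
  Finset.sum_nonneg fun v hv => mul_nonneg (hχ v hv t x) (sq_nonneg _)

theorem sum_wt_sq_le (hB : ∑ v ∈ S.Λ₁, ‖τ v • v‖ ^ 2 ≤ B ^ 2) :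
    ∑ μ ∈ S.fullΛ, wt τ τ₀ μ ^ 2 ≤ d ^ 2 * B ^ 2 + d * τ₀ ^ 2 := by
  rw [Scheme.fullΛ, Finset.sum_disjSum]
  simp only [wt, mul_pow, sq_abs, Finset.sum_const, Finset.card_univ, Fintype.card_fin,
    nsmul_eq_mul]
  rw [← Finset.mul_sum]
  gcongr

theorem energy_le (hh : 0 < h) (n : ℕ) {u : Rd d → ℝ} (hu : Sm u) {C : ℝ} (hC : DB n C u)
    (x : Rd d) :
    energy S τ τ₀ h n u x ≤ (∑ μ ∈ S.fullΛ, wt τ τ₀ μ ^ 2) ^ n * C ^ 2 := by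
  induction n generalizing u C with
  | zero =>
    simp only [pow_zero, one_mul]
    exact sq_le_sq' (by linarith [(abs_le.1 (hC.bound x)).1]) (abs_le.1 (hC.bound x)).2
  | succ n ih =>
    rw [energy_succ, pow_succ', mul_assoc, Finset.sum_mul]
    refine Finset.sum_le_sum fun μ _ => ?_
    refine (ih (hu.barDelta μ) (hC.barDelta hh hu μ)).trans (le_of_eq ?_)
    ring

theorem abs_bsum₂_mul_le (hh : 0 < h) (n : ℕ) (x : Rd d) (u : Rd d → ℝ) {f : Rd d → ℝ} (hf : Sm f)
    {C : ℝ} (hC : DB n C f) :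
    |bsum₂ S τ τ₀ h n (fun z => z.1 x * z.2 x) u f| ≤ C * absW S τ τ₀ h x n u := by
  induction n generalizing u f C with
  | zero =>
    simp only [wsum, absW]
    rw [abs_mul, mul_comm]
    exact mul_le_mul_of_nonneg_right (hC.bound x) (abs_nonneg _)
  | succ n ih =>
    rw [absW, Finset.mul_sum]
    refine (Finset.abs_sum_le_sum_abs _ _).trans (Finset.sum_le_sum fun μ _ => ?_)
    refine (ih (barDelta τ τ₀ h μ u) (hf.barDelta μ) (hC.barDelta hh hf μ)).trans (le_of_eq ?_)
    ring

/-- Coefficient families for the second order part. -/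
def QFam (s : Finset (Rd d)) (k : ℕ) (M : ℝ) (a : Rd d → Rd d → ℝ) : Prop :=
  (∀ v ∈ s, Sm (a v)) ∧ DBv s k M a ∧ ∀ x i, ∑ v ∈ s, v i * a v x = 0

theorem QFam.barDelta (hh : 0 < h) {s : Finset (Rd d)} {k : ℕ} {M : ℝ} {a : Rd d → Rd d → ℝ}
    (ha : QFam s (k + 1) M a) (μ : Rd d ⊕ Fin d) :
    QFam s k (wt τ τ₀ μ * M) (fun v => barDelta τ τ₀ h μ (a v)) := by
  refine ⟨fun v hv => (ha.1 v hv).barDelta μ, ha.2.1.barDelta hh ha.1 μ, fun x i => ?_⟩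
  have e : (fun x => ∑ v ∈ s, v i * a v x) = fun _ => (0 : ℝ) * 0 := by
    funext x; rw [ha.2.2 x i, mul_zero]
  have h2 := barDelta_sum (τ := τ) (τ₀ := τ₀) (h := h) s (φ := fun v x => v i * a v x)
    (fun v hv => (ha.1 v hv).const_mul _) μ
  rw [e, barDelta_const_mul (φ := fun _ => (0 : ℝ)) (Sm_const 0)] at h2
  have h3 := congrFun h2 x
  rw [zero_mul] at h3
  rw [h3]
  exact Finset.sum_congr rfl fun v hv => by rw [barDelta_const_mul (ha.1 v hv)]

theorem abs_second_order_le (hh : 0 < h) {s : Finset (Rd d)} (hA : ∑ v ∈ s, ‖v‖ ^ 2 ≤ A ^ 2)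
    {a : Rd d → Rd d → ℝ} {M C : ℝ} (ha : QFam s 0 M a) {ψ : Rd d → ℝ} (hψ : Sm ψ)
    (hC : DB 2 C ψ) (x : Rd d) :
    |prodOp h⁻¹ s (fdiff h) a ψ x| ≤ (d : ℝ) ^ 2 * A ^ 2 * M * C := by
  have hC0 := hC.nonneg
  have e1 : ∀ v, fdiff h v ψ x = dirD v ψ x + h⁻¹ * taylorRem 2 h v ψ x := fun v => by
    simp only [taylorRem, fdiff, Finset.sum_range_succ, Finset.sum_range_zero]
    simp
    field_simp
    ring
  have e2 : ∑ v ∈ s, a v x * dirD v ψ x = 0 := by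
    simp only [dirD, Finset.mul_sum]
    rw [Finset.sum_comm]
    refine Finset.sum_eq_zero fun i _ => ?_
    have : ∑ v ∈ s, a v x * (v i * pderiv i ψ x) = (∑ v ∈ s, v i * a v x) * pderiv i ψ x := by
      rw [Finset.sum_mul]; exact Finset.sum_congr rfl fun v _ => by ring
    rw [this, ha.2.2, zero_mul]
  have e3 : prodOp h⁻¹ s (fdiff h) a ψ x
      = ∑ v ∈ s, (h⁻¹ * (h⁻¹ * taylorRem 2 h v ψ x)) * a v x := by
    simp only [prodOp, e1, mul_add, Finset.sum_add_distrib, e2, zero_add]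
    rw [Finset.mul_sum]
    exact Finset.sum_congr rfl fun v _ => by ring
  rw [e3]
  have hb : ∀ v, |h⁻¹ * (h⁻¹ * taylorRem 2 h v ψ x)| ≤ (d : ℝ) ^ 2 * C * ‖v‖ ^ 2 := fun v => by
    have h1 := (DB.taylorRem (l := 0) (N := 2) (by simpa using hC) hψ hh.le v).bound x
    rw [abs_mul, abs_mul, abs_inv, abs_of_pos hh]
    calc h⁻¹ * (h⁻¹ * |taylorRem 2 h v ψ x|)
        ≤ h⁻¹ * (h⁻¹ * (h ^ 2 / ((2 : ℕ).factorial : ℝ) * ((d * ‖v‖) ^ 2 * C))) := by gcongr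
      _ = ((d : ℝ) ^ 2 * C * ‖v‖ ^ 2) / 2 := by
        rw [Nat.factorial_two]; push_cast; field_simp
      _ ≤ _ := half_le_self (by positivity)
  have hsum : ∑ v ∈ s, (h⁻¹ * (h⁻¹ * taylorRem 2 h v ψ x)) ^ 2 ≤ ((d : ℝ) ^ 2 * C * A ^ 2) ^ 2 := by
    have h1 := sum_norm_pow_le hA 1
    calc _ ≤ ∑ v ∈ s, ((d : ℝ) ^ 2 * C) ^ 2 * (‖v‖ ^ 2) ^ 2 := by
          refine Finset.sum_le_sum fun v _ => ?_
          rw [← mul_pow, ← sq_abs]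
          exact pow_le_pow_left₀ (abs_nonneg _) (hb v) 2
      _ = ((d : ℝ) ^ 2 * C) ^ 2 * ∑ v ∈ s, (‖v‖ ^ 2) ^ 2 := by rw [Finset.mul_sum]
      _ ≤ ((d : ℝ) ^ 2 * C) ^ 2 * (|A| ^ 2) ^ 2 := by gcongr
      _ = _ := by rw [sq_abs]; ring
  refine (ha.2.1.eval (by positivity) hsum x).trans (le_of_eq (by ring))

theorem abs_first_order_le (hh : 0 < h) {s : Finset (Rd d)} (hA : ∑ v ∈ s, ‖v‖ ^ 2 ≤ A ^ 2)
    {a : Rd d → Rd d → ℝ} {M C : ℝ} (ha : DBv s 0 M a) {ψ : Rd d → ℝ} (hψ : Sm ψ)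
    (hC : DB 1 C ψ) (x : Rd d) :
    |prodOp 1 s (fdiff h) a ψ x| ≤ d * |A| * M * C := by
  have hC0 := hC.nonneg
  have e3 : prodOp 1 s (fdiff h) a ψ x = ∑ v ∈ s, fdiff h v ψ x * a v x := by
    simp only [prodOp, one_mul]
    exact Finset.sum_congr rfl fun v _ => by ring
  rw [e3]
  have hb : ∀ v, |fdiff h v ψ x| ≤ d * C * ‖v‖ := fun v => by
    have h1 := DB.increment (n := 0) hC hψ.differentiable x (h • v)
    rw [norm_smul, Real.norm_eq_abs, abs_of_pos hh] at h1
    rw [fdiff, abs_div, abs_of_pos hh, div_le_iff₀ hh]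
    linarith
  have hsum : ∑ v ∈ s, fdiff h v ψ x ^ 2 ≤ (d * C * |A|) ^ 2 := by
    calc _ ≤ ∑ v ∈ s, ((d : ℝ) * C) ^ 2 * ‖v‖ ^ 2 := by
          refine Finset.sum_le_sum fun v _ => ?_
          rw [← mul_pow, ← sq_abs]
          exact pow_le_pow_left₀ (abs_nonneg _) (hb v) 2
      _ = ((d : ℝ) * C) ^ 2 * ∑ v ∈ s, ‖v‖ ^ 2 := by rw [Finset.mul_sum]
      _ ≤ ((d : ℝ) * C) ^ 2 * |A| ^ 2 := by gcongr; rw [sq_abs]; exact hA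
      _ = _ := by ring
  refine (ha.eval (by positivity) hsum x).trans (le_of_eq (by ring))

end Energy


/-! ### The energy inequality -/

section EnergyInequality

variable {S : Scheme d} {τ : Rd d → ℝ} {τ₀ h δ K c₀ A B Mb : ℝ} {m : ℕ}

theorem Lh_eq_prodOp (t : ℝ) (φ : Rd d → ℝ) (x : Rd d) :
    S.Lh h t φ x = prodOp h⁻¹ S.Λ₁ (fdiff h) (fun v => S.q v t) φ x
      + prodOp 1 S.Λ₁ (fdiff h) (fun v => S.p v t) φ x
      + prodOp (-1) {0} (fun _ φ => φ) (fun _ => S.c t) φ x := by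
  simp only [prodOp, Scheme.Lh, Finset.sum_singleton]; ring

theorem energy_decomposition (hS : S.Smooth) (t : ℝ) (n : ℕ) (x : Rd d) {u f : Rd d → ℝ}
    (hu : Sm u) (hf : Sm f) :
    bsum₂ S τ τ₀ h n (fun z => z.1 x * z.2 x) u (fun y => S.Lh h t u y + f y)
      = (∑ k ∈ Finset.range (n + 1), leib S τ τ₀ h
          (fun u a ψ => u x * prodOp h⁻¹ S.Λ₁ (fdiff h) a ψ x) n k u (fun v => S.q v t) u)
        + (∑ k ∈ Finset.range (n + 1), leib S τ τ₀ h
          (fun u a ψ => u x * prodOp 1 S.Λ₁ (fdiff h) a ψ x) n k u (fun v => S.p v t) u)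
        + (∑ k ∈ Finset.range (n + 1), leib S τ τ₀ h
          (fun u a ψ => u x * prodOp (-1) {0} (fun _ φ => φ) a ψ x) n k u (fun _ => S.c t) u)
        + bsum₂ S τ τ₀ h n (fun z => z.1 x * z.2 x) u f := by
  have hq : ∀ v ∈ S.Λ₁, Sm (S.q v t) := fun v hv => (hS.q v hv).slice t
  have hp : ∀ v ∈ S.Λ₁, Sm (S.p v t) := fun v hv => (hS.p v hv).slice t
  have hc : ∀ v ∈ ({0} : Finset (Rd d)), Sm (S.c t) := fun _ _ => hS.c.slice t
  rw [← (admissible_fdiff (τ := τ) (τ₀ := τ₀) (h := h)).leibniz n x u hq hu,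
    ← (admissible_fdiff (τ := τ) (τ₀ := τ₀) (h := h)).leibniz n x u hp hu,
    ← (admissible_id (τ := τ) (τ₀ := τ₀) (h := h)).leibniz n x u hc hu]
  have sq := (admissible_fdiff (τ := τ) (τ₀ := τ₀) (h := h)).sm_prodOp (κ := h⁻¹) hq hu
  have sp := (admissible_fdiff (τ := τ) (τ₀ := τ₀) (h := h)).sm_prodOp (κ := 1) hp hu
  have sc := (admissible_id (τ := τ) (τ₀ := τ₀) (h := h)).sm_prodOp (κ := -1) hc hu
  rw [← bsum₂_mul_add n x u sq sp, ← bsum₂_mul_add n x u (sq.add sp) sc,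
    ← bsum₂_mul_add n x u ((sq.add sp).add sc) hf]
  simp only [Lh_eq_prodOp]

theorem leib_zero_terms (hh : h ≠ 0) (t : ℝ) (n : ℕ) (x : Rd d) (u : Rd d → ℝ) :
    2 * (leib S τ τ₀ h (fun u a ψ => u x * prodOp h⁻¹ S.Λ₁ (fdiff h) a ψ x) n 0 u
          (fun v => S.q v t) u
        + leib S τ τ₀ h (fun u a ψ => u x * prodOp 1 S.Λ₁ (fdiff h) a ψ x) n 0 u
          (fun v => S.p v t) u
        + leib S τ τ₀ h (fun u a ψ => u x * prodOp (-1) {0} (fun _ φ => φ) a ψ x) n 0 u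
          (fun _ => S.c t) u)
      = ∑ v ∈ S.Λ₁, S.rate h v t x
          * (energy S τ τ₀ h n u (x + h • v) - energy S τ τ₀ h n u x)
        - bsum S τ τ₀ h n (fun ψ => S.calQ h t ψ x) u
        - 2 * S.c t x * energy S τ τ₀ h n u x := by
  rw [leib_zero_eq, leib_zero_eq, leib_zero_eq, bsum₂_diag, bsum₂_diag, bsum₂_diag]
  simp only [energy, bsum]
  simp only [← wsum_add, ← wsum_const_mul, ← wsum_sub, ← wsum_sum]
  congr 1
  funext φ
  have e : φ x * prodOp h⁻¹ S.Λ₁ (fdiff h) (fun v => S.q v t) φ x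
      + φ x * prodOp 1 S.Λ₁ (fdiff h) (fun v => S.p v t) φ x
      + φ x * prodOp (-1) {0} (fun _ φ => φ) (fun _ => S.c t) φ x = φ x * S.Lh h t φ x := by
    rw [Lh_eq_prodOp]; ring
  rw [e, S.Lh_eq hh, Scheme.calQ, ← Finset.sum_sub_distrib]
  have : ∑ v ∈ S.Λ₁, (S.rate h v t x * (φ (x + h • v) ^ 2 - φ x ^ 2)
      - S.chi h v t x * fdiff h v φ x ^ 2)
      = ∑ v ∈ S.Λ₁, 2 * φ x * (S.rate h v t x * (φ (x + h • v) - φ x)) := by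
    refine Finset.sum_congr rfl fun v _ => ?_
    rw [Scheme.rate, fdiff]; field_simp; ring
  rw [this, ← Finset.mul_sum]; ring

theorem leib_one_terms (t : ℝ) (n : ℕ) (x : Rd d) {u : Rd d → ℝ} (hu : Sm u) :
    2 * (leib S τ τ₀ h (fun u a ψ => u x * prodOp h⁻¹ S.Λ₁ (fdiff h) a ψ x) (n + 1) 1 u
          (fun v => S.q v t) u
        + leib S τ τ₀ h (fun u a ψ => u x * prodOp 1 S.Λ₁ (fdiff h) a ψ x) (n + 1) 1 u
          (fun v => S.p v t) u)
      = (n + 1) * bsum S τ τ₀ h n (fun ψ => S.Ah τ τ₀ h t ψ x) u := by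
  rw [leib_one_eq n hu, leib_one_eq n hu, bsum₂_diag, bsum₂_diag, ← mul_add]
  simp only [bsum]
  rw [← wsum_add, mul_left_comm, ← wsum_const_mul]
  congr 2
  funext φ
  simp only [Scheme.Ah, Scheme.Lmu, Scheme.Qmu, prodOp, one_mul]
  rw [← Finset.sum_add_distrib]
  congr 1
  exact Finset.sum_congr rfl fun μ _ => by ring

theorem leib_two_terms (t : ℝ) (n : ℕ) (x : Rd d) {u : Rd d → ℝ} (hu : Sm u) :
    2 * leib S τ τ₀ h (fun u a ψ => u x * prodOp h⁻¹ S.Λ₁ (fdiff h) a ψ x) (n + 2) 2 u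
        (fun v => S.q v t) u
      + (n + 2) * bsum S τ τ₀ h (n + 1) (fun ψ => S.Ah τ τ₀ h t ψ x) u
      = bsum S τ τ₀ h n (secondLHS S τ τ₀ h t (n + 2) x) u := by
  rw [leib_two_eq n hu, bsum₂_diag]
  simp only [bsum]
  rw [wsum_succ', ← wsum_const_mul, ← wsum_const_mul, ← wsum_add]
  congr 1
  funext φ
  rw [secondLHS, add_comm]
  push_cast
  congr 1
  rw [show (n : ℝ) + 2 - 1 = n + 1 by ring]
  rfl

theorem leib_tail (hh : 0 < h) {x : Rd d} {r j : ℕ} (hj : r < j) {κ' : ℝ}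
    {β : (Rd d → ℝ) → (Rd d → Rd d → ℝ) → (Rd d → ℝ) → ℝ} {PA : ℕ → ℝ → (Rd d → Rd d → ℝ) → Prop}
    (hPA : ∀ k M a, PA (k + 1) M a → ∀ μ,
      PA k (wt τ τ₀ μ * M) (fun v => barDelta τ τ₀ h μ (a v)))
    (hβ : ∀ u a ψ M C, PA 0 M a → Sm ψ → DB r C ψ → |β u a ψ| ≤ κ' * M * C * |u x|)
    (n : ℕ) {u : Rd d → ℝ} {a : Rd d → Rd d → ℝ} {M C : ℝ} (hκ : 0 ≤ κ' * M * C)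
    (ha : ∀ k ≤ n, PA k M a) (hu : Sm u) (hC : ∀ k < n, DB k C u) :
    |∑ k ∈ Finset.range (n + 1), leib S τ τ₀ h β n (k + j) u a u|
      ≤ (n + 1) * 2 ^ n * (κ' * M * C) * absW S τ τ₀ h x n u := by
  refine (Finset.abs_sum_le_sum_abs _ _).trans ?_
  have : ∀ k ∈ Finset.range (n + 1), |leib S τ τ₀ h β n (k + j) u a u|
      ≤ 2 ^ n * (κ' * M * C) * absW S τ τ₀ h x n u := fun k _ => by
    have h0 := absW_nonneg (S := S) (τ := τ) (τ₀ := τ₀) (h := h) x n u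
    by_cases hk : k + j ≤ n
    · refine (leib_bound hh hPA hβ n (k + j) hk u (ha _ hk) hu (hC _ (by omega))).trans ?_
      gcongr
      exact_mod_cast Nat.choose_le_two_pow n (k + j)
    · rw [leib_of_lt (by omega), abs_zero]; positivity
  refine (Finset.sum_le_sum this).trans (le_of_eq ?_)
  rw [Finset.sum_const, Finset.card_range, nsmul_eq_mul]; push_cast; ring

theorem leib_sum_split (β : (Rd d → ℝ) → (Rd d → Rd d → ℝ) → (Rd d → ℝ) → ℝ) (n j : ℕ)
    (u : Rd d → ℝ) (a : Rd d → Rd d → ℝ) (ψ : Rd d → ℝ) :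
    ∑ k ∈ Finset.range (n + 1), leib S τ τ₀ h β n k u a ψ
      = ∑ k ∈ Finset.range j, leib S τ τ₀ h β n k u a ψ
        + ∑ k ∈ Finset.range (n + 1), leib S τ τ₀ h β n (k + j) u a ψ := by
  have : ∑ k ∈ Finset.range (n + 1), leib S τ τ₀ h β n k u a ψ
      = ∑ k ∈ Finset.range (j + (n + 1)), leib S τ τ₀ h β n k u a ψ := by
    refine Finset.sum_subset (fun k hk => ?_) fun k _ hk => leib_of_lt ?_ _ _ _
    · simp only [Finset.mem_range] at hk ⊢; omega
    · simp only [Finset.mem_range] at hk; omega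
  rw [this, Finset.sum_range_add]
  simp only [add_comm j]

/-- The dissipation at the previous level. -/
noncomputable def prevQ (S : Scheme d) (τ : Rd d → ℝ) (τ₀ h t : ℝ) (x : Rd d) (u : Rd d → ℝ) :
    ℕ → ℝ
  | 0 => 0
  | n + 1 => bsum S τ τ₀ h n (fun ψ => S.calQ h t ψ x) u

theorem main_terms_le (H : SmoothHyp S τ τ₀ h δ K c₀ A B Mb m) (hδ1 : δ ≤ 1)
    (hK : 0 ≤ K) (hc₀ : 0 < c₀) {n : ℕ} (hn : n ≤ m) (t : ℝ) (x : Rd d) {u : Rd d → ℝ} (hu : Sm u)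
    {E X : ℝ} (hE : ∀ k < n, DB k E u) (hX : ∀ y, energy S τ τ₀ h n u y ≤ X) :
    2 * (leib S τ τ₀ h (fun u a ψ => u x * prodOp h⁻¹ S.Λ₁ (fdiff h) a ψ x) n 1 u
          (fun v => S.q v t) u
        + leib S τ τ₀ h (fun u a ψ => u x * prodOp 1 S.Λ₁ (fdiff h) a ψ x) n 1 u
          (fun v => S.p v t) u
        + leib S τ τ₀ h (fun u a ψ => u x * prodOp h⁻¹ S.Λ₁ (fdiff h) a ψ x) n 2 u
          (fun v => S.q v t) u)
      ≤ (1 - δ) * bsum S τ τ₀ h n (fun ψ => S.calQ h t ψ x) u + K * prevQ S τ τ₀ h t x u n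
        + 2 * (1 - δ) * S.c t x * X + K * ((d ^ 2 * B ^ 2 + d * τ₀ ^ 2) ^ (n - 1) * E ^ 2) := by
  have hc := hc₀.le.trans (H.c_le t x)
  have h1δ : 0 ≤ 1 - δ := by linarith
  have hX0 := (energy_nonneg n u x).trans (hX x)
  have hQ : 0 ≤ bsum S τ τ₀ h n (fun ψ => S.calQ h t ψ x) u :=
    wsum_nonneg (fun φ => calQ_nonneg H.chi_nonneg t φ x) n u
  have hΩ : (0 : ℝ) ≤ d ^ 2 * B ^ 2 + d * τ₀ ^ 2 := by positivity
  rcases n with _ | _ | n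
  · simp only [leib]
    have : 0 ≤ K * ((d ^ 2 * B ^ 2 + d * τ₀ ^ 2) ^ (0 - 1) * E ^ 2) := by positivity
    have h2 : 0 ≤ (1 - δ) * bsum S τ τ₀ h 0 (fun ψ => S.calQ h t ψ x) u := mul_nonneg h1δ hQ
    have h3 : 0 ≤ 2 * (1 - δ) * S.c t x * X := by positivity
    simp only [prevQ]
    linarith
  · have h1 := leib_one_terms (S := S) (τ := τ) (τ₀ := τ₀) (h := h) t 0 x hu
    have h2 := H.sup₁ t u X x hu hX
    have h3 : 0 ≤ K * ((d ^ 2 * B ^ 2 + d * τ₀ ^ 2) ^ (0 + 1 - 1) * E ^ 2) := by positivity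
    rw [leib_of_lt (k := 2) (by norm_num), add_zero]
    simp only [Nat.cast_zero, zero_add, one_mul, wsum] at h1 h2 h3 ⊢
    rw [h1]
    simp only [prevQ, wsum]
    linarith
  · have h1 := leib_one_terms (S := S) (τ := τ) (τ₀ := τ₀) (h := h) t (n + 1) x hu
    have h2 := leib_two_terms (S := S) (τ := τ) (τ₀ := τ₀) (h := h) t n x hu
    have hE1 := hE (n + 1) (by omega)
    have h3 := H.sup₂ n hn t u X ((d ^ 2 * B ^ 2 + d * τ₀ ^ 2) ^ (n + 1) * E ^ 2) x hu hX
      fun y => (energy_le H.hpos (n + 1) hu hE1 y).trans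
        (mul_le_mul_of_nonneg_right (pow_le_pow_left₀ (Finset.sum_nonneg fun _ _ => sq_nonneg _)
          (sum_wt_sq_le H.wsize) _) (sq_nonneg _))
    rw [← h2] at h3
    push_cast at h1
    simp only [prevQ, Nat.add_sub_cancel]
    have e : (n : ℝ) + 1 + 1 = n + 2 := by ring
    rw [e] at h1
    rw [mul_add, h1]
    linarith

/-- The energy inequality. -/
theorem exists_energy_inequality (d : ℕ) {δ K c₀ : ℝ} (τ₀ A B Mb : ℝ) (hδ : 0 < δ) (hδ1 : δ ≤ 1)
    (hK : 0 ≤ K) (hc₀ : 0 < c₀) (hMb : 0 ≤ Mb) (n : ℕ) :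
    ∃ Γ : ℝ, 0 ≤ Γ ∧ ∀ (S : Scheme d) (τ : Rd d → ℝ) (h : ℝ) (m : ℕ),
      SmoothHyp S τ τ₀ h δ K c₀ A B Mb m → n ≤ m → ∀ (t : ℝ) (x : Rd d) (u f : Rd d → ℝ)
        (E D X : ℝ), Sm u → Sm f → 0 ≤ E → (∀ k < n, DB k E u) → DB n D f →
        (∀ y, energy S τ τ₀ h n u y ≤ X) →
        2 * bsum₂ S τ τ₀ h n (fun z => z.1 x * z.2 x) u (fun y => S.Lh h t u y + f y)
          ≤ ∑ v ∈ S.Λ₁, S.rate h v t x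
              * (energy S τ τ₀ h n u (x + h • v) - energy S τ τ₀ h n u x)
            - (2 - δ) * S.c t x * energy S τ τ₀ h n u x
            - δ * bsum S τ τ₀ h n (fun ψ => S.calQ h t ψ x) u + K * prevQ S τ τ₀ h t x u n
            + 2 * (1 - δ) * S.c t x * X + Γ * (E + D) ^ 2 := by
  set Ω : ℝ := d ^ 2 * B ^ 2 + d * τ₀ ^ 2 with hΩ
  have hΩ0 : 0 ≤ Ω := by positivity
  set κ : ℝ := (n + 1) * 2 ^ n * (d ^ 2 * A ^ 2 + d * |A| + 1) * Mb with hκ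
  have hκ0 : 0 ≤ κ := by positivity
  refine ⟨(2 * (κ + 1)) ^ 2 / (4 * (δ * c₀)) * Ω ^ n + K * Ω ^ (n - 1), by positivity, ?_⟩
  intro S τ h m H hn t x u f E D X hu hf hE0 hE hD hX
  have hD0 := hD.nonneg
  have h0 := leib_zero_terms (S := S) (τ := τ) (τ₀ := τ₀) H.hpos.ne' t n x u
  have h1 := main_terms_le H hδ1 hK hc₀ hn t x hu hE hX
  have hW := absW_nonneg (S := S) (τ := τ) (τ₀ := τ₀) (h := h) x n u
  have tq := leib_tail (S := S) (τ := τ) (τ₀ := τ₀) H.hpos (x := x) (r := 2) (j := 3) (by norm_num)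
    (κ' := d ^ 2 * A ^ 2) (PA := QFam S.Λ₁)
    (β := fun u a ψ => u x * prodOp h⁻¹ S.Λ₁ (fdiff h) a ψ x)
    (fun k M a ha μ => ha.barDelta H.hpos μ)
    (fun u a ψ M C ha hψ hC => by
      rw [abs_mul, mul_comm]
      exact mul_le_mul_of_nonneg_right (abs_second_order_le H.hpos H.size ha hψ hC x)
        (abs_nonneg _)) n (u := u) (a := fun v => S.q v t) (M := Mb) (C := E) (by positivity)
    (fun k hk => ⟨fun v hv => (H.smooth.q v hv).slice t,
      fun b hb => (H.q_bd t b hb).mono (hk.trans hn) le_rfl, fun y i => H.q_zero t y i⟩) hu hE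
  have tp := leib_tail (S := S) (τ := τ) (τ₀ := τ₀) H.hpos (x := x) (r := 1) (j := 2) (by norm_num)
    (κ' := d * |A|) (PA := fun k M a => (∀ v ∈ S.Λ₁, Sm (a v)) ∧ DBv S.Λ₁ k M a)
    (β := fun u a ψ => u x * prodOp 1 S.Λ₁ (fdiff h) a ψ x)
    (fun k M a ha μ => ⟨fun v hv => (ha.1 v hv).barDelta μ, ha.2.barDelta H.hpos ha.1 μ⟩)
    (fun u a ψ M C ha hψ hC => by
      rw [abs_mul, mul_comm]
      exact mul_le_mul_of_nonneg_right (abs_first_order_le H.hpos H.size ha.2 hψ hC x)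
        (abs_nonneg _)) n (u := u) (a := fun v => S.p v t) (M := Mb) (C := E) (by positivity)
    (fun k hk => ⟨fun v hv => (H.smooth.p v hv).slice t,
      fun b hb => (H.p_bd t b hb).mono (hk.trans hn) le_rfl⟩) hu hE
  have tc := leib_tail (S := S) (τ := τ) (τ₀ := τ₀) H.hpos (x := x) (r := 0) (j := 1) (by norm_num)
    (κ' := 1) (PA := fun k M a => Sm (a 0) ∧ DB k M (a 0))
    (β := fun u a ψ => u x * prodOp (-1) {0} (fun _ φ => φ) a ψ x)
    (fun k M a ha μ => ⟨ha.1.barDelta μ, ha.2.barDelta H.hpos ha.1 μ⟩)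
    (fun u a ψ M C ha hψ hC => by
      have h1 := ha.2.bound x
      have h2 := hC.bound x
      have h3 := ha.2.nonneg
      rw [abs_mul, mul_comm, one_mul]
      refine mul_le_mul_of_nonneg_right ?_ (abs_nonneg _)
      simp only [prodOp, Finset.sum_singleton]
      rw [neg_one_mul, abs_neg, abs_mul]
      gcongr) n (u := u) (a := fun _ => S.c t) (M := Mb) (C := E) (by positivity)
    (fun k hk => ⟨H.smooth.c.slice t, (H.c_bd t).mono (hk.trans hn) le_rfl⟩) hu hE
  have tf := abs_bsum₂_mul_le (S := S) (τ := τ) (τ₀ := τ₀) H.hpos n x u hf hD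
  have key := energy_decomposition (τ := τ) (τ₀ := τ₀) (h := h) H.smooth t n x hu hf
  rw [leib_sum_split _ n 3, leib_sum_split _ n 2, leib_sum_split _ n 1] at key
  simp only [Finset.sum_range_succ _ 0, Finset.sum_range_succ _ 1, Finset.sum_range_succ _ 2,
    Finset.sum_range_zero, zero_add] at key
  have hab := absW_le (S := S) (τ := τ) (τ₀ := τ₀) (h := h) x n u
    (H := 2 * (κ + 1) * (E + D)) (ε := δ * c₀) (by positivity)
  have hΩn : (∑ μ ∈ S.fullΛ, wt τ τ₀ μ ^ 2) ^ n ≤ Ω ^ n :=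
    pow_le_pow_left₀ (Finset.sum_nonneg fun _ _ => sq_nonneg _) (sum_wt_sq_le H.wsize) _
  have h5 : (2 * (κ + 1) * (E + D)) ^ 2 / (4 * (δ * c₀)) * (∑ μ ∈ S.fullΛ, wt τ τ₀ μ ^ 2) ^ n
      ≤ (2 * (κ + 1)) ^ 2 / (4 * (δ * c₀)) * Ω ^ n * (E + D) ^ 2 := by
    calc _ ≤ (2 * (κ + 1) * (E + D)) ^ 2 / (4 * (δ * c₀)) * Ω ^ n := by gcongr
      _ = _ := by ring
  have h6 : K * (Ω ^ (n - 1) * E ^ 2) ≤ K * Ω ^ (n - 1) * (E + D) ^ 2 := by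
    rw [mul_assoc]; gcongr; linarith
  have h7 : 2 * ((n + 1) * 2 ^ n * (d ^ 2 * A ^ 2 * Mb * E) * absW S τ τ₀ h x n u)
      + 2 * ((n + 1) * 2 ^ n * (d * |A| * Mb * E) * absW S τ τ₀ h x n u)
      + 2 * ((n + 1) * 2 ^ n * (1 * Mb * E) * absW S τ τ₀ h x n u)
      + 2 * (D * absW S τ τ₀ h x n u) ≤ 2 * (κ + 1) * (E + D) * absW S τ τ₀ h x n u := by
    have : 2 * (κ + 1) * (E + D) * absW S τ τ₀ h x n u
        - (2 * ((n + 1) * 2 ^ n * (d ^ 2 * A ^ 2 * Mb * E) * absW S τ τ₀ h x n u)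
      + 2 * ((n + 1) * 2 ^ n * (d * |A| * Mb * E) * absW S τ τ₀ h x n u)
      + 2 * ((n + 1) * 2 ^ n * (1 * Mb * E) * absW S τ τ₀ h x n u)
      + 2 * (D * absW S τ τ₀ h x n u)) = 2 * (E + κ * D) * absW S τ τ₀ h x n u := by
      rw [hκ]; ring
    have h8 : 0 ≤ 2 * (E + κ * D) * absW S τ τ₀ h x n u := by positivity
    linarith
  have h9 : δ * c₀ * energy S τ τ₀ h n u x ≤ δ * S.c t x * energy S τ τ₀ h n u x := by
    have := energy_nonneg (S := S) (τ := τ) (τ₀ := τ₀) (h := h) n u x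
    have := H.c_le t x
    gcongr
  have a1 := (abs_le.1 tq).2
  have a2 := (abs_le.1 tp).2
  have a3 := (abs_le.1 tc).2
  have a4 := (abs_le.1 tf).2
  rw [key]
  linarith

end EnergyInequality


/-! ### The derivative estimate for smooth schemes -/

section SmoothEstimate

variable {S : Scheme d} {τ : Rd d → ℝ} {τ₀ h δ K c₀ A B Mb : ℝ} {m : ℕ}

/-- Weighted sum of the energies up to order `n`. -/
noncomputable def cumEnergy (S : Scheme d) (τ : Rd d → ℝ) (τ₀ h κ : ℝ) :
    ℕ → (Rd d → ℝ) → Rd d → ℝ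
  | 0, u, x => energy S τ τ₀ h 0 u x
  | n + 1, u, x => energy S τ τ₀ h (n + 1) u x + κ * cumEnergy S τ τ₀ h κ n u x

/-- Half the rate of change of `cumEnergy`. -/
noncomputable def cumPower (S : Scheme d) (τ : Rd d → ℝ) (τ₀ h κ : ℝ) :
    ℕ → (Rd d → ℝ) → (Rd d → ℝ) → Rd d → ℝ
  | 0, u, G, x => bsum₂ S τ τ₀ h 0 (fun z => z.1 x * z.2 x) u G
  | n + 1, u, G, x => bsum₂ S τ τ₀ h (n + 1) (fun z => z.1 x * z.2 x) u G
      + κ * cumPower S τ τ₀ h κ n u G x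

theorem cumEnergy_nonneg {κ : ℝ} (hκ : 0 ≤ κ) (n : ℕ) (u : Rd d → ℝ) (x : Rd d) :
    0 ≤ cumEnergy S τ τ₀ h κ n u x := by
  induction n with
  | zero => exact energy_nonneg 0 u x
  | succ n ih => exact add_nonneg (energy_nonneg _ u x) (mul_nonneg hκ ih)

theorem energy_le_cumEnergy {κ : ℝ} (hκ : 0 ≤ κ) (n : ℕ) (u : Rd d → ℝ) (x : Rd d) :
    energy S τ τ₀ h n u x ≤ cumEnergy S τ τ₀ h κ n u x := by
  cases n with
  | zero => exact le_rfl
  | succ n => exact le_add_of_nonneg_right (mul_nonneg hκ (cumEnergy_nonneg hκ n u x))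

theorem cumEnergy_le {κ Ω : ℝ} (hκ : 0 ≤ κ) (hh : 0 < h)
    (hΩ : ∑ μ ∈ S.fullΛ, wt τ τ₀ μ ^ 2 ≤ Ω) (n : ℕ) {u : Rd d → ℝ} (hu : Sm u) {C : ℝ}
    (hC : DB n C u) (x : Rd d) :
    cumEnergy S τ τ₀ h κ n u x ≤ (∑ k ∈ Finset.range (n + 1), κ ^ (n - k) * Ω ^ k) * C ^ 2 := by
  have h1 : ∀ k ≤ n, energy S τ τ₀ h k u x ≤ Ω ^ k * C ^ 2 := fun k hk =>
    (energy_le hh k hu (hC.mono hk le_rfl) x).trans (mul_le_mul_of_nonneg_right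
      (pow_le_pow_left₀ (Finset.sum_nonneg fun _ _ => sq_nonneg _) hΩ _) (sq_nonneg _))
  induction n with
  | zero => simpa [cumEnergy] using h1 0 le_rfl
  | succ n ih =>
    have h2 := ih (hC.mono (Nat.le_succ n) le_rfl) fun k hk => h1 k (hk.trans (Nat.le_succ n))
    rw [cumEnergy, Finset.sum_range_succ, add_mul, Nat.sub_self, pow_zero, one_mul, add_comm]
    refine add_le_add ((mul_le_mul_of_nonneg_left h2 hκ).trans (le_of_eq ?_)) (h1 _ le_rfl)
    rw [← mul_assoc, Finset.mul_sum]
    congr 1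
    refine Finset.sum_congr rfl fun k hk => ?_
    rw [Nat.succ_sub (Nat.lt_succ_iff.1 (Finset.mem_range.1 hk)), pow_succ]; ring

theorem cumEnergy_evolution {T κ : ℝ} (hT : 0 ≤ T) (n : ℕ) {u G : ℝ → Rd d → ℝ} {g : Rd d → ℝ}
    (hg : Sm g) (huS : STS u) (hG : STS G) (hu : ∀ t x, u t x = g x + tint T G t x) {t : ℝ}
    (ht : t ∈ Icc (0 : ℝ) T) (x : Rd d) :
    IntervalIntegrable (fun s => 2 * cumPower S τ τ₀ h κ n (u s) (G s) x) volume 0 t ∧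
    cumEnergy S τ τ₀ h κ n (u t) x = cumEnergy S τ τ₀ h κ n g x
      + ∫ s in (0 : ℝ)..t, 2 * cumPower S τ τ₀ h κ n (u s) (G s) x := by
  induction n with
  | zero => exact energy_evolution hT 0 hg huS hG hu ht x
  | succ n ih =>
    obtain ⟨i1, e1⟩ := energy_evolution (S := S) (τ := τ) (τ₀ := τ₀) (h := h) hT (n + 1) hg huS hG
      hu ht x
    obtain ⟨i2, e2⟩ := ih
    have e : (fun s => 2 * cumPower S τ τ₀ h κ (n + 1) (u s) (G s) x) = fun s =>
        2 * bsum₂ S τ τ₀ h (n + 1) (fun z => z.1 x * z.2 x) (u s) (G s)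
        + κ * (2 * cumPower S τ τ₀ h κ n (u s) (G s) x) := by
      funext s; rw [cumPower]; ring
    rw [e]
    refine ⟨i1.add (i2.const_mul κ), ?_⟩
    rw [intervalIntegral.integral_add i1 (i2.const_mul κ), intervalIntegral.integral_const_mul κ,
      cumEnergy, cumEnergy, e1, e2]
    ring

theorem exists_cumEnergy_inequality (d : ℕ) {δ K c₀ : ℝ} (τ₀ A B Mb : ℝ) (hδ : 0 < δ)
    (hδ1 : δ ≤ 1) (hK : 0 ≤ K) (hc₀ : 0 < c₀) (hMb : 0 ≤ Mb) (n : ℕ) :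
    ∃ Γ : ℝ, 0 ≤ Γ ∧ ∀ (S : Scheme d) (τ : Rd d → ℝ) (h : ℝ) (m : ℕ),
      SmoothHyp S τ τ₀ h δ K c₀ A B Mb m → n ≤ m → ∀ (t : ℝ) (x : Rd d) (u f : Rd d → ℝ)
        (E D X : ℝ), Sm u → Sm f → 0 ≤ E → (∀ k < n, DB k E u) → DB n D f →
        (∀ y, energy S τ τ₀ h n u y ≤ X) →
        2 * cumPower S τ τ₀ h (K / δ) n u (fun y => S.Lh h t u y + f y) x
          ≤ ∑ v ∈ S.Λ₁, S.rate h v t x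
              * (cumEnergy S τ τ₀ h (K / δ) n u (x + h • v) - cumEnergy S τ τ₀ h (K / δ) n u x)
            - (2 - δ) * S.c t x * cumEnergy S τ τ₀ h (K / δ) n u x
            - δ * bsum S τ τ₀ h n (fun ψ => S.calQ h t ψ x) u
            + 2 * (1 - δ) * S.c t x * X + S.c t x * (Γ * (E + D) ^ 2) := by
  induction n with
  | zero =>
    obtain ⟨Γ, hΓ, H⟩ := exists_energy_inequality d τ₀ A B Mb hδ hδ1 hK hc₀ hMb 0
    refine ⟨Γ / c₀, by positivity, fun S τ h m hS hm t x u f E D X hu hf hE0 hE hD hX => ?_⟩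
    have h1 := H S τ h m hS hm t x u f E D X hu hf hE0 hE hD hX
    have h2 : Γ * (E + D) ^ 2 ≤ S.c t x * (Γ / c₀ * (E + D) ^ 2) := by
      calc Γ * (E + D) ^ 2 = c₀ * (Γ / c₀ * (E + D) ^ 2) := by field_simp
        _ ≤ _ := mul_le_mul_of_nonneg_right (hS.c_le t x) (by positivity)
    simp only [prevQ, mul_zero, add_zero] at h1
    simp only [cumPower, cumEnergy]
    linarith
  | succ n ih =>
    obtain ⟨Γ', hΓ', H'⟩ := ih
    obtain ⟨Γ, hΓ, H⟩ := exists_energy_inequality d τ₀ A B Mb hδ hδ1 hK hc₀ hMb (n + 1)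
    set Ω : ℝ := d ^ 2 * B ^ 2 + d * τ₀ ^ 2 with hΩ
    refine ⟨Γ / c₀ + K / δ * (2 * Ω ^ n + Γ'), by positivity,
      fun S τ h m hS hm t x u f E D X hu hf hE0 hE hD hX => ?_⟩
    have hc := hc₀.le.trans (hS.c_le t x)
    have hD0 := hD.nonneg
    have h1 := H S τ h m hS hm t x u f E D X hu hf hE0 hE hD hX
    have h3 := H' S τ h m hS (Nat.le_of_succ_le hm) t x u f E D (Ω ^ n * E ^ 2) hu hf hE0
      (fun k hk => hE k (by omega)) (hD.mono (Nat.le_succ n) le_rfl)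
      fun y => (energy_le hS.hpos n hu (hE n (by omega)) y).trans
        (mul_le_mul_of_nonneg_right (pow_le_pow_left₀ (Finset.sum_nonneg fun _ _ => sq_nonneg _)
          (sum_wt_sq_le hS.wsize) _) (sq_nonneg _))
    have h2 : Γ * (E + D) ^ 2 ≤ S.c t x * (Γ / c₀ * (E + D) ^ 2) := by
      calc Γ * (E + D) ^ 2 = c₀ * (Γ / c₀ * (E + D) ^ 2) := by field_simp
        _ ≤ _ := mul_le_mul_of_nonneg_right (hS.c_le t x) (by positivity)
    have h4 : 2 * (1 - δ) * S.c t x * (Ω ^ n * E ^ 2) ≤ S.c t x * (2 * Ω ^ n * (E + D) ^ 2) := by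
      calc 2 * (1 - δ) * S.c t x * (Ω ^ n * E ^ 2) ≤ 2 * 1 * S.c t x * (Ω ^ n * (E + D) ^ 2) := by
            gcongr <;> linarith
        _ = _ := by ring
    have h5 := mul_le_mul_of_nonneg_left (h3.trans (add_le_add_left (add_le_add_right h4 _) _))
      (div_nonneg hK hδ.le)
    have h6 : K / δ * (δ * bsum S τ τ₀ h n (fun ψ => S.calQ h t ψ x) u)
        = K * bsum S τ τ₀ h n (fun ψ => S.calQ h t ψ x) u := by field_simp
    have h7 : ∑ v ∈ S.Λ₁, S.rate h v t x * (cumEnergy S τ τ₀ h (K / δ) (n + 1) u (x + h • v)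
          - cumEnergy S τ τ₀ h (K / δ) (n + 1) u x)
        = ∑ v ∈ S.Λ₁, S.rate h v t x
            * (energy S τ τ₀ h (n + 1) u (x + h • v) - energy S τ τ₀ h (n + 1) u x)
          + K / δ * ∑ v ∈ S.Λ₁, S.rate h v t x * (cumEnergy S τ τ₀ h (K / δ) n u (x + h • v)
          - cumEnergy S τ τ₀ h (K / δ) n u x) := by
      rw [Finset.mul_sum, ← Finset.sum_add_distrib]
      exact Finset.sum_congr rfl fun v _ => by simp only [cumEnergy]; ring
    rw [h7]
    simp only [cumPower, cumEnergy, prevQ] at h1 ⊢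
    linear_combination h1 + h5 + h2 - h6

theorem sq_pds_le_energy (τ₀ : ℝ) (w : List (Fin d)) {u : Rd d → ℝ} (hu : Sm u) (x : Rd d) :
    (τ₀ ^ w.length * pds w u x) ^ 2 ≤ energy S τ τ₀ h w.length u x := by
  induction w generalizing u with
  | nil => simp [energy, wsum]
  | cons i w ih =>
    have h1 := ih (hu.barDelta (τ := τ) (τ₀ := τ₀) (h := h) (Sum.inr i))
    have h2 : energy S τ τ₀ h w.length (barDelta τ τ₀ h (Sum.inr i) u) x
        ≤ energy S τ τ₀ h (w.length + 1) u x := by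
      rw [energy_succ]
      exact Finset.single_le_sum (f := fun μ => energy S τ τ₀ h w.length (barDelta τ τ₀ h μ u) x)
        (fun μ _ => energy_nonneg _ _ _) (by simp [Scheme.fullΛ])
    refine le_trans (le_of_eq ?_) (h1.trans h2)
    rw [pds_cons, ← pds_pderiv hu.1]
    simp only [barDelta]
    rw [pds_const_mul (hu.pderiv i).1, List.length_cons]
    ring

theorem exists_level_estimate (d : ℕ) {δ K c₀ : ℝ} (τ₀ A B Mb : ℝ) (hδ : 0 < δ) (hδ1 : δ ≤ 1)
    (hK : 0 ≤ K) (hc₀ : 0 < c₀) (hMb : 0 ≤ Mb) (n : ℕ) {N' : ℝ} (hN' : 0 ≤ N') :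
    ∃ N : ℝ, 0 ≤ N ∧ ∀ (S : Scheme d) (τ : Rd d → ℝ) (h : ℝ) (m : ℕ),
      SmoothHyp S τ τ₀ h δ K c₀ A B Mb m → n ≤ m → ∀ (T : ℝ) (F u : ℝ → Rd d → ℝ) (g : Rd d → ℝ)
        (D : ℝ), 0 ≤ T → STS F → Sm g → (∀ t, DB n D (F t)) → DB n D g → STS u →
        (∀ t x, u t x = g x + tint T (fun s x => S.Lh h s (u s) x + F s x) t x) →
        (∀ t, ∀ k < n, DB k (N' * D) (u t)) →
        ∀ t ∈ Icc (0 : ℝ) T, ∀ x, energy S τ τ₀ h n (u t) x ≤ N * D ^ 2 := by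
  obtain ⟨Γ, hΓ, H⟩ := exists_cumEnergy_inequality d τ₀ A B Mb hδ hδ1 hK hc₀ hMb n
  set Ω : ℝ := d ^ 2 * B ^ 2 + d * τ₀ ^ 2 with hΩ
  set Cv : ℝ := ∑ k ∈ Finset.range (n + 1), (K / δ) ^ (n - k) * Ω ^ k with hCv
  have hΩ0 : 0 ≤ Ω := by positivity
  have hCv0 : 0 ≤ Cv := Finset.sum_nonneg fun k _ => by positivity
  have hκ : 0 ≤ K / δ := by positivity
  refine ⟨(Γ * (N' + 1) ^ 2 + 2 * Cv) / δ, by positivity, ?_⟩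
  intro S τ h m hS hm T F u g D hT hF hg hFD hgD huS hu hlow t ht x
  have hD0 := hgD.nonneg
  have hGS : STS (fun s x => S.Lh h s (u s) x + F s x) := (hS.smooth.sts_Lh hS.hpos.ne' huS).add hF
  obtain ⟨C, hC⟩ := huS.bd n
  set Z : Set ℝ := {e | ∃ t ∈ Icc (0 : ℝ) T, ∃ x, e = energy S τ τ₀ h n (u t) x} with hZ
  have hwt := sum_wt_sq_le (τ₀ := τ₀) hS.wsize
  have hbV : ∀ t x, cumEnergy S τ τ₀ h (K / δ) n (u t) x ≤ Cv * C ^ 2 := fun t x =>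
    cumEnergy_le hκ hS.hpos hwt n (huS.slice t) (hC t) x
  have hbdd : BddAbove Z := ⟨Cv * C ^ 2, by
    rintro _ ⟨t, _, x, rfl⟩
    exact (energy_le_cumEnergy hκ n _ x).trans (hbV t x)⟩
  set X := sSup Z with hX
  have hXle : ∀ t ∈ Icc (0 : ℝ) T, ∀ x, energy S τ τ₀ h n (u t) x ≤ X := fun t ht x =>
    le_csSup hbdd ⟨t, ht, x, rfl⟩
  set R : ℝ := (2 * (1 - δ) * X + Γ * (N' * D + D) ^ 2) / (2 - δ) + Cv * D ^ 2 with hR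
  have hX0 : 0 ≤ X := (energy_nonneg n (u t) x).trans (hXle t ht x)
  have h2δ : 0 < 2 - δ := by linarith
  have h1δ : 0 ≤ 1 - δ := by linarith
  have hβ : ∃ β, ∀ t x, ∑ v ∈ S.Λ₁, S.rate h v t x ≤ β := by
    have : ∀ v, ∃ b, v ∈ S.Λ₁ → ∀ t x, |S.rate h v t x| ≤ b := fun v => by
      by_cases hv : v ∈ S.Λ₁
      · exact ((hS.smooth.rate h hv).bound).imp fun b hb _ t x => hb t x
      · exact ⟨0, fun h => (hv h).elim⟩
    choose b hb using this
    exact ⟨∑ v ∈ S.Λ₁, b v, fun t x => Finset.sum_le_sum fun v hv =>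
      (le_abs_self _).trans (hb v hv t x)⟩
  obtain ⟨β, hβ⟩ := hβ
  have h0 : u 0 = g := funext fun y => by
    rw [hu, tint, clampT_of_mem (left_mem_Icc.2 hT)]; simp
  have hmax := max_principle (T := T) (h := h) (s := S.Λ₁) (b := S.rate h) (R := R)
    (a := fun t x => (2 - δ) * S.c t x)
    (y := fun t x => cumEnergy S τ τ₀ h (K / δ) n (u t) x)
    (G := fun s x => 2 * cumPower S τ τ₀ h (K / δ) n (u s) (fun x => S.Lh h s (u s) x + F s x) x)
    (fun v hv t _ x => mul_nonneg (by positivity) (hS.chi_nonneg v hv t x))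
    (fun t _ x => hβ t x)
    (fun t _ x => mul_nonneg h2δ.le (hc₀.le.trans (hS.c_le t x)))
    (fun t _ x => hbV t x)
    (fun t ht x => (cumEnergy_evolution hT n hg huS hGS hu ht x).1)
    (fun t ht x => by
      rw [(cumEnergy_evolution hT n hg huS hGS hu ht x).2]
      simp only [h0])
    (fun x => by
      simp only [h0]
      refine (cumEnergy_le hκ hS.hpos hwt n hg hgD x).trans ?_
      rw [hR]
      have : 0 ≤ (2 * (1 - δ) * X + Γ * (N' * D + D) ^ 2) / (2 - δ) := by positivity
      linarith)
    (fun t ht x => by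
      have h1 := H S τ h m hS hm t x (u t) (F t) (N' * D) D X (huS.slice t) (hF.slice t)
        (by positivity) (hlow t) (hFD t) (hXle t ht)
      have h2 : 0 ≤ δ * bsum S τ τ₀ h n (fun ψ => S.calQ h t ψ x) (u t) :=
        mul_nonneg hδ.le (wsum_nonneg (fun φ => calQ_nonneg hS.chi_nonneg t φ x) n _)
      have hc := hc₀.le.trans (hS.c_le t x)
      have h3 : 2 * (1 - δ) * S.c t x * X + S.c t x * (Γ * (N' * D + D) ^ 2)
          ≤ (2 - δ) * S.c t x * R := by
        have e : (2 - δ) * S.c t x * R = 2 * (1 - δ) * S.c t x * X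
            + S.c t x * (Γ * (N' * D + D) ^ 2) + (2 - δ) * S.c t x * (Cv * D ^ 2) := by
          rw [hR]; field_simp
        have : 0 ≤ (2 - δ) * S.c t x * (Cv * D ^ 2) := by positivity
        linarith
      linarith)
  have hXR : X ≤ R := csSup_le ⟨_, t, ht, x, rfl⟩ (by
    rintro _ ⟨t, ht, x, rfl⟩
    exact (energy_le_cumEnergy hκ n _ x).trans (hmax t ht x))
  refine (hXle t ht x).trans ?_
  rw [div_mul_eq_mul_div, le_div_iff₀ hδ]
  have h1 := mul_le_mul_of_nonneg_right hXR h2δ.le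
  have e : R * (2 - δ) = 2 * (1 - δ) * X + Γ * (N' * D + D) ^ 2 + (2 - δ) * (Cv * D ^ 2) := by
    rw [hR]; field_simp
  have h4 : 0 ≤ δ * (Cv * D ^ 2) := by positivity
  have e2 : Γ * (N' * D + D) ^ 2 = Γ * (N' + 1) ^ 2 * D ^ 2 := by ring
  linarith

/-- The derivative estimate for smooth schemes, uniform in the mesh size. -/
theorem exists_smooth_estimate (d : ℕ) {δ K c₀ τ₀ : ℝ} (A B Mb : ℝ) (hδ : 0 < δ) (hδ1 : δ ≤ 1)
    (hK : 0 ≤ K) (hc₀ : 0 < c₀) (hτ₀ : 0 < τ₀) (hMb : 0 ≤ Mb) (n : ℕ) :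
    ∃ N : ℝ, 0 ≤ N ∧ ∀ (S : Scheme d) (τ : Rd d → ℝ) (h : ℝ) (m : ℕ),
      SmoothHyp S τ τ₀ h δ K c₀ A B Mb m → n ≤ m → ∀ (T : ℝ) (F u : ℝ → Rd d → ℝ) (g : Rd d → ℝ)
        (D : ℝ), 0 ≤ T → STS F → Sm g → (∀ t, DB n D (F t)) → DB n D g → STS u →
        (∀ t x, u t x = g x + tint T (fun s x => S.Lh h s (u s) x + F s x) t x) →
        ∀ t, DB n (N * D) (u t) := by
  have step : ∀ n, (∃ N' : ℝ, 0 ≤ N' ∧ ∀ (S : Scheme d) (τ : Rd d → ℝ) (h : ℝ) (m : ℕ),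
      SmoothHyp S τ τ₀ h δ K c₀ A B Mb m → n ≤ m → ∀ (T : ℝ) (F u : ℝ → Rd d → ℝ) (g : Rd d → ℝ)
        (D : ℝ), 0 ≤ T → STS F → Sm g → (∀ t, DB n D (F t)) → DB n D g → STS u →
        (∀ t x, u t x = g x + tint T (fun s x => S.Lh h s (u s) x + F s x) t x) →
        ∀ t, ∀ k < n, DB k (N' * D) (u t)) →
      ∃ N : ℝ, 0 ≤ N ∧ ∀ (S : Scheme d) (τ : Rd d → ℝ) (h : ℝ) (m : ℕ),
      SmoothHyp S τ τ₀ h δ K c₀ A B Mb m → n ≤ m → ∀ (T : ℝ) (F u : ℝ → Rd d → ℝ) (g : Rd d → ℝ)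
        (D : ℝ), 0 ≤ T → STS F → Sm g → (∀ t, DB n D (F t)) → DB n D g → STS u →
        (∀ t x, u t x = g x + tint T (fun s x => S.Lh h s (u s) x + F s x) t x) →
        ∀ t, DB n (N * D) (u t) := by
    rintro n ⟨N', hN', H'⟩
    obtain ⟨N, hN, H⟩ := exists_level_estimate d τ₀ A B Mb hδ hδ1 hK hc₀ hMb n hN'
    refine ⟨N' + √N / τ₀ ^ n, by positivity, ?_⟩
    intro S τ h m hS hm T F u g D hT hF hg hFD hgD huS hu
    have hD0 := hgD.nonneg
    have hl := H' S τ h m hS hm T F u g D hT hF hg hFD hgD huS hu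
    have hmain := H S τ h m hS hm T F u g D hT hF hg hFD hgD huS hu hl
    have hall : ∀ t x, energy S τ τ₀ h n (u t) x ≤ N * D ^ 2 := fun t x => by
      have : u t = u (clampT T t) := by
        funext y
        rw [hu t, hu (clampT T t), tint, tint, clampT_of_mem (clampT_mem hT t)]
      rw [this]; exact hmain _ (clampT_mem hT t) x
    intro t w hw x
    rcases hw.lt_or_eq with hlt | heq
    · refine (hl t w.length hlt w le_rfl x).trans ?_
      have : 0 ≤ √N / τ₀ ^ n * D := by positivity
      linarith
    · have h1 := sq_pds_le_energy (S := S) (τ := τ) (h := h) τ₀ w (huS.slice t) x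
      rw [heq] at h1
      replace h1 := h1.trans (hall t x)
      have h2 : |τ₀ ^ n * pds w (u t) x| ≤ √N * D :=
        abs_le_of_sq_le_sq (h1.trans (le_of_eq (by rw [mul_pow, Real.sq_sqrt hN]))) (by positivity)
      rw [abs_mul, abs_of_pos (by positivity : (0 : ℝ) < τ₀ ^ n), ← le_div_iff₀' (by positivity)] at h2
      refine h2.trans ?_
      have : 0 ≤ N' * D := by positivity
      rw [mul_div_right_comm]
      linarith
  induction n with
  | zero => exact step 0 ⟨0, le_rfl, fun _ _ _ _ _ _ _ _ _ _ _ _ _ _ _ _ _ _ _ k hk => absurd hk (by omega)⟩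
  | succ n ih =>
    obtain ⟨N, hN, H⟩ := ih
    refine step (n + 1) ⟨N, hN, ?_⟩
    intro S τ h m hS hm T F u g D hT hF hg hFD hgD huS hu t k hk
    exact (H S τ h m hS (by omega) T F u g D hT hF hg (fun t => (hFD t).mono (by omega) le_rfl)
      (hgD.mono (by omega) le_rfl) huS hu t).mono (by omega) le_rfl

end SmoothEstimate


/-! ### Words and multi-indices -/

/-- The word `1 ⋯ 1 2 ⋯ 2 ⋯` in which the letter `i` occurs `α i` times. -/
def wordOf (α : Fin d → ℕ) : List (Fin d) :=
  (List.finRange d).flatMap fun i => List.replicate (α i) i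

theorem pds_replicate (n : ℕ) (i : Fin d) (φ : Rd d → ℝ) :
    pds (List.replicate n i) φ = (pderiv i)^[n] φ := by
  induction n with
  | zero => rfl
  | succ n ih => rw [List.replicate_succ, pds_cons, ih, Function.iterate_succ_apply']

theorem multiDeriv_eq_pds (α : Fin d → ℕ) (φ : Rd d → ℝ) : multiDeriv α φ = pds (wordOf α) φ := by
  unfold multiDeriv wordOf
  induction List.finRange d with
  | nil => rfl
  | cons i l ih => rw [List.foldr_cons, List.flatMap_cons, pds_append, ih, pds_replicate]

theorem length_wordOf (α : Fin d → ℕ) : (wordOf α).length = order α := by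
  rw [wordOf, List.length_flatMap, order, Fin.sum_univ_def]
  simp

theorem count_wordOf (α : Fin d → ℕ) (j : Fin d) : (wordOf α).count j = α j := by
  rw [wordOf, List.count_flatMap, ← Fin.sum_univ_def]
  simp [List.count_replicate]

theorem perm_wordOf (w : List (Fin d)) : w.Perm (wordOf fun i => w.count i) :=
  List.perm_iff_count.2 fun j => (count_wordOf (fun i => w.count i) j).symm

theorem order_count (w : List (Fin d)) : order (fun i => w.count i) = w.length := by
  rw [← length_wordOf, (perm_wordOf w).length_eq]

/-! ### Test functions -/

theorem IsTest.pderiv {η : Rd d → ℝ} (h : IsTest η) (i : Fin d) : IsTest (pderiv i η) :=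
  ⟨contDiff_pderiv_top h.1 i, h.2.fderiv_apply ℝ _⟩

theorem IsTest.pds {η : Rd d → ℝ} (h : IsTest η) (w : List (Fin d)) : IsTest (pds w η) := by
  induction w with
  | nil => exact h
  | cons i w ih => exact ih.pderiv i

theorem IsTest.sm {η : Rd d → ℝ} (h : IsTest η) : Sm η := by
  refine ⟨h.1, fun n => ?_⟩
  induction n generalizing η with
  | zero =>
    obtain ⟨C, hC⟩ := h.2.exists_bound_of_continuous h.1.continuous
    exact ⟨C, DB_zero_iff.2 hC⟩
  | succ n ih =>
    obtain ⟨C, hC⟩ := h.2.exists_bound_of_continuous h.1.continuous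
    choose B hB using fun i => ih (h.pderiv i)
    have hC0 : 0 ≤ C := (norm_nonneg _).trans (hC 0)
    have hB0 : ∀ i, 0 ≤ B i := fun i => (hB i).nonneg
    refine ⟨C + ∑ i, B i, DB_succ_iff.2 ⟨fun x => (hC x).trans ?_, fun i => (hB i).mono le_rfl ?_⟩⟩
    · exact le_add_of_nonneg_right (Finset.sum_nonneg fun i _ => hB0 i)
    · have := Finset.single_le_sum (f := B) (fun i _ => hB0 i) (Finset.mem_univ i)
      linarith

theorem pds_congr_nhds {φ ψ : Rd d → ℝ} {x : Rd d} (h : φ =ᶠ[𝓝 x] ψ) (w : List (Fin d)) :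
    pds w φ =ᶠ[𝓝 x] pds w ψ := by
  induction w with
  | nil => exact h
  | cons i w ih =>
    filter_upwards [ih.fderiv (𝕜 := ℝ)] with y hy
    rw [pds_cons, pds_cons, FDExpansion.pderiv, FDExpansion.pderiv, hy]

theorem pds_comp_neg (w : List (Fin d)) (φ : Rd d → ℝ) :
    pds w (fun x => φ (-x)) = fun x => (-1) ^ w.length * pds w φ (-x) := by
  induction w generalizing φ with
  | nil => funext x; simp [pds]
  | cons i w ih =>
    funext x
    rw [pds_cons, ih, pds_cons, List.length_cons]
    have e : (fun x => (-1) ^ w.length * pds w φ (-x)) = ((-1 : ℝ) ^ w.length) •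
        (pds w φ ∘ (ContinuousLinearEquiv.neg ℝ : Rd d ≃L[ℝ] Rd d)) := rfl
    rw [FDExpansion.pderiv, e, fderiv_const_smul_field, Pi.smul_apply,
      ContinuousLinearEquiv.comp_right_fderiv]
    simp only [FDExpansion.pderiv, FunLike.coe_smul, Pi.smul_apply,
      ContinuousLinearMap.comp_apply, ContinuousLinearEquiv.coe_coe,
      ContinuousLinearEquiv.neg_apply, map_neg, smul_eq_mul]
    ring

/-! ### Mollification -/

/-- A bump function concentrated on the ball of radius `1/(k+1)`. -/
noncomputable def bumpK (d k : ℕ) : ContDiffBump (0 : Rd d) where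
  rIn := 1 / (2 * ((k : ℝ) + 1))
  rOut := 1 / ((k : ℝ) + 1)
  rIn_pos := by positivity
  rIn_lt_rOut := one_div_lt_one_div_of_lt (by positivity) (by linarith [k.cast_nonneg (α := ℝ)])

/-- A smoothing kernel. -/
noncomputable def kern (k : ℕ) : Rd d → ℝ := (bumpK d k).normed volume

theorem isTest_kern (k : ℕ) : IsTest (kern k : Rd d → ℝ) :=
  ⟨(bumpK d k).contDiff_normed, (bumpK d k).hasCompactSupport_normed⟩

theorem kern_nonneg (k : ℕ) (y : Rd d) : 0 ≤ kern k y := (bumpK d k).nonneg_normed y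

theorem kern_neg (k : ℕ) (y : Rd d) : kern k (-y) = kern k y := (bumpK d k).normed_neg y

theorem integral_kern (k : ℕ) : ∫ y, (kern k y : ℝ) ∂(volume : Measure (Rd d)) = 1 :=
  (bumpK d k).integral_normed

theorem one_div_succ_le_one (k : ℕ) : 1 / ((k : ℝ) + 1) ≤ 1 := by
  rw [div_le_one (by positivity)]; linarith [k.cast_nonneg (α := ℝ)]

theorem kern_eq_zero {k : ℕ} {y : Rd d} (hy : 1 / ((k : ℝ) + 1) < ‖y‖) : kern k y = 0 := by
  have h : y ∉ Function.support (kern k : Rd d → ℝ) := by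
    rw [kern, (bumpK d k).support_normed_eq, mem_ball_zero_iff]; exact not_lt.2 hy.le
  simpa using h

theorem integrable_kern (k : ℕ) : Integrable (kern k : Rd d → ℝ) volume :=
  (isTest_kern k).1.continuous.integrable_of_hasCompactSupport (isTest_kern k).2

/-- The probability measure with density `kern k`. -/
noncomputable def kmeas (d k : ℕ) : Measure (Rd d) :=
  volume.withDensity fun y => ENNReal.ofReal (kern k y)

theorem measurable_kern (k : ℕ) : Measurable (kern k : Rd d → ℝ) :=
  (isTest_kern k).1.continuous.measurable

instance (k : ℕ) : IsProbabilityMeasure (kmeas d k) := ⟨by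
  rw [kmeas, withDensity_apply _ MeasurableSet.univ, Measure.restrict_univ,
    ← ofReal_integral_eq_lintegral_ofReal (integrable_kern k)
      (Eventually.of_forall (kern_nonneg k)), integral_kern, ENNReal.ofReal_one]⟩

theorem integral_kmeas (k : ℕ) (g : Rd d → ℝ) : ∫ y, g y ∂(kmeas d k) = ∫ y, kern k y * g y := by
  rw [kmeas, integral_withDensity_eq_integral_toReal_smul (measurable_kern k).ennreal_ofReal
    (Eventually.of_forall fun _ => ENNReal.ofReal_lt_top)]
  simp only [ENNReal.toReal_ofReal (kern_nonneg k _), smul_eq_mul]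

theorem ae_kmeas_norm_le (k : ℕ) : ∀ᵐ y ∂(kmeas d k), ‖y‖ ≤ 1 / ((k : ℝ) + 1) := by
  rw [kmeas, ae_withDensity_iff (measurable_kern k).ennreal_ofReal]
  refine Eventually.of_forall fun y hy => ?_
  by_contra hlt
  exact hy (by rw [kern_eq_zero (not_le.1 hlt), ENNReal.ofReal_zero])

/-- The mollification of `φ`. -/
noncomputable def moll (k : ℕ) (φ : Rd d → ℝ) (x : Rd d) : ℝ := ∫ y, φ (x + y) ∂(kmeas d k)

theorem moll_eq (k : ℕ) (φ : Rd d → ℝ) (x : Rd d) : moll k φ x = ∫ y, φ y * kern k (x - y) := by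
  rw [moll, integral_kmeas, ← integral_add_left_eq_self (fun y => φ y * kern k (x - y)) x]
  refine integral_congr_ae (Eventually.of_forall fun y => ?_)
  simp only
  rw [sub_add_cancel_left, kern_neg, mul_comm]

theorem integrable_kmeas {φ : Rd d → ℝ} {C : ℝ} (hm : Measurable φ) (hb : ∀ x, |φ x| ≤ C) (k : ℕ) :
    Integrable φ (kmeas d k) :=
  Integrable.of_bound hm.aestronglyMeasurable C (Eventually.of_forall hb)

theorem integrable_kmeas_add {φ : Rd d → ℝ} {C : ℝ} (hm : Measurable φ) (hb : ∀ x, |φ x| ≤ C)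
    (k : ℕ) (x : Rd d) : Integrable (fun y => φ (x + y)) (kmeas d k) :=
  integrable_kmeas (hm.comp (measurable_const_add x)) (fun y => hb (x + y)) k

theorem abs_moll_sub_le {φ : Rd d → ℝ} {C a e : ℝ} (hm : Measurable φ) (hb : ∀ x, |φ x| ≤ C)
    (k : ℕ) (x : Rd d) (h : ∀ y, ‖y‖ ≤ 1 / ((k : ℝ) + 1) → |φ (x + y) - a| ≤ e) :
    |moll k φ x - a| ≤ e := by
  have e1 : moll k φ x - a = ∫ y, (φ (x + y) - a) ∂(kmeas d k) := by
    rw [integral_sub (integrable_kmeas_add hm hb k x) (integrable_const a)]; simp [moll]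
  have h2 := norm_integral_le_of_norm_le_const (μ := kmeas d k) (f := fun y => φ (x + y) - a) (C := e)
    (by filter_upwards [ae_kmeas_norm_le k] with y hy using h y hy)
  rw [e1]
  simpa using h2

theorem abs_moll_le {φ : Rd d → ℝ} {C : ℝ} (hm : Measurable φ) (hb : ∀ x, |φ x| ≤ C)
    (k : ℕ) (x : Rd d) : |moll k φ x| ≤ C := by
  have := abs_moll_sub_le (a := 0) (e := C) hm hb k x fun y _ => by simpa using hb (x + y)
  simpa using this

theorem moll_sub {φ ψ : Rd d → ℝ} {C C' : ℝ} (hm : Measurable φ) (hb : ∀ x, |φ x| ≤ C)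
    (hm' : Measurable ψ) (hb' : ∀ x, |ψ x| ≤ C') (k : ℕ) (x : Rd d) :
    moll k (fun x => φ x - ψ x) x = moll k φ x - moll k ψ x :=
  integral_sub (integrable_kmeas_add hm hb k x) (integrable_kmeas_add hm' hb' k x)

theorem moll_const_mul (k : ℕ) (a : ℝ) (φ : Rd d → ℝ) (x : Rd d) :
    moll k (fun x => a * φ x) x = a * moll k φ x := integral_const_mul a _

theorem moll_sum {ι : Type*} (s : Finset ι) {φ : ι → Rd d → ℝ} (hm : ∀ v ∈ s, Measurable (φ v))
    (hb : ∀ v ∈ s, ∃ C, ∀ x, |φ v x| ≤ C) (k : ℕ) (x : Rd d) :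
    moll k (fun x => ∑ v ∈ s, φ v x) x = ∑ v ∈ s, moll k (φ v) x :=
  integral_finsetSum s fun v hv => by
    obtain ⟨C, hC⟩ := hb v hv
    exact integrable_kmeas_add (hm v hv) hC k x

theorem pds_kern_eq_zero {k : ℕ} {y : Rd d} (hy : 1 < ‖y‖) (w : List (Fin d)) :
    pds w (kern k) y = 0 := by
  have h : (kern k : Rd d → ℝ) =ᶠ[𝓝 y] fun _ => 0 := by
    filter_upwards [(isOpen_lt continuous_const continuous_norm).mem_nhds hy] with z hz
    exact kern_eq_zero ((one_div_succ_le_one k).trans_lt hz)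
  rw [(pds_congr_nhds h w).eq_of_nhds, pds_zero]

theorem moll_smooth {φ : Rd d → ℝ} {C : ℝ} (hm : Measurable φ) (hb : ∀ x, |φ x| ≤ C) (k : ℕ) :
    ContDiff ℝ ∞ (moll k φ) ∧
      ∀ w x, pds w (moll k φ) x = ∫ y, φ y * pds w (kern k) (x - y) := by
  have hC : 0 ≤ C := (abs_nonneg _).trans (hb 0)
  have hsts : STS (fun y x : Rd d => φ y * kern k (x + -y)) := by
    refine STS.mul (ψ := fun y _ => φ y) (φ := fun y x => kern k (x + -y)) ⟨hm.comp measurable_fst,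
      fun y => contDiff_const, fun n => ⟨C, fun y => (DB_const n (φ y)).mono le_rfl (hb y)⟩⟩
      ⟨?_, fun y => ((isTest_kern k).sm.translate _).1, fun n => ?_⟩
    · exact ((isTest_kern k).1.continuous.comp
        (continuous_snd.add continuous_fst.neg)).measurable
    · obtain ⟨B, hB⟩ := (isTest_kern (d := d) k).sm.2 n
      exact ⟨B, fun y => hB.translate _⟩
  have hloc : ∀ x₀ : Rd d, (moll k φ =ᶠ[𝓝 x₀]
      fun x => ∫ y, φ y * kern k (x + -y) ∂(volume.restrict (Metric.closedBall x₀ 3))) := by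
    intro x₀
    filter_upwards [Metric.ball_mem_nhds x₀ one_pos] with x hx
    rw [moll_eq]
    simp_rw [← sub_eq_add_neg]
    refine (setIntegral_eq_integral_of_forall_compl_eq_zero fun y hy => ?_).symm
    rw [kern_eq_zero, mul_zero]
    refine (one_div_succ_le_one k).trans_lt ?_
    rw [Metric.mem_closedBall, not_le] at hy
    rw [Metric.mem_ball] at hx
    have := dist_triangle y x x₀
    rw [← dist_eq_norm, dist_comm]; linarith
  have hfin : ∀ x₀ : Rd d, IsFiniteMeasure (volume.restrict (Metric.closedBall x₀ 3)) := fun x₀ =>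
    ⟨by rw [Measure.restrict_apply_univ]; exact measure_closedBall_lt_top⟩
  refine ⟨contDiff_iff_contDiffAt.2 fun x₀ => ?_, fun w x₀ => ?_⟩
  · have := hfin x₀
    exact ((hsts.integral _).1.1.contDiffAt).congr_of_eventuallyEq (hloc x₀)
  · have := hfin x₀
    rw [(pds_congr_nhds (hloc x₀) w).eq_of_nhds, (hsts.integral _).2]
    have e : ∀ y, pds w (fun x => φ y * kern k (x + -y)) x₀ = φ y * pds w (kern k) (x₀ - y) :=
      fun y => by
        rw [pds_const_mul ((isTest_kern k).sm.translate _).1, pds_translate, sub_eq_add_neg]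
    simp_rw [e]
    refine setIntegral_eq_integral_of_forall_compl_eq_zero fun y hy => ?_
    rw [pds_kern_eq_zero, mul_zero]
    rw [Metric.mem_closedBall, not_le] at hy
    rw [← dist_eq_norm, dist_comm]; linarith

theorem STS.moll {Ω : Type*} [MeasurableSpace Ω] {ψ : Ω → Rd d → ℝ} {C : ℝ}
    (hm : Measurable (Function.uncurry ψ)) (hb : ∀ t x, |ψ t x| ≤ C) (k : ℕ) :
    STS (fun t => moll k (ψ t)) := by
  have hmt : ∀ t, Measurable (ψ t) := fun t => hm.comp measurable_prodMk_left
  refine ⟨?_, fun t => (moll_smooth (hmt t) (hb t) k).1, fun n => ?_⟩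
  · have h1 : Measurable fun z : (Ω × Rd d) × Rd d => ψ z.1.1 (z.1.2 + z.2) :=
      hm.comp (f := fun z : (Ω × Rd d) × Rd d => (z.1.1, z.1.2 + z.2))
        ((measurable_fst.comp measurable_fst).prodMk
          ((measurable_snd.comp measurable_fst).add measurable_snd))
    exact (StronglyMeasurable.integral_prod_right' (ν := kmeas d k) h1.stronglyMeasurable).measurable
  · have hex : ∀ w : List (Fin d), ∃ B, ∀ t x, |FDExpansion.pds w (FDExpansion.moll k (ψ t)) x| ≤ B :=
      fun w => by
        refine ⟨C * ∫ y, |FDExpansion.pds w (kern k) y|, fun t x => ?_⟩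
        have hC : 0 ≤ C := (abs_nonneg _).trans (hb t 0)
        rw [(moll_smooth (hmt t) (hb t) k).2]
        have hi : Integrable (fun y : Rd d => FDExpansion.pds w (kern k) (x - y)) volume :=
          (((isTest_kern k).pds w).1.continuous.integrable_of_hasCompactSupport
            ((isTest_kern k).pds w).2).comp_sub_left x
        calc |∫ y, ψ t y * FDExpansion.pds w (kern k) (x - y)|
            ≤ ∫ y, C * |FDExpansion.pds w (kern k) (x - y)| := by
              rw [← Real.norm_eq_abs]
              refine norm_integral_le_of_norm_le (hi.abs.const_mul C)
                (Eventually.of_forall fun y => ?_)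
              rw [Real.norm_eq_abs, abs_mul]
              exact mul_le_mul_of_nonneg_right (hb t y) (abs_nonneg _)
          _ = _ := by
            rw [integral_const_mul,
              integral_sub_left_eq_self (fun y : Rd d => |FDExpansion.pds w (kern k) y|) volume x]
    choose B hB using hex
    induction n with
    | zero => exact ⟨B [], fun t => DB_zero_iff.2 fun x => hB [] t x⟩
    | succ n ih =>
      obtain ⟨D, hD⟩ := ih
      refine ⟨|D| + ∑ l : List.Vector (Fin d) (n + 1), |B l.1|, fun t w hw x => ?_⟩
      have h0 : 0 ≤ ∑ l : List.Vector (Fin d) (n + 1), |B l.1| :=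
        Finset.sum_nonneg fun _ _ => abs_nonneg _
      rcases hw.lt_or_eq with hlt | heq
      · have := (hD t w (by omega) x).trans (le_abs_self D)
        linarith
      · have h1 := Finset.single_le_sum (f := fun l : List.Vector (Fin d) (n + 1) => |B l.1|)
          (fun _ _ => abs_nonneg _) (Finset.mem_univ ⟨w, heq⟩)
        have h2 := (hB w t x).trans (le_abs_self _)
        have := abs_nonneg D
        simp only at h1
        linarith

theorem Sm.pds_moll {φ : Rd d → ℝ} (hs : Sm φ) (k : ℕ) :
    Sm (moll k φ) ∧ ∀ w, FDExpansion.pds w (moll k φ) = moll k (FDExpansion.pds w φ) := by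
  have hsts : STS (fun y x : Rd d => φ (x + y)) := by
    refine ⟨(hs.continuous.comp (continuous_snd.add continuous_fst)).measurable,
      fun y => (hs.translate y).1, fun n => ?_⟩
    obtain ⟨B, hB⟩ := hs.2 n
    exact ⟨B, fun y => hB.translate _⟩
  have := hsts.integral (kmeas d k)
  refine ⟨this.1, fun w => ?_⟩
  have h2 := this.2 w
  funext x
  refine (congrFun h2 x).trans ?_
  simp only [pds_translate, moll]

theorem DB.moll {n : ℕ} {C : ℝ} {φ : Rd d → ℝ} (hb : DB n C φ) (hs : Sm φ) (k : ℕ) :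
    DB n C (moll k φ) := fun w hw x => by
  rw [(hs.pds_moll k).2 w]
  exact abs_moll_le (hs.pds w).continuous.measurable (hb w hw) k x

theorem moll_tendstoUniformly {φ : Rd d → ℝ} {ψ : ℕ → Rd d → ℝ} {C : ℝ}
    (hm : Measurable φ) (hb : ∀ x, |φ x| ≤ C) (hm' : ∀ j, Measurable (ψ j))
    (hb' : ∀ j x, |ψ j x| ≤ C) (h : TendstoUniformly ψ φ atTop) (k : ℕ) :
    TendstoUniformly (fun j => moll k (ψ j)) (moll k φ) atTop := by
  rw [Metric.tendstoUniformly_iff] at h ⊢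
  intro ε hε
  filter_upwards [h (ε / 2) (by positivity)] with j hj x
  rw [Real.dist_eq, ← moll_sub hm hb (hm' j) (hb' j)]
  refine lt_of_le_of_lt (abs_moll_le (C := ε / 2) (hm.sub (hm' j)) (fun y => ?_) k x) (by linarith)
  exact (Real.dist_eq (φ y) (ψ j y)).symm.le.trans (hj y).le

theorem LB.sm_moll {n : ℕ} {C : ℝ} {φ : Rd d → ℝ} (h : LB n C φ) (k : ℕ) : Sm (moll k φ) :=
  (STS.moll (Ω := Unit) (ψ := fun _ => φ) (h.continuous.measurable.comp measurable_snd)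
    (fun _ => h.bound) k).slice ()

theorem LB.db_moll {n : ℕ} {C : ℝ} {φ : Rd d → ℝ} (h : LB n C φ) (k : ℕ) : DB n C (moll k φ) := by
  obtain ⟨ψ, hs, hb, ht⟩ := h.exists_seq
  have h1 := moll_tendstoUniformly h.continuous.measurable h.bound
    (fun j => (hs j).continuous.measurable) (fun j => (hb j).bound) ht k
  have h2 : LB n C (FDExpansion.moll k φ) :=
    LB.of_tendsto (fun j => ((hb j).moll (hs j) k).lb ((hs j).pds_moll k).1) h1
  exact fun w hw x => h2.pds_bound (contDiff_infty.1 (h.sm_moll k).1 n) w hw x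

theorem LB.pds_moll {n : ℕ} {C : ℝ} {φ : Rd d → ℝ} (h : LB n C φ) (k : ℕ) (w : List (Fin d))
    (hw : w.length < n) :
    FDExpansion.pds w (moll k φ) = moll k (FDExpansion.pds w φ) := by
  obtain ⟨ψ, hs, hb, ht⟩ := h.exists_seq
  have h1 := moll_tendstoUniformly h.continuous.measurable h.bound
    (fun j => (hs j).continuous.measurable) (fun j => (hb j).bound) ht k
  have h2 := tendstoUniformly_pds (fun j => ((hs j).pds_moll k).1)
    (fun j => (hb j).moll (hs j) k) h1 w hw
  have h3 : LB 1 C (FDExpansion.pds w φ) := h.pds w le_rfl (by omega)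
  have h4 := moll_tendstoUniformly h3.continuous.measurable h3.bound
    (fun j => ((hs j).pds w).continuous.measurable) (fun j => (hb j) w hw.le)
    (tendstoUniformly_pds hs hb ht w hw) k
  funext x
  refine tendsto_nhds_unique (h2.tendsto_at x) ?_
  simp_rw [((hs _).pds_moll k).2 w]
  exact h4.tendsto_at x

theorem abs_moll_sub_self_le {φ : Rd d → ℝ} {C C' : ℝ} (hm : Measurable φ) (hb : ∀ x, |φ x| ≤ C')
    (hC : 0 ≤ C) (hi : ∀ x v, |φ (x + v) - φ x| ≤ d * ‖v‖ * C) (k : ℕ) (x : Rd d) :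
    |moll k φ x - φ x| ≤ d * C / ((k : ℝ) + 1) :=
  abs_moll_sub_le hm hb k x fun y hy => (hi x y).trans (by
    calc (d : ℝ) * ‖y‖ * C ≤ d * (1 / ((k : ℝ) + 1)) * C := by gcongr
      _ = _ := by ring)

theorem LB.moll_close {n : ℕ} {C : ℝ} {φ : Rd d → ℝ} (h : LB (n + 1) C φ) (k : ℕ) (x : Rd d) :
    |moll k φ x - φ x| ≤ d * C / ((k : ℝ) + 1) :=
  abs_moll_sub_self_le h.continuous.measurable h.bound h.nonneg h.increment k x

/-! ### Generalized derivatives and smooth approximation -/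

theorem abs_pds_moll_le_of_weak {φ ζ : Rd d → ℝ} {C C' : ℝ} (hc : Continuous φ)
    (hb : ∀ x, |φ x| ≤ C') (w : List (Fin d)) (hw : HasWeakDeriv (fun i => w.count i) φ ζ)
    (hC : ∀ᵐ x, |ζ x| ≤ C) (k : ℕ) (x : Rd d) : |pds w (moll k φ) x| ≤ C := by
  have hη : IsTest (fun y => kern k (y + -x)) :=
    ⟨((isTest_kern k).sm.translate _).1, (isTest_kern k).2.comp_homeomorph (Homeomorph.addRight (-x))⟩
  have h1 := hw.2 _ hη
  rw [multiDeriv_eq_pds, ← pds_perm hη.1 (perm_wordOf w), pds_translate] at h1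
  have hk : (kern k : Rd d → ℝ) = fun y => kern k (-y) := funext fun y => (kern_neg k y).symm
  have h2 : pds w (moll k φ) x = (-1) ^ w.length * ∫ y, φ y * pds w (kern k) (y + -x) := by
    rw [(moll_smooth hc.measurable hb k).2, ← integral_const_mul]
    refine integral_congr_ae (Eventually.of_forall fun y => ?_)
    simp only
    conv_lhs => rw [hk, pds_comp_neg]
    beta_reduce
    rw [neg_sub, sub_eq_add_neg]; ring
  have hi : Integrable (fun y => kern k (y + -x)) :=
    hη.1.continuous.integrable_of_hasCompactSupport hη.2
  rw [h2, h1, abs_mul, abs_mul, abs_pow, abs_pow, abs_neg, abs_one, one_pow, one_pow, one_mul,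
    one_mul]
  calc |∫ y, ζ y * kern k (y + -x)| ≤ ∫ y, C * kern k (y + -x) := by
        rw [← Real.norm_eq_abs]
        refine norm_integral_le_of_norm_le (hi.const_mul C) ?_
        filter_upwards [hC] with y hy
        rw [Real.norm_eq_abs, abs_mul, abs_of_nonneg (kern_nonneg k _)]
        exact mul_le_mul_of_nonneg_right hy (kern_nonneg k _)
    _ = C := by
      rw [integral_const_mul, integral_add_right_eq_self (fun y => (kern k y : ℝ)), integral_kern,
        mul_one]

theorem LB.of_weak {n : ℕ} {φ : Rd d → ℝ} {C C' : ℝ} (hc : Continuous φ)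
    (hb : ∀ x, |φ x| ≤ C') (hw : ∀ α : Fin d → ℕ, order α ≤ n + 1 →
      ∃ ζ, HasWeakDeriv α φ ζ ∧ ∀ᵐ x, |ζ x| ≤ C) : LB (n + 1) C φ := by
  have hs : ∀ k, Sm (moll k φ) := fun k =>
    (STS.moll (Ω := Unit) (ψ := fun _ => φ) (hc.measurable.comp measurable_snd) (fun _ => hb) k).slice ()
  have hdb : ∀ k, DB (n + 1) C (moll k φ) := fun k w hw' x => by
    obtain ⟨ζ, h1, h2⟩ := hw (fun i => w.count i) (by rwa [order_count])
    exact abs_pds_moll_le_of_weak hc hb w h1 h2 k x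
  have hlim : ∀ x, Tendsto (fun k => moll k φ x) atTop (𝓝 (φ x)) := fun x => by
    rw [Metric.tendsto_atTop]
    intro ε hε
    obtain ⟨r, hr, hr'⟩ := Metric.continuous_iff.1 hc x (ε / 2) (by positivity)
    obtain ⟨N, hN⟩ := exists_nat_one_div_lt hr
    refine ⟨N, fun k hk => ?_⟩
    refine lt_of_le_of_lt (abs_moll_sub_le (e := ε / 2) hc.measurable hb k x fun y hy => ?_)
      (by linarith)
    rw [← Real.dist_eq]
    refine (hr' _ ?_).le
    rw [dist_eq_norm, add_sub_cancel_left]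
    refine hy.trans_lt (lt_of_le_of_lt ?_ hN)
    exact one_div_le_one_div_of_le (by positivity) (by exact_mod_cast Nat.succ_le_succ hk)
  have hinc : ∀ x v, |φ (x + v) - φ x| ≤ d * ‖v‖ * C := fun x v =>
    le_of_tendsto (((hlim (x + v)).sub (hlim x)).abs)
      (Eventually.of_forall fun k => (hdb k).increment (hs k).differentiable x v)
  have hC : 0 ≤ C := (hdb 0).nonneg
  intro ε hε
  obtain ⟨k, hk⟩ := exists_nat_one_div_lt (show 0 < ε / (d * C + 1) by positivity)
  refine ⟨moll k φ, hs k, hdb k, fun x => ?_⟩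
  rw [abs_sub_comm]
  refine (abs_moll_sub_self_le hc.measurable hb hC hinc k x).trans ?_
  rw [lt_div_iff₀ (by positivity)] at hk
  have h0 : 0 ≤ 1 / ((k : ℝ) + 1) := by positivity
  calc d * C / ((k : ℝ) + 1) = 1 / ((k : ℝ) + 1) * (d * C) := by ring
    _ ≤ 1 / ((k : ℝ) + 1) * (d * C + 1) := by gcongr; linarith
    _ ≤ ε := hk.le


/-! ### Rough schemes and their mollification -/

/-- `∑_v b_v a_v` belongs to `LB n C` whenever `∑_v b_v² ≤ 1`. -/
def LBv (s : Finset (Rd d)) (n : ℕ) (C : ℝ) (a : Rd d → Rd d → ℝ) : Prop :=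
  ∀ b : Rd d → ℝ, ∑ v ∈ s, b v ^ 2 ≤ 1 → LB n C (fun x => ∑ v ∈ s, b v * a v x)

theorem LBv.comp {s : Finset (Rd d)} {n : ℕ} {C : ℝ} {a : Rd d → Rd d → ℝ} (h : LBv s n C a)
    {v : Rd d} (hv : v ∈ s) : LB n C (a v) := by
  classical
  have h1 := h (fun w => if w = v then 1 else 0) (by simp [hv])
  simpa [hv] using h1

/-- The hypotheses on a scheme with rough coefficients. -/
structure RoughHyp (S : Scheme d) (τ : Rd d → ℝ) (τ₀ h₀ δ K c₀ A B Mb : ℝ) (m : ℕ) : Prop where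
  size : ∑ v ∈ S.Λ₁, ‖v‖ ^ 2 ≤ A ^ 2
  wsize : ∑ v ∈ S.Λ₁, ‖τ v • v‖ ^ 2 ≤ B ^ 2
  q_meas : ∀ v ∈ S.Λ₁, Measurable (Function.uncurry (S.q v))
  p_meas : ∀ v ∈ S.Λ₁, Measurable (Function.uncurry (S.p v))
  c_meas : Measurable (Function.uncurry S.c)
  q_bd : ∀ t, LBv S.Λ₁ m Mb (fun v => S.q v t)
  p_bd : ∀ t, LBv S.Λ₁ m Mb (fun v => S.p v t)
  c_bd : ∀ t, LB m Mb (S.c t)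
  chi_nonneg : ∀ h ∈ Ioc 0 h₀, ∀ v ∈ S.Λ₁, ∀ t x, 0 ≤ S.chi h v t x
  q_zero : ∀ t x i, ∑ v ∈ S.Λ₁, v i * S.q v t x = 0
  c_le : ∀ t x, c₀ ≤ S.c t x
  sup₁ : ∀ h ∈ Ioc 0 h₀, Sup₁ S τ τ₀ h δ K
  sup₂ : ∀ h ∈ Ioc 0 h₀, Sup₂ S τ τ₀ h δ K m

/-- The scheme with mollified coefficients. -/
noncomputable def Scheme.moll (S : Scheme d) (k : ℕ) : Scheme d where
  Λ₁ := S.Λ₁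
  q v t := FDExpansion.moll k (S.q v t)
  p v t := FDExpansion.moll k (S.p v t)
  c t := FDExpansion.moll k (S.c t)

/-- The scheme with translated coefficients. -/
def Scheme.trans (S : Scheme d) (y : Rd d) : Scheme d where
  Λ₁ := S.Λ₁
  q v t x := S.q v t (x + y)
  p v t x := S.p v t (x + y)
  c t x := S.c t (x + y)

section Averages

variable {τ : Rd d → ℝ} {τ₀ h : ℝ}

theorem wsum_map {L X : Type*} {Λ : Finset L} {D : L → X → X} {R : X → X}
    (hR : ∀ l x, D l (R x) = R (D l x)) (n : ℕ) (F : X → ℝ) (x : X) :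
    wsum Λ D n F (R x) = wsum Λ D n (fun z => F (R z)) x := by
  induction n generalizing x with
  | zero => rfl
  | succ n ih => simp only [wsum, hR, ih]

/-- `E` is the average of `e` with respect to `kmeas`. -/
def AvgTo (k : ℕ) (e : Rd d → ℝ) (E : ℝ) : Prop :=
  Integrable e (kmeas d k) ∧ ∫ y, e y ∂(kmeas d k) = E

theorem AvgTo.add {k : ℕ} {e e' : Rd d → ℝ} {E E' : ℝ} (h : AvgTo k e E) (h' : AvgTo k e' E') :
    AvgTo k (fun y => e y + e' y) (E + E') :=
  ⟨h.1.add h'.1, by rw [integral_add h.1 h'.1, h.2, h'.2]⟩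

theorem AvgTo.const_mul {k : ℕ} {e : Rd d → ℝ} {E : ℝ} (h : AvgTo k e E) (a : ℝ) :
    AvgTo k (fun y => a * e y) (a * E) := ⟨h.1.const_mul a, by rw [integral_const_mul, h.2]⟩

theorem AvgTo.mul_const {k : ℕ} {e : Rd d → ℝ} {E : ℝ} (h : AvgTo k e E) (a : ℝ) :
    AvgTo k (fun y => e y * a) (E * a) := ⟨h.1.mul_const a, by rw [integral_mul_const, h.2]⟩

theorem AvgTo_const (k : ℕ) (a : ℝ) : AvgTo k (fun _ : Rd d => a) a :=
  ⟨integrable_const a, by simp⟩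

theorem AvgTo.sum {ι : Type*} {s : Finset ι} {k : ℕ} {e : ι → Rd d → ℝ} {E : ι → ℝ}
    (h : ∀ i ∈ s, AvgTo k (e i) (E i)) : AvgTo k (fun y => ∑ i ∈ s, e i y) (∑ i ∈ s, E i) :=
  ⟨integrable_finsetSum s fun i hi => (h i hi).1, by
    rw [integral_finsetSum s fun i hi => (h i hi).1]
    exact Finset.sum_congr rfl fun i hi => (h i hi).2⟩

theorem AvgTo.le {k : ℕ} {e e' : Rd d → ℝ} {E E' : ℝ} (h : AvgTo k e E) (h' : AvgTo k e' E')
    (hle : ∀ y, e y ≤ e' y) : E ≤ E' := by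
  rw [← h.2, ← h'.2]; exact integral_mono h.1 h'.1 hle

theorem AvgTo.wsum {L X : Type*} {Λ : Finset L} {D : L → X → X} {P : X → Prop}
    (hP : ∀ x, P x → ∀ l, P (D l x)) {k : ℕ} {F : Rd d → X → ℝ} {G : X → ℝ}
    (h : ∀ x, P x → AvgTo k (fun y => F y x) (G x)) (n : ℕ) {x : X} (hx : P x) :
    AvgTo k (fun y => FDExpansion.wsum Λ D n (F y) x) (FDExpansion.wsum Λ D n G x) := by
  induction n generalizing x with
  | zero => exact h x hx
  | succ n ih => exact AvgTo.sum fun l _ => ih (hP x hx l)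

theorem LB.avgTo {n : ℕ} {C : ℝ} {φ : Rd d → ℝ} (h : LB n C φ) (k : ℕ) (x : Rd d) :
    AvgTo k (fun y => φ (x + y)) (moll k φ x) :=
  ⟨integrable_kmeas_add h.continuous.measurable h.bound k x, rfl⟩

theorem LB.barDelta {h₁ : ℝ} {n : ℕ} {C : ℝ} {φ : Rd d → ℝ} (h : LB (n + 2) C φ) (μ : Rd d ⊕ Fin d) :
    ∃ C', LB (n + 1) C' (barDelta τ τ₀ h₁ μ φ) := by
  cases μ with
  | inl v => exact ⟨_, (((h.translate _).sub h).const_mul _).mono (Nat.le_succ _) le_rfl⟩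
  | inr i => exact ⟨_, (h.pderiv i).const_mul _⟩

theorem LB.barDelta_moll {n : ℕ} {C : ℝ} {φ : Rd d → ℝ} (h' : LB (n + 2) C φ)
    (μ : Rd d ⊕ Fin d) (k : ℕ) :
    FDExpansion.barDelta τ τ₀ h μ (moll k φ) = moll k (FDExpansion.barDelta τ τ₀ h μ φ) := by
  cases μ with
  | inl v =>
    funext x
    simp only [FDExpansion.barDelta]
    have h1 : moll k φ (x + h • v) = moll k (fun x => φ (x + h • v)) x := by
      simp only [moll, add_right_comm]
    rw [h1, ← moll_sub (h'.translate _).continuous.measurable (h'.translate _).bound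
      h'.continuous.measurable h'.bound, ← moll_const_mul]
  | inr i =>
    funext x
    simp only [FDExpansion.barDelta]
    have := congrFun (h'.pds_moll k [i] (by simp)) x
    simp only [pds_cons, pds_nil] at this
    rw [this, ← moll_const_mul]

theorem shift_translate (φ : Rd d → ℝ) (a : Rd d) (μ : Rd d ⊕ Fin d) :
    shift h μ (fun x => φ (x + a)) = fun x => shift h μ φ (x + a) := by
  cases μ with
  | inl w => funext x; simp only [shift]; rw [add_right_comm x]
  | inr j => rfl

theorem fdiff_translate (φ : Rd d → ℝ) (a : Rd d) (v : Rd d) :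
    fdiff h v (fun x => φ (x + a)) = fun x => fdiff h v φ (x + a) := by
  funext x; simp only [fdiff]; rw [add_right_comm x]

variable {S : Scheme d} {δ K : ℝ}

theorem Ah_trans (t : ℝ) (y : Rd d) (φ : Rd d → ℝ) (x : Rd d) :
    (S.trans y).Ah τ τ₀ h t φ x = S.Ah τ τ₀ h t (fun z => φ (z + -y)) (x + y) := by
  simp only [Scheme.Ah, Scheme.Lmu, Scheme.Qmu, barDelta_translate, shift_translate,
    fdiff_translate, add_neg_cancel_right, Scheme.trans, Scheme.fullΛ]

theorem calQ_trans (t : ℝ) (y : Rd d) (φ : Rd d → ℝ) (x : Rd d) :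
    (S.trans y).calQ h t φ x = S.calQ h t (fun z => φ (z + -y)) (x + y) := by
  simp only [Scheme.calQ, Scheme.chi, fdiff_translate, add_neg_cancel_right, Scheme.trans]

theorem secondLHS_trans (t : ℝ) (y : Rd d) (n : ℕ) (φ : Rd d → ℝ) (x : Rd d) :
    secondLHS (S.trans y) τ τ₀ h t n x φ = secondLHS S τ τ₀ h t n (x + y) (fun z => φ (z + -y)) := by
  simp only [secondLHS, Ah_trans, Scheme.Qmu, barDelta_translate, shift_translate,
    fdiff_translate, add_neg_cancel_right]
  simp only [Scheme.trans, Scheme.fullΛ, barDelta_translate]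

theorem bsum_translate (n : ℕ) (F : (Rd d → ℝ) → ℝ) (φ : Rd d → ℝ) (a : Rd d) :
    bsum S τ τ₀ h n F (fun z => φ (z + a)) = bsum S τ τ₀ h n (fun ψ => F fun z => ψ (z + a)) φ :=
  wsum_map (R := fun (φ : Rd d → ℝ) z => φ (z + a)) (fun μ φ => barDelta_translate φ a μ) n F φ

theorem Sup₁.trans (H : Sup₁ S τ τ₀ h δ K) (y : Rd d) : Sup₁ (S.trans y) τ τ₀ h δ K := by
  intro t φ C x hφ hC
  have h1 := H t (fun z => φ (z + -y)) C (x + y) (hφ.translate _) fun z => by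
    have := hC (z + -y)
    simp only [Scheme.gradSq, barDelta_translate] at this ⊢
    exact this
  rw [Ah_trans]
  simp only [calQ_trans]
  simp only [barDelta_translate] at h1
  exact h1

theorem Sup₂.trans {m : ℕ} (H : Sup₂ S τ τ₀ h δ K m) (y : Rd d) : Sup₂ (S.trans y) τ τ₀ h δ K m := by
  intro n hn t φ C₂ C₁ x hφ hC₂ hC₁
  have e : ∀ k z, energy S τ τ₀ h k (fun z => φ (z + -y)) z = energy S τ τ₀ h k φ (z + -y) :=
    fun k z => bsum_translate k _ φ (-y)
  have h1 := H n hn t (fun z => φ (z + -y)) C₂ C₁ (x + y) (hφ.translate _)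
    (fun z => by rw [e]; exact hC₂ _) (fun z => by rw [e]; exact hC₁ _)
  simp only [bsum_translate, ← secondLHS_trans, ← calQ_trans] at h1
  exact h1

theorem avgTo_Qmu {t : ℝ} {k : ℕ} {D : (Rd d → ℝ) → Rd d → ℝ} {C : ℝ}
    (hD : ∀ v ∈ S.Λ₁, LB 1 C (D (S.q v t)))
    (hDm : ∀ v ∈ S.Λ₁, D (moll k (S.q v t)) = moll k (D (S.q v t)))
    (hDt : ∀ φ a, D (fun x => φ (x + a)) = fun x => D φ (x + a)) (ψ : Rd d → ℝ) (x : Rd d) :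
    AvgTo k (fun y => (S.trans y).Qmu h t D ψ x) ((S.moll k).Qmu h t D ψ x) := by
  refine AvgTo.const_mul (AvgTo.sum fun v hv => AvgTo.mul_const ?_ _) _
  simp only [Scheme.trans, Scheme.moll, hDt, hDm v hv]
  exact (hD v hv).avgTo k x

theorem exists_LB_barDelta {Mb : ℝ} {n : ℕ} {a : Rd d → Rd d → ℝ} {s : Finset (Rd d)}
    (ha : ∀ v ∈ s, LB (n + 2) Mb (a v)) (μ : Rd d ⊕ Fin d) :
    ∃ C, ∀ v ∈ s, LB (n + 1) C (barDelta τ τ₀ h μ (a v)) := by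
  have : ∀ v, ∃ C, v ∈ s → LB (n + 1) C (barDelta τ τ₀ h μ (a v)) := fun v => by
    by_cases hv : v ∈ s
    · exact ((ha v hv).barDelta μ).imp fun C hC _ => hC
    · exact ⟨0, fun h => (hv h).elim⟩
  choose C hC using this
  refine ⟨∑ v ∈ s, |C v|, fun v hv => (hC v hv).mono le_rfl ((le_abs_self _).trans ?_)⟩
  exact Finset.single_le_sum (f := fun v => |C v|) (fun _ _ => abs_nonneg _) hv

theorem avgTo_Ah {t Mb : ℝ} {n : ℕ} (hq : ∀ v ∈ S.Λ₁, LB (n + 2) Mb (S.q v t))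
    (hp : ∀ v ∈ S.Λ₁, LB (n + 2) Mb (S.p v t)) (k : ℕ) (φ : Rd d → ℝ) (x : Rd d) :
    AvgTo k (fun y => (S.trans y).Ah τ τ₀ h t φ x) ((S.moll k).Ah τ τ₀ h t φ x) := by
  change AvgTo k (fun y => 2 * ∑ μ ∈ S.fullΛ, barDelta τ τ₀ h μ φ x
      * ((S.trans y).Qmu h t (barDelta τ τ₀ h μ) (shift h μ φ) x
        + ∑ v ∈ S.Λ₁, barDelta τ τ₀ h μ ((S.trans y).p v t) x * fdiff h v (shift h μ φ) x))
    (2 * ∑ μ ∈ S.fullΛ, barDelta τ τ₀ h μ φ x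
      * ((S.moll k).Qmu h t (barDelta τ τ₀ h μ) (shift h μ φ) x
        + ∑ v ∈ S.Λ₁, barDelta τ τ₀ h μ ((S.moll k).p v t) x * fdiff h v (shift h μ φ) x))
  refine AvgTo.const_mul (AvgTo.sum fun μ _ => AvgTo.const_mul (AvgTo.add ?_
    (AvgTo.sum fun v hv => AvgTo.mul_const ?_ _)) _) _
  · obtain ⟨C, hC⟩ := exists_LB_barDelta (τ := τ) (τ₀ := τ₀) (h := h) hq μ
    exact avgTo_Qmu (fun v hv => (hC v hv).mono (by omega) le_rfl)
      (fun v hv => (hq v hv).barDelta_moll μ k) (fun φ a => barDelta_translate φ a μ) _ x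
  · obtain ⟨C, hC⟩ := (hp v hv).barDelta (τ := τ) (τ₀ := τ₀) (h₁ := h) μ
    simp only [Scheme.trans, Scheme.moll, barDelta_translate, (hp v hv).barDelta_moll]
    exact hC.avgTo k x

theorem avgTo_calQ {t Mb : ℝ} {n : ℕ} (hq : ∀ v ∈ S.Λ₁, LB n Mb (S.q v t))
    (hp : ∀ v ∈ S.Λ₁, LB n Mb (S.p v t)) (k : ℕ) (φ : Rd d → ℝ) (x : Rd d) :
    AvgTo k (fun y => (S.trans y).calQ h t φ x) ((S.moll k).calQ h t φ x) := by
  simp only [Scheme.calQ, Scheme.chi, Scheme.trans, Scheme.moll]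
  refine AvgTo.sum fun v hv => AvgTo.mul_const (AvgTo.add ?_ (AvgTo.const_mul ?_ h)) _
  · exact (hq v hv).avgTo k x
  · exact (hp v hv).avgTo k x

theorem Sup₁.moll {Mb : ℝ} {n : ℕ} (hq : ∀ v ∈ S.Λ₁, ∀ t, LB (n + 2) Mb (S.q v t))
    (hp : ∀ v ∈ S.Λ₁, ∀ t, LB (n + 2) Mb (S.p v t)) (hc : ∀ t, LB (n + 2) Mb (S.c t))
    (H : Sup₁ S τ τ₀ h δ K) (k : ℕ) : Sup₁ (S.moll k) τ τ₀ h δ K := by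
  intro t φ C x hφ hC
  have hQ := fun ψ : Rd d → ℝ => avgTo_calQ (h := h) (fun v hv => hq v hv t) (fun v hv => hp v hv t)
    k ψ x
  have hR : AvgTo k (fun y => (1 - δ) * ∑ μ ∈ S.fullΛ, (S.trans y).calQ h t (barDelta τ τ₀ h μ φ) x
      + K * (S.trans y).calQ h t φ x + 2 * (1 - δ) * S.c t (x + y) * C)
      ((1 - δ) * ∑ μ ∈ S.fullΛ, (S.moll k).calQ h t (barDelta τ τ₀ h μ φ) x
      + K * (S.moll k).calQ h t φ x + 2 * (1 - δ) * FDExpansion.moll k (S.c t) x * C) := by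
    refine AvgTo.add (AvgTo.add (AvgTo.const_mul (AvgTo.sum fun μ _ => hQ _) _)
      (AvgTo.const_mul (hQ φ) _)) (AvgTo.mul_const (AvgTo.const_mul ?_ _) _)
    exact (hc t).avgTo k x
  exact AvgTo.le (avgTo_Ah (fun v hv => hq v hv t) (fun v hv => hp v hv t) k φ x) hR
    fun y => H.trans y t φ C x hφ hC

theorem avgTo_secondLHS {t Mb : ℝ} {n : ℕ} (hq : ∀ v ∈ S.Λ₁, LB (n + 3) Mb (S.q v t))
    (hp : ∀ v ∈ S.Λ₁, LB (n + 3) Mb (S.p v t)) (k j : ℕ) (φ : Rd d → ℝ) (x : Rd d) :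
    AvgTo k (fun y => secondLHS (S.trans y) τ τ₀ h t j x φ)
      (secondLHS (S.moll k) τ τ₀ h t j x φ) := by
  change AvgTo k (fun y => (j : ℝ) * ∑ ν ∈ S.fullΛ,
      (S.trans y).Ah τ τ₀ h t (barDelta τ τ₀ h ν φ) x
    + (j : ℝ) * ((j : ℝ) - 1) * ∑ μ ∈ S.fullΛ, ∑ ν ∈ S.fullΛ,
      barDelta τ τ₀ h μ (barDelta τ τ₀ h ν φ) x * (S.trans y).Qmu h t
        (fun ψ => barDelta τ τ₀ h μ (barDelta τ τ₀ h ν ψ)) (shift h μ (shift h ν φ)) x)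
    ((j : ℝ) * ∑ ν ∈ S.fullΛ, (S.moll k).Ah τ τ₀ h t (barDelta τ τ₀ h ν φ) x
    + (j : ℝ) * ((j : ℝ) - 1) * ∑ μ ∈ S.fullΛ, ∑ ν ∈ S.fullΛ,
      barDelta τ τ₀ h μ (barDelta τ τ₀ h ν φ) x * (S.moll k).Qmu h t
        (fun ψ => barDelta τ τ₀ h μ (barDelta τ τ₀ h ν ψ)) (shift h μ (shift h ν φ)) x)
  refine AvgTo.add (AvgTo.const_mul (AvgTo.sum fun μ _ => ?_) _) (AvgTo.const_mul
    (AvgTo.sum fun μ _ => AvgTo.sum fun ν _ => AvgTo.const_mul ?_ _) _)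
  · exact avgTo_Ah (n := n + 1) hq hp k _ x
  · obtain ⟨C, hC⟩ := exists_LB_barDelta (n := n + 1) (τ := τ) (τ₀ := τ₀) (h := h) hq ν
    obtain ⟨C', hC'⟩ := exists_LB_barDelta (n := n) (τ := τ) (τ₀ := τ₀) (h := h) hC μ
    exact avgTo_Qmu (fun v hv => (hC' v hv).mono (by omega) le_rfl)
      (fun v hv => by
        rw [(hq v hv).barDelta_moll (n := n + 1) ν k, (hC v hv).barDelta_moll μ k])
      (fun φ a => by rw [barDelta_translate, barDelta_translate]) _ x

theorem Sup₂.moll {Mb : ℝ} {n m : ℕ} (hq : ∀ v ∈ S.Λ₁, ∀ t, LB (n + 3) Mb (S.q v t))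
    (hp : ∀ v ∈ S.Λ₁, ∀ t, LB (n + 3) Mb (S.p v t)) (hc : ∀ t, LB (n + 3) Mb (S.c t))
    (H : Sup₂ S τ τ₀ h δ K m) (k : ℕ) : Sup₂ (S.moll k) τ τ₀ h δ K m := by
  intro j hj t φ C₂ C₁ x hφ hC₂ hC₁
  have hP : ∀ φ : Rd d → ℝ, Sm φ → ∀ μ, Sm (barDelta τ τ₀ h μ φ) := fun φ hφ μ => hφ.barDelta μ
  have hQ : ∀ ψ : Rd d → ℝ, Sm ψ →
      AvgTo k (fun y => (S.trans y).calQ h t ψ x) ((S.moll k).calQ h t ψ x) := fun ψ _ =>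
    avgTo_calQ (fun v hv => hq v hv t) (fun v hv => hp v hv t) k ψ x
  have hL : AvgTo k (fun y => bsum S τ τ₀ h j (secondLHS (S.trans y) τ τ₀ h t (j + 2) x) φ)
      (bsum S τ τ₀ h j (secondLHS (S.moll k) τ τ₀ h t (j + 2) x) φ) :=
    AvgTo.wsum hP (fun ψ _ => avgTo_secondLHS (fun v hv => hq v hv t) (fun v hv => hp v hv t)
      k (j + 2) ψ x) j hφ
  have hR : AvgTo k (fun y => (1 - δ) * bsum S τ τ₀ h (j + 2) (fun ψ => (S.trans y).calQ h t ψ x) φ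
        + K * bsum S τ τ₀ h (j + 1) (fun ψ => (S.trans y).calQ h t ψ x) φ
        + 2 * (1 - δ) * S.c t (x + y) * C₂ + K * C₁)
      ((1 - δ) * bsum S τ τ₀ h (j + 2) (fun ψ => (S.moll k).calQ h t ψ x) φ
        + K * bsum S τ τ₀ h (j + 1) (fun ψ => (S.moll k).calQ h t ψ x) φ
        + 2 * (1 - δ) * FDExpansion.moll k (S.c t) x * C₂ + K * C₁) := by
    have h2 : ∀ i, AvgTo k (fun y => bsum S τ τ₀ h i (fun ψ => (S.trans y).calQ h t ψ x) φ)
        (bsum S τ τ₀ h i (fun ψ => (S.moll k).calQ h t ψ x) φ) := fun i => AvgTo.wsum hP hQ i hφ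
    refine AvgTo.add (AvgTo.add (AvgTo.add ((h2 _).const_mul _) ((h2 _).const_mul _))
      (AvgTo.mul_const (AvgTo.const_mul ?_ _) _)) (AvgTo_const k _)
    exact (hc t).avgTo k x
  exact AvgTo.le hL hR fun y => H.trans y j hj t φ C₂ C₁ x hφ hC₂ hC₁

end Averages

section RoughToSmooth

variable {S : Scheme d} {τ : Rd d → ℝ} {τ₀ h₀ δ K c₀ A B Mb : ℝ} {m : ℕ}

theorem RoughHyp.q_lb (H : RoughHyp S τ τ₀ h₀ δ K c₀ A B Mb m) : ∀ v ∈ S.Λ₁, ∀ t, LB m Mb (S.q v t) :=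
  fun _ hv t => (H.q_bd t).comp hv

theorem RoughHyp.p_lb (H : RoughHyp S τ τ₀ h₀ δ K c₀ A B Mb m) : ∀ v ∈ S.Λ₁, ∀ t, LB m Mb (S.p v t) :=
  fun _ hv t => (H.p_bd t).comp hv

theorem LBv.moll {s : Finset (Rd d)} {n : ℕ} {C : ℝ} {a : Rd d → Rd d → ℝ} (h : LBv s n C a)
    (k : ℕ) : DBv s n C (fun v => moll k (a v)) := fun b hb => by
  have h1 := (h b hb).db_moll k
  have e : FDExpansion.moll k (fun x => ∑ v ∈ s, b v * a v x)
      = fun x => ∑ v ∈ s, b v * FDExpansion.moll k (a v) x := by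
    funext x
    rw [moll_sum s (φ := fun v x => b v * a v x)
      (fun v hv => (h.comp hv).continuous.measurable.const_mul _)
      (fun v hv => ⟨_, fun x => ((h.comp hv).const_mul (b v)).bound x⟩)]
    exact Finset.sum_congr rfl fun v _ => moll_const_mul k _ _ x
  rwa [e] at h1

theorem RoughHyp.moll (H : RoughHyp S τ τ₀ h₀ δ K c₀ A B Mb m) (hm : 3 ≤ m) {h : ℝ}
    (hh : h ∈ Ioc 0 h₀) (k : ℕ) : SmoothHyp (S.moll k) τ τ₀ h δ K c₀ A B Mb m := by
  obtain ⟨n, rfl⟩ : ∃ n, m = n + 3 := ⟨m - 3, by omega⟩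
  have hq := H.q_lb
  have hp := H.p_lb
  refine ⟨⟨fun v hv => ?_, fun v hv => ?_, ?_⟩, hh.1, H.size, H.wsize, fun t => (H.q_bd t).moll k,
    fun t => (H.p_bd t).moll k, fun t => (H.c_bd t).db_moll k, fun v hv t x => ?_, fun t x i => ?_,
    fun t x => ?_, ?_, ?_⟩
  · exact STS.moll (H.q_meas v hv) (fun t x => (hq v hv t).bound x) k
  · exact STS.moll (H.p_meas v hv) (fun t x => (hp v hv t).bound x) k
  · exact STS.moll H.c_meas (fun t x => (H.c_bd t).bound x) k
  · have h1 := ((hq v hv t).avgTo k x).add (((hp v hv t).avgTo k x).const_mul h)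
    exact (AvgTo_const k 0).le h1 fun y => H.chi_nonneg h hh v hv t (x + y)
  · have h1 : AvgTo k (fun y => ∑ v ∈ S.Λ₁, v i * S.q v t (x + y))
        (∑ v ∈ S.Λ₁, v i * FDExpansion.moll k (S.q v t) x) :=
      AvgTo.sum fun v hv => ((hq v hv t).avgTo k x).const_mul _
    simp only [H.q_zero] at h1
    have h2 := AvgTo_const (d := d) k 0
    exact h1.2.symm.trans h2.2
  · exact (AvgTo_const k c₀).le ((H.c_bd t).avgTo k x) fun y => H.c_le t _
  · exact Sup₁.moll (n := n + 1) hq hp H.c_bd (H.sup₁ h hh) k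
  · exact Sup₂.moll (n := n) hq hp H.c_bd (H.sup₂ h hh) k

end RoughToSmooth

/-! ### The structural conditions in terms of upper bounds -/

section Structural

variable {S : Scheme d} {τ : Rd d → ℝ} {τ₀ h δ K : ℝ}

theorem Sm.isBddBorel {φ : Rd d → ℝ} (h : Sm φ) : IsBddBorel φ :=
  ⟨h.continuous.measurable, h.bound⟩

theorem IsSubMarkov.le_const {𝒦 : (Rd d → ℝ) → Rd d → ℝ} (h𝒦 : IsSubMarkov 𝒦) {φ : Rd d → ℝ}
    (hφ : IsBddBorel φ) {C : ℝ} (hC : 0 ≤ C) (h : ∀ x, φ x ≤ C) (x : Rd d) : 𝒦 φ x ≤ C := by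
  have h1 : IsBddBorel (fun _ : Rd d => (1 : ℝ)) := ⟨measurable_const, 1, fun _ => by simp⟩
  have hs : ∀ (a : ℝ) (ψ : Rd d → ℝ), IsBddBorel ψ → IsBddBorel (a • ψ) := fun a ψ hψ =>
    ⟨hψ.1.const_smul a, by
      obtain ⟨B, hB⟩ := hψ.2
      exact ⟨|a| * B, fun x => by
        rw [Pi.smul_apply, smul_eq_mul, abs_mul]
        exact mul_le_mul_of_nonneg_left (hB x) (abs_nonneg _)⟩⟩
  have ha : IsBddBorel (C • (fun _ : Rd d => (1 : ℝ)) + (-1 : ℝ) • φ) := by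
    obtain ⟨B, hB⟩ := (hs C _ h1).2
    obtain ⟨B', hB'⟩ := (hs (-1) _ hφ).2
    exact ⟨(hs C _ h1).1.add (hs (-1) _ hφ).1, B + B', fun x =>
      (abs_add_le _ _).trans (add_le_add (hB x) (hB' x))⟩
  have h2 := h𝒦.nonneg _ ha (fun y => by
    simp only [Pi.add_apply, Pi.smul_apply, smul_eq_mul]; linarith [h y]) x
  rw [h𝒦.add _ _ (hs C _ h1) (hs (-1) _ hφ), h𝒦.smul _ _ h1, h𝒦.smul _ _ hφ] at h2
  simp only [Pi.add_apply, Pi.smul_apply, smul_eq_mul] at h2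
  have h3 := mul_le_mul_of_nonneg_left (h𝒦.one_le x) hC
  linarith

theorem IsSubMarkov.sum {𝒦 : (Rd d → ℝ) → Rd d → ℝ} (h𝒦 : IsSubMarkov 𝒦) {ι : Type*}
    (s : Finset ι) {φ : ι → Rd d → ℝ} (hφ : ∀ i ∈ s, IsBddBorel (φ i)) (x : Rd d) :
    𝒦 (fun y => ∑ i ∈ s, φ i y) x = ∑ i ∈ s, 𝒦 (φ i) x := by
  classical
  have hz : IsBddBorel (fun _ : Rd d => (0 : ℝ)) := ⟨measurable_const, 0, fun _ => by simp⟩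
  induction s using Finset.induction_on with
  | empty =>
    have h1 := congrFun (h𝒦.smul 0 _ hz) x
    simp only [Pi.smul_apply, smul_eq_mul, zero_mul] at h1
    have e : ((0 : ℝ) • fun _ : Rd d => (0 : ℝ)) = fun _ => 0 := by funext y; simp
    rw [e] at h1
    simpa using h1
  | insert i s hi ih =>
    have hs : IsBddBorel (fun y => ∑ i ∈ s, φ i y) := by
      refine ⟨Finset.measurable_sum _ fun j hj => (hφ j (Finset.mem_insert_of_mem hj)).1, ?_⟩
      have : ∀ j, ∃ B, j ∈ s → ∀ x, |φ j x| ≤ B := fun j => by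
        by_cases hj : j ∈ s
        · exact ((hφ j (Finset.mem_insert_of_mem hj)).2).imp fun B hB _ => hB
        · exact ⟨0, fun h => (hj h).elim⟩
      choose B hB using this
      exact ⟨∑ j ∈ s, B j, fun x => (Finset.abs_sum_le_sum_abs _ _).trans
        (Finset.sum_le_sum fun j hj => hB j hj x)⟩
    have e : (fun y => ∑ j ∈ insert i s, φ j y) = φ i + fun y => ∑ j ∈ s, φ j y := by
      funext y; rw [Finset.sum_insert hi]; rfl
    rw [e, h𝒦.add _ _ (hφ i (Finset.mem_insert_self _ _)) hs, Finset.sum_insert hi, Pi.add_apply,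
      ih fun j hj => hφ j (Finset.mem_insert_of_mem hj)]

theorem IsSubMarkov.wsum {𝒦 : (Rd d → ℝ) → Rd d → ℝ} (h𝒦 : IsSubMarkov 𝒦) {L X : Type*}
    {Λ : Finset L} {D : L → X → X} {P : X → Prop} (hP : ∀ z, P z → ∀ l, P (D l z))
    {G : X → Rd d → ℝ}
    (hGw : ∀ n z, P z → IsBddBorel fun y => wsum Λ D n (fun z => G z y) z) (n : ℕ) {z : X}
    (hz : P z) (x : Rd d) :
    FDExpansion.wsum Λ D n (fun z => 𝒦 (G z) x) z
      = 𝒦 (fun y => FDExpansion.wsum Λ D n (fun z => G z y) z) x := by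
  induction n generalizing z with
  | zero => rfl
  | succ n ih =>
    rw [FDExpansion.wsum, Finset.sum_congr rfl fun l _ => ih (hP z hz l)]
    exact (h𝒦.sum Λ (φ := fun l y => FDExpansion.wsum Λ D n (fun z => G z y) (D l z))
      (fun l _ => hGw n _ (hP z hz l)) x).symm

theorem sm_energy (n : ℕ) {φ : Rd d → ℝ} (hφ : Sm φ) : Sm (energy S τ τ₀ h n φ) := by
  induction n generalizing φ with
  | zero =>
    have : energy S τ τ₀ h 0 φ = fun x => φ x * φ x := by funext x; exact sq (φ x)
    rw [this]; exact hφ.mul hφ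
  | succ n ih => exact Sm.sum _ fun μ _ => ih (hφ.barDelta μ)

theorem wsum_wsum {L X : Type*} {Λ : Finset L} {D : L → X → X} (n j : ℕ) (F : X → ℝ) (x : X) :
    wsum Λ D n (fun y => wsum Λ D j F y) x = wsum Λ D (n + j) F x := by
  induction n generalizing x with
  | zero => rw [zero_add]; rfl
  | succ n ih =>
    rw [Nat.succ_add]
    exact Finset.sum_congr rfl fun l _ => ih _

theorem energy_add (n j : ℕ) (φ : Rd d → ℝ) (y : Rd d) :
    bsum S τ τ₀ h n (fun ψ => energy S τ τ₀ h j ψ y) φ = energy S τ τ₀ h (n + j) φ y :=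
  wsum_wsum n j _ φ

theorem gradSq_eq (φ : Rd d → ℝ) : S.gradSq τ τ₀ h φ = energy S τ τ₀ h 1 φ := rfl

theorem hessSq_eq {φ : Rd d → ℝ} (hφ : Sm φ) : S.hessSq τ τ₀ h φ = energy S τ τ₀ h 2 φ := by
  funext x
  simp only [Scheme.hessSq, energy, bsum, wsum, barDelta_comm hφ]

theorem sup₁_of_structural {m : ℕ} (hm : 1 ≤ m) (hδ1 : δ ≤ 1) (hK : 0 ≤ K)
    (hS : ∀ t, ∃ 𝒦 : (Rd d → ℝ) → Rd d → ℝ, IsSubMarkov 𝒦 ∧ ∀ φ : Rd d → ℝ, IsBddSmooth φ → ∀ x,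
      (m : ℝ) * S.Ah τ τ₀ h t φ x ≤
        (1 - δ) * ∑ μ ∈ S.fullΛ, S.calQ h t (barDelta τ τ₀ h μ φ) x
        + K * S.calQ h t φ x
        + 2 * (1 - δ) * S.c t x * 𝒦 (S.gradSq τ τ₀ h φ) x)
    (hχ : ∀ v ∈ S.Λ₁, ∀ t x, 0 ≤ S.chi h v t x) (hc : ∀ t x, 0 ≤ S.c t x) :
    Sup₁ S τ τ₀ h δ K := by
  intro t φ C x hφ hC
  obtain ⟨𝒦, h𝒦, H⟩ := hS t
  have h1 := H φ hφ.isBddSmooth x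
  have h1δ : 0 ≤ 1 - δ := by linarith
  have hC0 : 0 ≤ C := (energy_nonneg 1 φ x).trans (hC x)
  have h2 : 𝒦 (S.gradSq τ τ₀ h φ) x ≤ C := h𝒦.le_const (sm_energy 1 hφ).isBddBorel hC0 hC x
  have hcx := hc t x
  have h3 := mul_le_mul_of_nonneg_left h2 (by positivity : 0 ≤ 2 * (1 - δ) * S.c t x)
  have h4 : 0 ≤ (1 - δ) * ∑ μ ∈ S.fullΛ, S.calQ h t (barDelta τ τ₀ h μ φ) x :=
    mul_nonneg h1δ (Finset.sum_nonneg fun μ _ => calQ_nonneg hχ t _ x)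
  have h5 : 0 ≤ K * S.calQ h t φ x := mul_nonneg hK (calQ_nonneg hχ t _ x)
  have h6 : 0 ≤ 2 * (1 - δ) * S.c t x * C := by positivity
  rcases le_total (S.Ah τ τ₀ h t φ x) 0 with hA | hA
  · linarith
  · have : S.Ah τ τ₀ h t φ x ≤ m * S.Ah τ τ₀ h t φ x :=
      le_mul_of_one_le_left hA (by exact_mod_cast hm)
    linarith

theorem sup₂_of_structural {m : ℕ} (hδ1 : δ ≤ 1) (hK : 0 ≤ K)
    (hS : ∀ n ∈ Finset.Icc 1 m, ∀ t, ∃ 𝒦 : (Rd d → ℝ) → Rd d → ℝ, IsSubMarkov 𝒦 ∧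
      ∀ φ : Rd d → ℝ, IsBddSmooth φ → ∀ x, secondLHS S τ τ₀ h t n x φ ≤
        (1 - δ) * ∑ μ ∈ S.fullΛ, ∑ ν ∈ S.fullΛ,
            S.calQ h t (barDelta τ τ₀ h μ (barDelta τ τ₀ h ν φ)) x
        + K * ∑ μ ∈ S.fullΛ, S.calQ h t (barDelta τ τ₀ h μ φ) x
        + 2 * (1 - δ) * S.c t x * 𝒦 (S.hessSq τ τ₀ h φ) x
        + K * 𝒦 (S.gradSq τ τ₀ h φ) x)
    (hc : ∀ t x, 0 ≤ S.c t x) : Sup₂ S τ τ₀ h δ K m := by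
  intro n hn t φ C₂ C₁ x hφ hC₂ hC₁
  obtain ⟨𝒦, h𝒦, H⟩ := hS (n + 2) (Finset.mem_Icc.2 ⟨by omega, hn⟩) t
  have h1δ : 0 ≤ 1 - δ := by linarith
  have hP : ∀ φ : Rd d → ℝ, Sm φ → ∀ μ, Sm (barDelta τ τ₀ h μ φ) := fun φ hφ μ => hφ.barDelta μ
  have hle := wsum_le (Λ := S.fullΛ) (D := barDelta τ τ₀ h) (P := Sm)
    (F := secondLHS S τ τ₀ h t (n + 2) x)
    (G := fun φ => (1 - δ) * wsum S.fullΛ (barDelta τ τ₀ h) 2 (fun ψ => S.calQ h t ψ x) φ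
        + K * wsum S.fullΛ (barDelta τ τ₀ h) 1 (fun ψ => S.calQ h t ψ x) φ
        + 2 * (1 - δ) * S.c t x * 𝒦 (energy S τ τ₀ h 2 φ) x
        + K * 𝒦 (energy S τ τ₀ h 1 φ) x) (fun φ hφ μ _ => hφ.barDelta μ)
    (fun ψ hψ => by
      have := H ψ hψ.isBddSmooth x
      rw [hessSq_eq hψ, gradSq_eq] at this
      simp only [wsum, barDelta_comm hψ] at this ⊢
      exact this) n hφ
  have hE : ∀ j, wsum S.fullΛ (barDelta τ τ₀ h) n (fun φ => 𝒦 (energy S τ τ₀ h j φ) x) φ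
      = 𝒦 (energy S τ τ₀ h (n + j) φ) x := fun j => by
    have := h𝒦.wsum (Λ := S.fullΛ) hP (G := energy S τ τ₀ h j)
      (fun k z hz => by
        simp only [energy_add]
        exact (sm_energy _ hz).isBddBorel) n hφ x
    simp only [energy_add] at this
    exact this
  simp only [wsum_add, wsum_const_mul, wsum_wsum] at hle
  rw [hE, hE] at hle
  have h2 := h𝒦.le_const (sm_energy (n + 2) hφ).isBddBorel ((energy_nonneg _ φ x).trans (hC₂ x)) hC₂ x
  have h1 := h𝒦.le_const (sm_energy (n + 1) hφ).isBddBorel ((energy_nonneg _ φ x).trans (hC₁ x)) hC₁ x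
  have hcx := hc t x
  have h3 := mul_le_mul_of_nonneg_left h2 (by positivity : 0 ≤ 2 * (1 - δ) * S.c t x)
  have h4 := mul_le_mul_of_nonneg_left h1 hK
  linarith

end Structural


/-! ### Stability of the finite difference equation -/

section Stability

variable {S : Scheme d}

/-- A bound of the norm of `L_h` for coefficients bounded by one. -/
noncomputable def opConst (S : Scheme d) (h : ℝ) : ℝ := 2 * (S.Λ₁.card * (h⁻¹ ^ 2 * (1 + h))) + 1

theorem opConst_nonneg {h : ℝ} (hh : 0 < h) : 0 ≤ opConst S h := by
  unfold opConst; positivity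

theorem abs_rate_le {h e t : ℝ} {v x : Rd d} (hh : 0 < h) (hq : |S.q v t x| ≤ e)
    (hp : |S.p v t x| ≤ e) : |S.rate h v t x| ≤ h⁻¹ ^ 2 * (1 + h) * e := by
  rw [Scheme.rate, Scheme.chi, abs_mul, abs_of_nonneg (by positivity : 0 ≤ h⁻¹ ^ 2), mul_assoc]
  refine mul_le_mul_of_nonneg_left ((abs_add_le _ _).trans ?_) (by positivity)
  rw [abs_mul, abs_of_pos hh, add_mul, one_mul]
  gcongr

theorem abs_Lh_le {h e C t : ℝ} {x : Rd d} {φ : Rd d → ℝ} (hh : 0 < h)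
    (hq : ∀ v ∈ S.Λ₁, |S.q v t x| ≤ e) (hp : ∀ v ∈ S.Λ₁, |S.p v t x| ≤ e) (hc : |S.c t x| ≤ e)
    (hφ : ∀ y, |φ y| ≤ C) : |S.Lh h t φ x| ≤ opConst S h * e * C := by
  have he : 0 ≤ e := (abs_nonneg _).trans hc
  rw [S.Lh_eq hh.ne']
  have h1 : |∑ v ∈ S.Λ₁, S.rate h v t x * (φ (x + h • v) - φ x)|
      ≤ ∑ v ∈ S.Λ₁, h⁻¹ ^ 2 * (1 + h) * e * (C + C) := by
    refine (Finset.abs_sum_le_sum_abs _ _).trans (Finset.sum_le_sum fun v hv => ?_)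
    rw [abs_mul]
    exact mul_le_mul (abs_rate_le hh (hq v hv) (hp v hv))
      ((abs_sub _ _).trans (add_le_add (hφ _) (hφ _))) (abs_nonneg _) (by positivity)
  have h2 : |S.c t x * φ x| ≤ e * C := by
    rw [abs_mul]; exact mul_le_mul hc (hφ x) (abs_nonneg _) he
  refine (abs_sub _ _).trans ((add_le_add h1 h2).trans (le_of_eq ?_))
  rw [Finset.sum_const, nsmul_eq_mul, opConst]; ring

theorem abs_Lh_sub_le {S' : Scheme d} (hΛ : S'.Λ₁ = S.Λ₁) {h e C t : ℝ} {x : Rd d} {φ : Rd d → ℝ}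
    (hh : 0 < h) (hq : ∀ v ∈ S.Λ₁, |S'.q v t x - S.q v t x| ≤ e)
    (hp : ∀ v ∈ S.Λ₁, |S'.p v t x - S.p v t x| ≤ e) (hc : |S'.c t x - S.c t x| ≤ e)
    (hφ : ∀ y, |φ y| ≤ C) : |S'.Lh h t φ x - S.Lh h t φ x| ≤ opConst S h * e * C := by
  have h1 := abs_Lh_le (S := ⟨S.Λ₁, fun v t x => S'.q v t x - S.q v t x,
    fun v t x => S'.p v t x - S.p v t x, fun t x => S'.c t x - S.c t x⟩) hh hq hp hc hφ
  have e1 : S'.Lh h t φ x - S.Lh h t φ x = Scheme.Lh ⟨S.Λ₁, fun v t x => S'.q v t x - S.q v t x,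
      fun v t x => S'.p v t x - S.p v t x, fun t x => S'.c t x - S.c t x⟩ h t φ x := by
    simp only [Scheme.Lh, hΛ, sub_mul, Finset.sum_sub_distrib]; ring
  rw [e1]; exact h1

theorem fd_stability {h T c₀ a b e B : ℝ} (hh : 0 < h) (hc₀ : 0 < c₀) (ha : 0 ≤ a) (hb : 0 ≤ b)
    (hq : ∀ v ∈ S.Λ₁, ∀ t ∈ Icc (0 : ℝ) T, ∀ x, |S.q v t x| ≤ e)
    (hp : ∀ v ∈ S.Λ₁, ∀ t ∈ Icc (0 : ℝ) T, ∀ x, |S.p v t x| ≤ e)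
    (hχ : ∀ v ∈ S.Λ₁, ∀ t ∈ Icc (0 : ℝ) T, ∀ x, 0 ≤ S.chi h v t x)
    (hc : ∀ t ∈ Icc (0 : ℝ) T, ∀ x, c₀ ≤ S.c t x) {w G : ℝ → Rd d → ℝ} {w₀ : Rd d → ℝ}
    (hB : ∀ t ∈ Icc (0 : ℝ) T, ∀ x, |w t x| ≤ B)
    (hint : ∀ t ∈ Icc (0 : ℝ) T, ∀ x,
      IntervalIntegrable (fun s => S.Lh h s (w s) x + G s x) volume 0 t)
    (hw : ∀ t ∈ Icc (0 : ℝ) T, ∀ x,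
      w t x = w₀ x + ∫ s in (0 : ℝ)..t, (S.Lh h s (w s) x + G s x))
    (h0 : ∀ x, |w₀ x| ≤ a) (hG : ∀ t ∈ Icc (0 : ℝ) T, ∀ x, |G t x| ≤ b) :
    ∀ t ∈ Icc (0 : ℝ) T, ∀ x, |w t x| ≤ a + b / c₀ := by
  intro t ht x
  have hT : (0 : ℝ) ≤ T := ht.1.trans ht.2
  have hw0 : ∀ x, w 0 x = w₀ x := fun x => by rw [hw 0 (left_mem_Icc.2 hT)]; simp
  have hrate : ∀ v ∈ S.Λ₁, ∀ t ∈ Icc (0 : ℝ) T, ∀ x, 0 ≤ S.rate h v t x := fun v hv t ht x =>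
    mul_nonneg (by positivity) (hχ v hv t ht x)
  have hβ : ∀ t ∈ Icc (0 : ℝ) T, ∀ x,
      ∑ v ∈ S.Λ₁, S.rate h v t x ≤ ∑ v ∈ S.Λ₁, h⁻¹ ^ 2 * (1 + h) * e := fun t ht x =>
    Finset.sum_le_sum fun v hv => (le_abs_self _).trans
      (abs_rate_le hh (hq v hv t ht x) (hp v hv t ht x))
  have hc0 : ∀ t ∈ Icc (0 : ℝ) T, ∀ x, 0 ≤ S.c t x := fun t ht x => hc₀.le.trans (hc t ht x)
  have hcR : ∀ t ∈ Icc (0 : ℝ) T, ∀ x, b ≤ S.c t x * (a + b / c₀) := fun t ht x => by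
    have h1 : c₀ * (b / c₀) = b := by field_simp
    have h2 : c₀ * (a + b / c₀) ≤ S.c t x * (a + b / c₀) :=
      mul_le_mul_of_nonneg_right (hc t ht x) (by positivity)
    have h3 : 0 ≤ c₀ * a := by positivity
    linarith
  have hR : 0 ≤ b / c₀ := by positivity
  have up := max_principle (h := h) (y := w) (R := a + b / c₀) hrate hβ hc0
    (fun t ht x => (le_abs_self _).trans (hB t ht x)) hint
    (fun t ht x => by rw [hw0]; exact hw t ht x)
    (fun x => by rw [hw0]; linarith [le_abs_self (w₀ x), h0 x])
    (fun t ht x => by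
      rw [S.Lh_eq hh.ne']
      have := hcR t ht x
      have := (abs_le.1 (hG t ht x)).2
      linarith) t ht x
  have dn := max_principle (h := h) (y := fun t x => -w t x)
    (G := fun s x => -(S.Lh h s (w s) x + G s x)) (R := a + b / c₀) hrate hβ hc0
    (fun t ht x => (neg_le_abs _).trans (hB t ht x)) (fun t ht x => (hint t ht x).neg)
    (fun t ht x => by
      rw [intervalIntegral.integral_neg, hw0, hw t ht x]; ring)
    (fun x => by rw [hw0]; linarith [neg_le_abs (w₀ x), h0 x])
    (fun t ht x => by
      rw [S.Lh_eq hh.ne']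
      have h1 := hcR t ht x
      have h2 := (abs_le.1 (hG t ht x)).1
      have h3 : ∑ v ∈ S.Λ₁, S.rate h v t x * (-w t (x + h • v) - -w t x)
          = -∑ v ∈ S.Λ₁, S.rate h v t x * (w t (x + h • v) - w t x) := by
        rw [← Finset.sum_neg_distrib]
        exact Finset.sum_congr rfl fun v _ => by ring
      rw [h3]
      linarith) t ht x
  exact abs_le.2 ⟨by linarith, up⟩

theorem fd_unique {h T c₀ e : ℝ} (hh : 0 < h) (hc₀ : 0 < c₀)
    (hq : ∀ v ∈ S.Λ₁, ∀ t ∈ Icc (0 : ℝ) T, ∀ x, |S.q v t x| ≤ e)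
    (hp : ∀ v ∈ S.Λ₁, ∀ t ∈ Icc (0 : ℝ) T, ∀ x, |S.p v t x| ≤ e)
    (hχ : ∀ v ∈ S.Λ₁, ∀ t ∈ Icc (0 : ℝ) T, ∀ x, 0 ≤ S.chi h v t x)
    (hc : ∀ t ∈ Icc (0 : ℝ) T, ∀ x, c₀ ≤ S.c t x) {f u v : ℝ → Rd d → ℝ} {g : Rd d → ℝ}
    (hu : S.IsFDSolution T h f g u) (hv : S.IsFDSolution T h f g v) :
    ∀ t ∈ Icc (0 : ℝ) T, ∀ x, v t x = u t x := by
  obtain ⟨⟨C, hC⟩, hu⟩ := hu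
  obtain ⟨⟨C', hC'⟩, hv⟩ := hv
  have e1 : ∀ x, (fun s => S.Lh h s (fun x => v s x - u s x) x + 0)
      = fun s => (S.Lh h s (v s) x + f s x) - (S.Lh h s (u s) x + f s x) := fun x => by
    funext s; rw [S.Lh_sub]; ring
  intro t ht x
  have := fd_stability (S := S) (T := T) (w := fun t x => v t x - u t x) (G := fun _ _ => 0)
    (w₀ := fun _ => 0) (B := C' + C) hh hc₀ le_rfl le_rfl hq hp hχ hc
    (fun t ht x => (abs_sub _ _).trans (add_le_add (hC' t ht x) (hC t ht x)))
    (fun t ht x => by rw [e1]; exact (hv t ht x).1.sub (hu t ht x).1)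
    (fun t ht x => by
      rw [e1, intervalIntegral.integral_sub (hv t ht x).1 (hu t ht x).1, (hv t ht x).2,
        (hu t ht x).2]; ring)
    (fun x => by simp) (fun t _ x => by simp) t ht x
  simp only [zero_div, add_zero] at this
  exact sub_eq_zero.1 (abs_eq_zero.1 (le_antisymm this (abs_nonneg _)))

end Stability

/-! ### Solutions for rough schemes -/

theorem exists_limit_of_rate {X : Type*} {f : ℕ → X → ℝ} {C : ℝ}
    (h : ∀ k j x, |f k x - f j x| ≤ C * (1 / ((k : ℝ) + 1) + 1 / ((j : ℝ) + 1))) :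
    ∃ g : X → ℝ, ∀ k x, |f k x - g x| ≤ C * (1 / ((k : ℝ) + 1)) := by
  have h0 : Tendsto (fun j : ℕ => 1 / ((j : ℝ) + 1)) atTop (𝓝 0) :=
    tendsto_one_div_add_atTop_nhds_zero_nat
  have hc : ∀ x, ∃ y, Tendsto (fun j => f j x) atTop (𝓝 y) := fun x => by
    refine cauchySeq_tendsto_of_complete (cauchySeq_of_le_tendsto_0
      (fun k : ℕ => |C| * (1 / ((k : ℝ) + 1) + 1 / ((k : ℝ) + 1))) (fun n k N hn hk => ?_) ?_)
    · rw [Real.dist_eq]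
      refine (h n k x).trans ?_
      have h1 : 1 / ((n : ℝ) + 1) ≤ 1 / ((N : ℝ) + 1) :=
        one_div_le_one_div_of_le (by positivity) (by exact_mod_cast Nat.succ_le_succ hn)
      have h2 : 1 / ((k : ℝ) + 1) ≤ 1 / ((N : ℝ) + 1) :=
        one_div_le_one_div_of_le (by positivity) (by exact_mod_cast Nat.succ_le_succ hk)
      exact mul_le_mul (le_abs_self C) (add_le_add h1 h2) (by positivity) (abs_nonneg _)
    · simpa using (h0.add h0).const_mul |C|
  choose g hg using hc
  refine ⟨g, fun k x => ?_⟩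
  have h1 : Tendsto (fun j : ℕ => C * (1 / ((k : ℝ) + 1) + 1 / ((j : ℝ) + 1))) atTop
      (𝓝 (C * (1 / ((k : ℝ) + 1)))) := by
    simpa using (tendsto_const_nhds.add h0).const_mul C
  exact le_of_tendsto_of_tendsto (((hg x).const_sub (f k x)).abs) h1
    (Eventually.of_forall fun j => h k j x)

/-- Measurable families of functions in `LB n D`. -/
structure TB (n : ℕ) (D : ℝ) (F : ℝ → Rd d → ℝ) : Prop where
  meas : Measurable (Function.uncurry F)
  lb : ∀ t, LB n D (F t)

section RoughSolution

variable {S : Scheme d} {τ : Rd d → ℝ} {τ₀ h₀ δ K c₀ A B Mb : ℝ} {m : ℕ}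

theorem measurable_Lh {h : ℝ} (hh : h ≠ 0)
    (hq : ∀ v ∈ S.Λ₁, Measurable (Function.uncurry (S.q v)))
    (hp : ∀ v ∈ S.Λ₁, Measurable (Function.uncurry (S.p v))) (hc : Measurable (Function.uncurry S.c))
    {u : ℝ → Rd d → ℝ} (hu : Measurable (Function.uncurry u)) :
    Measurable (Function.uncurry fun t x => S.Lh h t (u t) x) := by
  simp_rw [S.Lh_eq hh]
  refine (Finset.measurable_sum _ fun v hv => ?_).sub (hc.mul hu)
  refine Measurable.mul (((hq v hv).add ((hp v hv).const_mul h)).const_mul _) (Measurable.sub ?_ hu)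
  exact hu.comp (f := fun z : ℝ × Rd d => (z.1, z.2 + h • v))
    (measurable_fst.prodMk (measurable_snd.add_const _))

theorem RoughHyp.abs_Lh_le (H : RoughHyp S τ τ₀ h₀ δ K c₀ A B Mb m) {h C t : ℝ} {x : Rd d}
    {φ : Rd d → ℝ} (hh : 0 < h) (hφ : ∀ y, |φ y| ≤ C) : |S.Lh h t φ x| ≤ opConst S h * Mb * C :=
  FDExpansion.abs_Lh_le hh (fun v hv => (H.q_lb v hv t).bound x) (fun v hv => (H.p_lb v hv t).bound x)
    ((H.c_bd t).bound x) hφ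

theorem RoughHyp.abs_Lh_moll_sub_le (H : RoughHyp S τ τ₀ h₀ δ K c₀ A B Mb m) (hm : 1 ≤ m)
    {h C t : ℝ} {x : Rd d} {φ : Rd d → ℝ} (hh : 0 < h) (hφ : ∀ y, |φ y| ≤ C) (k : ℕ) :
    |(S.moll k).Lh h t φ x - S.Lh h t φ x| ≤ opConst S h * (d * Mb) * C * (1 / ((k : ℝ) + 1)) := by
  obtain ⟨n, rfl⟩ : ∃ n, m = n + 1 := ⟨m - 1, by omega⟩
  have := abs_Lh_sub_le (S := S) (S' := S.moll k) rfl hh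
    (fun v hv => (H.q_lb v hv t).moll_close k x)
    (fun v hv => (H.p_lb v hv t).moll_close k x) ((H.c_bd t).moll_close k x) hφ
  refine this.trans (le_of_eq ?_)
  ring

theorem RoughHyp.exists_solution (H : RoughHyp S τ τ₀ h₀ δ K c₀ A B Mb m) (hm : 3 ≤ m)
    (hc₀ : 0 < c₀) {n : ℕ} {D N : ℝ} (hn1 : 1 ≤ n)
    (hest : ∀ (S : Scheme d) (τ : Rd d → ℝ) (h : ℝ),
      SmoothHyp S τ τ₀ h δ K c₀ A B Mb m → ∀ (T : ℝ) (F u : ℝ → Rd d → ℝ) (g : Rd d → ℝ)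
        (D : ℝ), 0 ≤ T → STS F → Sm g → (∀ t, DB n D (F t)) → DB n D g → STS u →
        (∀ t x, u t x = g x + tint T (fun s x => S.Lh h s (u s) x + F s x) t x) →
        ∀ t, DB n (N * D) (u t)) {h T : ℝ} (hh : h ∈ Ioc 0 h₀) (hT : 0 ≤ T)
    {F : ℝ → Rd d → ℝ} {g : Rd d → ℝ} (hF : TB n D F) (hg : LB n D g) :
    ∃ u : ℝ → Rd d → ℝ, TB n (N * D) u ∧
      ∀ t x, u t x = g x + tint T (fun s x => S.Lh h s (u s) x + F s x) t x := by
  obtain ⟨n, rfl⟩ : ∃ i, n = i + 1 := ⟨n - 1, by omega⟩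
  have hFS : ∀ k, STS (fun t => FDExpansion.moll k (F t)) := fun k =>
    STS.moll hF.meas (fun t x => (hF.lb t).bound x) k
  have hSm := fun k => H.moll hm hh k
  have hex := fun k => exists_smooth_solution (hSm k).smooth hh.1.ne' hT (hFS k) (hg.sm_moll k)
  choose U hUS hU using hex
  have hUD : ∀ k t, DB (n + 1) (N * D) (U k t) := fun k =>
    hest _ τ h (hSm k) T _ _ _ D hT (hFS k) (hg.sm_moll k) (fun t => (hF.lb t).db_moll k)
      (hg.db_moll k) (hUS k) (hU k)
  have hMb : 0 ≤ Mb := (H.c_bd 0).nonneg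
  have hD : 0 ≤ D := hg.nonneg
  have hND : 0 ≤ N * D := (hUD 0 0).nonneg
  have hop := opConst_nonneg (S := S) hh.1
  have hclamp : ∀ k t, U k t = U k (clampT T t) := fun k t => funext fun x => by
    rw [hU k t, hU k (clampT T t), tint, tint, clampT_of_mem (clampT_mem hT t)]
  have hii : ∀ k x t, IntervalIntegrable (fun s => (S.moll k).Lh h s (U k s) x
      + FDExpansion.moll k (F s) x) volume 0 t := fun k x t =>
    (((hSm k).smooth.sts_Lh hh.1.ne' (hUS k)).add (hFS k)).intervalIntegrable x 0 t
  set C₁ : ℝ := d * D + (opConst S h * (d * Mb) * (N * D) + d * D) / c₀ with hC₁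
  have hC₁0 : 0 ≤ C₁ := by positivity
  have hdist : ∀ k j : ℕ, ∀ z : ℝ × Rd d, |U k z.1 z.2 - U j z.1 z.2|
      ≤ C₁ * (1 / ((k : ℝ) + 1) + 1 / ((j : ℝ) + 1)) := by
    rintro k j ⟨t, x⟩
    simp only
    rw [hclamp k t, hclamp j t]
    set ρ : ℝ := 1 / ((k : ℝ) + 1) + 1 / ((j : ℝ) + 1) with hρ
    have hρ0 : 0 ≤ ρ := by positivity
    have h1 := fd_stability (S := S.moll k) (T := T) (c₀ := c₀) (a := d * D * ρ)
      (b := (opConst S h * (d * Mb) * (N * D) + d * D) * ρ) (e := Mb) (B := N * D + N * D)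
      (w := fun t x => U k t x - U j t x)
      (w₀ := fun x => FDExpansion.moll k g x - FDExpansion.moll j g x)
      (G := fun s x => (S.moll k).Lh h s (U j s) x - (S.moll j).Lh h s (U j s) x
        + (FDExpansion.moll k (F s) x - FDExpansion.moll j (F s) x))
      hh.1 hc₀ (by positivity) (by positivity)
      (fun v hv t _ x => ((H.q_lb v hv t).db_moll k).bound x)
      (fun v hv t _ x => ((H.p_lb v hv t).db_moll k).bound x)
      (fun v hv t _ x => (hSm k).chi_nonneg v hv t x) (fun t _ x => (hSm k).c_le t x)
      (fun t _ x => (abs_sub _ _).trans (add_le_add ((hUD k t).bound x) ((hUD j t).bound x)))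
    have e1 : ∀ x, (fun s => (S.moll k).Lh h s (fun x => U k s x - U j s x) x
        + ((S.moll k).Lh h s (U j s) x - (S.moll j).Lh h s (U j s) x
          + (FDExpansion.moll k (F s) x - FDExpansion.moll j (F s) x)))
        = fun s => ((S.moll k).Lh h s (U k s) x + FDExpansion.moll k (F s) x)
          - ((S.moll j).Lh h s (U j s) x + FDExpansion.moll j (F s) x) := fun x => by
      funext s; rw [Scheme.Lh_sub]; ring
    have hclose : ∀ φ : Rd d → ℝ, LB (n + 1) D φ → ∀ x,
        |FDExpansion.moll k φ x - FDExpansion.moll j φ x| ≤ d * D * ρ := fun φ hφ x => by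
      have a1 := hφ.moll_close k x
      have a2 := hφ.moll_close j x
      rw [abs_sub_comm] at a2
      refine (abs_sub_le _ (φ x) _).trans ((add_le_add a1 a2).trans (le_of_eq ?_))
      rw [hρ]; ring
    refine (h1 (fun t ht x => ?_) (fun t ht x => ?_) (hclose g hg) (fun t ht x => ?_) _
      (clampT_mem hT t) x).trans (le_of_eq ?_)
    · rw [e1]; exact (hii k x t).sub (hii j x t)
    · rw [e1, intervalIntegral.integral_sub (hii k x t) (hii j x t), hU k t, hU j t, tint, tint,
        clampT_of_mem ht]; ring
    · refine (abs_add_le _ _).trans ?_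
      rw [add_mul]
      refine add_le_add ?_ (hclose _ (hF.lb t) x)
      have a1 := H.abs_Lh_moll_sub_le (by omega) (t := t) (x := x) hh.1 (fun y => (hUD j t).bound y) k
      have a2 := H.abs_Lh_moll_sub_le (by omega) (t := t) (x := x) hh.1 (fun y => (hUD j t).bound y) j
      rw [abs_sub_comm] at a2
      refine (abs_sub_le _ (S.Lh h t (U j t) x) _).trans ((add_le_add a1 a2).trans (le_of_eq ?_))
      rw [hρ]; ring
    · rw [hC₁]; ring
  obtain ⟨u', hu'⟩ := exists_limit_of_rate hdist
  set u : ℝ → Rd d → ℝ := fun t x => u' (t, x) with hu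
  have hlim : ∀ k t x, |U k t x - u t x| ≤ C₁ * (1 / ((k : ℝ) + 1)) := fun k t x => hu' k (t, x)
  have h0 : Tendsto (fun j : ℕ => 1 / ((j : ℝ) + 1)) atTop (𝓝 0) :=
    tendsto_one_div_add_atTop_nhds_zero_nat
  have htend : ∀ t x, Tendsto (fun k => U k t x) atTop (𝓝 (u t x)) := fun t x => by
    rw [tendsto_iff_dist_tendsto_zero]
    refine squeeze_zero (fun _ => dist_nonneg) (fun k => (Real.dist_eq _ _).le.trans (hlim k t x)) ?_
    simpa using h0.const_mul C₁
  have hmeas : Measurable (Function.uncurry u) :=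
    measurable_of_tendsto_metrizable (fun k => (hUS k).meas) (tendsto_pi_nhds.2 fun z => htend z.1 z.2)
  have hlb : ∀ t, LB (n + 1) (N * D) (u t) := fun t =>
    LB.of_tendsto (fun k => (hUD k t).lb ((hUS k).slice t)) (by
      rw [Metric.tendstoUniformly_iff]
      intro ε hε
      have := (h0.const_mul C₁).eventually_lt_const (by simpa using hε : C₁ * 0 < ε)
      filter_upwards [this] with k hk x
      rw [dist_comm, Real.dist_eq]
      exact (hlim k t x).trans_lt hk)
  refine ⟨u, ⟨hmeas, hlb⟩, fun t x => ?_⟩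
  have hmL := measurable_Lh hh.1.ne' H.q_meas H.p_meas H.c_meas hmeas
  have hiu : IntervalIntegrable (fun s => S.Lh h s (u s) x + F s x) volume 0 (clampT T t) :=
    intervalIntegrable_of_bound
      ((hmL.comp measurable_prodMk_right).add (hF.meas.comp measurable_prodMk_right))
      (C := opConst S h * Mb * (N * D) + D)
      (fun s => (abs_add_le _ _).trans (add_le_add (H.abs_Lh_le hh.1 (hlb s).bound)
        ((hF.lb s).bound x))) 0 _
  set C₂ : ℝ := opConst S h * (d * Mb) * (N * D) + opConst S h * Mb * C₁ + d * D with hC₂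
  refine tendsto_nhds_unique (htend t x) ?_
  have hrhs : Tendsto (fun k => FDExpansion.moll k g x + tint T (fun s x => (S.moll k).Lh h s (U k s) x
      + FDExpansion.moll k (F s) x) t x) atTop (𝓝 (g x + tint T (fun s x => S.Lh h s (u s) x + F s x)
      t x)) := by
    rw [tendsto_iff_dist_tendsto_zero]
    refine squeeze_zero (fun _ => dist_nonneg) (g := fun k : ℕ => (d * D + C₂ * |clampT T t - 0|)
      * (1 / ((k : ℝ) + 1))) (fun k => ?_) (by simpa using h0.const_mul _)
    rw [Real.dist_eq, add_sub_add_comm, add_mul]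
    refine (abs_add_le _ _).trans (add_le_add ?_ ?_)
    · refine (hg.moll_close k x).trans (le_of_eq (by ring))
    · simp only [tint]
      rw [← intervalIntegral.integral_sub (hii k x _) hiu]
      rw [← Real.norm_eq_abs]
      refine le_trans (b := C₂ * (1 / ((k : ℝ) + 1)) * |clampT T t - 0|)
        (intervalIntegral.norm_integral_le_of_norm_le_const fun s _ => ?_) (le_of_eq (by ring))
      have a1 := H.abs_Lh_moll_sub_le (by omega) (t := s) (x := x) hh.1 (fun y => (hUD k s).bound y) k
      have a2 : |S.Lh h s (U k s) x - S.Lh h s (u s) x|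
          ≤ opConst S h * Mb * (C₁ * (1 / ((k : ℝ) + 1))) := by
        rw [← S.Lh_sub]; exact H.abs_Lh_le hh.1 fun y => hlim k s y
      have a3 := (hF.lb s).moll_close k x
      rw [Real.norm_eq_abs]
      have e : (S.moll k).Lh h s (U k s) x + FDExpansion.moll k (F s) x - (S.Lh h s (u s) x + F s x)
          = ((S.moll k).Lh h s (U k s) x - S.Lh h s (U k s) x)
            + (S.Lh h s (U k s) x - S.Lh h s (u s) x) + (FDExpansion.moll k (F s) x - F s x) := by ring
      rw [e]
      refine (abs_add_three _ _ _).trans ((add_le_add (add_le_add a1 a2) a3).trans (le_of_eq ?_))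
      rw [hC₂]; ring
  refine hrhs.congr fun k => ?_
  rw [hU k t x]

theorem RoughHyp.isFDSolution (H : RoughHyp S τ τ₀ h₀ δ K c₀ A B Mb m) {n n' : ℕ} {D D' : ℝ}
    {h T : ℝ} (hh : 0 < h) {F u : ℝ → Rd d → ℝ} {g : Rd d → ℝ} (hF : TB n D F) (hu : TB n' D' u)
    (heq : ∀ t x, u t x = g x + tint T (fun s x => S.Lh h s (u s) x + F s x) t x) :
    S.IsFDSolution T h F g u := by
  have hmL := measurable_Lh hh.ne' H.q_meas H.p_meas H.c_meas hu.meas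
  refine ⟨⟨D', fun t _ x => (hu.lb t).bound x⟩, fun t ht x => ⟨?_, ?_⟩⟩
  · exact intervalIntegrable_of_bound
      ((hmL.comp measurable_prodMk_right).add (hF.meas.comp measurable_prodMk_right))
      (C := opConst S h * Mb * D' + D)
      (fun s => (abs_add_le _ _).trans (add_le_add (H.abs_Lh_le hh (hu.lb s).bound)
        ((hF.lb s).bound x))) 0 _
  · rw [heq, tint, clampT_of_mem ht]

end RoughSolution


/-! ### Directional derivatives as sums over words -/

/-- `∂_v^k φ`, with classical derivatives. -/
noncomputable def clDir (v : Rd d) (k : ℕ) (φ : Rd d → ℝ) (x : Rd d) : ℝ :=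
  ∑ ι : Fin k → Fin d, (∏ j, v (ι j)) * pds (List.ofFn ι) φ x

theorem clDir_zero (v : Rd d) (φ : Rd d → ℝ) (x : Rd d) : clDir v 0 φ x = φ x := by
  simp [clDir, pds]

theorem clDir_one (v : Rd d) (φ : Rd d → ℝ) (x : Rd d) : clDir v 1 φ x = dirD v φ x := by
  rw [clDir, dirD, ← (Equiv.funUnique (Fin 1) (Fin d)).symm.sum_comp]
  refine Finset.sum_congr rfl fun i _ => ?_
  simp [pds]

theorem clDir_neg (v : Rd d) (k : ℕ) (φ : Rd d → ℝ) (x : Rd d) :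
    clDir (-v) k φ x = (-1) ^ k * clDir v k φ x := by
  rw [clDir, clDir, Finset.mul_sum]
  refine Finset.sum_congr rfl fun ι _ => ?_
  simp only [PiLp.neg_apply, Finset.prod_neg, Finset.card_univ, Fintype.card_fin]
  ring

theorem Sm.clDir {φ : Rd d → ℝ} (h : Sm φ) (v : Rd d) (k : ℕ) :
    FDExpansion.clDir v k φ = (FDExpansion.dirD v)^[k] φ := by
  induction k with
  | zero => funext x; exact clDir_zero v φ x
  | succ k ih =>
    rw [Function.iterate_succ_apply', ← ih]
    funext x
    rw [FDExpansion.clDir, FDExpansion.dirD, ← (Fin.consEquiv (fun _ : Fin (k + 1) => Fin d)).sum_comp,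
      Fintype.sum_prod_type]
    refine Finset.sum_congr rfl fun i _ => ?_
    have e : FDExpansion.clDir v k φ
        = fun y => ∑ ι : Fin k → Fin d, (∏ j, v (ι j)) * FDExpansion.pds (List.ofFn ι) φ y := rfl
    rw [e, pderiv_sum _ fun ι _ => ((h.pds _).differentiable.const_mul _), Finset.mul_sum]
    refine Finset.sum_congr rfl fun ι _ => ?_
    rw [pderiv_const_mul (h.pds _).differentiable]
    simp [Fin.consEquiv, Fin.prod_univ_succ, List.ofFn_succ, pds_cons, mul_assoc]

theorem abs_prod_coord_le (v : Rd d) {k : ℕ} (ι : Fin k → Fin d) :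
    |∏ j, v (ι j)| ≤ ‖v‖ ^ k := by
  rw [Finset.abs_prod]
  refine (Finset.prod_le_prod (fun _ _ => abs_nonneg _) fun j _ => abs_coord_le v (ι j)).trans ?_
  simp

theorem LB.const_mul_le {n : ℕ} {C a A : ℝ} {φ : Rd d → ℝ} (h : LB n C φ) (ha : |a| ≤ A) :
    LB n (A * C) (fun x => a * φ x) :=
  (h.const_mul a).mono le_rfl (mul_le_mul_of_nonneg_right ha h.nonneg)

theorem LB.clDir {n k : ℕ} {C : ℝ} {φ : Rd d → ℝ} (h : LB (n + k) C φ) (hn : 1 ≤ n) (v : Rd d) :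
    LB n ((d * ‖v‖) ^ k * C) (clDir v k φ) := by
  refine (LB.sum Finset.univ fun ι _ => (h.pds (List.ofFn ι) hn (by simp)).const_mul_le
    (abs_prod_coord_le v ι)).mono le_rfl (le_of_eq ?_)
  simp [mul_pow, mul_assoc]

theorem tendstoUniformly_mul_sum {X ι : Type*} {s : Finset ι} {a : ι → ℝ} {f : ι → ℕ → X → ℝ}
    {g : ι → X → ℝ} (h : ∀ i ∈ s, TendstoUniformly (f i) (g i) atTop) :
    TendstoUniformly (fun k x => ∑ i ∈ s, a i * f i k x) (fun x => ∑ i ∈ s, a i * g i x) atTop := by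
  classical
  induction s using Finset.induction_on with
  | empty => simpa using Metric.tendstoUniformly_iff.2 fun ε hε => by simp [hε]
  | insert i s hi ih =>
    simp only [Finset.sum_insert hi]
    refine TendstoUniformly.add ?_ (ih fun j hj => h j (Finset.mem_insert_of_mem hj))
    have := (h i (Finset.mem_insert_self _ _))
    exact ((uniformContinuous_const_smul (a i)).comp_tendstoUniformly this)

theorem tendstoUniformly_clDir {n k : ℕ} {C : ℝ} {φ : Rd d → ℝ} {ψ : ℕ → Rd d → ℝ}
    (hs : ∀ k, Sm (ψ k)) (hb : ∀ k, DB n C (ψ k)) (ht : TendstoUniformly ψ φ atTop) (v : Rd d)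
    (hk : k < n) : TendstoUniformly (fun j => clDir v k (ψ j)) (clDir v k φ) atTop :=
  tendstoUniformly_mul_sum fun ι _ => tendstoUniformly_pds hs hb ht _ (by simpa using hk)

/-- The remainder in Taylor's formula, with derivatives written as sums over words. -/
noncomputable def wordRem (N : ℕ) (h : ℝ) (v : Rd d) (φ : Rd d → ℝ) (x : Rd d) : ℝ :=
  φ (x + h • v) - ∑ i ∈ Finset.range N, h ^ i / (i.factorial : ℝ) * clDir v i φ x

theorem Sm.wordRem {φ : Rd d → ℝ} (hs : Sm φ) (N : ℕ) (h : ℝ) (v : Rd d) :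
    FDExpansion.wordRem N h v φ = FDExpansion.taylorRem N h v φ := by
  funext x
  simp only [FDExpansion.wordRem, FDExpansion.taylorRem, hs.clDir]

theorem LB.wordRem {l N : ℕ} {C : ℝ} {φ : Rd d → ℝ} (hb : LB (l + N) C φ) {h : ℝ}
    (hh : 0 ≤ h) (v : Rd d) :
    LB l (h ^ N * ((d * ‖v‖) ^ N * C)) (wordRem N h v φ) := by
  obtain ⟨ψ, h1, h2, h3⟩ := hb.exists_seq
  have hc := hb.nonneg
  refine LB.of_tendsto (ψ := fun k => FDExpansion.wordRem N h v (ψ k)) (fun k => ?_) ?_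
  · rw [(h1 k).wordRem]
    refine (((h2 k).taylorRem (h1 k) hh v).lb ((h1 k).taylorRem N h v)).mono le_rfl ?_
    refine mul_le_mul_of_nonneg_right (div_le_self (by positivity) ?_) (by positivity)
    exact_mod_cast Nat.one_le_iff_ne_zero.2 N.factorial_ne_zero
  · unfold FDExpansion.wordRem
    refine TendstoUniformly.sub ?_ (tendstoUniformly_mul_sum fun i hi =>
      tendstoUniformly_clDir h1 h2 h3 v (by have := Finset.mem_range.1 hi; omega))
    rw [Metric.tendstoUniformly_iff] at h3 ⊢
    exact fun ε hε => (h3 ε hε).mono fun k hk x => hk _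

/-! ### Classical limit operators -/

section Operators

variable {S : Scheme d}

/-- `ℒ^{(i)}`, with classical derivatives. -/
noncomputable def Scheme.clOpI (S : Scheme d) (i : ℕ) (t : ℝ) (φ : Rd d → ℝ) (x : Rd d) : ℝ :=
  1 / (((i : ℝ) + 1) * ((i : ℝ) + 2)) * ∑ v ∈ S.Λ₁, S.q v t x * clDir v (i + 2) φ x
    + 1 / ((i : ℝ) + 1) * ∑ v ∈ S.Λ₁, S.p v t x * clDir v (i + 1) φ x

/-- `ℒ`, with classical derivatives. -/
noncomputable def Scheme.clOp (S : Scheme d) (t : ℝ) (φ : Rd d → ℝ) (x : Rd d) : ℝ :=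
  S.clOpI 0 t φ x - S.c t x * φ x

/-- The remainder in the expansion of `L_h φ` in powers of `h`. -/
noncomputable def Scheme.opRem (S : Scheme d) (J : ℕ) (h t : ℝ) (φ : Rd d → ℝ) (x : Rd d) : ℝ :=
  h⁻¹ ^ 2 * ∑ v ∈ S.Λ₁, S.q v t x * wordRem (J + 3) h v φ x
    + h⁻¹ * ∑ v ∈ S.Λ₁, S.p v t x * wordRem (J + 2) h v φ x

theorem Scheme.Lh_expansion {h t : ℝ} {x : Rd d} (hh : h ≠ 0)
    (hq : ∀ i, ∑ v ∈ S.Λ₁, v i * S.q v t x = 0) (J : ℕ) (φ : Rd d → ℝ) :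
    S.Lh h t φ x = ∑ i ∈ Finset.range (J + 1), h ^ i / (i.factorial : ℝ) * S.clOpI i t φ x
      - S.c t x * φ x + S.opRem J h t φ x := by
  have hq1 : ∑ v ∈ S.Λ₁, S.q v t x * clDir v 1 φ x = 0 := by
    simp only [clDir_one, dirD, Finset.mul_sum]
    rw [Finset.sum_comm]
    refine Finset.sum_eq_zero fun i _ => ?_
    have : ∑ v ∈ S.Λ₁, S.q v t x * (v i * pderiv i φ x)
        = (∑ v ∈ S.Λ₁, v i * S.q v t x) * pderiv i φ x := by
      rw [Finset.sum_mul]; exact Finset.sum_congr rfl fun v _ => by ring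
    rw [this, hq, zero_mul]
  have e1 : ∀ (N : ℕ) (a : Rd d → ℝ), ∑ v ∈ S.Λ₁, a v * (φ (x + h • v) - φ x)
      = ∑ i ∈ Finset.range N, h ^ (i + 1) / ((i + 1).factorial : ℝ)
        * ∑ v ∈ S.Λ₁, a v * clDir v (i + 1) φ x + ∑ v ∈ S.Λ₁, a v * wordRem (N + 1) h v φ x := by
    intro N a
    simp_rw [Finset.mul_sum]
    rw [Finset.sum_comm, ← Finset.sum_add_distrib]
    refine Finset.sum_congr rfl fun v _ => ?_
    rw [wordRem, Finset.sum_range_succ' _ N]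
    simp only [clDir_zero, pow_zero, Nat.factorial_zero, Nat.cast_one, div_one, one_mul, mul_sub,
      mul_add, Finset.mul_sum]
    rw [← sub_sub, add_sub, add_sub, add_comm, ← sub_eq_zero, add_sub_assoc]
    have : ∀ i, h ^ (i + 1) / ((i + 1).factorial : ℝ) * (a v * clDir v (i + 1) φ x)
        = a v * (h ^ (i + 1) / ((i + 1).factorial : ℝ) * clDir v (i + 1) φ x) := fun i => by ring
    simp only [this]
    ring
  have e2 : h⁻¹ ^ 2 * ∑ v ∈ S.Λ₁, S.q v t x * (φ (x + h • v) - φ x)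
      = ∑ i ∈ Finset.range (J + 1), h ^ i / (i.factorial : ℝ)
        * (1 / (((i : ℝ) + 1) * ((i : ℝ) + 2)) * ∑ v ∈ S.Λ₁, S.q v t x * clDir v (i + 2) φ x)
        + h⁻¹ ^ 2 * ∑ v ∈ S.Λ₁, S.q v t x * wordRem (J + 3) h v φ x := by
    rw [e1 (J + 2) fun v => S.q v t x, Finset.sum_range_succ' _ (J + 1), hq1, mul_zero, add_zero,
      mul_add, Finset.mul_sum]
    congr 1
    refine Finset.sum_congr rfl fun i _ => ?_
    have : ((i + 1 + 1).factorial : ℝ) = ((i : ℝ) + 2) * (((i : ℝ) + 1) * i.factorial) := by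
      rw [Nat.factorial_succ, Nat.factorial_succ]; push_cast; ring
    rw [this]
    have hf : (i.factorial : ℝ) ≠ 0 := by positivity
    have h1 : (i : ℝ) + 1 ≠ 0 := by positivity
    have h2 : (i : ℝ) + 2 ≠ 0 := by positivity
    field_simp
    ring
  have e4 : h⁻¹ * ∑ v ∈ S.Λ₁, S.p v t x * (φ (x + h • v) - φ x)
      = ∑ i ∈ Finset.range (J + 1), h ^ i / (i.factorial : ℝ)
        * (1 / ((i : ℝ) + 1) * ∑ v ∈ S.Λ₁, S.p v t x * clDir v (i + 1) φ x)
        + h⁻¹ * ∑ v ∈ S.Λ₁, S.p v t x * wordRem (J + 2) h v φ x := by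
    rw [e1 (J + 1) fun v => S.p v t x, mul_add, Finset.mul_sum]
    congr 1
    refine Finset.sum_congr rfl fun i _ => ?_
    rw [Nat.factorial_succ]
    push_cast
    have hf : (i.factorial : ℝ) ≠ 0 := by positivity
    have h1 : (i : ℝ) + 1 ≠ 0 := by positivity
    field_simp
    ring
  have e5 : S.Lh h t φ x = h⁻¹ ^ 2 * ∑ v ∈ S.Λ₁, S.q v t x * (φ (x + h • v) - φ x)
      + h⁻¹ * ∑ v ∈ S.Λ₁, S.p v t x * (φ (x + h • v) - φ x) - S.c t x * φ x := by
    simp only [Scheme.Lh, fdiff, Finset.mul_sum]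
    congr 2
    · exact Finset.sum_congr rfl fun v _ => by ring
    · exact Finset.sum_congr rfl fun v _ => by ring
  rw [e5, e2, e4, Scheme.opRem]
  simp only [Scheme.clOpI, mul_add, Finset.sum_add_distrib]
  ring

theorem sum_norm_pow_two_le {s : Finset (Rd d)} {A : ℝ} (hA : ∑ v ∈ s, ‖v‖ ^ 2 ≤ A ^ 2) (k : ℕ) :
    ∑ v ∈ s, ‖v‖ ^ (k + 2) ≤ |A| ^ (k + 2) := by
  have h1 : ∀ v ∈ s, ‖v‖ ≤ |A| := fun v hv => by
    have := Finset.single_le_sum (f := fun v : Rd d => ‖v‖ ^ 2) (fun v _ => sq_nonneg ‖v‖) hv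
    exact abs_le_of_sq_le_sq' (by rw [sq_abs]; exact this.trans hA) (abs_nonneg _) |>.2
  calc ∑ v ∈ s, ‖v‖ ^ (k + 2) ≤ ∑ v ∈ s, |A| ^ k * ‖v‖ ^ 2 := by
        refine Finset.sum_le_sum fun v hv => ?_
        rw [pow_add]
        have := h1 v hv
        gcongr
    _ = |A| ^ k * ∑ v ∈ s, ‖v‖ ^ 2 := by rw [Finset.mul_sum]
    _ ≤ |A| ^ k * A ^ 2 := by gcongr
    _ = |A| ^ (k + 2) := by rw [pow_add, sq_abs A]

theorem LB.sum_mul {n : ℕ} {Mb ρ A : ℝ} {k : ℕ} {s : Finset (Rd d)} {a R : Rd d → Rd d → ℝ}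
    (hA : ∑ v ∈ s, ‖v‖ ^ 2 ≤ A ^ 2) (hρ : 0 ≤ ρ) (hMb : 0 ≤ Mb) (ha : ∀ v ∈ s, LB n Mb (a v))
    (hR : ∀ v ∈ s, LB n (‖v‖ ^ (k + 2) * ρ) (R v)) :
    LB n (2 ^ n * Mb * (|A| ^ (k + 2) * ρ)) (fun x => ∑ v ∈ s, a v x * R v x) := by
  refine (LB.sum s fun v hv => (ha v hv).mul (hR v hv)).mono le_rfl ?_
  rw [← Finset.mul_sum, ← Finset.sum_mul]
  have := sum_norm_pow_two_le hA k
  gcongr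

theorem LB.clOpI {n i e : ℕ} {C Mb A t : ℝ} {φ : Rd d → ℝ} (hA : ∑ v ∈ S.Λ₁, ‖v‖ ^ 2 ≤ A ^ 2)
    (hMb : 0 ≤ Mb) (hq : ∀ v ∈ S.Λ₁, LB n Mb (S.q v t)) (hp : ∀ v ∈ S.Λ₁, LB n Mb (S.p v t))
    (hn : 1 ≤ n) (h : LB (n + (i + 2)) C φ) (hi : i = e + 1) :
    LB n (2 ^ n * Mb * ((d * |A|) ^ (i + 2) + (d * |A|) ^ (i + 1)) * C) (S.clOpI i t φ) := by
  have hC := h.nonneg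
  have h1 : LB n (2 ^ n * Mb * (|A| ^ (i + 2) * (d ^ (i + 2) * C)))
      (fun x => ∑ v ∈ S.Λ₁, S.q v t x * FDExpansion.clDir v (i + 2) φ x) :=
    LB.sum_mul hA (by positivity) hMb hq fun v _ => (h.clDir hn v).mono le_rfl
      (le_of_eq (by rw [mul_pow]; ring))
  have h2 : LB n (2 ^ n * Mb * (|A| ^ (e + 2) * (d ^ (i + 1) * C)))
      (fun x => ∑ v ∈ S.Λ₁, S.p v t x * FDExpansion.clDir v (i + 1) φ x) :=
    LB.sum_mul hA (by positivity) hMb hp fun v _ =>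
      ((h.mono (n' := n + (i + 1)) (by omega) le_rfl).clDir hn v).mono le_rfl
        (le_of_eq (by subst hi; rw [mul_pow]; ring))
  have a1 : |1 / (((i : ℝ) + 1) * ((i : ℝ) + 2))| ≤ 1 := by
    rw [abs_of_nonneg (by positivity), div_le_one (by positivity)]
    nlinarith [(Nat.cast_nonneg i : (0 : ℝ) ≤ i)]
  have a2 : |1 / ((i : ℝ) + 1)| ≤ 1 := by
    rw [abs_of_nonneg (by positivity), div_le_one (by positivity)]
    linarith [(Nat.cast_nonneg i : (0 : ℝ) ≤ i)]
  refine ((h1.const_mul_le a1).add (h2.const_mul_le a2)).mono le_rfl (le_of_eq ?_)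
  subst hi
  rw [mul_pow, mul_pow]; ring

theorem LB.opRem {l J : ℕ} {C Mb A t h : ℝ} {φ : Rd d → ℝ} (hA : ∑ v ∈ S.Λ₁, ‖v‖ ^ 2 ≤ A ^ 2)
    (hMb : 0 ≤ Mb) (hq : ∀ v ∈ S.Λ₁, LB l Mb (S.q v t)) (hp : ∀ v ∈ S.Λ₁, LB l Mb (S.p v t))
    (hh : 0 < h) (hφ : LB (l + (J + 3)) C φ) :
    LB l (h ^ (J + 1) * (2 ^ l * Mb * ((d * |A|) ^ (J + 3) + (d * |A|) ^ (J + 2)) * C))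
      (S.opRem J h t φ) := by
  have hC := hφ.nonneg
  have h1 : LB l (2 ^ l * Mb * (|A| ^ (J + 1 + 2) * (h ^ (J + 3) * d ^ (J + 3) * C)))
      (fun x => ∑ v ∈ S.Λ₁, S.q v t x * FDExpansion.wordRem (J + 3) h v φ x) :=
    LB.sum_mul hA (by positivity) hMb hq fun v _ => (hφ.wordRem hh.le v).mono le_rfl
      (le_of_eq (by rw [mul_pow]; ring))
  have h2 : LB l (2 ^ l * Mb * (|A| ^ (J + 2) * (h ^ (J + 2) * d ^ (J + 2) * C)))
      (fun x => ∑ v ∈ S.Λ₁, S.p v t x * FDExpansion.wordRem (J + 2) h v φ x) :=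
    LB.sum_mul hA (by positivity) hMb hp fun v _ =>
      ((hφ.mono (n' := l + (J + 2)) (by omega) le_rfl).wordRem hh.le v).mono le_rfl
        (le_of_eq (by rw [mul_pow]; ring))
  refine ((h1.const_mul_le (abs_of_nonneg (by positivity : 0 ≤ h⁻¹ ^ 2)).le).add
    (h2.const_mul_le (abs_of_nonneg (by positivity : 0 ≤ h⁻¹)).le)).mono le_rfl (le_of_eq ?_)
  rw [mul_pow, mul_pow]
  field_simp
  ring

end Operators

/-! ### Measurable families -/

section Families

theorem TB.bound {n : ℕ} {D : ℝ} {F : ℝ → Rd d → ℝ} (h : TB n D F) (t : ℝ) (x : Rd d) :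
    |F t x| ≤ D := (h.lb t).bound x

theorem TB.mono {n n' : ℕ} {D D' : ℝ} {F : ℝ → Rd d → ℝ} (h : TB n D F) (hn : n' ≤ n)
    (hD : D ≤ D') : TB n' D' F := ⟨h.meas, fun t => (h.lb t).mono hn hD⟩

theorem TB.const_mul {n : ℕ} {D : ℝ} {F : ℝ → Rd d → ℝ} (h : TB n D F) (a : ℝ) :
    TB n (|a| * D) (fun t x => a * F t x) := ⟨h.meas.const_mul a, fun t => (h.lb t).const_mul a⟩

theorem TB.sum {ι : Type*} (s : Finset ι) {n : ℕ} {D : ι → ℝ} {F : ι → ℝ → Rd d → ℝ}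
    (h : ∀ v ∈ s, TB n (D v) (F v)) : TB n (∑ v ∈ s, D v) (fun t x => ∑ v ∈ s, F v t x) :=
  ⟨Finset.measurable_sum (f := fun v => Function.uncurry (F v)) _ fun v hv => (h v hv).meas,
    fun t => LB.sum s fun v hv => (h v hv).lb t⟩

theorem TB.pds {n k : ℕ} {D : ℝ} {F : ℝ → Rd d → ℝ} (h : TB n D F) (w : List (Fin d))
    (hk : 1 ≤ k) (hw : k + w.length ≤ n) : TB k D (fun t => FDExpansion.pds w (F t)) := by
  refine ⟨?_, fun t => (h.lb t).pds w hk hw⟩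
  obtain ⟨k, rfl⟩ : ∃ j, k = j + 1 := ⟨k - 1, by omega⟩
  refine measurable_of_tendsto_metrizable (fun j =>
    ((STS.moll h.meas (fun t x => h.bound t x) j).pds w).meas) (tendsto_pi_nhds.2 ?_)
  rintro ⟨t, x⟩
  simp only [Function.uncurry]
  have h0 : Tendsto (fun j : ℕ => d * D * (1 / ((j : ℝ) + 1))) atTop (𝓝 0) := by
    simpa using tendsto_one_div_add_atTop_nhds_zero_nat.const_mul (d * D)
  rw [tendsto_iff_dist_tendsto_zero]
  refine squeeze_zero (fun _ => dist_nonneg) (fun j => ?_) h0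
  rw [Real.dist_eq, (h.lb t).pds_moll j w (by omega)]
  exact (((h.lb t).pds w hk hw).moll_close j x).trans (le_of_eq (by ring))

theorem TB.clDir {n k : ℕ} {D : ℝ} {F : ℝ → Rd d → ℝ} (h : TB (n + k) D F) (hn : 1 ≤ n) (v : Rd d) :
    TB n ((d * ‖v‖) ^ k * D) (fun t => clDir v k (F t)) :=
  ⟨(TB.sum Finset.univ fun ι _ => (h.pds (List.ofFn ι) hn (by simp)).const_mul (∏ j, v (ι j))).meas,
    fun t => (h.lb t).clDir hn v⟩

end Families


/-! ### Solutions of the limit equation -/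

theorem LB.tendsto_pds {n : ℕ} {C : ℝ} {φ : Rd d → ℝ} {ψ : ℕ → Rd d → ℝ} (hψ : ∀ k, LB n C (ψ k))
    (hφ : LB n C φ) (h : TendstoUniformly ψ φ atTop) (w : List (Fin d)) (hw : w.length < n)
    (x : Rd d) : Tendsto (fun k => FDExpansion.pds w (ψ k) x) atTop (𝓝 (FDExpansion.pds w φ x)) := by
  rw [Metric.tendsto_atTop']
  intro ε hε
  obtain ⟨η, hη, H⟩ := LB.close (d := d) n C (half_pos hε)
  obtain ⟨k, hk⟩ := eventually_atTop.1 (Metric.tendstoUniformly_iff.1 h η hη)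
  refine ⟨k, fun j hj => ?_⟩
  rw [Real.dist_eq]
  refine (H _ _ (hψ j) hφ (fun y => ?_) w hw x).trans_lt (half_lt_self hε)
  have := hk j hj.le y
  rw [dist_comm, Real.dist_eq] at this
  exact this.le

theorem LB.tendsto_clDir {n k : ℕ} {C : ℝ} {φ : Rd d → ℝ} {ψ : ℕ → Rd d → ℝ}
    (hψ : ∀ k, LB n C (ψ k)) (hφ : LB n C φ) (h : TendstoUniformly ψ φ atTop) (v : Rd d) (hk : k < n)
    (x : Rd d) : Tendsto (fun j => FDExpansion.clDir v k (ψ j) x) atTop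
      (𝓝 (FDExpansion.clDir v k φ x)) :=
  tendsto_finsetSum _ fun ι _ => (LB.tendsto_pds hψ hφ h _ (by simpa using hk) x).const_mul _

section LimitEquation

variable {S : Scheme d} {τ : Rd d → ℝ} {τ₀ h₀ δ K c₀ A B Mb : ℝ} {m : ℕ}

theorem LB.tendsto_clOp {n : ℕ} {C t : ℝ} {φ : Rd d → ℝ} {ψ : ℕ → Rd d → ℝ}
    (hψ : ∀ k, LB n C (ψ k)) (hφ : LB n C φ) (h : TendstoUniformly ψ φ atTop) (hn : 3 ≤ n)
    (x : Rd d) : Tendsto (fun j => S.clOp t (ψ j) x) atTop (𝓝 (S.clOp t φ x)) := by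
  refine Tendsto.sub (Tendsto.add ?_ ?_) ((h.tendsto_at x).const_mul _)
  · exact (tendsto_finsetSum _ fun v _ =>
      (LB.tendsto_clDir hψ hφ h v (by omega) x).const_mul _).const_mul _
  · exact (tendsto_finsetSum _ fun v _ =>
      (LB.tendsto_clDir hψ hφ h v (by omega) x).const_mul _).const_mul _

theorem RoughHyp.abs_clOp_le (H : RoughHyp S τ τ₀ h₀ δ K c₀ A B Mb m) {C t : ℝ} {φ : Rd d → ℝ}
    (hφ : LB 3 C φ) (x : Rd d) : |S.clOp t φ x| ≤
      (∑ v ∈ S.Λ₁, Mb * ((d * ‖v‖) ^ 2 * C) + ∑ v ∈ S.Λ₁, Mb * ((d * ‖v‖) ^ 1 * C)) + Mb * C := by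
  have hMb : 0 ≤ Mb := (H.c_bd 0).nonneg
  have hC := hφ.nonneg
  have key : ∀ (a : Rd d → ℝ) (k : ℕ), k ≤ 2 → (∀ v ∈ S.Λ₁, |a v| ≤ Mb) →
      |∑ v ∈ S.Λ₁, a v * clDir v k φ x| ≤ ∑ v ∈ S.Λ₁, Mb * ((d * ‖v‖) ^ k * C) := fun a k hk ha => by
    refine (Finset.abs_sum_le_sum_abs _ _).trans (Finset.sum_le_sum fun v hv => ?_)
    rw [abs_mul]
    exact mul_le_mul (ha v hv) (((hφ.mono (n' := 1 + k) (by omega) le_rfl).clDir le_rfl v).bound x)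
      (abs_nonneg _) hMb
  have k1 := key (fun v => S.q v t x) 2 le_rfl fun v hv => (H.q_lb v hv t).bound x
  have k2 := key (fun v => S.p v t x) 1 (by omega) fun v hv => (H.p_lb v hv t).bound x
  refine (abs_sub _ _).trans (add_le_add ((abs_add_le _ _).trans (add_le_add ?_ ?_)) ?_)
  · rw [abs_mul]
    refine le_trans ?_ k1
    refine (mul_le_mul_of_nonneg_right ?_ (abs_nonneg _)).trans (one_mul _).le
    norm_num
  · rw [abs_mul]
    refine le_trans ?_ k2
    refine (mul_le_mul_of_nonneg_right ?_ (abs_nonneg _)).trans (one_mul _).le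
    norm_num
  · rw [abs_mul]
    exact mul_le_mul ((H.c_bd t).bound x) (hφ.bound x) (abs_nonneg _) hMb

theorem RoughHyp.abs_Lh_sub_clOp_le (H : RoughHyp S τ τ₀ h₀ δ K c₀ A B Mb m) {h C t : ℝ}
    {φ : Rd d → ℝ} (hh : 0 < h) (hφ : LB 3 C φ) (x : Rd d) :
    |S.Lh h t φ x - S.clOp t φ x| ≤ h * (Mb * ((d * |A|) ^ 3 + (d * |A|) ^ 2) * C) := by
  have hMb : 0 ≤ Mb := (H.c_bd 0).nonneg
  have h1 := LB.opRem (l := 0) (J := 0) (t := t) (φ := φ) (C := C) H.size hMb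
    (fun v hv => (H.q_lb v hv t).mono (Nat.zero_le _) le_rfl)
    (fun v hv => (H.p_lb v hv t).mono (Nat.zero_le _) le_rfl) hh hφ
  have h2 := S.Lh_expansion hh.ne' (fun i => H.q_zero t x i) 0 φ
  simp only [zero_add, Finset.sum_range_one, pow_zero, Nat.factorial_zero, Nat.cast_one, div_one,
    one_mul] at h2
  rw [h2, Scheme.clOp, add_sub_cancel_left]
  refine (h1.bound x).trans (le_of_eq ?_)
  ring

theorem RoughHyp.measurable_clOp (H : RoughHyp S τ τ₀ h₀ δ K c₀ A B Mb m) {n : ℕ} {D : ℝ}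
    {u : ℝ → Rd d → ℝ} (hn : 3 ≤ n) (hu : TB n D u) :
    Measurable (Function.uncurry fun t x => S.clOp t (u t) x) := by
  refine Measurable.sub (Measurable.add ?_ ?_) (H.c_meas.mul hu.meas)
  · exact (Finset.measurable_sum (f := fun v (z : ℝ × Rd d) => S.q v z.1 z.2 * clDir v 2 (u z.1) z.2)
      _ fun v hv => (H.q_meas v hv).mul
      ((hu.mono (n' := 1 + 2) (by omega) le_rfl).clDir le_rfl v).meas).const_mul _
  · exact (Finset.measurable_sum (f := fun v (z : ℝ × Rd d) => S.p v z.1 z.2 * clDir v 1 (u z.1) z.2)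
      _ fun v hv => (H.p_meas v hv).mul
      ((hu.mono (n' := 1 + 1) (by omega) le_rfl).clDir le_rfl v).meas).const_mul _

theorem RoughHyp.exists_limit_solution (H : RoughHyp S τ τ₀ h₀ δ K c₀ A B Mb m) (hm : 3 ≤ m)
    (hc₀ : 0 < c₀) (hh₀ : 0 < h₀) {n : ℕ} {D N : ℝ} (hn : 3 ≤ n)
    (hest : ∀ (S : Scheme d) (τ : Rd d → ℝ) (h : ℝ),
      SmoothHyp S τ τ₀ h δ K c₀ A B Mb m → ∀ (T : ℝ) (F u : ℝ → Rd d → ℝ) (g : Rd d → ℝ)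
        (D : ℝ), 0 ≤ T → STS F → Sm g → (∀ t, DB n D (F t)) → DB n D g → STS u →
        (∀ t x, u t x = g x + tint T (fun s x => S.Lh h s (u s) x + F s x) t x) →
        ∀ t, DB n (N * D) (u t)) {T : ℝ} (hT : 0 ≤ T)
    {F : ℝ → Rd d → ℝ} {g : Rd d → ℝ} (hF : TB n D F) (hg : LB n D g) :
    ∃ u : ℝ → Rd d → ℝ, TB n (N * D) u ∧
      ∀ t x, u t x = g x + tint T (fun s x => S.clOp s (u s) x + F s x) t x := by
  have hhk : ∀ k : ℕ, h₀ * (1 / ((k : ℝ) + 1)) ∈ Ioc 0 h₀ := fun k =>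
    ⟨by positivity, mul_le_of_le_one_right hh₀.le (by
      rw [div_le_one (by positivity)]; linarith [(Nat.cast_nonneg k : (0 : ℝ) ≤ k)])⟩
  set hk : ℕ → ℝ := fun k => h₀ * (1 / ((k : ℝ) + 1)) with hk_def
  choose U hU hUe using fun k => H.exists_solution hm hc₀ (by omega) hest (hhk k) hT hF hg
  have hMb : 0 ≤ Mb := (H.c_bd 0).nonneg
  have hD : 0 ≤ D := hg.nonneg
  have hND : 0 ≤ N * D := ((hU 0).lb 0).nonneg
  set R : ℝ := Mb * ((d * |A|) ^ 3 + (d * |A|) ^ 2) * (N * D) with hR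
  have hR0 : 0 ≤ R := by positivity
  have hU3 : ∀ k t, LB 3 (N * D) (U k t) := fun k t => ((hU k).lb t).mono hn le_rfl
  have hmL : ∀ k, Measurable (Function.uncurry fun t x => S.Lh (hk k) t (U k t) x) := fun k =>
    measurable_Lh (hhk k).1.ne' H.q_meas H.p_meas H.c_meas (hU k).meas
  have hclamp : ∀ k t, U k t = U k (clampT T t) := fun k t => funext fun x => by
    rw [hUe k t, hUe k (clampT T t), tint, tint, clampT_of_mem (clampT_mem hT t)]
  have hii : ∀ k x t, IntervalIntegrable (fun s => S.Lh (hk k) s (U k s) x + F s x) volume 0 t :=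
    fun k x t => intervalIntegrable_of_bound
      (((hmL k).comp measurable_prodMk_right).add (hF.meas.comp measurable_prodMk_right))
      (C := opConst S (hk k) * Mb * (N * D) + D)
      (fun s => (abs_add_le _ _).trans (add_le_add (H.abs_Lh_le (hhk k).1 ((hU k).lb s).bound)
        ((hF.lb s).bound x))) 0 _
  have hdist : ∀ k j : ℕ, ∀ z : ℝ × Rd d, |U k z.1 z.2 - U j z.1 z.2|
      ≤ R * h₀ / c₀ * (1 / ((k : ℝ) + 1) + 1 / ((j : ℝ) + 1)) := by
    rintro k j ⟨t, x⟩
    simp only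
    rw [hclamp k t, hclamp j t]
    have h1 := fd_stability (S := S) (T := T) (c₀ := c₀) (a := 0) (b := R * (hk k + hk j))
      (e := Mb) (B := N * D + N * D) (w := fun t x => U k t x - U j t x) (w₀ := fun _ => 0)
      (G := fun s x => S.Lh (hk k) s (U j s) x - S.Lh (hk j) s (U j s) x)
      (hhk k).1 hc₀ le_rfl (by have := (hhk k).1; have := (hhk j).1; positivity)
      (fun v hv t _ x => (H.q_lb v hv t).bound x) (fun v hv t _ x => (H.p_lb v hv t).bound x)
      (fun v hv t _ x => H.chi_nonneg _ (hhk k) v hv t x) (fun t _ x => H.c_le t x)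
      (fun t _ x => (abs_sub _ _).trans (add_le_add ((hU k).bound t x) ((hU j).bound t x)))
    have e1 : ∀ x, (fun s => S.Lh (hk k) s (fun x => U k s x - U j s x) x
        + (S.Lh (hk k) s (U j s) x - S.Lh (hk j) s (U j s) x))
        = fun s => (S.Lh (hk k) s (U k s) x + F s x) - (S.Lh (hk j) s (U j s) x + F s x) := fun x => by
      funext s; rw [Scheme.Lh_sub]; ring
    refine (h1 (fun t ht x => ?_) (fun t ht x => ?_) (fun x => by simp) (fun t ht x => ?_) _
      (clampT_mem hT t) x).trans (le_of_eq ?_)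
    · rw [e1]; exact (hii k x t).sub (hii j x t)
    · rw [e1, intervalIntegral.integral_sub (hii k x t) (hii j x t), hUe k t, hUe j t, tint, tint,
        clampT_of_mem ht]; ring
    · have a1 := H.abs_Lh_sub_clOp_le (hhk k).1 (hU3 j t) x (t := t)
      have a2 := H.abs_Lh_sub_clOp_le (hhk j).1 (hU3 j t) x (t := t)
      rw [abs_sub_comm] at a2
      refine (abs_sub_le _ (S.clOp t (U j t) x) _).trans ((add_le_add a1 a2).trans (le_of_eq ?_))
      rw [hR]; ring
    · rw [hk_def]; ring
  obtain ⟨u', hu'⟩ := exists_limit_of_rate hdist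
  set u : ℝ → Rd d → ℝ := fun t x => u' (t, x) with hu
  have hlim : ∀ k t x, |U k t x - u t x| ≤ R * h₀ / c₀ * (1 / ((k : ℝ) + 1)) :=
    fun k t x => hu' k (t, x)
  have h0 : Tendsto (fun j : ℕ => 1 / ((j : ℝ) + 1)) atTop (𝓝 0) :=
    tendsto_one_div_add_atTop_nhds_zero_nat
  have hunif : ∀ t, TendstoUniformly (fun k => U k t) (u t) atTop := fun t => by
    rw [Metric.tendstoUniformly_iff]
    intro ε hε
    have := (h0.const_mul (R * h₀ / c₀)).eventually_lt_const
      (by simpa using hε : R * h₀ / c₀ * 0 < ε)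
    filter_upwards [this] with k hk x
    rw [dist_comm, Real.dist_eq]
    exact (hlim k t x).trans_lt hk
  have hmeas : Measurable (Function.uncurry u) :=
    measurable_of_tendsto_metrizable (fun k => (hU k).meas)
      (tendsto_pi_nhds.2 fun z => (hunif z.1).tendsto_at z.2)
  have hlb : ∀ t, LB n (N * D) (u t) := fun t => LB.of_tendsto (fun k => (hU k).lb t) (hunif t)
  refine ⟨u, ⟨hmeas, hlb⟩, fun t x => ?_⟩
  refine tendsto_nhds_unique ((hunif t).tendsto_at x) ?_
  set C₂ : ℝ := (∑ v ∈ S.Λ₁, Mb * ((d * ‖v‖) ^ 2 * (N * D))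
    + ∑ v ∈ S.Λ₁, Mb * ((d * ‖v‖) ^ 1 * (N * D))) + Mb * (N * D) with hC₂
  have hLc : ∀ k s, |S.Lh (hk k) s (U k s) x - S.clOp s (U k s) x| ≤ hk k * R := fun k s =>
    H.abs_Lh_sub_clOp_le (hhk k).1 (hU3 k s) x
  have hk0 : Tendsto (fun k => hk k * R) atTop (𝓝 0) := by
    have := (h0.const_mul h₀).mul_const R
    rwa [mul_zero, zero_mul] at this
  refine Tendsto.congr (fun k => (hUe k t x).symm) (tendsto_const_nhds.add ?_)
  refine intervalIntegral.tendsto_integral_filter_of_dominated_convergence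
    (fun _ => h₀ * R + C₂ + D) ?_ ?_ (by simp) ?_
  · refine Eventually.of_forall fun k => Measurable.aestronglyMeasurable ?_
    exact ((hmL k).comp measurable_prodMk_right).add (hF.meas.comp measurable_prodMk_right)
  · refine Eventually.of_forall fun k => Eventually.of_forall fun s _ => ?_
    have a1 := hLc k s
    have a2 := H.abs_clOp_le (t := s) (hU3 k s) x
    have a3 : hk k * R ≤ h₀ * R := mul_le_mul_of_nonneg_right (hhk k).2 hR0
    refine (abs_add_le _ _).trans (add_le_add ?_ (hF.bound s x))
    have := abs_sub_abs_le_abs_sub (S.Lh (hk k) s (U k s) x) (S.clOp s (U k s) x)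
    linarith
  · refine Eventually.of_forall fun s _ => Tendsto.add_const _ ?_
    have a1 : Tendsto (fun k => S.Lh (hk k) s (U k s) x - S.clOp s (U k s) x) atTop (𝓝 0) :=
      squeeze_zero_norm (fun k => hLc k s) hk0
    have a2 := a1.add (LB.tendsto_clOp (S := S) (t := s) (fun k => (hU k).lb s) (hlb s) (hunif s) hn x)
    rw [zero_add] at a2
    exact a2.congr fun k => sub_add_cancel _ _

end LimitEquation


/-! ### The coefficients of the expansion -/

theorem sum_eq_zero_of_odd {s : Finset (Rd d)} {F : Rd d → ℝ} (hs : ∀ v ∈ s, -v ∈ s)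
    (hF : ∀ v ∈ s, F (-v) = -F v) : ∑ v ∈ s, F v = 0 := by
  refine Finset.sum_involution (fun v _ => -v) (fun v hv => by rw [hF v hv]; ring)
    (fun v hv hne he => hne ?_) hs (fun v _ => neg_neg v)
  have := hF v hv
  rw [he] at this
  linarith

theorem clDir_of_eq_zero (v : Rd d) (k : ℕ) : clDir v k (fun _ : Rd d => (0 : ℝ)) = fun _ => 0 := by
  funext x
  simp [clDir, pds_zero]

section Coefficients

variable {S : Scheme d} {τ : Rd d → ℝ} {τ₀ h₀ δ K c₀ A B Mb : ℝ} {m : ℕ}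

theorem Scheme.clOpI_zero (i : ℕ) (t x) : S.clOpI i t (fun _ : Rd d => (0 : ℝ)) x = 0 := by
  simp [Scheme.clOpI, clDir_of_eq_zero]

theorem Scheme.clOp_zero (t x) : S.clOp t (fun _ : Rd d => (0 : ℝ)) x = 0 := by
  simp [Scheme.clOp, S.clOpI_zero]

theorem Scheme.opRem_zero (J : ℕ) (h t x) : S.opRem J h t (fun _ : Rd d => (0 : ℝ)) x = 0 := by
  simp [Scheme.opRem, wordRem, clDir_of_eq_zero]

/-- The symmetry of `Λ₁` and `q` at all times. -/
def Scheme.QEven (S : Scheme d) : Prop :=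
  ∀ v ∈ S.Λ₁, -v ∈ S.Λ₁ ∧ ∀ t x, S.q (-v) t x = S.q v t x

/-- The antisymmetry of `p` at all times. -/
def Scheme.PAnti (S : Scheme d) : Prop := ∀ v ∈ S.Λ₁, ∀ t x, S.p (-v) t x = -S.p v t x

theorem Scheme.QEven.sum_q (hS : S.QEven) {k : ℕ} (hk : Odd k) (t : ℝ) (φ : Rd d → ℝ) (x : Rd d) :
    ∑ v ∈ S.Λ₁, S.q v t x * clDir v k φ x = 0 :=
  sum_eq_zero_of_odd (fun v hv => (hS v hv).1) fun v hv => by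
    rw [(hS v hv).2, clDir_neg, hk.neg_one_pow]; ring

theorem Scheme.clOpI_of_odd (hS : S.QEven) (hp : S.PAnti) {i : ℕ} (hi : Odd i) (t : ℝ)
    (φ : Rd d → ℝ) (x : Rd d) : S.clOpI i t φ x = 0 := by
  have h2 : ∑ v ∈ S.Λ₁, S.p v t x * clDir v (i + 1) φ x = 0 :=
    sum_eq_zero_of_odd (fun v hv => (hS v hv).1) fun v hv => by
      rw [hp v hv, clDir_neg, hi.add_one.neg_one_pow]; ring
  rw [Scheme.clOpI, hS.sum_q (hi.add_even even_two), h2]; simp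

/-- The number `a` of derivatives that are lost at each step. -/
def StepLoss (S : Scheme d) (a : ℕ) : Prop := a = 3 ∨ (a = 2 ∧ S.QEven)

/-- A bound for the operators `ℒ^{(i)}` and the remainders of the expansion of `L_h`. -/
noncomputable def opBound (d m : ℕ) (A Mb : ℝ) : ℝ := 2 ^ m * Mb * (2 * (d * |A| + 1) ^ (m + 3))

theorem opBound_nonneg (hMb : 0 ≤ Mb) : 0 ≤ opBound d m A Mb := by unfold opBound; positivity

theorem le_opBound (hMb : 0 ≤ Mb) {n p p' : ℕ} (hn : n ≤ m) (hp : p ≤ m + 3) (hp' : p' ≤ m + 3) :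
    2 ^ n * Mb * ((d * |A|) ^ p + (d * |A|) ^ p') ≤ opBound d m A Mb := by
  have h0 : 0 ≤ d * |A| := by positivity
  have key : ∀ p ≤ m + 3, (d * |A|) ^ p ≤ (d * |A| + 1) ^ (m + 3) := fun p hp =>
    (pow_le_pow_left₀ h0 (by linarith) p).trans (pow_le_pow_right₀ (by linarith) hp)
  have h1 := key p hp
  have h2 := key p' hp'
  have h3 : (2 : ℝ) ^ n ≤ 2 ^ m := pow_le_pow_right₀ (by norm_num) hn
  unfold opBound
  gcongr
  linarith

theorem RoughHyp.measurable_clOpI (H : RoughHyp S τ τ₀ h₀ δ K c₀ A B Mb m) {i a n : ℕ} {D : ℝ}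
    (ha : StepLoss S a) (hi : 1 ≤ i) {u : ℝ → Rd d → ℝ} (hn : 1 ≤ n) (hu : TB (n + a * i) D u) :
    Measurable (Function.uncurry fun t x => S.clOpI i t (u t) x) := by
  have h2 : Measurable (fun z : ℝ × Rd d => ∑ v ∈ S.Λ₁, S.p v z.1 z.2 * clDir v (i + 1) (u z.1) z.2) :=
    Finset.measurable_sum (f := fun v (z : ℝ × Rd d) => S.p v z.1 z.2 * clDir v (i + 1) (u z.1) z.2)
      _ fun v hv => (H.p_meas v hv).mul
      ((hu.mono (n' := 1 + (i + 1)) (by rcases ha with rfl | ⟨rfl, -⟩ <;> omega) le_rfl).clDir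
        le_rfl v).meas
  refine Measurable.add (Measurable.const_mul ?_ _) (h2.const_mul _)
  by_cases ho : a = 2 ∧ Odd i
  · rcases ha with rfl | ⟨rfl, hS⟩
    · omega
    · simp only [hS.sum_q (ho.2.add_even even_two)]
      exact measurable_const
  · refine Finset.measurable_sum
      (f := fun v (z : ℝ × Rd d) => S.q v z.1 z.2 * clDir v (i + 2) (u z.1) z.2)
      _ fun v hv => (H.q_meas v hv).mul ((hu.mono (n' := 1 + (i + 2)) ?_ le_rfl).clDir
        le_rfl v).meas
    rcases ha with rfl | ⟨rfl, -⟩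
    · omega
    · have : ¬ Odd i := fun h => ho ⟨rfl, h⟩
      have : i ≠ 1 := by rintro rfl; exact this odd_one
      omega

theorem RoughHyp.tb_clOpI (H : RoughHyp S τ τ₀ h₀ δ K c₀ A B Mb m) {i a n : ℕ} {D : ℝ}
    (ha : StepLoss S a) (hi : 1 ≤ i) (him : i ≤ m) (hnm : n ≤ m) {u : ℝ → Rd d → ℝ} (hn : 1 ≤ n)
    (hu : TB (n + a * i) D u) :
    TB n (opBound d m A Mb * D) (fun t => S.clOpI i t (u t)) := by
  refine ⟨H.measurable_clOpI ha hi hn hu, fun t => ?_⟩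
  have hMb : 0 ≤ Mb := (H.c_bd 0).nonneg
  have hD : 0 ≤ D := (hu.lb 0).nonneg
  have hq : ∀ v ∈ S.Λ₁, LB n Mb (S.q v t) := fun v hv => (H.q_lb v hv t).mono hnm le_rfl
  have hp : ∀ v ∈ S.Λ₁, LB n Mb (S.p v t) := fun v hv => (H.p_lb v hv t).mono hnm le_rfl
  have hb := le_opBound (d := d) (A := A) hMb hnm (p := i + 2) (p' := i + 1) (by omega) (by omega)
  obtain ⟨e, rfl⟩ : ∃ e, i = e + 1 := ⟨i - 1, by omega⟩
  by_cases ho : a = 2 ∧ Odd (e + 1)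
  · rcases ha with rfl | ⟨rfl, hS⟩
    · omega
    · have h2 : LB n (2 ^ n * Mb * (|A| ^ (e + 2) * (d ^ (e + 1 + 1) * D)))
          (fun x => ∑ v ∈ S.Λ₁, S.p v t x * FDExpansion.clDir v (e + 1 + 1) (u t) x) :=
        LB.sum_mul H.size (by positivity) hMb hp fun v _ =>
          (((hu.lb t).mono (n' := n + (e + 1 + 1)) (by omega) le_rfl).clDir hn v).mono le_rfl
            (le_of_eq (by rw [mul_pow]; ring))
      have a2 : |1 / (((e + 1 : ℕ) : ℝ) + 1)| ≤ 1 := by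
        rw [abs_of_nonneg (by positivity), div_le_one (by positivity)]
        linarith [(Nat.cast_nonneg (e + 1) : (0 : ℝ) ≤ ((e + 1 : ℕ) : ℝ))]
      have e1 : S.clOpI (e + 1) t (u t) = fun x => 1 / (((e + 1 : ℕ) : ℝ) + 1)
          * ∑ v ∈ S.Λ₁, S.p v t x * FDExpansion.clDir v (e + 1 + 1) (u t) x := by
        funext x
        rw [Scheme.clOpI, hS.sum_q (ho.2.add_even even_two)]; simp
      rw [e1]
      refine (h2.const_mul_le a2).mono le_rfl ?_
      calc 1 * (2 ^ n * Mb * (|A| ^ (e + 2) * (d ^ (e + 1 + 1) * D)))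
          = 2 ^ n * Mb * (0 + (d * |A|) ^ (e + 1 + 1)) * D := by rw [mul_pow]; ring
        _ ≤ 2 ^ n * Mb * ((d * |A|) ^ (e + 1 + 2) + (d * |A|) ^ (e + 1 + 1)) * D := by
            have : 0 ≤ (d * |A|) ^ (e + 1 + 2) := by positivity
            gcongr
        _ ≤ _ := mul_le_mul_of_nonneg_right hb hD
  · refine ((hu.lb t).mono (n' := n + (e + 1 + 2)) ?_ le_rfl).clOpI H.size hMb hq hp hn rfl |>.mono
      le_rfl (mul_le_mul_of_nonneg_right hb hD)
    rcases ha with rfl | ⟨rfl, -⟩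
    · omega
    · have : ¬ Odd (e + 1) := fun h => ho ⟨rfl, h⟩
      have : e + 1 ≠ 1 := fun h => this (by rw [h]; exact odd_one)
      omega

/-- The right-hand side of the equation for the `j`-th coefficient. -/
noncomputable def coefRHS (S : Scheme d) (f : ℝ → Rd d → ℝ) (U : ℕ → ℝ → Rd d → ℝ) (j : ℕ) (t : ℝ)
    (x : Rd d) : ℝ :=
  (if j = 0 then f t x else 0)
    + ∑ i ∈ Finset.Icc 1 j, (j.choose i : ℝ) * S.clOpI i t (U (j - i) t) x

theorem coefRHS_congr {f : ℝ → Rd d → ℝ} {U V : ℕ → ℝ → Rd d → ℝ} {j : ℕ}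
    (h : ∀ i < j, U i = V i) : coefRHS S f U j = coefRHS S f V j := by
  funext t x
  unfold coefRHS
  congr 1
  refine Finset.sum_congr rfl fun i hi => ?_
  rw [Finset.mem_Icc] at hi
  rw [h (j - i) (by omega)]

/-- Bounds for the coefficients of the expansion. -/
noncomputable def coefBound (X : ℝ) : ℕ → ℝ
  | 0 => X
  | j + 1 => 2 ^ (j + 1) * X * coefBound X j

theorem one_le_coefBound {X : ℝ} (hX : 1 ≤ X) (j : ℕ) : 1 ≤ coefBound X j := by
  induction j with
  | zero => exact hX
  | succ j ih =>
    exact one_le_mul_of_one_le_of_one_le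
      (one_le_mul_of_one_le_of_one_le (one_le_pow₀ (by norm_num)) hX) ih

theorem coefBound_mono {X : ℝ} (hX : 1 ≤ X) : Monotone (coefBound X) :=
  monotone_nat_of_le_succ fun j =>
    le_mul_of_one_le_left (zero_le_one.trans (one_le_coefBound hX j))
      (one_le_mul_of_one_le_of_one_le (one_le_pow₀ (by norm_num)) hX)

/-- `U j` is the `j`-th coefficient of the expansion of the solutions. -/
structure IsCoef (S : Scheme d) (T : ℝ) (f : ℝ → Rd d → ℝ) (g : Rd d → ℝ) (n : ℕ) (D : ℝ)
    (U : ℕ → ℝ → Rd d → ℝ) (j : ℕ) : Prop where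
  tb : TB n D (U j)
  eqn : ∀ t x, U j t x = (if j = 0 then g x else 0)
    + tint T (fun s x => S.clOp s (U j s) x + coefRHS S f U j s x) t x
  odd : S.QEven → S.PAnti → Odd j → U j = fun _ _ => 0
  tb_three : ∃ D', TB 3 D' (U j)
  tb_rhs : ∃ n' D', TB n' D' (coefRHS S f U j)

theorem IsCoef.congr {T : ℝ} {f : ℝ → Rd d → ℝ} {g : Rd d → ℝ} {n : ℕ} {D : ℝ}
    {U V : ℕ → ℝ → Rd d → ℝ} {j : ℕ} (h : IsCoef S T f g n D U j) (hUV : ∀ i ≤ j, U i = V i) :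
    IsCoef S T f g n D V j := by
  refine ⟨hUV j le_rfl ▸ h.tb, fun t x => ?_, fun h1 h2 h3 => hUV j le_rfl ▸ h.odd h1 h2 h3,
    hUV j le_rfl ▸ h.tb_three, coefRHS_congr (fun i hi => hUV i hi.le) ▸ h.tb_rhs⟩
  rw [← coefRHS_congr fun i hi => hUV i hi.le, ← hUV j le_rfl]
  exact h.eqn t x

theorem RoughHyp.intervalIntegrable_clOp (H : RoughHyp S τ τ₀ h₀ δ K c₀ A B Mb m) {n n' : ℕ}
    {D D' : ℝ} {u F : ℝ → Rd d → ℝ} (hn : 3 ≤ n) (hu : TB n D u) (hF : TB n' D' F) (t : ℝ) (x : Rd d) :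
    IntervalIntegrable (fun s => S.clOp s (u s) x + F s x) volume 0 t :=
  intervalIntegrable_of_bound
    (((H.measurable_clOp hn hu).comp measurable_prodMk_right).add (hF.meas.comp measurable_prodMk_right))
    (fun s => (abs_add_le _ _).trans (add_le_add (H.abs_clOp_le ((hu.lb s).mono hn le_rfl) x)
      (hF.bound s x))) 0 t

theorem IsCoef.int (H : RoughHyp S τ τ₀ h₀ δ K c₀ A B Mb m) {T : ℝ} {f : ℝ → Rd d → ℝ} {g : Rd d → ℝ}
    {n : ℕ} {D : ℝ} {U : ℕ → ℝ → Rd d → ℝ} {j : ℕ} (h : IsCoef S T f g n D U j) (t : ℝ) (x : Rd d) :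
    IntervalIntegrable (fun s => S.clOp s (U j s) x + coefRHS S f U j s x) volume 0 t := by
  obtain ⟨D', hD'⟩ := h.tb_three
  obtain ⟨n', D'', hD''⟩ := h.tb_rhs
  exact H.intervalIntegrable_clOp le_rfl hD' hD'' t x

theorem TB_zero (n : ℕ) {D : ℝ} (hD : 0 ≤ D) : TB n D (fun _ (_ : Rd d) => (0 : ℝ)) :=
  ⟨measurable_const, fun _ => (LB_zero n).mono le_rfl hD⟩

/-- An a priori estimate for solutions of smooth finite difference equations. -/
def Estimate (d : ℕ) (τ₀ δ K c₀ A B Mb : ℝ) (m n : ℕ) (N : ℝ) : Prop :=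
  ∀ (S : Scheme d) (τ : Rd d → ℝ) (h : ℝ),
    SmoothHyp S τ τ₀ h δ K c₀ A B Mb m → ∀ (T : ℝ) (F u : ℝ → Rd d → ℝ) (g : Rd d → ℝ)
      (D : ℝ), 0 ≤ T → STS F → Sm g → (∀ t, DB n D (F t)) → DB n D g → STS u →
      (∀ t x, u t x = g x + tint T (fun s x => S.Lh h s (u s) x + F s x) t x) →
      ∀ t, DB n (N * D) (u t)

theorem RoughHyp.tb_coefRHS (H : RoughHyp S τ τ₀ h₀ δ K c₀ A B Mb m) {a j : ℕ} {D X T : ℝ}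
    (ha : StepLoss S a) (hD : 0 ≤ D) (hX : 1 ≤ X) {f : ℝ → Rd d → ℝ} {g : Rd d → ℝ}
    {U : ℕ → ℝ → Rd d → ℝ} (hj : 1 ≤ j) (hjm : a * j + 1 ≤ m)
    (hU : ∀ i < j, IsCoef S T f g (m - a * i) (coefBound X i * D) U i) :
    TB (m - a * j) (2 ^ j * opBound d m A Mb * coefBound X (j - 1) * D) (coefRHS S f U j) := by
  have hMb : 0 ≤ Mb := (H.c_bd 0).nonneg
  have hop : 0 ≤ opBound d m A Mb := opBound_nonneg hMb
  have hjj : j ≤ a * j := Nat.le_mul_of_pos_left j (by rcases ha with rfl | ⟨rfl, -⟩ <;> omega)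
  have h1 : ∀ i ∈ Finset.Icc 1 j, TB (m - a * j)
      ((j.choose i : ℝ) * (opBound d m A Mb * (coefBound X (j - 1) * D)))
      (fun t x => (j.choose i : ℝ) * S.clOpI i t (U (j - i) t) x) := fun i hi => by
    rw [Finset.mem_Icc] at hi
    have hij : a * j = a * (j - i) + a * i := by rw [← mul_add]; congr 1; omega
    have h2 := (H.tb_clOpI ha hi.1 (by omega) (by omega) (n := m - a * j) (by omega)
      ((hU (j - i) (by omega)).tb.mono (n' := m - a * j + a * i) (by omega)
        (mul_le_mul_of_nonneg_right (coefBound_mono hX (by omega : j - i ≤ j - 1)) hD))).const_mul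
        (j.choose i : ℝ)
    rwa [abs_of_nonneg (by positivity)] at h2
  have h3 := TB.sum (Finset.Icc 1 j) h1
  have e : coefRHS S f U j = fun t x => ∑ i ∈ Finset.Icc 1 j,
      (j.choose i : ℝ) * S.clOpI i t (U (j - i) t) x := by
    funext t x; rw [coefRHS, if_neg (by omega), zero_add]
  rw [e]
  refine h3.mono le_rfl ?_
  rw [← Finset.sum_mul]
  have h4 : ∑ i ∈ Finset.Icc 1 j, (j.choose i : ℝ) ≤ 2 ^ j := by
    have : ∑ i ∈ Finset.range (j + 1), (j.choose i : ℝ) = 2 ^ j := by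
      exact_mod_cast Nat.sum_range_choose j
    rw [← this]
    exact Finset.sum_le_sum_of_subset_of_nonneg (fun i hi => by
      rw [Finset.mem_Icc] at hi; rw [Finset.mem_range]; omega) fun _ _ _ => by positivity
  have h5 := zero_le_one.trans (one_le_coefBound hX (j - 1))
  calc _ ≤ 2 ^ j * (opBound d m A Mb * (coefBound X (j - 1) * D)) := by gcongr
    _ = _ := by ring

theorem coefRHS_of_odd (hS : S.QEven) (hp : S.PAnti) {f : ℝ → Rd d → ℝ} {U : ℕ → ℝ → Rd d → ℝ}
    {j : ℕ} (hj : Odd j) (hU : ∀ i < j, Odd i → U i = fun _ _ => 0) :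
    coefRHS S f U j = fun _ _ => 0 := by
  funext t x
  rw [coefRHS, if_neg hj.pos.ne', zero_add]
  refine Finset.sum_eq_zero fun i hi => ?_
  rw [Finset.mem_Icc] at hi
  rcases Nat.even_or_odd i with he | ho
  · rw [hU (j - i) (by omega) (Nat.Odd.sub_even hi.2 hj he), S.clOpI_zero, mul_zero]
  · rw [S.clOpI_of_odd hS hp ho, mul_zero]

theorem RoughHyp.exists_coef (H : RoughHyp S τ τ₀ h₀ δ K c₀ A B Mb m) (hm : 3 ≤ m)
    (hc₀ : 0 < c₀) (hh₀ : 0 < h₀) {N X T D : ℝ}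
    (hest : ∀ n ≤ m, Estimate d τ₀ δ K c₀ A B Mb m n N) (hX : 1 ≤ X) (hNX : N ≤ X)
    (hNX' : N * opBound d m A Mb ≤ X) (hT : 0 ≤ T) {f : ℝ → Rd d → ℝ} {g : Rd d → ℝ}
    (hf : TB m D f) (hg : LB m D g) {a k : ℕ} (ha : StepLoss S a)
    (hk : ∀ j ≤ k, a * j + 3 ≤ m ∨ (Odd j ∧ S.QEven ∧ S.PAnti)) :
    ∃ U : ℕ → ℝ → Rd d → ℝ, ∀ j ≤ k, IsCoef S T f g (m - a * j) (coefBound X j * D) U j := by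
  have hD := hg.nonneg
  induction k with
  | zero =>
    obtain ⟨u, hu, hue⟩ := H.exists_limit_solution hm hc₀ hh₀ hm (hest m le_rfl) hT hf hg
    refine ⟨fun _ => u, fun j hj => ?_⟩
    obtain rfl : j = 0 := by omega
    have e : coefRHS S f (fun _ => u) 0 = f := by funext t x; simp [coefRHS]
    refine ⟨hu.mono (by simp) (mul_le_mul_of_nonneg_right hNX hD), fun t x => ?_, fun _ _ h => ?_,
      ⟨_, hu.mono hm le_rfl⟩, ⟨m, D, by rwa [e]⟩⟩
    · simpa [e] using hue t x
    · exact absurd h (by simp)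
  | succ k ih =>
    obtain ⟨U, hU⟩ := ih fun j hj => hk j (by omega)
    have main : ∃ u : ℝ → Rd d → ℝ, TB (m - a * (k + 1)) (coefBound X (k + 1) * D) u ∧
        (∀ t x, u t x = tint T (fun s x => S.clOp s (u s) x + coefRHS S f U (k + 1) s x) t x) ∧
        (S.QEven → S.PAnti → Odd (k + 1) → u = fun _ _ => 0) ∧
        (∃ D', TB 3 D' u) ∧ ∃ n' D', TB n' D' (coefRHS S f U (k + 1)) := by
      have hCD : 0 ≤ coefBound X (k + 1) * D :=
        mul_nonneg (zero_le_one.trans (one_le_coefBound hX _)) hD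
      by_cases hodd : Odd (k + 1) ∧ S.QEven ∧ S.PAnti
      · have := coefRHS_of_odd hodd.2.1 hodd.2.2 (f := f) hodd.1 fun i hi ho =>
          (hU i (by omega)).odd hodd.2.1 hodd.2.2 ho
        refine ⟨fun _ _ => 0, TB_zero _ hCD, fun t x => ?_, fun _ _ _ => rfl,
          ⟨0, TB_zero 3 le_rfl⟩, ⟨0, 0, this ▸ TB_zero 0 le_rfl⟩⟩
        simp only [this, S.clOp_zero, tint, add_zero, intervalIntegral.integral_zero]
      · have hkm : a * (k + 1) + 3 ≤ m := (hk (k + 1) le_rfl).resolve_right hodd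
        have hF := H.tb_coefRHS ha hD hX (T := T) (f := f) (g := g) (U := U) (j := k + 1)
          (by omega) (by omega) fun i hi => hU i (by omega)
        obtain ⟨u, hu, hue⟩ := H.exists_limit_solution hm hc₀ hh₀ (n := m - a * (k + 1)) (by omega)
          (hest _ (by omega)) hT hF ((LB_zero _).mono le_rfl (hF.lb 0).nonneg)
        refine ⟨u, hu.mono le_rfl ?_, fun t x => by simpa using hue t x,
          fun h1 h2 h3 => absurd ⟨h3, h1, h2⟩ hodd,
          ⟨_, hu.mono (by omega) le_rfl⟩, ⟨_, _, hF⟩⟩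
        have h5 := zero_le_one.trans (one_le_coefBound hX k)
        calc N * (2 ^ (k + 1) * opBound d m A Mb * coefBound X (k + 1 - 1) * D)
            = 2 ^ (k + 1) * (N * opBound d m A Mb) * coefBound X k * D := by
              rw [Nat.add_sub_cancel]; ring
          _ ≤ 2 ^ (k + 1) * X * coefBound X k * D := by gcongr
          _ = _ := rfl
    obtain ⟨u, hu, hue, huo, hu3, hur⟩ := main
    refine ⟨Function.update U (k + 1) u, fun j hj => ?_⟩
    have hlt : ∀ i ≤ k, U i = Function.update U (k + 1) u i := fun i hi =>
      (Function.update_of_ne (by omega) _ _).symm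
    rcases Nat.lt_or_ge j (k + 1) with hj' | hj'
    · exact (hU j (by omega)).congr fun i hi => hlt i (by omega)
    · obtain rfl : j = k + 1 := by omega
      refine ⟨by rwa [Function.update_self], fun t x => ?_, by rwa [Function.update_self],
        by rwa [Function.update_self], by rwa [← coefRHS_congr fun i hi => hlt i (by omega)]⟩
      rw [Function.update_self, ← coefRHS_congr fun i hi => hlt i (by omega)]
      simpa using hue t x

end Coefficients


/-! ### The remainder of the expansion -/

theorem abs_clampT_sub_le (T s t : ℝ) : |clampT T t - clampT T s| ≤ |t - s| := by
  unfold clampT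
  rw [max_comm 0, max_comm 0]
  refine (abs_max_sub_max_le_abs _ _ _).trans ((abs_min_sub_min_le_max t T s T).trans ?_)
  simp

theorem abs_tint_sub_le {T C : ℝ} {F : ℝ → Rd d → ℝ} {x : Rd d}
    (hi : ∀ t, IntervalIntegrable (fun s => F s x) volume 0 t) (hb : ∀ s, |F s x| ≤ C) (s t : ℝ) :
    |tint T F t x - tint T F s x| ≤ C * |t - s| := by
  have hC : 0 ≤ C := (abs_nonneg _).trans (hb 0)
  rw [tint, tint, intervalIntegral.integral_interval_sub_left (hi _) (hi _), ← Real.norm_eq_abs]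
  exact (intervalIntegral.norm_integral_le_of_norm_le_const fun r _ => hb r).trans
    (mul_le_mul_of_nonneg_left (abs_clampT_sub_le T s t) hC)

theorem TB.continuous_pds {n : ℕ} {D L : ℝ} {u : ℝ → Rd d → ℝ} (hu : TB n D u)
    (hL : ∀ s t x, |u t x - u s x| ≤ L * |t - s|) (w : List (Fin d)) (hw : w.length < n) :
    Continuous fun z : ℝ × Rd d => FDExpansion.pds w (u z.1) z.2 := by
  rw [continuous_iff_continuousAt]
  rintro ⟨t, x⟩
  rw [Metric.continuousAt_iff']
  intro ε hε
  obtain ⟨η, hη, H⟩ := LB.close (d := d) n D (half_pos (half_pos hε))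
  have h1 : ∀ᶠ z : ℝ × Rd d in 𝓝 (t, x), L * |z.1 - t| < η := by
    have : Continuous (fun z : ℝ × Rd d => L * |z.1 - t|) := by fun_prop
    have := this.tendsto (t, x)
    simp only [sub_self, abs_zero, mul_zero] at this
    exact this.eventually_lt_const hη
  have hc : Continuous (FDExpansion.pds w (u t)) :=
    ((hu.lb t).pds (k := 1) w le_rfl (by omega)).continuous
  have h2 : ∀ᶠ z : ℝ × Rd d in 𝓝 (t, x),
      dist (FDExpansion.pds w (u t) z.2) (FDExpansion.pds w (u t) x) < ε / 2 :=
    (Metric.continuousAt_iff'.1 (hc.comp continuous_snd).continuousAt) (ε / 2) (half_pos hε)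
  filter_upwards [h1, h2] with z hz1 hz2
  have h3 := H (u z.1) (u t) (hu.lb _) (hu.lb _) (fun y => (hL t z.1 y).trans hz1.le) w hw z.2
  rw [← Real.dist_eq] at h3
  have := dist_triangle (FDExpansion.pds w (u z.1) z.2) (FDExpansion.pds w (u t) z.2)
    (FDExpansion.pds w (u t) x)
  linarith

section Remainder

variable {S : Scheme d} {τ : Rd d → ℝ} {τ₀ h₀ δ K c₀ A B Mb : ℝ} {m : ℕ}

theorem Scheme.Lh_const_mul {h t a : ℝ} (hh : h ≠ 0) (φ : Rd d → ℝ) (x : Rd d) :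
    S.Lh h t (fun x => a * φ x) x = a * S.Lh h t φ x := by
  rw [S.Lh_eq hh, S.Lh_eq hh, mul_sub, Finset.mul_sum]
  congr 1
  · exact Finset.sum_congr rfl fun v _ => by ring
  · ring

theorem Scheme.Lh_sum {h t : ℝ} (hh : h ≠ 0) {ι : Type*} (s : Finset ι) (a : ι → ℝ)
    (φ : ι → Rd d → ℝ) (x : Rd d) :
    S.Lh h t (fun x => ∑ j ∈ s, a j * φ j x) x = ∑ j ∈ s, a j * S.Lh h t (φ j) x := by
  have e1 : ∀ j, a j * S.Lh h t (φ j) x = ∑ v ∈ S.Λ₁, S.rate h v t x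
      * (a j * φ j (x + h • v) - a j * φ j x) - S.c t x * (a j * φ j x) := fun j => by
    rw [S.Lh_eq hh, mul_sub, Finset.mul_sum]
    congr 1
    · exact Finset.sum_congr rfl fun v _ => by ring
    · ring
  simp_rw [e1]
  rw [S.Lh_eq hh, Finset.sum_sub_distrib, Finset.sum_comm, ← Finset.mul_sum]
  congr 1
  refine Finset.sum_congr rfl fun v _ => ?_
  rw [← Finset.mul_sum, Finset.sum_sub_distrib]

theorem TB.wordRem {n N : ℕ} {D h : ℝ} {u : ℝ → Rd d → ℝ} (hu : TB (n + N) D u)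
    (v : Rd d) : Measurable (Function.uncurry fun t => wordRem N h v (u t)) := by
  have h1 : Measurable fun z : ℝ × Rd d => u z.1 (z.2 + h • v) :=
    hu.meas.comp (f := fun z : ℝ × Rd d => (z.1, z.2 + h • v))
      (measurable_fst.prodMk (measurable_snd.add_const _))
  refine h1.sub (Finset.measurable_sum
    (f := fun i (z : ℝ × Rd d) => h ^ i / (i.factorial : ℝ) * FDExpansion.clDir v i (u z.1) z.2) _
    fun i hi => Measurable.const_mul ?_ _)
  have := Finset.mem_range.1 hi
  exact ((hu.mono (n' := 1 + i) (by omega) le_rfl).clDir le_rfl v).meas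

theorem RoughHyp.tb_opRem (H : RoughHyp S τ τ₀ h₀ δ K c₀ A B Mb m) {l J : ℕ} {D h : ℝ}
    (hlJ : l + J ≤ m) (hh : 0 < h) {u : ℝ → Rd d → ℝ} (hu : TB (l + (J + 3)) D u) :
    TB l (h ^ (J + 1) * (opBound d m A Mb * D)) (fun t => S.opRem J h t (u t)) := by
  have hMb : 0 ≤ Mb := (H.c_bd 0).nonneg
  refine ⟨Measurable.add ?_ ?_, fun t => ?_⟩
  · exact (Finset.measurable_sum
      (f := fun v (z : ℝ × Rd d) => S.q v z.1 z.2 * FDExpansion.wordRem (J + 3) h v (u z.1) z.2) _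
      fun v hv => (H.q_meas v hv).mul (hu.wordRem v)).const_mul _
  · exact (Finset.measurable_sum
      (f := fun v (z : ℝ × Rd d) => S.p v z.1 z.2 * FDExpansion.wordRem (J + 2) h v (u z.1) z.2) _
      fun v hv => (H.p_meas v hv).mul
        ((hu.mono (n' := l + (J + 2)) (by omega) le_rfl).wordRem v)).const_mul _
  · refine ((hu.lb t).opRem H.size hMb (fun v hv => (H.q_lb v hv t).mono (by omega) le_rfl)
      (fun v hv => (H.p_lb v hv t).mono (by omega) le_rfl) hh).mono le_rfl ?_
    have := le_opBound (d := d) (A := A) hMb (n := l) (m := m) (p := J + 3) (p' := J + 2)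
      (by omega) (by omega) (by omega)
    have hD := (hu.lb 0).nonneg
    gcongr

theorem sum_coef_eq {f : ℝ → Rd d → ℝ} {U : ℕ → ℝ → Rd d → ℝ} (h t : ℝ) (x : Rd d) (k : ℕ) :
    ∑ j ∈ Finset.range (k + 1), h ^ j / (j.factorial : ℝ) *
        (S.clOp t (U j t) x + coefRHS S f U j t x)
      = f t x + ∑ j ∈ Finset.range (k + 1), h ^ j / (j.factorial : ℝ) *
        (∑ i ∈ Finset.range (k - j + 1), h ^ i / (i.factorial : ℝ) * S.clOpI i t (U j t) x
          - S.c t x * U j t x) := by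
  set φ : ℕ → ℕ → ℝ := fun b i => h ^ b / (b.factorial : ℝ) * (h ^ i / (i.factorial : ℝ)
    * S.clOpI i t (U b t) x) with hφ
  have e1 : ∀ j, h ^ j / (j.factorial : ℝ) * (S.clOp t (U j t) x + coefRHS S f U j t x)
      = (if j = 0 then f t x else 0) + ∑ b ∈ Finset.range (j + 1), φ b (j - b)
        - h ^ j / (j.factorial : ℝ) * (S.c t x * U j t x) := fun j => by
    have a1 : ∑ b ∈ Finset.range (j + 1), φ b (j - b)
        = ∑ i ∈ Finset.range (j + 1), h ^ j / (j.factorial : ℝ)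
          * ((j.choose i : ℝ) * S.clOpI i t (U (j - i) t) x) := by
      rw [← Finset.sum_flip]
      refine Finset.sum_congr rfl fun i hi => ?_
      have hij : i ≤ j := Nat.lt_succ_iff.1 (Finset.mem_range.1 hi)
      rw [hφ]
      simp only
      rw [Nat.sub_sub_self hij, Nat.cast_choose ℝ hij, ← mul_assoc, ← mul_assoc]
      congr 1
      have f1 : (i.factorial : ℝ) ≠ 0 := by positivity
      have f2 : ((j - i).factorial : ℝ) ≠ 0 := by positivity
      have f3 : (j.factorial : ℝ) ≠ 0 := by positivity
      have : h ^ j = h ^ (j - i) * h ^ i := by rw [← pow_add, Nat.sub_add_cancel hij]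
      rw [this]
      field_simp
    have a2 : Finset.range (j + 1) = insert 0 (Finset.Icc 1 j) := by
      ext i; simp only [Finset.mem_range, Finset.mem_insert, Finset.mem_Icc]; omega
    rw [a1, ← Finset.mul_sum, a2, Finset.sum_insert (by simp), coefRHS, Scheme.clOp]
    simp only [Nat.choose_zero_right, Nat.cast_one, one_mul, Nat.sub_zero]
    split_ifs with hj
    · subst hj; simp; ring
    · ring
  have e2 : ∑ j ∈ Finset.range (k + 1), ∑ b ∈ Finset.range (j + 1), φ b (j - b)
      = ∑ j ∈ Finset.range (k + 1), ∑ i ∈ Finset.range (k - j + 1), φ j i := by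
    rw [Finset.sum_range_diag_flip]
    refine Finset.sum_congr rfl fun j hj => ?_
    have := Finset.mem_range.1 hj
    rw [show k + 1 - j = k - j + 1 by omega]
  simp only [e1, Finset.sum_sub_distrib, Finset.sum_add_distrib, e2, mul_sub]
  simp only [Finset.sum_ite_eq', Finset.mem_range, Nat.zero_lt_succ, if_true, hφ, Finset.mul_sum]
  ring

/-- The remainder `r_h` of the expansion of `u` in powers of `h`. -/
noncomputable def expRem (U : ℕ → ℝ → Rd d → ℝ) (k : ℕ) (h : ℝ) (u : ℝ → Rd d → ℝ) (t : ℝ)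
    (x : Rd d) : ℝ :=
  h⁻¹ ^ (k + 1) * (u t x - ∑ j ∈ Finset.range (k + 1), h ^ j / (j.factorial : ℝ) * U j t x)

theorem RoughHyp.expRem_eqn (H : RoughHyp S τ τ₀ h₀ δ K c₀ A B Mb m) {h T D E : ℝ} (hh : 0 < h)
    {f u : ℝ → Rd d → ℝ} {g : Rd d → ℝ} {U : ℕ → ℝ → Rd d → ℝ} {n : ℕ} {e : ℕ → ℕ} {C : ℕ → ℝ}
    (hf : TB n D f) (hu : TB n E u)
    (hue : ∀ t x, u t x = g x + tint T (fun s x => S.Lh h s (u s) x + f s x) t x) {k : ℕ}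
    (hU : ∀ j ≤ k, IsCoef S T f g (e j) (C j) U j) :
    (∀ t x, expRem U k h u t x = 0 + tint T (fun s x => S.Lh h s (expRem U k h u s) x
      + ∑ j ∈ Finset.range (k + 1), h⁻¹ ^ (k + 1) *
        (h ^ j / (j.factorial : ℝ) * S.opRem (k - j) h s (U j s) x)) t x) ∧
    ∀ t x, IntervalIntegrable (fun s => S.Lh h s (expRem U k h u s) x
      + ∑ j ∈ Finset.range (k + 1), h⁻¹ ^ (k + 1) *
        (h ^ j / (j.factorial : ℝ) * S.opRem (k - j) h s (U j s) x)) volume 0 t := by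
  have hi0 : ∀ t x, IntervalIntegrable (fun s => S.Lh h s (u s) x + f s x) volume 0 t := fun t x =>
    intervalIntegrable_of_bound
      (((measurable_Lh hh.ne' H.q_meas H.p_meas H.c_meas hu.meas).comp measurable_prodMk_right).add
        (hf.meas.comp measurable_prodMk_right))
      (fun s => (abs_add_le _ _).trans (add_le_add (H.abs_Lh_le hh (hu.lb s).bound)
        (hf.bound s x))) 0 _
  have hij : ∀ j ∈ Finset.range (k + 1), ∀ t x, IntervalIntegrable (fun s =>
      h ^ j / (j.factorial : ℝ) * (S.clOp s (U j s) x + coefRHS S f U j s x)) volume 0 t :=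
    fun j hj t x => ((hU j (Nat.lt_succ_iff.1 (Finset.mem_range.1 hj))).int H t x).const_mul _
  have key : ∀ x, (fun s => S.Lh h s (expRem U k h u s) x
      + ∑ j ∈ Finset.range (k + 1), h⁻¹ ^ (k + 1) *
        (h ^ j / (j.factorial : ℝ) * S.opRem (k - j) h s (U j s) x))
      = fun s => h⁻¹ ^ (k + 1) * ((S.Lh h s (u s) x + f s x)
        - ∑ j ∈ Finset.range (k + 1), h ^ j / (j.factorial : ℝ) *
          (S.clOp s (U j s) x + coefRHS S f U j s x)) := fun x => by
    funext s
    have e1 : expRem U k h u s = fun x => h⁻¹ ^ (k + 1) * (u s x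
      - ∑ j ∈ Finset.range (k + 1), h ^ j / (j.factorial : ℝ) * U j s x) := rfl
    rw [e1, S.Lh_const_mul hh.ne', S.Lh_sub, S.Lh_sum hh.ne', sum_coef_eq, ← Finset.mul_sum,
      ← mul_add]
    congr 1
    have e2 : ∀ j, S.Lh h s (U j s) x - S.opRem (k - j) h s (U j s) x
        = ∑ i ∈ Finset.range (k - j + 1), h ^ i / (i.factorial : ℝ) * S.clOpI i s (U j s) x
          - S.c s x * U j s x := fun j => by
      rw [S.Lh_expansion hh.ne' (fun i => H.q_zero s x i) (k - j)]; ring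
    simp only [← e2, mul_sub, Finset.sum_sub_distrib]
    ring
  have hisum : ∀ t x, IntervalIntegrable (fun s => ∑ j ∈ Finset.range (k + 1),
      h ^ j / (j.factorial : ℝ) * (S.clOp s (U j s) x + coefRHS S f U j s x)) volume 0 t :=
    fun t x => by
      have := IntervalIntegrable.sum (Finset.range (k + 1)) fun j hj => hij j hj t x
      refine this.congr_ae (Eventually.of_forall fun s => ?_)
      simp only [Finset.sum_apply]
  refine ⟨fun t x => ?_, fun t x => ?_⟩
  · rw [tint, key, intervalIntegral.integral_const_mul, intervalIntegral.integral_sub (hi0 _ x)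
      (hisum _ x), intervalIntegral.integral_finsetSum fun j hj => hij j hj _ x, expRem, zero_add,
      hue t x, tint]
    congr 1
    have e3 : ∑ j ∈ Finset.range (k + 1), h ^ j / (j.factorial : ℝ) * U j t x
        = g x + ∑ j ∈ Finset.range (k + 1), ∫ s in (0 : ℝ)..clampT T t,
          h ^ j / (j.factorial : ℝ) * (S.clOp s (U j s) x + coefRHS S f U j s x) := by
      have e4 : ∀ j ∈ Finset.range (k + 1), h ^ j / (j.factorial : ℝ) * U j t x
          = (if j = 0 then g x else 0) + ∫ s in (0 : ℝ)..clampT T t,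
            h ^ j / (j.factorial : ℝ) * (S.clOp s (U j s) x + coefRHS S f U j s x) := fun j hj => by
        rw [(hU j (Nat.lt_succ_iff.1 (Finset.mem_range.1 hj))).eqn t x,
          intervalIntegral.integral_const_mul, tint, mul_add]
        congr 1
        split_ifs with h0
        · subst h0; simp
        · ring
      rw [Finset.sum_congr rfl e4, Finset.sum_add_distrib]
      simp
    rw [e3]
    ring
  · rw [key]
    exact ((hi0 t x).sub (hisum t x)).const_mul _

theorem RoughHyp.expRem_bound (H : RoughHyp S τ τ₀ h₀ δ K c₀ A B Mb m) (hm : 3 ≤ m) (hc₀ : 0 < c₀)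
    {h T N X D E : ℝ} (hest : ∀ n ≤ m, Estimate d τ₀ δ K c₀ A B Mb m n N) (hX : 1 ≤ X) (hT : 0 ≤ T)
    (hh : h ∈ Ioc 0 h₀) {f u : ℝ → Rd d → ℝ} {g : Rd d → ℝ} {U : ℕ → ℝ → Rd d → ℝ} {k l a : ℕ}
    (hf : TB m D f) (hu : TB m E u)
    (hue : ∀ t x, u t x = g x + tint T (fun s x => S.Lh h s (u s) x + f s x) t x)
    (hU : ∀ j ≤ k, IsCoef S T f g (m - a * j) (coefBound X j * D) U j)
    (hl : l + 1 ≤ m)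
    (hord : ∀ j ≤ k, a * j + (l + (k - j + 3)) ≤ m ∨ U j = fun _ _ => 0) :
    (∀ t, ContDiff ℝ l (u t)) ∧ (∀ j ≤ k, ∀ t, ContDiff ℝ l (U j t)) ∧
      (∀ t, ContDiff ℝ l (expRem U k h u t)) ∧
      ∀ t ∈ Icc (0 : ℝ) T, ∀ w : List (Fin d), w.length ≤ l → ∀ x,
        |pds w (expRem U k h u t) x|
          ≤ max N (1 / c₀) * ((k + 1) * (opBound d m A Mb * coefBound X k)) * D := by
  have hMb : 0 ≤ Mb := (H.c_bd 0).nonneg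
  have hop : 0 ≤ opBound d m A Mb := opBound_nonneg hMb
  have hD : 0 ≤ D := (hf.lb 0).nonneg
  have hh0 := hh.1
  have hcu : ∀ t, ContDiff ℝ l (u t) := fun t => ((hu.lb t).mono hl le_rfl).contDiff
  have hcU : ∀ j ≤ k, ∀ t, ContDiff ℝ l (U j t) := fun j hj t => by
    rcases hord j hj with h1 | h1
    · exact (((hU j hj).tb.lb t).mono (n' := l + 1) (by omega) le_rfl).contDiff
    · rw [h1]; exact contDiff_const
  have hcr : ∀ t, ContDiff ℝ l (expRem U k h u t) := fun t =>
    contDiff_const.mul ((hcu t).sub (ContDiff.sum fun j hj => contDiff_const.mul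
      (hcU j (Nat.lt_succ_iff.1 (Finset.mem_range.1 hj)) t)))
  refine ⟨hcu, hcU, hcr, ?_⟩
  obtain ⟨heq, hint⟩ := H.expRem_eqn hh0 hf hu hue hU
  set G : ℝ → Rd d → ℝ := fun s x => ∑ j ∈ Finset.range (k + 1), h⁻¹ ^ (k + 1) *
        (h ^ j / (j.factorial : ℝ) * S.opRem (k - j) h s (U j s) x) with hG
  set E' : ℝ := (k + 1) * (opBound d m A Mb * coefBound X k) * D with hE'
  have hE0 : 0 ≤ E' := by
    have := zero_le_one.trans (one_le_coefBound hX k); positivity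
  have hGtb : TB l E' G := by
    have h1 : ∀ j ∈ Finset.range (k + 1), TB l (opBound d m A Mb * coefBound X k * D)
        (fun s x => h⁻¹ ^ (k + 1) * (h ^ j / (j.factorial : ℝ) * S.opRem (k - j) h s (U j s) x)) :=
      fun j hj => by
        have hjk : j ≤ k := Nat.lt_succ_iff.1 (Finset.mem_range.1 hj)
        have hck := zero_le_one.trans (one_le_coefBound hX k)
        have hcj := zero_le_one.trans (one_le_coefBound hX j)
        rcases hord j hjk with h1 | h1
        · have h2 := ((H.tb_opRem (l := l) (J := k - j) (by omega) hh0
            ((hU j hjk).tb.mono (by omega) le_rfl)).const_mul (h ^ j / (j.factorial : ℝ))).const_mul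
            (h⁻¹ ^ (k + 1))
          refine h2.mono le_rfl ?_
          rw [abs_of_nonneg (by positivity), abs_of_nonneg (by positivity)]
          have e1 : h ^ (k + 1) = h ^ j * h ^ (k - j + 1) := by
            rw [← pow_add]; congr 1; omega
          have e2 : h⁻¹ ^ (k + 1) * (h ^ j / (j.factorial : ℝ) * (h ^ (k - j + 1) *
              (opBound d m A Mb * (coefBound X j * D))))
              = (opBound d m A Mb * (coefBound X j * D)) / (j.factorial : ℝ) := by
            rw [inv_pow, e1]; field_simp
          rw [e2]
          refine (div_le_self (by positivity)
            (by exact_mod_cast Nat.one_le_iff_ne_zero.2 j.factorial_ne_zero)).trans ?_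
          rw [mul_assoc]
          have := coefBound_mono hX hjk
          gcongr
        · have e1 : (fun s x => h⁻¹ ^ (k + 1) * (h ^ j / (j.factorial : ℝ)
              * S.opRem (k - j) h s (U j s) x)) = fun _ _ => 0 := by
            funext s x; rw [h1, S.opRem_zero]; simp
          rw [e1]; exact TB_zero l (by positivity)
    refine (TB.sum _ h1).mono le_rfl (le_of_eq ?_)
    rw [Finset.sum_const, Finset.card_range, nsmul_eq_mul, hE']; push_cast; ring
  have hbd : ∃ C, ∀ t ∈ Icc (0 : ℝ) T, ∀ x, |expRem U k h u t x| ≤ C := by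
    refine ⟨|h⁻¹ ^ (k + 1)| * (E + ∑ j ∈ Finset.range (k + 1), |h ^ j / (j.factorial : ℝ)|
      * (coefBound X j * D)), fun t _ x => ?_⟩
    rw [expRem, abs_mul]
    refine mul_le_mul_of_nonneg_left ((abs_sub _ _).trans (add_le_add (hu.bound t x) ?_))
      (abs_nonneg _)
    refine (Finset.abs_sum_le_sum_abs _ _).trans (Finset.sum_le_sum fun j hj => ?_)
    rw [abs_mul]
    exact mul_le_mul_of_nonneg_left
      ((hU j (Nat.lt_succ_iff.1 (Finset.mem_range.1 hj))).tb.bound t x) (abs_nonneg _)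
  have heq' : ∀ t ∈ Icc (0 : ℝ) T, ∀ x, expRem U k h u t x
      = 0 + ∫ s in (0 : ℝ)..t, (S.Lh h s (expRem U k h u s) x + G s x) := fun t ht x => by
    have := heq t x
    rwa [tint, clampT_of_mem ht] at this
  intro t ht w hw x
  have hqb : ∀ v ∈ S.Λ₁, ∀ t ∈ Icc (0 : ℝ) T, ∀ x, |S.q v t x| ≤ Mb := fun v hv t _ x =>
    (H.q_lb v hv t).bound x
  have hpb : ∀ v ∈ S.Λ₁, ∀ t ∈ Icc (0 : ℝ) T, ∀ x, |S.p v t x| ≤ Mb := fun v hv t _ x =>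
    (H.p_lb v hv t).bound x
  rcases Nat.eq_zero_or_pos l with rfl | hl0
  · obtain rfl : w = [] := List.length_eq_zero_iff.1 (by omega)
    obtain ⟨C, hC⟩ := hbd
    have := fd_stability (S := S) (w₀ := fun _ => 0) (a := 0) (b := E') hh0 hc₀ le_rfl hE0 hqb hpb
      (fun v hv t _ x => H.chi_nonneg h hh v hv t x) (fun t _ x => H.c_le t x) hC
      (fun t _ x => hint t x) heq' (fun x => by simp) (fun t _ x => hGtb.bound t x) t ht x
    refine this.trans ?_
    rw [zero_add, mul_assoc, div_eq_inv_mul, ← one_div]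
    exact mul_le_mul_of_nonneg_right (le_max_right _ _) hE0
  · obtain ⟨r, hr, hre⟩ := H.exists_solution hm hc₀ hl0 (hest l (by omega)) hh hT hGtb
      ((LB_zero l).mono le_rfl hE0)
    have hrfd := H.isFDSolution (T := T) hh0 hGtb hr hre
    have hefd : S.IsFDSolution T h G (fun _ => 0) (expRem U k h u) :=
      ⟨hbd, fun t ht x => ⟨hint t x, heq' t ht x⟩⟩
    have huniq := fd_unique hh0 hc₀ hqb hpb (fun v hv t _ x => H.chi_nonneg h hh v hv t x)
      (fun t _ x => H.c_le t x) hrfd hefd t ht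
    have hlb : LB l (N * E') (expRem U k h u t) := by rw [funext huniq]; exact hr.lb t
    refine (hlb.pds_bound (hcr t) w hw x).trans ?_
    rw [mul_assoc]
    exact mul_le_mul_of_nonneg_right (le_max_left _ _) hE0

end Remainder


/-! ### Generalized derivatives -/

theorem IsTest.mul_left {η φ : Rd d → ℝ} (hη : IsTest η) (hφ : ContDiff ℝ ∞ φ) :
    IsTest (fun x => φ x * η x) := ⟨hφ.mul hη.1, hη.2.mul_left⟩

theorem IsTest.integrable {η : Rd d → ℝ} (hη : IsTest η) : Integrable η volume :=
  hη.1.continuous.integrable_of_hasCompactSupport hη.2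

theorem integral_mul_pds_test {ψ η : Rd d → ℝ} (hψ : Sm ψ) (hη : IsTest η) (w : List (Fin d)) :
    ∫ x, ψ x * pds w η x = (-1) ^ w.length * ∫ x, pds w ψ x * η x := by
  induction w generalizing ψ with
  | nil => simp [pds]
  | cons i w ih =>
    have h1 : ∫ x, ψ x * pds (i :: w) η x = -∫ x, pderiv i ψ x * pds w η x :=
      integral_mul_fderiv_eq_neg_fderiv_mul_of_integrable
        ((hη.pds w).mul_left (hψ.pderiv i).1).integrable
        (((hη.pds w).pderiv i).mul_left hψ.1).integrable
        ((hη.pds w).mul_left hψ.1).integrable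
        (fun x _ => hψ.differentiable x) (fun x _ => (hη.pds w).sm.differentiable x)
    rw [h1, ih (hψ.pderiv i), pds_pderiv hψ.1, pds_cons, List.length_cons, pow_succ]
    ring

theorem tendsto_integral_mul_of_unif {φ ζ : Rd d → ℝ} {ψ : ℕ → Rd d → ℝ} {C : ℝ}
    (hm : ∀ k, Continuous (ψ k)) (hb : ∀ k x, |ψ k x| ≤ C) (h : TendstoUniformly ψ φ atTop)
    (hζ : Integrable ζ volume) :
    Tendsto (fun k => ∫ x, ψ k x * ζ x) atTop (𝓝 (∫ x, φ x * ζ x)) := by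
  refine tendsto_integral_of_dominated_convergence (fun x => C * ‖ζ x‖)
    (fun k => (hm k).aestronglyMeasurable.mul hζ.aestronglyMeasurable) (hζ.norm.const_mul C)
    (fun k => Eventually.of_forall fun x => ?_)
    (Eventually.of_forall fun x => (h.tendsto_at x).mul_const _)
  rw [norm_mul]
  exact mul_le_mul_of_nonneg_right (hb k x) (norm_nonneg _)

theorem LB.integral_mul_pds_test {n : ℕ} {C : ℝ} {φ η : Rd d → ℝ} (h : LB n C φ) (hη : IsTest η)
    (w : List (Fin d)) (hw : w.length < n) :
    ∫ x, φ x * FDExpansion.pds w η x = (-1) ^ w.length * ∫ x, FDExpansion.pds w φ x * η x := by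
  obtain ⟨ψ, h1, h2, h3⟩ := h.exists_seq
  have a1 := tendsto_integral_mul_of_unif (fun k => (h1 k).continuous) (fun k => (h2 k).bound) h3
    (hη.pds w).integrable
  have a2 := (tendsto_integral_mul_of_unif (fun k => ((h1 k).pds w).continuous)
    (fun k x => h2 k w hw.le x) (tendstoUniformly_pds h1 h2 h3 w hw) hη.integrable).const_mul
    ((-1) ^ w.length)
  refine tendsto_nhds_unique a1 (a2.congr fun k => ?_)
  exact (FDExpansion.integral_mul_pds_test (h1 k) hη w).symm

theorem multiDeriv_count {η : Rd d → ℝ} (hη : ContDiff ℝ ∞ η) (w : List (Fin d)) :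
    multiDeriv (fun i => w.count i) η = pds w η := by
  rw [multiDeriv_eq_pds, ← pds_perm hη (perm_wordOf w)]

theorem LB.hasWeakDeriv {n : ℕ} {C : ℝ} {φ : Rd d → ℝ} (h : LB n C φ) (w : List (Fin d))
    (hw : w.length < n) : HasWeakDeriv (fun i => w.count i) φ (FDExpansion.pds w φ) := by
  refine ⟨((h.pds (k := 1) w le_rfl (by omega)).continuous).locallyIntegrable, fun η hη => ?_⟩
  rw [multiDeriv_count hη.1, h.integral_mul_pds_test hη w hw, order_count]

theorem HasWeakDeriv.ae_eq {α : Fin d → ℕ} {φ w w' : Rd d → ℝ} (h : HasWeakDeriv α φ w)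
    (h' : HasWeakDeriv α φ w') : w =ᵐ[volume] w' := by
  refine ae_eq_of_integral_contDiff_smul_eq h.1 h'.1 fun η h1 h2 => ?_
  have a1 := h.2 η ⟨h1, h2⟩
  have a2 := h'.2 η ⟨h1, h2⟩
  rw [a1] at a2
  have := mul_left_cancel₀ (pow_ne_zero _ (by norm_num : (-1 : ℝ) ≠ 0)) a2
  simpa only [smul_eq_mul, mul_comm] using this

theorem hasWeakDeriv_weakDeriv {α : Fin d → ℕ} {φ w : Rd d → ℝ} (h : HasWeakDeriv α φ w) :
    HasWeakDeriv α φ (weakDeriv α φ) := by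
  have hex : ∃ w, HasWeakDeriv α φ w := ⟨w, h⟩
  rw [weakDeriv, dif_pos hex]
  exact hex.choose_spec

theorem HasWeakDeriv.weakDeriv_ae_eq {α : Fin d → ℕ} {φ w : Rd d → ℝ} (h : HasWeakDeriv α φ w) :
    weakDeriv α φ =ᵐ[volume] w := (hasWeakDeriv_weakDeriv h).ae_eq h

theorem locallyIntegrable_of_bound {φ : Rd d → ℝ} {C : ℝ} (hm : AEStronglyMeasurable φ volume)
    (hb : ∀ᵐ x, |φ x| ≤ C) : LocallyIntegrable φ volume :=
  (locallyIntegrable_const C).mono hm (hb.mono fun x hx => by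
    rw [Real.norm_eq_abs, Real.norm_eq_abs]; exact hx.trans (le_abs_self C))

theorem LB.lipschitz {n : ℕ} {C : ℝ} {φ : Rd d → ℝ} (h : LB (n + 1) C φ) :
    LipschitzWith (d * C).toNNReal φ :=
  LipschitzWith.of_dist_le' fun x y => by
    rw [Real.dist_eq, dist_eq_norm]
    have := h.increment y (x - y)
    rw [add_sub_cancel] at this
    exact this.trans (le_of_eq (by ring))

theorem LB.exists_hasWeakDeriv {n : ℕ} {C : ℝ} {φ : Rd d → ℝ} (h : LB (n + 1) C φ)
    {α : Fin d → ℕ} (hα : order α ≤ n + 1) :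
    ∃ w, HasWeakDeriv α φ w ∧ ∀ᵐ x, |w x| ≤ (d + 1) * C := by
  have hC := h.nonneg
  have e : (fun i => (wordOf α).count i) = α := funext (count_wordOf α)
  rcases hα.lt_or_eq with hlt | heq
  · have hw : (wordOf α).length < n + 1 := by rwa [length_wordOf]
    refine ⟨FDExpansion.pds (wordOf α) φ, ?_, Eventually.of_forall fun x => ?_⟩
    · have := h.hasWeakDeriv (wordOf α) hw
      rwa [e] at this
    · refine ((h.pds (k := 1) (wordOf α) le_rfl (by omega)).bound x).trans ?_
      nlinarith [(Nat.cast_nonneg d : (0 : ℝ) ≤ d)]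
  · rw [← length_wordOf] at heq
    obtain ⟨i, w, hiw⟩ : ∃ i w, wordOf α = i :: w := by
      cases hc : wordOf α with
      | nil => rw [hc] at heq; simp at heq
      | cons i w => exact ⟨i, w, rfl⟩
    have hwl : w.length < n + 1 := by rw [hiw] at heq; simp at heq; omega
    have hψ : LB 1 C (FDExpansion.pds w φ) := h.pds w le_rfl (by omega)
    have hLip := LB.lipschitz (n := 0) hψ
    have hbd : ∀ x, |lineDeriv ℝ (FDExpansion.pds w φ) x (bvec i)| ≤ (d + 1) * C := fun x => by
      have := norm_lineDeriv_le_of_lipschitz (𝕜 := ℝ) (x₀ := x) (v := bvec i) hLip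
      rw [Real.norm_eq_abs, PiLp.norm_single, norm_one, mul_one,
        Real.coe_toNNReal _ (by positivity)] at this
      linarith
    refine ⟨fun x => lineDeriv ℝ (FDExpansion.pds w φ) x (bvec i),
      ⟨locallyIntegrable_of_bound (measurable_lineDeriv hψ.continuous).aestronglyMeasurable
        (Eventually.of_forall hbd), fun η hη => ?_⟩, Eventually.of_forall hbd⟩
    obtain ⟨L, hL⟩ := ContDiff.lipschitzWith_of_hasCompactSupport hη.2 hη.1 (by simp)
    rw [multiDeriv_eq_pds, hiw, pds_cons, ← pds_pderiv hη.1, h.integral_mul_pds_test (hη.pderiv i) w hwl,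
      hLip.integral_lineDeriv_mul_eq hL hη.2, ← length_wordOf, hiw, List.length_cons, pow_succ,
      mul_assoc, neg_one_mul, ← integral_neg]
    congr 1
    refine integral_congr_ae (Eventually.of_forall fun x => ?_)
    simp only
    rw [(hη.sm.differentiable x).lineDeriv_eq_fderiv, map_neg, FDExpansion.pderiv]
    ring

theorem card_filter_eq_count {k : ℕ} (ι : Fin k → Fin d) (i : Fin d) :
    (Finset.univ.filter fun j => ι j = i).card = (List.ofFn ι).count i := by
  induction k with
  | zero => simp
  | succ k ih =>
    rw [Fin.card_filter_univ_succ, List.ofFn_succ, List.count_cons, ← ih fun j => ι j.succ]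
    by_cases h : ι 0 = i <;> simp [h]

theorem weakDirDeriv_eq (v : Rd d) (k : ℕ) (φ : Rd d → ℝ) (x : Rd d) :
    weakDirDeriv v k φ x = ∑ ι : Fin k → Fin d, (∏ j, v (ι j)) *
      weakDeriv (fun i => (List.ofFn ι).count i) φ x := by
  simp only [weakDirDeriv, card_filter_eq_count]

theorem LB.weakDirDeriv {n k : ℕ} {C : ℝ} {φ : Rd d → ℝ} (h : LB n C φ) (hk : k < n) (v : Rd d) :
    FDExpansion.weakDirDeriv v k φ =ᵐ[volume] FDExpansion.clDir v k φ := by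
  have h1 : ∀ ι : Fin k → Fin d, ∀ᵐ x, weakDeriv (fun i => (List.ofFn ι).count i) φ x
      = FDExpansion.pds (List.ofFn ι) φ x := fun ι =>
    (h.hasWeakDeriv (List.ofFn ι) (by simpa using hk)).weakDeriv_ae_eq
  filter_upwards [ae_all_iff.2 h1] with x hx
  rw [weakDirDeriv_eq, FDExpansion.clDir]
  exact Finset.sum_congr rfl fun ι _ => by rw [hx]

theorem weakDirDeriv_neg (v : Rd d) (k : ℕ) (φ : Rd d → ℝ) (x : Rd d) :
    weakDirDeriv (-v) k φ x = (-1) ^ k * weakDirDeriv v k φ x := by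
  rw [weakDirDeriv, weakDirDeriv, Finset.mul_sum]
  refine Finset.sum_congr rfl fun ι _ => ?_
  simp only [PiLp.neg_apply, Finset.prod_neg, Finset.card_univ, Fintype.card_fin]
  ring

section WeakOperators

variable {S : Scheme d}

theorem ae_sum_mul_weakDirDeriv {n k : ℕ} {C : ℝ} {φ : Rd d → ℝ} (h : LB n C φ) (hk : k < n)
    (a : Rd d → Rd d → ℝ) : ∀ᵐ x, ∑ v ∈ S.Λ₁, a v x * FDExpansion.weakDirDeriv v k φ x
      = ∑ v ∈ S.Λ₁, a v x * clDir v k φ x := by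
  have h1 : ∀ v : S.Λ₁, ∀ᵐ x, FDExpansion.weakDirDeriv v.1 k φ x = clDir v.1 k φ x := fun v =>
    h.weakDirDeriv hk v.1
  filter_upwards [ae_all_iff.2 h1] with x hx
  exact Finset.sum_congr rfl fun v hv => by rw [hx ⟨v, hv⟩]

theorem LB.limitOp {n : ℕ} {C t : ℝ} {φ : Rd d → ℝ} (h : LB n C φ) (hn : 3 ≤ n) :
    S.limitOp t φ =ᵐ[volume] S.clOp t φ := by
  filter_upwards [ae_sum_mul_weakDirDeriv (S := S) h (k := 2) (by omega) fun v => S.q v t,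
    ae_sum_mul_weakDirDeriv (S := S) h (k := 1) (by omega) fun v => S.p v t] with x h1 h2
  rw [Scheme.limitOp, h1, h2, Scheme.clOp, Scheme.clOpI]
  norm_num

theorem Scheme.QEven.sum_q_weak (hS : S.QEven) {k : ℕ} (hk : Odd k) (t : ℝ) (φ : Rd d → ℝ)
    (x : Rd d) : ∑ v ∈ S.Λ₁, S.q v t x * weakDirDeriv v k φ x = 0 :=
  sum_eq_zero_of_odd (fun v hv => (hS v hv).1) fun v hv => by
    rw [(hS v hv).2, weakDirDeriv_neg, hk.neg_one_pow]; ring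

theorem LB.limitOpI {i a n : ℕ} {C t : ℝ} {φ : Rd d → ℝ} (ha : StepLoss S a) (hi : 1 ≤ i)
    (hn : 1 ≤ n) (h : LB (n + a * i) C φ) : S.limitOpI i t φ =ᵐ[volume] S.clOpI i t φ := by
  have hp := ae_sum_mul_weakDirDeriv (S := S) h (k := i + 1)
    (by rcases ha with rfl | ⟨rfl, -⟩ <;> omega) fun v => S.p v t
  by_cases ho : a = 2 ∧ Odd i
  · rcases ha with rfl | ⟨rfl, hS⟩
    · omega
    · filter_upwards [hp] with x h2
      rw [Scheme.limitOpI, Scheme.clOpI, hS.sum_q (ho.2.add_even even_two),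
        hS.sum_q_weak (ho.2.add_even even_two), h2]
  · have hlt : i + 2 < n + a * i := by
      rcases ha with rfl | ⟨rfl, -⟩
      · omega
      · have : ¬ Odd i := fun h => ho ⟨rfl, h⟩
        have : i ≠ 1 := by rintro rfl; exact this odd_one
        omega
    filter_upwards [hp, ae_sum_mul_weakDirDeriv (S := S) h hlt fun v => S.q v t] with x h2 h1
    rw [Scheme.limitOpI, Scheme.clOpI, h1, h2]

end WeakOperators


/-! ### The limit equation in the sense of generalized functions -/

theorem abs_integral_mul_test_le {η φ : Rd d → ℝ} {C : ℝ} (hη : IsTest η) (hb : ∀ᵐ x, |φ x| ≤ C) :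
    |∫ x, η x * φ x| ≤ C * ∫ x, |η x| := by
  rw [← Real.norm_eq_abs, ← integral_const_mul]
  refine norm_integral_le_of_norm_le (hη.integrable.abs.const_mul C) ?_
  filter_upwards [hb] with x hx
  rw [norm_mul, Real.norm_eq_abs, Real.norm_eq_abs, mul_comm]
  exact mul_le_mul_of_nonneg_right hx (abs_nonneg _)

theorem IsTest.integrable_mul {η φ : Rd d → ℝ} {C : ℝ} (hη : IsTest η)
    (hm : AEStronglyMeasurable φ volume) (hb : ∀ᵐ x, |φ x| ≤ C) :
    Integrable (fun x => η x * φ x) volume :=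
  hη.integrable.mul_bdd hm (hb.mono fun x hx => by rwa [Real.norm_eq_abs])

theorem measurable_integral_test {G : ℝ → Rd d → ℝ} (hG : Measurable (Function.uncurry G))
    {η : Rd d → ℝ} (hη : IsTest η) : Measurable fun s => ∫ x, η x * G s x := by
  have h1 : Measurable (Function.uncurry fun (s : ℝ) x => η x * G s x) :=
    (hη.1.continuous.measurable.comp measurable_snd).mul hG
  exact (StronglyMeasurable.integral_prod_right (ν := volume) h1.stronglyMeasurable).measurable

theorem intervalIntegrable_integral_test {G : ℝ → Rd d → ℝ} (hG : Measurable (Function.uncurry G))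
    {C : ℝ} (hb : ∀ s x, |G s x| ≤ C) {η : Rd d → ℝ} (hη : IsTest η) (a b : ℝ) :
    IntervalIntegrable (fun s => ∫ x, η x * G s x) volume a b :=
  intervalIntegrable_of_bound (measurable_integral_test hG hη)
    (fun s => abs_integral_mul_test_le hη (Eventually.of_forall (hb s))) a b

theorem integral_test_intervalIntegral {G : ℝ → Rd d → ℝ} (hG : Measurable (Function.uncurry G))
    {C : ℝ} (hb : ∀ s x, |G s x| ≤ C) {η : Rd d → ℝ} (hη : IsTest η) (t : ℝ) :
    ∫ x, η x * ∫ s in (0 : ℝ)..t, G s x = ∫ s in (0 : ℝ)..t, ∫ x, η x * G s x := by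
  have hfin : IsFiniteMeasure (volume.restrict (uIoc 0 t)) :=
    ⟨by rw [Measure.restrict_apply_univ, uIoc]; exact measure_Ioc_lt_top⟩
  have h1 : Integrable (Function.uncurry fun s x => η x * G s x)
      ((volume.restrict (uIoc 0 t)).prod volume) := by
    have h2 : Integrable (fun z : ℝ × Rd d => (1 : ℝ) * η z.2)
        ((volume.restrict (uIoc 0 t)).prod volume) :=
      Integrable.mul_prod (f := fun _ : ℝ => (1 : ℝ)) (integrable_const 1) hη.integrable
    have h3 := h2.mul_bdd (c := C) hG.aestronglyMeasurable
      (Eventually.of_forall fun z => by rw [Real.norm_eq_abs]; exact hb z.1 z.2)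
    simpa [Function.uncurry_def] using h3
  rw [intervalIntegral_integral_swap h1]
  simp_rw [intervalIntegral.integral_const_mul]

section Weak

variable {S : Scheme d} {τ : Rd d → ℝ} {τ₀ h₀ δ K c₀ A B Mb : ℝ} {m : ℕ}

theorem IsCoef.weak_eqn {T : ℝ} {f : ℝ → Rd d → ℝ} {g : Rd d → ℝ} {n j : ℕ} {D : ℝ}
    {U : ℕ → ℝ → Rd d → ℝ} (h : IsCoef S T f g n D U j) (H : RoughHyp S τ τ₀ h₀ δ K c₀ A B Mb m)
    {n' : ℕ} {D' : ℝ} (hg : LB n' D' g) {η : Rd d → ℝ} (hη : IsTest η) {t : ℝ}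
    (ht : t ∈ Icc (0 : ℝ) T) :
    ∫ x, η x * U j t x = (∫ x, η x * if j = 0 then g x else 0) + ∫ s in (0 : ℝ)..t, ∫ x, η x *
      (S.limitOp s (U j s) x + coefRHS S f U j s x) := by
  obtain ⟨D₁, h3⟩ := h.tb_three
  obtain ⟨n₂, D₂, hr⟩ := h.tb_rhs
  have hm : Measurable (Function.uncurry fun s x => S.clOp s (U j s) x + coefRHS S f U j s x) :=
    (H.measurable_clOp le_rfl h3).add hr.meas
  have hb : ∀ s x, |S.clOp s (U j s) x + coefRHS S f U j s x| ≤ _ := fun s x =>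
    (abs_add_le _ _).trans (add_le_add (H.abs_clOp_le (h3.lb s) x) (hr.bound s x))
  have e1 : ∀ x, η x * U j t x = η x * (if j = 0 then g x else 0)
      + η x * ∫ s in (0 : ℝ)..t, (S.clOp s (U j s) x + coefRHS S f U j s x) := fun x => by
    rw [h.eqn t x, tint, clampT_of_mem ht, mul_add]
  have i1 : Integrable (fun x => η x * if j = 0 then g x else 0) := by
    split_ifs
    · exact hη.integrable_mul hg.continuous.aestronglyMeasurable (Eventually.of_forall hg.bound)
    · simp
  have i2 : Integrable (fun x => η x * U j t x) :=
    hη.integrable_mul (h3.lb t).continuous.aestronglyMeasurable (Eventually.of_forall (h3.lb t).bound)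
  have i3 : Integrable (fun x => η x * ∫ s in (0 : ℝ)..t,
      (S.clOp s (U j s) x + coefRHS S f U j s x)) :=
    (i2.sub i1).congr (Eventually.of_forall fun x => by
      simp only [Pi.sub_apply, e1]; ring)
  simp_rw [e1]
  rw [integral_add i1 i3, integral_test_intervalIntegral hm hb hη]
  congr 1
  refine intervalIntegral.integral_congr fun s _ => integral_congr_ae ?_
  filter_upwards [(h3.lb s).limitOp (S := S) (t := s) le_rfl] with x hx
  rw [hx]

/-! ### Uniqueness for the limit equation -/

/-- Measurable families of functions with two bounded generalized derivatives. -/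
structure WTwo (C : ℝ) (V : ℝ → Rd d → ℝ) : Prop where
  meas : Measurable (Function.uncurry V)
  cont : ∀ t, Continuous (V t)
  bd : ∀ t x, |V t x| ≤ C
  weak : ∀ t (w : List (Fin d)), w.length ≤ 2 →
    ∃ ζ, HasWeakDeriv (fun i => w.count i) (V t) ζ ∧ ∀ᵐ x, |ζ x| ≤ C

/-- A representative of the generalized derivative along a word. -/
noncomputable def wordDeriv (w : List (Fin d)) (φ : Rd d → ℝ) : Rd d → ℝ :=
  weakDeriv (fun i => w.count i) φ

theorem WTwo.hasWeakDeriv {C : ℝ} {V : ℝ → Rd d → ℝ} (h : WTwo C V) (t : ℝ) {w : List (Fin d)}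
    (hw : w.length ≤ 2) : HasWeakDeriv (fun i => w.count i) (V t) (wordDeriv w (V t)) ∧
      ∀ᵐ x, |wordDeriv w (V t) x| ≤ C := by
  obtain ⟨ζ, h1, h2⟩ := h.weak t w hw
  refine ⟨hasWeakDeriv_weakDeriv h1, ?_⟩
  filter_upwards [h1.weakDeriv_ae_eq, h2] with x hx hx2
  rw [wordDeriv, hx]; exact hx2

theorem WTwo.aestronglyMeasurable {C : ℝ} {V : ℝ → Rd d → ℝ} (h : WTwo C V) (t : ℝ)
    {w : List (Fin d)} (hw : w.length ≤ 2) : AEStronglyMeasurable (wordDeriv w (V t)) volume :=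
  (h.hasWeakDeriv t hw).1.1.aestronglyMeasurable

theorem HasWeakDeriv.sub {α : Fin d → ℕ} {φ ψ ζ ξ : Rd d → ℝ} (hφ : HasWeakDeriv α φ ζ)
    (hψ : HasWeakDeriv α ψ ξ) (hφc : Continuous φ) (hψc : Continuous ψ) :
    HasWeakDeriv α (fun x => φ x - ψ x) (fun x => ζ x - ξ x) := by
  refine ⟨hφ.1.sub hψ.1, fun η hη => ?_⟩
  have hm : IsTest (multiDeriv α η) := by rw [multiDeriv_eq_pds]; exact hη.pds _
  have key : ∀ {φ : Rd d → ℝ}, Continuous φ → Integrable (fun x => φ x * multiDeriv α η x) :=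
    fun hc => (hc.mul hm.1.continuous).integrable_of_hasCompactSupport hm.2.mul_left
  have key' : ∀ {ζ : Rd d → ℝ}, LocallyIntegrable ζ volume → Integrable (fun x => ζ x * η x) :=
    fun hc => by
      simpa [mul_comm] using hc.integrable_smul_left_of_hasCompactSupport hη.1.continuous hη.2
  simp_rw [sub_mul]
  rw [integral_sub (key hφc) (key hψc), integral_sub (key' hφ.1) (key' hψ.1), hφ.2 η hη, hψ.2 η hη]
  ring

theorem WTwo.sub {C C' : ℝ} {V W : ℝ → Rd d → ℝ} (h : WTwo C V) (h' : WTwo C' W) :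
    WTwo (C + C') (fun t x => V t x - W t x) := by
  refine ⟨h.meas.sub h'.meas, fun t => (h.cont t).sub (h'.cont t),
    fun t x => (abs_sub _ _).trans (add_le_add (h.bd t x) (h'.bd t x)), fun t w hw => ?_⟩
  obtain ⟨a1, a2⟩ := h.hasWeakDeriv t hw
  obtain ⟨b1, b2⟩ := h'.hasWeakDeriv t hw
  refine ⟨_, a1.sub b1 (h.cont t) (h'.cont t), ?_⟩
  filter_upwards [a2, b2] with x hx hx'
  exact (abs_sub _ _).trans (add_le_add hx hx')

theorem WTwo.wordDeriv_sub {C C' : ℝ} {V W : ℝ → Rd d → ℝ} (h : WTwo C V) (h' : WTwo C' W) (t : ℝ)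
    {w : List (Fin d)} (hw : w.length ≤ 2) : ∀ᵐ x, wordDeriv w (fun x => V t x - W t x) x
      = wordDeriv w (V t) x - wordDeriv w (W t) x :=
  ((h.hasWeakDeriv t hw).1.sub (h'.hasWeakDeriv t hw).1 (h.cont t) (h'.cont t)).weakDeriv_ae_eq

theorem WTwo.integrable {C : ℝ} {V : ℝ → Rd d → ℝ} (h : WTwo C V) {w : List (Fin d)}
    (hw : w.length ≤ 2) {M : ℝ} {b : Rd d → ℝ} (hb : LB 1 M b) {η : Rd d → ℝ} (hη : IsTest η)
    (t : ℝ) : Integrable (fun x => η x * (b x * wordDeriv w (V t) x)) := by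
  refine hη.integrable_mul (C := M * C)
    (hb.continuous.aestronglyMeasurable.mul (h.aestronglyMeasurable t hw)) ?_
  filter_upwards [(h.hasWeakDeriv t hw).2] with x hx
  rw [abs_mul]
  exact mul_le_mul (hb.bound x) hx (abs_nonneg _) hb.nonneg

theorem WTwo.abs_integral_le {C : ℝ} {V : ℝ → Rd d → ℝ} (h : WTwo C V) {w : List (Fin d)}
    (hw : w.length ≤ 2) {M : ℝ} {b : Rd d → ℝ} (hM : 0 ≤ M) (hb : ∀ x, |b x| ≤ M) {η : Rd d → ℝ}
    (hη : IsTest η) (t : ℝ) :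
    |∫ x, η x * (b x * wordDeriv w (V t) x)| ≤ M * C * ∫ x, |η x| := by
  refine abs_integral_mul_test_le hη ?_
  filter_upwards [(h.hasWeakDeriv t hw).2] with x hx
  rw [abs_mul]
  exact mul_le_mul (hb x) hx (abs_nonneg _) hM

theorem WTwo.measurable_integral {C : ℝ} {V : ℝ → Rd d → ℝ} (h : WTwo C V) {w : List (Fin d)}
    (hw : w.length ≤ 2) {M : ℝ} {b : ℝ → Rd d → ℝ} (hb : TB 1 M b) {η : Rd d → ℝ}
    (hη : IsTest η) : Measurable fun s => ∫ x, η x * (b s x * wordDeriv w (V s) x) := by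
  have hM : 0 ≤ M := (hb.lb 0).nonneg
  have hS : ∀ k, STS fun (s : ℝ) x => moll k (b s) x * η x := fun k =>
    (STS.moll hb.meas hb.bound k).mul (STS_const hη.sm)
  have hT : ∀ k s, IsTest fun x => moll k (b s) x * η x := fun k s =>
    hη.mul_left ((hb.lb s).sm_moll k).1
  have e1 : ∀ k s, ∫ x, η x * (moll k (b s) x * wordDeriv w (V s) x)
      = (-1) ^ w.length * ∫ x, pds w (fun x => moll k (b s) x * η x) x * V s x := fun k s => by
    have := (h.hasWeakDeriv s hw).1.2 _ (hT k s)
    rw [multiDeriv_count (hT k s).1, order_count] at this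
    have e2 : ∫ x, pds w (fun x => moll k (b s) x * η x) x * V s x
        = ∫ x, V s x * pds w (fun x => moll k (b s) x * η x) x := by simp_rw [mul_comm]
    rw [e2, this, ← mul_assoc, ← mul_pow]
    simp only [mul_neg, mul_one, neg_neg, one_pow, one_mul]
    refine integral_congr_ae (Eventually.of_forall fun x => ?_)
    simp only; ring
  have hmk : ∀ k, Measurable fun s => ∫ x, η x * (moll k (b s) x * wordDeriv w (V s) x) := fun k => by
    simp_rw [e1]
    refine Measurable.const_mul ?_ _
    exact (StronglyMeasurable.integral_prod_right (ν := volume)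
      (((hS k).pds w).meas.mul h.meas).stronglyMeasurable).measurable
  refine measurable_of_tendsto_metrizable hmk (tendsto_pi_nhds.2 fun s => ?_)
  have h0 : Tendsto (fun k : ℕ => d * M * C * (∫ x, |η x|) * (1 / ((k : ℝ) + 1))) atTop (𝓝 0) := by
    simpa using tendsto_one_div_add_atTop_nhds_zero_nat.const_mul (d * M * C * ∫ x, |η x|)
  rw [tendsto_iff_dist_tendsto_zero]
  refine squeeze_zero (fun _ => dist_nonneg) (fun k => ?_) h0
  rw [Real.dist_eq, ← integral_sub
    (h.integrable hw (((hb.lb s).db_moll k).lb ((hb.lb s).sm_moll k)) hη s)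
    (h.integrable hw (hb.lb s) hη s)]
  have e3 : ∀ x, η x * (moll k (b s) x * wordDeriv w (V s) x) - η x * (b s x * wordDeriv w (V s) x)
      = η x * ((moll k (b s) x - b s x) * wordDeriv w (V s) x) := fun x => by ring
  simp_rw [e3]
  refine (h.abs_integral_le hw (b := fun x => moll k (b s) x - b s x)
    (M := d * M / ((k : ℝ) + 1)) (by positivity) ((hb.lb s).moll_close k) hη s).trans (le_of_eq ?_)
  ring

theorem isTest_kern_sub (k : ℕ) (x : Rd d) : IsTest fun y => kern k (x - y) := by
  have e : (fun y => (kern k (x - y) : ℝ)) = fun y => kern k (y + -x) := funext fun y => by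
    rw [← kern_neg, neg_sub, sub_eq_add_neg]
  rw [e]
  exact ⟨((isTest_kern k).sm.translate _).1,
    (isTest_kern k).2.comp_homeomorph (Homeomorph.addRight (-x))⟩

theorem integral_kern_sub (k : ℕ) (x : Rd d) : ∫ y, |(kern k (x - y) : ℝ)| = 1 := by
  simp_rw [abs_of_nonneg (kern_nonneg k _)]
  rw [integral_sub_left_eq_self (fun y : Rd d => (kern k y : ℝ)) volume x, integral_kern]

theorem pds_kern_sub (k : ℕ) (x : Rd d) (w : List (Fin d)) (y : Rd d) :
    pds w (fun y => kern k (x - y)) y = (-1) ^ w.length * pds w (kern k) (x - y) := by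
  have e : (fun y => (kern k (x - y) : ℝ)) = fun y => (fun z => kern k (-z)) (y + -x) :=
    funext fun y => by simp only; congr 1; abel
  have e2 := pds_translate (fun z => kern k (-z)) (-x) w
  rw [e, e2, pds_comp_neg]
  simp only
  congr 2
  abel

theorem pds_moll_eq_of_weak {φ ζ : Rd d → ℝ} {C : ℝ} (hc : Continuous φ)
    (hb : ∀ x, |φ x| ≤ C) (w : List (Fin d)) (hw : HasWeakDeriv (fun i => w.count i) φ ζ)
    (k : ℕ) (x : Rd d) : pds w (moll k φ) x = ∫ y, kern k (x - y) * ζ y := by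
  have h1 := hw.2 _ (isTest_kern_sub k x)
  rw [multiDeriv_count (isTest_kern_sub k x).1, order_count] at h1
  simp_rw [pds_kern_sub] at h1
  rw [(moll_smooth hc.measurable hb k).2]
  have e1 : ∀ y, φ y * ((-1) ^ w.length * pds w (kern k) (x - y))
      = (-1) ^ w.length * (φ y * pds w (kern k) (x - y)) := fun y => by ring
  simp_rw [e1, integral_const_mul] at h1
  have h2 := mul_left_cancel₀ (pow_ne_zero _ (by norm_num : (-1 : ℝ) ≠ 0)) h1
  rw [h2]
  simp_rw [mul_comm]

theorem WTwo.abs_commutator_le {C : ℝ} {V : ℝ → Rd d → ℝ} (h : WTwo C V) {w : List (Fin d)}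
    (hw : w.length ≤ 2) {M : ℝ} {b : Rd d → ℝ} (hb : LB 1 M b) (t : ℝ) (k : ℕ) (x : Rd d) :
    |(∫ y, kern k (x - y) * (b y * wordDeriv w (V t) y)) - b x * pds w (moll k (V t)) x|
      ≤ d * M * C * (1 / ((k : ℝ) + 1)) := by
  have hk := isTest_kern_sub k x
  have hM := hb.nonneg
  rw [pds_moll_eq_of_weak (h.cont t) (h.bd t) w (h.hasWeakDeriv t hw).1, ← integral_const_mul,
    ← integral_sub (h.integrable hw hb hk t)
      ((hk.integrable_mul (h.aestronglyMeasurable t hw) (h.hasWeakDeriv t hw).2).const_mul _),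
    ← Real.norm_eq_abs]
  calc _ ≤ ∫ y, d * M * C * (1 / ((k : ℝ) + 1)) * |kern k (x - y)| := by
        refine norm_integral_le_of_norm_le (hk.integrable.abs.const_mul _) ?_
        filter_upwards [(h.hasWeakDeriv t hw).2] with y hy
        have e1 : kern k (x - y) * (b y * wordDeriv w (V t) y)
            - b x * (kern k (x - y) * wordDeriv w (V t) y)
            = (b y - b x) * wordDeriv w (V t) y * kern k (x - y) := by ring
        rw [e1, Real.norm_eq_abs, abs_mul]
        by_cases hyx : ‖x - y‖ ≤ 1 / ((k : ℝ) + 1)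
        · refine mul_le_mul_of_nonneg_right ?_ (abs_nonneg _)
          rw [abs_mul]
          have h1 := LB.increment (n := 0) hb x (y - x)
          rw [add_sub_cancel, norm_sub_rev] at h1
          have h2 : |b y - b x| ≤ d * M * (1 / ((k : ℝ) + 1)) :=
            h1.trans (by
              calc d * ‖x - y‖ * M = d * M * ‖x - y‖ := by ring
                _ ≤ _ := mul_le_mul_of_nonneg_left hyx (by positivity))
          refine (mul_le_mul h2 hy (abs_nonneg _) (by positivity)).trans (le_of_eq (by ring))
        · rw [kern_eq_zero (not_le.1 hyx)]; simp
    _ = _ := by rw [integral_const_mul, integral_kern_sub, mul_one]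

end Weak


/-! ### Uniqueness of weak solutions -/

section Uniqueness

variable {S : Scheme d} {τ : Rd d → ℝ} {τ₀ h₀ δ K c₀ A B Mb : ℝ} {m : ℕ}

/-- The terms of the operator `ℒ`. -/
abbrev OpTerm (S : Scheme d) : Type :=
  (S.Λ₁ × (Fin 2 → Fin d)) ⊕ ((S.Λ₁ × (Fin 1 → Fin d)) ⊕ Unit)

/-- The words of the derivatives in `ℒ`. -/
def opWord : OpTerm S → List (Fin d)
  | Sum.inl i => List.ofFn i.2
  | Sum.inr (Sum.inl i) => List.ofFn i.2
  | Sum.inr (Sum.inr _) => []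

/-- The coefficients of the terms of `ℒ`. -/
noncomputable def opCoef : OpTerm S → ℝ → Rd d → ℝ
  | Sum.inl i => fun t x => (1 / 2 * ∏ j, i.1.1 (i.2 j)) * S.q i.1.1 t x
  | Sum.inr (Sum.inl i) => fun t x => (∏ j, i.1.1 (i.2 j)) * S.p i.1.1 t x
  | Sum.inr (Sum.inr _) => fun t x => (-1) * S.c t x

theorem length_opWord (i : OpTerm S) : (opWord i).length ≤ 2 := by
  rcases i with i | i | i <;> simp [opWord]

theorem sum_opCoef (t : ℝ) (x : Rd d) (ξ : List (Fin d) → ℝ) :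
    ∑ i : OpTerm S, opCoef i t x * ξ (opWord i)
      = 1 / 2 * ∑ v ∈ S.Λ₁, S.q v t x * ∑ ι : Fin 2 → Fin d, (∏ j, v (ι j)) * ξ (List.ofFn ι)
        + ∑ v ∈ S.Λ₁, S.p v t x * ∑ ι : Fin 1 → Fin d, (∏ j, v (ι j)) * ξ (List.ofFn ι)
        - S.c t x * ξ [] := by
  rw [Fintype.sum_sum_type, Fintype.sum_sum_type, Fintype.sum_prod_type, Fintype.sum_prod_type,
    ← add_assoc, sub_eq_add_neg, Finset.mul_sum]
  rw [← Finset.sum_coe_sort S.Λ₁ fun v => 1 / 2 * (S.q v t x * ∑ ι : Fin 2 → Fin d,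
      (∏ j, v (ι j)) * ξ (List.ofFn ι)),
    ← Finset.sum_coe_sort S.Λ₁ fun v => S.p v t x * ∑ ι : Fin 1 → Fin d,
      (∏ j, v (ι j)) * ξ (List.ofFn ι)]
  congr 1
  · congr 1
    · refine Finset.sum_congr rfl fun v _ => ?_
      rw [Finset.mul_sum, Finset.mul_sum]
      refine Finset.sum_congr rfl fun ι _ => ?_
      simp only [opCoef, opWord]; ring
    · refine Finset.sum_congr rfl fun v _ => ?_
      rw [Finset.mul_sum]
      refine Finset.sum_congr rfl fun ι _ => ?_
      simp only [opCoef, opWord]; ring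
  · simp only [Finset.univ_unique, Finset.sum_singleton, opCoef, opWord]; ring

theorem clOp_eq_sum (t : ℝ) (φ : Rd d → ℝ) (x : Rd d) :
    S.clOp t φ x = ∑ i : OpTerm S, opCoef i t x * pds (opWord i) φ x := by
  rw [sum_opCoef t x fun w => pds w φ x]
  have e1 : (1 : ℝ) / ((((0 : ℕ) : ℝ) + 1) * (((0 : ℕ) : ℝ) + 2)) = 1 / 2 := by norm_num
  have e2 : (1 : ℝ) / (((0 : ℕ) : ℝ) + 1) = 1 := by norm_num
  rw [Scheme.clOp, Scheme.clOpI, e1, e2, one_mul]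
  rfl

theorem limitOp_eq_sum (t : ℝ) {φ : Rd d → ℝ} (hφ : Continuous φ) :
    ∀ᵐ x, S.limitOp t φ x = ∑ i : OpTerm S, opCoef i t x * wordDeriv (opWord i) φ x := by
  have h0 : HasWeakDeriv (fun i => ([] : List (Fin d)).count i) φ φ :=
    ⟨hφ.locallyIntegrable, fun η hη => by
      rw [multiDeriv_count hη.1, order_count]; simp [pds]⟩
  filter_upwards [h0.weakDeriv_ae_eq] with x hx
  rw [sum_opCoef t x fun w => wordDeriv w φ x]
  simp only [Scheme.limitOp, weakDirDeriv_eq, wordDeriv, hx]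

theorem RoughHyp.exists_opCoef (H : RoughHyp S τ τ₀ h₀ δ K c₀ A B Mb m) (hm : 1 ≤ m) (i : OpTerm S) :
    ∃ M, TB 1 M (opCoef i) := by
  rcases i with i | i | i
  · exact ⟨_, (TB.mk (H.q_meas _ i.1.2) fun t => (H.q_lb _ i.1.2 t).mono hm le_rfl).const_mul _⟩
  · exact ⟨_, (TB.mk (H.p_meas _ i.1.2) fun t => (H.p_lb _ i.1.2 t).mono hm le_rfl).const_mul _⟩
  · exact ⟨_, (TB.mk H.c_meas fun t => (H.c_bd t).mono hm le_rfl).const_mul _⟩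

theorem WTwo.integral_limitOp {C : ℝ} {V : ℝ → Rd d → ℝ} (h : WTwo C V)
    (H : RoughHyp S τ τ₀ h₀ δ K c₀ A B Mb m) (hm : 1 ≤ m) {η : Rd d → ℝ} (hη : IsTest η) (t : ℝ) :
    Integrable (fun x => η x * S.limitOp t (V t) x) ∧ ∫ x, η x * S.limitOp t (V t) x
      = ∑ i : OpTerm S, ∫ x, η x * (opCoef i t x * wordDeriv (opWord i) (V t) x) := by
  have hi : ∀ i : OpTerm S, Integrable fun x => η x * (opCoef i t x * wordDeriv (opWord i) (V t) x) :=
    fun i => by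
      obtain ⟨M, hM⟩ := H.exists_opCoef hm i
      exact h.integrable (length_opWord i) (hM.lb t) hη t
  have e : (fun x => η x * S.limitOp t (V t) x) =ᵐ[volume] fun x => ∑ i : OpTerm S,
      η x * (opCoef i t x * wordDeriv (opWord i) (V t) x) := by
    filter_upwards [limitOp_eq_sum (S := S) t (h.cont t)] with x hx
    rw [hx, Finset.mul_sum]
  refine ⟨(integrable_finsetSum _ fun i _ => hi i).congr e.symm, ?_⟩
  rw [integral_congr_ae e, integral_finsetSum _ fun i _ => hi i]

theorem WTwo.intervalIntegrable_limitOp {C : ℝ} {V : ℝ → Rd d → ℝ} (h : WTwo C V)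
    (H : RoughHyp S τ τ₀ h₀ δ K c₀ A B Mb m) (hm : 1 ≤ m) {η : Rd d → ℝ} (hη : IsTest η) (a b : ℝ) :
    IntervalIntegrable (fun s => ∫ x, η x * S.limitOp s (V s) x) volume a b := by
  choose M hM using H.exists_opCoef hm
  refine intervalIntegrable_of_bound (C := ∑ i : OpTerm S, M i * C * ∫ x, |η x|) ?_ (fun s => ?_) a b
  · simp_rw [(h.integral_limitOp H hm hη _).2]
    exact Finset.measurable_sum _ fun i _ => h.measurable_integral (length_opWord i) (hM i) hη
  · rw [(h.integral_limitOp H hm hη _).2]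
    exact (Finset.abs_sum_le_sum_abs _ _).trans (Finset.sum_le_sum fun i _ =>
      h.abs_integral_le (length_opWord i) ((hM i).lb 0).nonneg ((hM i).bound s) hη s)

theorem WTwo.integral_limitOp_sub {C C' : ℝ} {V W : ℝ → Rd d → ℝ} (h : WTwo C V) (h' : WTwo C' W)
    (H : RoughHyp S τ τ₀ h₀ δ K c₀ A B Mb m) (hm : 1 ≤ m) {η : Rd d → ℝ} (hη : IsTest η) (t : ℝ) :
    ∫ x, η x * S.limitOp t (fun x => V t x - W t x) x
      = (∫ x, η x * S.limitOp t (V t) x) - ∫ x, η x * S.limitOp t (W t) x := by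
  rw [((h.sub h').integral_limitOp H hm hη t).2, (h.integral_limitOp H hm hη t).2,
    (h'.integral_limitOp H hm hη t).2, ← Finset.sum_sub_distrib]
  refine Finset.sum_congr rfl fun i _ => ?_
  obtain ⟨M, hM⟩ := H.exists_opCoef hm i
  rw [← integral_sub (h.integrable (length_opWord i) (hM.lb t) hη t)
    (h'.integrable (length_opWord i) (hM.lb t) hη t)]
  refine integral_congr_ae ?_
  filter_upwards [h.wordDeriv_sub h' t (length_opWord i)] with x hx
  rw [hx]; ring

theorem WTwo.eq_zero {C T : ℝ} {W : ℝ → Rd d → ℝ} (h : WTwo C W)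
    (H : RoughHyp S τ τ₀ h₀ δ K c₀ A B Mb m) (hm : 1 ≤ m) (hc₀ : 0 < c₀) (hh₀ : 0 < h₀)
    (heq : ∀ t ∈ Icc (0 : ℝ) T, ∀ η : Rd d → ℝ, IsTest η →
      ∫ x, η x * W t x = ∫ s in (0 : ℝ)..t, ∫ x, η x * S.limitOp s (W s) x) :
    ∀ t ∈ Icc (0 : ℝ) T, ∀ x, W t x = 0 := by
  choose M hM using H.exists_opCoef hm
  have hM0 : ∀ i, 0 ≤ M i := fun i => ((hM i).lb 0).nonneg
  have hC : 0 ≤ C := (abs_nonneg _).trans (h.bd 0 0)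
  set E : ℝ := ∑ i : OpTerm S, d * M i * C with hE
  have hE0 : 0 ≤ E := Finset.sum_nonneg fun i _ => by have := hM0 i; positivity
  have hlb : ∀ t, LB 2 C (W t) := fun t => LB.of_weak (n := 1) (h.cont t) (h.bd t) fun α hα => by
    obtain ⟨ζ, h1, h2⟩ := h.weak t (wordOf α) (by rwa [length_wordOf])
    rw [show (fun i => (wordOf α).count i) = α from funext (count_wordOf α)] at h1
    exact ⟨ζ, h1, h2⟩
  have key : ∀ (k : ℕ), ∀ t ∈ Icc (0 : ℝ) T, ∀ x,
      |moll k (W t) x| ≤ E * (1 / ((k : ℝ) + 1)) / c₀ := by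
    intro k
    set ρ : ℝ := 1 / ((k : ℝ) + 1) with hρ
    have hρ0 : 0 ≤ ρ := by positivity
    have hsts := STS.moll h.meas h.bd k
    obtain ⟨D, hD⟩ := hsts.bd 3
    have hD0 : 0 ≤ D := (hD 0).nonneg
    have hMb : 0 ≤ Mb := (H.c_bd 0).nonneg
    set R : ℝ := Mb * ((d * |A|) ^ 3 + (d * |A|) ^ 2) * D with hR
    have hR0 : 0 ≤ R := by positivity
    have hcomm : ∀ s x, |(∫ y, kern k (x - y) * S.limitOp s (W s) y) - S.clOp s (moll k (W s)) x|
        ≤ E * ρ := fun s x => by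
      rw [(h.integral_limitOp H hm (isTest_kern_sub k x) s).2, clOp_eq_sum, ← Finset.sum_sub_distrib,
        hE, Finset.sum_mul]
      exact (Finset.abs_sum_le_sum_abs _ _).trans (Finset.sum_le_sum fun i _ =>
        h.abs_commutator_le (length_opWord i) ((hM i).lb s) s k x)
    have hh : ∀ h ∈ Ioc 0 h₀, ∀ t ∈ Icc (0 : ℝ) T, ∀ x, |moll k (W t) x| ≤ (E * ρ + h * R) / c₀ := by
      intro e he t ht x
      have e1 : ∀ x, (fun s => S.Lh e s (moll k (W s)) x
          + ((∫ y, kern k (x - y) * S.limitOp s (W s) y) - S.Lh e s (moll k (W s)) x))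
          = fun s => ∫ y, kern k (x - y) * S.limitOp s (W s) y := fun x => by funext s; ring
      have := fd_stability (S := S) (w := fun t => moll k (W t)) (w₀ := fun _ => 0) (a := 0)
        (b := E * ρ + e * R) (e := Mb) (B := C) (T := T)
        (G := fun s x => (∫ y, kern k (x - y) * S.limitOp s (W s) y) - S.Lh e s (moll k (W s)) x)
        he.1 hc₀ le_rfl (by have := he.1; positivity)
        (fun v hv t _ x => (H.q_lb v hv t).bound x) (fun v hv t _ x => (H.p_lb v hv t).bound x)
        (fun v hv t _ x => H.chi_nonneg _ he v hv t x) (fun t _ x => H.c_le t x)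
        (fun t _ x => abs_moll_le (h.cont t).measurable (h.bd t) k x)
        (fun t _ x => by
          rw [e1]; exact h.intervalIntegrable_limitOp H hm (isTest_kern_sub k x) 0 t)
        (fun t ht x => by
          rw [e1, zero_add, ← heq t ht _ (isTest_kern_sub k x), moll_eq]
          simp_rw [mul_comm])
        (fun x => by simp)
        (fun s _ x => by
          have a1 := H.abs_Lh_sub_clOp_le he.1 ((hD s).lb (hsts.slice s)) x (t := s)
          rw [abs_sub_comm] at a1
          exact (abs_sub_le _ (S.clOp s (moll k (W s)) x) _).trans (add_le_add (hcomm s x) a1)) t ht x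
      rwa [zero_add] at this
    intro t ht x
    have hlim : Tendsto (fun j : ℕ => (E * ρ + h₀ * (1 / ((j : ℝ) + 1)) * R) / c₀) atTop
        (𝓝 ((E * ρ + h₀ * 0 * R) / c₀)) :=
      (((tendsto_one_div_add_atTop_nhds_zero_nat.const_mul h₀).mul_const R).const_add _).div_const _
    rw [mul_zero, zero_mul, add_zero] at hlim
    refine ge_of_tendsto' hlim fun j => hh _ ⟨by positivity, ?_⟩ t ht x
    exact mul_le_of_le_one_right hh₀.le (one_div_succ_le_one j)
  intro t ht x
  have h1 : ∀ k : ℕ, |W t x| ≤ (E / c₀ + d * C) * (1 / ((k : ℝ) + 1)) := fun k => by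
    have a1 := key k t ht x
    have a2 := LB.moll_close (n := 1) (hlb t) k x
    have a3 := abs_sub_abs_le_abs_sub (W t x) (moll k (W t) x)
    rw [abs_sub_comm] at a3
    calc |W t x| ≤ E * (1 / ((k : ℝ) + 1)) / c₀ + d * C / ((k : ℝ) + 1) := by linarith
      _ = _ := by ring
  have h2 : Tendsto (fun k : ℕ => (E / c₀ + d * C) * (1 / ((k : ℝ) + 1))) atTop (𝓝 0) := by
    simpa using tendsto_one_div_add_atTop_nhds_zero_nat.const_mul (E / c₀ + d * C)
  exact abs_eq_zero.1 (le_antisymm (ge_of_tendsto' h2 h1) (abs_nonneg _))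

end Uniqueness


/-! ### Reduction of the assumptions to rough schemes -/

theorem HasWeakDeriv.sum_mul {ι : Type*} (s : Finset ι) (b : ι → ℝ) {α : Fin d → ℕ}
    {φ ζ : ι → Rd d → ℝ} (h : ∀ v ∈ s, HasWeakDeriv α (φ v) (ζ v)) (hc : ∀ v ∈ s, Continuous (φ v)) :
    HasWeakDeriv α (fun x => ∑ v ∈ s, b v * φ v x) (fun x => ∑ v ∈ s, b v * ζ v x) := by
  refine ⟨locallyIntegrable_finsetSum _ fun v hv => (h v hv).1.smul (b v), fun η hη => ?_⟩
  have hm : IsTest (multiDeriv α η) := by rw [multiDeriv_eq_pds]; exact hη.pds _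
  have i1 : ∀ v ∈ s, Integrable fun x => b v * (φ v x * multiDeriv α η x) := fun v hv =>
    (((hc v hv).mul hm.1.continuous).integrable_of_hasCompactSupport hm.2.mul_left).const_mul _
  have i2 : ∀ v ∈ s, Integrable fun x => b v * (ζ v x * η x) := fun v hv => by
    simpa [mul_comm] using ((h v hv).1.integrable_smul_left_of_hasCompactSupport hη.1.continuous
      hη.2).const_mul (b v)
  simp_rw [Finset.sum_mul, mul_assoc]
  rw [integral_finsetSum s i1, integral_finsetSum s i2, Finset.mul_sum]
  refine Finset.sum_congr rfl fun v hv => ?_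
  rw [integral_const_mul, integral_const_mul, (h v hv).2 η hη]
  ring

theorem weakDeriv_sq_le_derivSq (α : Fin d → ℕ) (φ : Rd d → ℝ) (x : Rd d) :
    weakDeriv α φ x ^ 2 ≤ derivSq (order α) φ x :=
  Finset.single_le_sum (f := fun α => weakDeriv α φ x ^ 2) (fun _ _ => sq_nonneg _)
    (Finset.mem_piAntidiag.2 ⟨rfl, fun _ _ => Finset.mem_univ _⟩)

theorem derivSq_nonneg (k : ℕ) (φ : Rd d → ℝ) (x : Rd d) : 0 ≤ derivSq k φ x :=
  Finset.sum_nonneg fun _ _ => sq_nonneg _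

theorem normB_nonneg (T : ℝ) (m : ℕ) (ψ : ℝ → Rd d → ℝ) : 0 ≤ normB T m ψ :=
  Real.sInf_nonneg fun _ h => h.1

theorem MemB.measurable_clampT {T : ℝ} {m : ℕ} {ψ : ℝ → Rd d → ℝ} (h : MemB T m ψ) (hT : 0 ≤ T) :
    Measurable (Function.uncurry fun t => ψ (clampT T t)) :=
  h.1.comp (g := fun z : Icc (0 : ℝ) T × Rd d => ψ z.1 z.2)
    (f := fun z : ℝ × Rd d => (⟨clampT T z.1, clampT_mem hT z.1⟩, z.2))
    ((((continuous_clampT T).measurable.comp measurable_fst).subtype_mk).prodMk measurable_snd)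

theorem MemB.hasWeakDeriv {T : ℝ} {m : ℕ} {ψ : ℝ → Rd d → ℝ} (h : MemB T m ψ) {t : ℝ}
    (ht : t ∈ Icc (0 : ℝ) T) {α : Fin d → ℕ} (hα : order α ≤ m) :
    HasWeakDeriv α (ψ t) (weakDeriv α (ψ t)) := by
  obtain ⟨C, hC⟩ := h.2.2
  obtain ⟨w, hw, -⟩ := (hC t ht).2 α hα
  exact hasWeakDeriv_weakDeriv hw

theorem MemB.ae_sum_derivSq_le {T : ℝ} {m : ℕ} {ψ : ℝ → Rd d → ℝ} (h : MemB T m ψ) {t : ℝ}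
    (ht : t ∈ Icc (0 : ℝ) T) :
    ∀ᵐ x, ∑ k ∈ Finset.range (m + 1), derivSq k (ψ t) x ≤ normB T m ψ ^ 2 := by
  set E : Set ℝ := {C : ℝ | 0 ≤ C ∧ ∀ t ∈ Icc (0 : ℝ) T, ∀ᵐ x,
    ∑ k ∈ Finset.range (m + 1), derivSq k (ψ t) x ≤ C ^ 2} with hE
  have hne : E.Nonempty := by
    obtain ⟨C, hC⟩ := h.2.2
    refine ⟨√(∑ k ∈ Finset.range (m + 1),
      ∑ α ∈ Finset.piAntidiag (Finset.univ : Finset (Fin d)) k, C ^ 2), Real.sqrt_nonneg _,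
      fun s hs => ?_⟩
    have h1 : ∀ᵐ x, ∀ k ∈ Finset.range (m + 1),
        ∀ α ∈ Finset.piAntidiag (Finset.univ : Finset (Fin d)) k, weakDeriv α (ψ s) x ^ 2 ≤ C ^ 2 := by
      rw [Finset.eventually_all]
      intro k hk
      rw [Finset.eventually_all]
      intro α hα
      obtain ⟨w, hw, hb⟩ := (hC s hs).2 α (by
        rw [Finset.mem_range] at hk
        have : order α = k := (Finset.mem_piAntidiag.1 hα).1
        omega)
      filter_upwards [hw.weakDeriv_ae_eq, hb] with x hx hbx
      rw [hx]; exact sq_le_sq' (neg_le_of_abs_le hbx) (le_of_abs_le hbx)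
    filter_upwards [h1] with x hx
    rw [Real.sq_sqrt (Finset.sum_nonneg fun _ _ => Finset.sum_nonneg fun _ _ => sq_nonneg _)]
    exact Finset.sum_le_sum fun k hk => Finset.sum_le_sum fun α hα => hx k hk α hα
  have h2 : ∀ n : ℕ, ∀ᵐ x, ∑ k ∈ Finset.range (m + 1), derivSq k (ψ t) x
      ≤ (normB T m ψ + 1 / ((n : ℝ) + 1)) ^ 2 := fun n => by
    obtain ⟨C, ⟨hC0, hC⟩, hlt⟩ := exists_lt_of_csInf_lt hne
      (lt_add_of_pos_right (normB T m ψ) (Nat.one_div_pos_of_nat (n := n)))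
    filter_upwards [hC t ht] with x hx
    exact hx.trans (pow_le_pow_left₀ hC0 hlt.le 2)
  filter_upwards [ae_all_iff.2 h2] with x hx
  refine ge_of_tendsto' (x := atTop) ?_ hx
  simpa using (tendsto_one_div_add_atTop_nhds_zero_nat (𝕜 := ℝ)).const_add (normB T m ψ) |>.pow 2

theorem MemB.lb {T : ℝ} {m : ℕ} {ψ : ℝ → Rd d → ℝ} (h : MemB T m ψ) (hm : 1 ≤ m) {t : ℝ}
    (ht : t ∈ Icc (0 : ℝ) T) : LB m (normB T m ψ) (ψ t) := by
  obtain ⟨C, hC⟩ := h.2.2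
  obtain ⟨n, rfl⟩ := Nat.exists_eq_add_of_le' hm
  refine LB.of_weak (h.2.1 t ht) (hC t ht).1 fun α hα => ⟨_, h.hasWeakDeriv ht hα, ?_⟩
  filter_upwards [h.ae_sum_derivSq_le ht] with x hx
  refine abs_le_of_sq_le_sq (((weakDeriv_sq_le_derivSq α (ψ t) x).trans ?_).trans hx)
    (normB_nonneg _ _ _)
  exact Finset.single_le_sum (f := fun k => derivSq k (ψ t) x) (fun k _ => derivSq_nonneg k _ x)
    (Finset.mem_range.2 (by omega))

theorem MemB.tb_clampT {T : ℝ} {m : ℕ} {ψ : ℝ → Rd d → ℝ} (h : MemB T m ψ) (hm : 1 ≤ m) (hT : 0 ≤ T) :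
    TB m (normB T m ψ) (fun t => ψ (clampT T t)) :=
  ⟨h.measurable_clampT hT, fun t => h.lb hm (clampT_mem hT t)⟩

theorem TB.memB {T : ℝ} {n : ℕ} {D : ℝ} {u : ℝ → Rd d → ℝ} (h : TB (n + 1) D u) {n' : ℕ}
    (hn : n' ≤ n + 1) : MemB T n' u := by
  have hD := (h.lb 0).nonneg
  refine ⟨h.meas.comp (f := fun z : Icc (0 : ℝ) T × Rd d => ((z.1 : ℝ), z.2))
      (measurable_fst.subtype_val.prodMk measurable_snd), fun t _ => (h.lb t).continuous,
    (d + 1) * D, fun t _ => ⟨fun x => ((h.lb t).bound x).trans ?_, fun α hα =>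
      (h.lb t).exists_hasWeakDeriv (hα.trans hn)⟩⟩
  nlinarith [(Nat.cast_nonneg d : (0 : ℝ) ≤ d)]

theorem lbv_of_ae {s : Finset (Rd d)} {m : ℕ} (hm : 1 ≤ m) {a : Rd d → Rd d → ℝ} {C Mb : ℝ}
    (hMb : 0 ≤ Mb) (hc : ∀ v ∈ s, Continuous (a v)) (hb : ∀ v ∈ s, ∀ x, |a v x| ≤ C)
    (hw : ∀ v ∈ s, ∀ α : Fin d → ℕ, order α ≤ m → HasWeakDeriv α (a v) (weakDeriv α (a v)))
    (hM : ∀ k ≤ m, ∀ᵐ x, ∑ v ∈ s, derivSq k (a v) x ≤ Mb ^ 2) : LBv s m Mb a := by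
  intro b hb1
  obtain ⟨n, rfl⟩ := Nat.exists_eq_add_of_le' hm
  refine LB.of_weak (C' := ∑ v ∈ s, |b v| * C) (continuous_finsetSum _ fun v hv =>
    continuous_const.mul (hc v hv)) (fun x => (Finset.abs_sum_le_sum_abs _ _).trans
      (Finset.sum_le_sum fun v hv => ?_)) fun α hα =>
    ⟨_, HasWeakDeriv.sum_mul s b (fun v hv => hw v hv α hα) hc, ?_⟩
  · rw [abs_mul]; exact mul_le_mul_of_nonneg_left (hb v hv x) (abs_nonneg _)
  · filter_upwards [hM _ hα] with x hx
    refine abs_le_of_sq_le_sq ((Finset.sum_mul_sq_le_sq_mul_sq s b _).trans ?_) hMb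
    have h1 : ∑ v ∈ s, weakDeriv α (a v) x ^ 2 ≤ Mb ^ 2 :=
      (Finset.sum_le_sum fun v _ => weakDeriv_sq_le_derivSq α (a v) x).trans hx
    have h2 : 0 ≤ ∑ v ∈ s, weakDeriv α (a v) x ^ 2 := Finset.sum_nonneg fun _ _ => sq_nonneg _
    nlinarith

/-- The scheme with coefficients frozen outside `[0,T]`. -/
noncomputable def Scheme.clamp (S : Scheme d) (T : ℝ) : Scheme d where
  Λ₁ := S.Λ₁
  q v t := S.q v (clampT T t)
  p v t := S.p v (clampT T t)
  c t := S.c (clampT T t)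

theorem sum_sq_norm_le_of_sqrt_eq {s : Finset (Rd d)} {a : Rd d → Rd d} {A : ℝ}
    (h : √(∑ v ∈ s, ‖a v‖ ^ 2) = A) : ∑ v ∈ s, ‖a v‖ ^ 2 ≤ A ^ 2 := by
  rw [← h, Real.sq_sqrt (Finset.sum_nonneg fun _ _ => by positivity)]

theorem Scheme.RegularData.roughHyp_clamp {S : Scheme d} {m : ℕ} {T h₀ δ K τ₀ c₀ A B : ℝ}
    {M : Fin (m + 1) → ℝ} {τ : Rd d → ℝ} {f : ℝ → Rd d → ℝ} {g : Rd d → ℝ}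
    (hR : S.RegularData T m M f g) (hm : 1 ≤ m) (hT : 0 ≤ T) (hδ1 : δ ≤ 1) (hK : 0 ≤ K)
    (hc₀ : 0 < c₀) (hA : S.size = A) (hB : S.weightedSize τ = B)
    (hχ : ∀ v ∈ S.Λ₁, ∀ h ∈ Ioc 0 h₀, ∀ t ∈ Icc 0 T, ∀ x, 0 ≤ S.chi h v t x)
    (hq : ∀ t ∈ Icc 0 T, ∀ x, ∑ v ∈ S.Λ₁, S.q v t x • v = 0)
    (hc : ∀ t ∈ Icc 0 T, ∀ x, c₀ ≤ S.c t x) (h₁ : S.Structural₁ T h₀ δ K τ τ₀ m)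
    (h₂ : S.Structural₂ T h₀ δ K τ τ₀ m) :
    RoughHyp (S.clamp T) τ τ₀ h₀ δ K c₀ A B (∑ k, |M k|) m := by
  obtain ⟨hpq, hcB, -, -, hM⟩ := hR
  have hmem := clampT_mem hT
  have hMb : 0 ≤ ∑ k, |M k| := Finset.sum_nonneg fun _ _ => abs_nonneg _
  have key : ∀ k ≤ m, ∀ t, ∀ᵐ x, ∑ v ∈ S.Λ₁, (derivSq k (S.q v (clampT T t)) x
      + derivSq k (S.p v (clampT T t)) x) + derivSq k (S.c (clampT T t)) x ≤ (∑ k, |M k|) ^ 2 :=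
    fun k hk t => by
      filter_upwards [hM ⟨k, by omega⟩ _ (hmem t)] with x hx
      refine hx.trans ?_
      rw [← sq_abs]
      exact pow_le_pow_left₀ (abs_nonneg _) (Finset.single_le_sum (f := fun k => |M k|)
        (fun _ _ => abs_nonneg _) (Finset.mem_univ _)) 2
  have hbd : ∀ a : Rd d → ℝ → Rd d → ℝ, (∀ v ∈ S.Λ₁, MemB T m (a v)) → (∀ k ≤ m, ∀ t, ∀ᵐ x,
      ∑ v ∈ S.Λ₁, derivSq k (a v (clampT T t)) x ≤ (∑ k, |M k|) ^ 2) →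
      ∀ t, LBv S.Λ₁ m (∑ k, |M k|) (fun v => a v (clampT T t)) := fun a ha hk t =>
    lbv_of_ae hm hMb (C := ∑ v ∈ S.Λ₁, normB T m (a v)) (fun v hv => (ha v hv).2.1 _ (hmem t))
      (fun v hv x => (((ha v hv).lb hm (hmem t)).bound x).trans
        (Finset.single_le_sum (f := fun v => normB T m (a v)) (fun _ _ => normB_nonneg _ _ _) hv))
      (fun v hv α hα => (ha v hv).hasWeakDeriv (hmem t) hα) fun k hkm => hk k hkm t
  have hs : ∀ (k : ℕ) (a : Rd d → ℝ → Rd d → ℝ) (t : ℝ) (x : Rd d),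
      0 ≤ ∑ v ∈ S.Λ₁, derivSq k (a v t) x :=
    fun k a t x => Finset.sum_nonneg fun _ _ => derivSq_nonneg _ _ _
  refine ⟨sum_sq_norm_le_of_sqrt_eq (a := fun v => v) hA,
    sum_sq_norm_le_of_sqrt_eq (a := fun v => τ v • v) hB,
    fun v hv => (hpq v hv).2.measurable_clampT hT, fun v hv => (hpq v hv).1.measurable_clampT hT,
    hcB.measurable_clampT hT, ?_, ?_, fun t => ?_, fun h hh v hv t => hχ v hv h hh _ (hmem t),
    fun t x i => ?_, fun t => hc _ (hmem t), fun h hh => ?_, fun h hh => ?_⟩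
  · refine hbd S.q (fun v hv => (hpq v hv).2) fun k hk t => ?_
    filter_upwards [key k hk t] with x hx
    rw [Finset.sum_add_distrib] at hx
    linarith [hs k S.p (clampT T t) x, derivSq_nonneg k (S.c (clampT T t)) x]
  · refine hbd S.p (fun v hv => (hpq v hv).1) fun k hk t => ?_
    filter_upwards [key k hk t] with x hx
    rw [Finset.sum_add_distrib] at hx
    linarith [hs k S.q (clampT T t) x, derivSq_nonneg k (S.c (clampT T t)) x]
  · have h1 := lbv_of_ae (s := {0}) (a := fun _ => S.c (clampT T t)) hm hMb
      (fun _ _ => hcB.2.1 _ (hmem t)) (fun _ _ => (hcB.lb hm (hmem t)).bound)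
      (fun _ _ α hα => hcB.hasWeakDeriv (hmem t) hα) fun k hk => by
        filter_upwards [key k hk t] with x hx
        rw [Finset.sum_add_distrib] at hx
        rw [Finset.sum_singleton]
        linarith [hs k S.q (clampT T t) x, hs k S.p (clampT T t) x]
    exact h1.comp (Finset.mem_singleton_self 0)
  · have := congrArg (fun y : Rd d => y i) (hq _ (hmem t) x)
    simp only [WithLp.ofLp_sum, Finset.sum_apply, PiLp.smul_apply, smul_eq_mul, PiLp.zero_apply] at this
    rw [← this]
    exact Finset.sum_congr rfl fun v _ => mul_comm _ _
  · exact sup₁_of_structural (S := S.clamp T) hm hδ1 hK (fun t => h₁ h hh _ (hmem t))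
      (fun v hv t x => hχ v hv h hh _ (hmem t) x) fun t x => hc₀.le.trans (hc _ (hmem t) x)
  · exact sup₂_of_structural (S := S.clamp T) hδ1 hK (fun n hn t => h₂ h hh n hn _ (hmem t))
      fun t x => hc₀.le.trans (hc _ (hmem t) x)

theorem Scheme.Symm.qEven_clamp {S : Scheme d} {T : ℝ} (h : S.Symm T) (hT : 0 ≤ T) :
    (S.clamp T).QEven :=
  fun v hv => ⟨(h v hv).1, fun t x => ((h v hv).2 _ (clampT_mem hT t) x).symm⟩

theorem Scheme.POdd.pAnti_clamp {S : Scheme d} {T : ℝ} (h : S.POdd T) (hT : 0 ≤ T) :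
    (S.clamp T).PAnti :=
  fun v hv t x => h v hv _ (clampT_mem hT t) x


/-! ### Solutions for the original and for the frozen data -/

section Expansion

variable {S : Scheme d} {τ : Rd d → ℝ} {τ₀ h₀ δ K c₀ A B Mb T : ℝ} {m : ℕ}

theorem mem_Icc_of_mem_uIcc {s t : ℝ} (ht : t ∈ Icc (0 : ℝ) T) (hs : s ∈ uIcc 0 t) :
    s ∈ Icc (0 : ℝ) T := by
  rw [uIcc_of_le ht.1] at hs
  exact ⟨hs.1, hs.2.trans ht.2⟩

theorem Scheme.IsFDSolution.of_clamp {h : ℝ} {f u : ℝ → Rd d → ℝ} {g : Rd d → ℝ}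
    (hu : (S.clamp T).IsFDSolution T h (fun t => f (clampT T t)) g u) : S.IsFDSolution T h f g u := by
  refine ⟨hu.1, fun t ht x => ?_⟩
  have e : EqOn (fun s => (S.clamp T).Lh h s (u s) x + f (clampT T s) x)
      (fun s => S.Lh h s (u s) x + f s x) (uIcc 0 t) := fun s hs => by
    have e1 : (S.clamp T).Lh h s (u s) x = S.Lh h (clampT T s) (u s) x := rfl
    simp only [e1, clampT_of_mem (mem_Icc_of_mem_uIcc ht hs)]
  obtain ⟨h1, h2⟩ := hu.2 t ht x
  exact ⟨h1.congr_uIoo (e.mono Ioo_subset_Icc_self), h2.trans (by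
    rw [intervalIntegral.integral_congr e])⟩

theorem Scheme.limitOp_clamp {t : ℝ} (ht : t ∈ Icc (0 : ℝ) T) (φ : Rd d → ℝ) :
    (S.clamp T).limitOp t φ = S.limitOp t φ := by
  have : (S.clamp T).limitOp t φ = S.limitOp (clampT T t) φ := rfl
  rw [this, clampT_of_mem ht]

theorem Scheme.limitOpI_clamp {t : ℝ} (ht : t ∈ Icc (0 : ℝ) T) (i : ℕ) (φ : Rd d → ℝ) :
    (S.clamp T).limitOpI i t φ = S.limitOpI i t φ := by
  have : (S.clamp T).limitOpI i t φ = S.limitOpI i (clampT T t) φ := rfl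
  rw [this, clampT_of_mem ht]

theorem ae_coefRHS_eq_systemRHS {f : ℝ → Rd d → ℝ} {U : ℕ → ℝ → Rd d → ℝ} {a j : ℕ} {D : ℕ → ℝ}
    (ha : StepLoss S a) (hj : 1 ≤ j) (hjm : a * j + 1 ≤ m) (hU : ∀ i < j, TB (m - a * i) (D i) (U i))
    (t : ℝ) : coefRHS S f U j t =ᵐ[volume] S.systemRHS U j t := by
  have h1 : ∀ᵐ x, ∀ i ∈ Finset.Icc 1 j, S.limitOpI i t (U (j - i) t) x
      = S.clOpI i t (U (j - i) t) x := by
    rw [Finset.eventually_all]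
    intro i hi
    rw [Finset.mem_Icc] at hi
    have hij : a * j = a * (j - i) + a * i := by rw [← mul_add]; congr 1; omega
    exact LB.limitOpI (n := m - a * j) ha hi.1 (by omega)
      (((hU (j - i) (by omega)).lb t).mono (by omega) le_rfl)
  filter_upwards [h1] with x hx
  rw [coefRHS, if_neg (by omega), zero_add]
  exact Finset.sum_congr rfl fun i hi => by rw [hx i hi]

theorem IsCoef.abs_sub_le {f : ℝ → Rd d → ℝ} {g : Rd d → ℝ} {n j : ℕ} {D : ℝ} {U : ℕ → ℝ → Rd d → ℝ}
    (h : IsCoef S T f g n D U j) (H : RoughHyp S τ τ₀ h₀ δ K c₀ A B Mb m) :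
    ∃ L, ∀ s t x, |U j t x - U j s x| ≤ L * |t - s| := by
  obtain ⟨D₁, h3⟩ := h.tb_three
  obtain ⟨n₂, D₂, hr⟩ := h.tb_rhs
  obtain ⟨L, hL⟩ : ∃ L, ∀ s x, |S.clOp s (U j s) x + coefRHS S f U j s x| ≤ L :=
    ⟨_, fun s x => (abs_add_le _ _).trans (add_le_add (H.abs_clOp_le (h3.lb s) x) (hr.bound s x))⟩
  refine ⟨L, fun s t x => ?_⟩
  rw [h.eqn t x, h.eqn s x, add_sub_add_left_eq_sub]
  exact abs_tint_sub_le (fun t => h.int H t x) (fun s => hL s x) s t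

theorem IsCoef.isLimitSolution {f F : ℝ → Rd d → ℝ} {g g' : Rd d → ℝ} {n j n' : ℕ} {D D' : ℝ}
    {U : ℕ → ℝ → Rd d → ℝ} (h : IsCoef (S.clamp T) T f g n D U j)
    (H : RoughHyp (S.clamp T) τ τ₀ h₀ δ K c₀ A B Mb m) (hg : LB n' D' g)
    (hF : ∀ s ∈ Icc (0 : ℝ) T, coefRHS (S.clamp T) f U j s =ᵐ[volume] F s)
    (hg' : ∀ x, (if j = 0 then g x else 0) = g' x) : S.IsLimitSolution T F g' (U j) := by
  obtain ⟨D₁, h3⟩ := h.tb_three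
  obtain ⟨L, hL⟩ := h.abs_sub_le H
  refine ⟨(h3.continuous_pds hL [] (by simp)).continuousOn, h3.memB (by norm_num), fun t ht η hη => ?_⟩
  rw [h.weak_eqn H hg hη ht]
  simp_rw [hg']
  congr 1
  refine intervalIntegral.integral_congr fun s hs => integral_congr_ae ?_
  have hs' := mem_Icc_of_mem_uIcc ht hs
  filter_upwards [hF s hs'] with x hx
  rw [hx, Scheme.limitOp_clamp hs']

/-! ### Uniqueness for the system -/

theorem MemB.wTwo {u : ℝ → Rd d → ℝ} (h : MemB T 2 u) (hT : 0 ≤ T) :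
    ∃ C, WTwo C fun t => u (clampT T t) := by
  obtain ⟨C, hC⟩ := h.2.2
  exact ⟨C, h.measurable_clampT hT, fun t => h.2.1 _ (clampT_mem hT t),
    fun t => (hC _ (clampT_mem hT t)).1,
    fun t w hw => (hC _ (clampT_mem hT t)).2 _ ((order_count w).trans_le hw)⟩

theorem Scheme.IsLimitSolution.weak_eqn {F G u : ℝ → Rd d → ℝ} {g : Rd d → ℝ} {n : ℕ} {C D : ℝ}
    (hu : S.IsLimitSolution T F g u) (H : RoughHyp (S.clamp T) τ τ₀ h₀ δ K c₀ A B Mb m) (hm : 1 ≤ m)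
    (hw : WTwo C fun t => u (clampT T t)) (hG : TB n D G)
    (hGF : ∀ s ∈ Icc (0 : ℝ) T, G s =ᵐ[volume] F s) {t : ℝ} (ht : t ∈ Icc (0 : ℝ) T)
    {η : Rd d → ℝ} (hη : IsTest η) :
    ∫ x, η x * u t x = (∫ x, η x * g x)
      + (∫ s in (0 : ℝ)..t, ∫ x, η x * (S.clamp T).limitOp s (u (clampT T s)) x)
      + ∫ s in (0 : ℝ)..t, ∫ x, η x * G s x := by
  rw [hu.2.2 t ht η hη, add_assoc, ← intervalIntegral.integral_add
    (hw.intervalIntegrable_limitOp H hm hη 0 t)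
    (intervalIntegrable_integral_test hG.meas hG.bound hη 0 t)]
  congr 1
  refine intervalIntegral.integral_congr fun s hs => ?_
  have hs' := mem_Icc_of_mem_uIcc ht hs
  rw [← integral_add (hw.integral_limitOp H hm hη s).1 (hη.integrable_mul
    (hG.lb s).continuous.aestronglyMeasurable (Eventually.of_forall (hG.lb s).bound))]
  refine integral_congr_ae ?_
  filter_upwards [hGF s hs'] with x hx
  rw [hx, Scheme.limitOp_clamp hs', clampT_of_mem hs', mul_add]

theorem Scheme.IsLimitSolution.unique {F G u v : ℝ → Rd d → ℝ} {g : Rd d → ℝ} {n : ℕ} {D : ℝ}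
    (hu : S.IsLimitSolution T F g u) (hv : S.IsLimitSolution T F g v)
    (H : RoughHyp (S.clamp T) τ τ₀ h₀ δ K c₀ A B Mb m) (hm : 1 ≤ m) (hc₀ : 0 < c₀) (hh₀ : 0 < h₀)
    (hT : 0 ≤ T) (hG : TB n D G) (hGF : ∀ s ∈ Icc (0 : ℝ) T, G s =ᵐ[volume] F s) :
    ∀ t ∈ Icc (0 : ℝ) T, ∀ x, v t x = u t x := by
  obtain ⟨C, hwu⟩ := hu.2.1.wTwo hT
  obtain ⟨C', hwv⟩ := hv.2.1.wTwo hT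
  have h0 := (hwv.sub hwu).eq_zero H hm hc₀ hh₀ (T := T) fun t ht η hη => by
    have iv := hη.integrable_mul (hwv.cont t).aestronglyMeasurable (Eventually.of_forall (hwv.bd t))
    have iu := hη.integrable_mul (hwu.cont t).aestronglyMeasurable (Eventually.of_forall (hwu.bd t))
    simp_rw [hwv.integral_limitOp_sub hwu H hm hη, mul_sub]
    rw [integral_sub iv iu, intervalIntegral.integral_sub (hwv.intervalIntegrable_limitOp H hm hη 0 t)
      (hwu.intervalIntegrable_limitOp H hm hη 0 t), clampT_of_mem ht,
      hu.weak_eqn H hm hwu hG hGF ht hη, hv.weak_eqn H hm hwv hG hGF ht hη]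
    ring
  intro t ht x
  have := h0 t ht x
  rw [clampT_of_mem ht] at this
  exact sub_eq_zero.1 this

theorem Scheme.systemRHS_congr {U V : ℕ → ℝ → Rd d → ℝ} {j : ℕ} {t : ℝ}
    (h : ∀ i < j, ∀ x, V i t x = U i t x) : S.systemRHS V j t = S.systemRHS U j t := by
  funext x
  refine Finset.sum_congr rfl fun i hi => ?_
  rw [Finset.mem_Icc] at hi
  rw [funext (h (j - i) (by omega))]

theorem Scheme.IsLimitSolution.congr {F F' u : ℝ → Rd d → ℝ} {g : Rd d → ℝ}
    (hu : S.IsLimitSolution T F g u) (h : ∀ t ∈ Icc (0 : ℝ) T, F t = F' t) :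
    S.IsLimitSolution T F' g u := by
  refine ⟨hu.1, hu.2.1, fun t ht η hη => (hu.2.2 t ht η hη).trans ?_⟩
  congr 1
  exact intervalIntegral.integral_congr fun s hs => by
    simp only [h s (mem_Icc_of_mem_uIcc ht hs)]

theorem isCoefficientSystem_of_isCoef {f : ℝ → Rd d → ℝ} {g : Rd d → ℝ} {a k n' : ℕ}
    {C : ℕ → ℝ} {D' : ℝ} {U : ℕ → ℝ → Rd d → ℝ} (H : RoughHyp (S.clamp T) τ τ₀ h₀ δ K c₀ A B Mb m)
    (hm : 1 ≤ m) (hc₀ : 0 < c₀) (hh₀ : 0 < h₀) (hT : 0 ≤ T) (hg : LB n' D' g)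
    (ha : StepLoss (S.clamp T) a) (hk : a * k + 1 ≤ m)
    (hU : ∀ j ≤ k, IsCoef (S.clamp T) T (fun t => f (clampT T t)) g (m - a * j) (C j) U j) :
    S.IsCoefficientSystem T f g m a k U ∧ ∀ V, S.IsCoefficientSystem T f g m a k V →
      ∀ j ≤ k, ∀ t ∈ Icc (0 : ℝ) T, ∀ x, V j t x = U j t x := by
  have hak : ∀ j ≤ k, a * j + 1 ≤ m := fun j hj =>
    (Nat.succ_le_succ (Nat.mul_le_mul_left a hj)).trans hk
  have hF0 : ∀ s ∈ Icc (0 : ℝ) T,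
      coefRHS (S.clamp T) (fun t => f (clampT T t)) U 0 s =ᵐ[volume] f s := fun s hs => by
    refine Eventually.of_forall fun x => ?_
    simp [coefRHS, clampT_of_mem hs]
  have hFj : ∀ j, 1 ≤ j → j ≤ k → ∀ s ∈ Icc (0 : ℝ) T,
      coefRHS (S.clamp T) (fun t => f (clampT T t)) U j s =ᵐ[volume] S.systemRHS U j s :=
    fun j hj hjk s hs => by
      filter_upwards [ae_coefRHS_eq_systemRHS (f := fun t => f (clampT T t)) ha hj (hak j hjk)
        (fun i hi => (hU i (by omega)).tb) s] with x hx
      rw [hx]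
      exact Finset.sum_congr rfl fun i _ => by rw [Scheme.limitOpI_clamp hs]
  have h0 : S.IsLimitSolution T f g (U 0) :=
    (hU 0 (Nat.zero_le k)).isLimitSolution H hg hF0 fun x => by simp
  have hj0 : ∀ j, 1 ≤ j → j ≤ k → S.IsLimitSolution T (S.systemRHS U j) 0 (U j) := fun j hj hjk =>
    (hU j hjk).isLimitSolution H hg (hFj j hj hjk) fun x => by rw [if_neg (by omega)]; rfl
  refine ⟨⟨h0, fun j hj => hj0 j (Finset.mem_Icc.1 hj).1 (Finset.mem_Icc.1 hj).2, fun j hj => ?_⟩,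
    fun V hV j => ?_⟩
  · obtain ⟨n, hn⟩ : ∃ n, m - a * j = n + 1 := ⟨m - a * j - 1, by have := hak j hj; omega⟩
    have := (hU j hj).tb
    rw [hn] at this ⊢
    exact this.memB le_rfl
  · induction j using Nat.strong_induction_on with
    | _ j ih =>
      intro hjk
      obtain ⟨n₂, D₂, hr⟩ := (hU j hjk).tb_rhs
      rcases Nat.eq_zero_or_pos j with rfl | hj
      · exact h0.unique hV.1 H hm hc₀ hh₀ hT hr hF0
      · have hVj := (hV.2.1 j (Finset.mem_Icc.2 ⟨hj, hjk⟩)).congr (F' := S.systemRHS U j)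
          fun t ht => Scheme.systemRHS_congr fun i hi => ih i hi (by omega) t ht
        exact (hj0 j hj hjk).unique hVj H hm hc₀ hh₀ hT hr (hFj j hj hjk)

/-! ### The expansion -/

theorem RoughHyp.abs_sub_le (H : RoughHyp S τ τ₀ h₀ δ K c₀ A B Mb m) {h D E : ℝ} {n n' : ℕ}
    (hh : 0 < h) {f u : ℝ → Rd d → ℝ} {g : Rd d → ℝ} (hf : TB n D f) (hu : TB n' E u)
    (hue : ∀ t x, u t x = g x + tint T (fun s x => S.Lh h s (u s) x + f s x) t x) :
    ∃ L, ∀ s t x, |u t x - u s x| ≤ L * |t - s| := by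
  have hmL := measurable_Lh hh.ne' H.q_meas H.p_meas H.c_meas hu.meas
  have hb : ∀ s x, |S.Lh h s (u s) x + f s x| ≤ opConst S h * Mb * E + D := fun s x =>
    (abs_add_le _ _).trans (add_le_add (H.abs_Lh_le hh (hu.lb s).bound) (hf.bound s x))
  refine ⟨opConst S h * Mb * E + D, fun s t x => ?_⟩
  rw [hue t x, hue s x, add_sub_add_left_eq_sub]
  exact abs_tint_sub_le (fun t => intervalIntegrable_of_bound
    ((hmL.comp measurable_prodMk_right).add (hf.meas.comp measurable_prodMk_right))
    (fun s => hb s x) 0 t) (fun s => hb s x) s t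

theorem multiDeriv_eq_expansion {U : ℕ → ℝ → Rd d → ℝ} {u : ℝ → Rd d → ℝ} {k l : ℕ} {h t : ℝ}
    (hh : h ≠ 0) (hU : ∀ j ≤ k, ContDiff ℝ l (U j t)) (hr : ContDiff ℝ l (expRem U k h u t))
    {α : Fin d → ℕ} (hα : order α ≤ l) (x : Rd d) :
    multiDeriv α (u t) x = multiDeriv α (U 0 t) x
      + ∑ j ∈ Finset.Icc 1 k, h ^ j / (j.factorial : ℝ) * multiDeriv α (U j t) x
      + h ^ (k + 1) * multiDeriv α (expRem U k h u t) x := by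
  have e : u t = fun x => ∑ j ∈ Finset.range (k + 1), h ^ j / (j.factorial : ℝ) * U j t x
      + h ^ (k + 1) * expRem U k h u t x := by
    funext x
    rw [expRem, ← mul_assoc, ← mul_pow, mul_inv_cancel₀ hh, one_pow, one_mul, add_sub_cancel]
  simp only [multiDeriv_eq_pds]
  have hw : ((wordOf α).length : ℕ∞) ≤ l := by rw [length_wordOf]; exact_mod_cast hα
  have hU' : ∀ j ∈ Finset.range (k + 1), ContDiff ℝ (wordOf α).length (U j t) := fun j hj =>
    (hU j (Nat.lt_succ_iff.1 (Finset.mem_range.1 hj))).of_le (by exact_mod_cast hw)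
  have hr' : ContDiff ℝ (wordOf α).length (expRem U k h u t) := hr.of_le (by exact_mod_cast hw)
  conv_lhs => rw [e]
  rw [pds_add_of_contDiff _ (ContDiff.sum fun j hj => contDiff_const.mul (hU' j hj))
    (contDiff_const.mul hr'), pds_sum_of_contDiff _ _ fun j hj => contDiff_const.mul (hU' j hj),
    pds_const_mul_of_contDiff _ hr']
  simp only
  congr 1
  rw [Finset.sum_range_succ', add_comm, Finset.range_eq_Ico, Finset.sum_Ico_add'
    (fun j => FDExpansion.pds (wordOf α) (fun x => h ^ j / (j.factorial : ℝ) * U j t x) x) 0 k 1]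
  congr 1
  · simp
  · refine Finset.sum_congr rfl fun j hj => ?_
    have hj' : j ∈ Finset.range (k + 1) := by
      rw [Finset.mem_Icc] at hj; exact Finset.mem_range.2 (by omega)
    rw [pds_const_mul_of_contDiff _ (hU' j hj')]

end Expansion


theorem exists_estimate (d m : ℕ) {δ K c₀ τ₀ : ℝ} (A B Mb : ℝ) (hδ : 0 < δ) (hδ1 : δ ≤ 1)
    (hK : 0 ≤ K) (hc₀ : 0 < c₀) (hτ₀ : 0 < τ₀) (hMb : 0 ≤ Mb) :
    ∃ N : ℝ, ∀ n ≤ m, Estimate d τ₀ δ K c₀ A B Mb m n N := by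
  choose N hN0 hN using exists_smooth_estimate d (τ₀ := τ₀) A B Mb hδ hδ1 hK hc₀ hτ₀ hMb
  refine ⟨∑ n ∈ Finset.range (m + 1), N n, fun n hn S τ h hS T F u g D hT hF hg hFb hgb hu hue t =>
    (hN n S τ h m hS hn T F u g D hT hF hg hFb hgb hu hue t).mono le_rfl
      (mul_le_mul_of_nonneg_right ?_ hgb.nonneg)⟩
  exact Finset.single_le_sum (fun i _ => hN0 i) (Finset.mem_range.2 (by omega))

end FDExpansion

theorem theorem1p25p11p08 (d m : ℕ) (hm : 3 ≤ m) (δ K τ₀ c₀ A B : ℝ) (M : Fin (m + 1) → ℝ)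
    (hδ : 0 < δ) (hδ1 : δ ≤ 1) (hK : 1 ≤ K) (hτ₀ : 0 < τ₀) (hc₀ : 0 < c₀) :
    -- the constant depends only on `d, m, δ, K, τ₀, c₀, A = |Λ₁|, B = ‖Λ₁‖, M_0, …, M_m`
    ∃ N : ℝ, ∀ (T h₀ : ℝ) (S : FDExpansion.Scheme d) (τ : FDExpansion.Rd d → ℝ)
      (f : ℝ → FDExpansion.Rd d → ℝ) (g : FDExpansion.Rd d → ℝ),
      0 < T → 0 < h₀ → (0 : FDExpansion.Rd d) ∉ S.Λ₁ →
      S.size = A → S.weightedSize τ = B →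
      (∀ v ∈ S.Λ₁, 0 ≤ τ v) →
      (∀ v ∈ S.Λ₁, ∀ t ∈ Set.Icc 0 T, ∀ x, 0 ≤ S.q v t x) →
      S.RegularData T m M f g →
      (∀ v ∈ S.Λ₁, ∀ h ∈ Set.Ioc 0 h₀, ∀ t ∈ Set.Icc 0 T, ∀ x, 0 ≤ S.chi h v t x) →
      (∀ t ∈ Set.Icc 0 T, ∀ x, ∑ v ∈ S.Λ₁, S.q v t x • v = 0) →
      (∀ t ∈ Set.Icc 0 T, ∀ x, c₀ ≤ S.c t x) →
      S.Structural₁ T h₀ δ K τ τ₀ m →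
      S.Structural₂ T h₀ δ K τ τ₀ m →
      -- `a` is the number of derivatives lost at each step: `u^{(j)} ∈ 𝔅^{m - a j}`
      ∀ k l a : ℕ,
      ((a = 3 ∧ 3 * k + 3 + l ≤ m) ∨
        (a = 2 ∧ 2 * k + 3 + l ≤ m ∧ S.Symm T) ∨
        (a = 2 ∧ Odd k ∧ 2 * k + 2 + l ≤ m ∧ S.Symm T ∧ S.POdd T)) →
      ∃ (u : ℝ → ℝ → FDExpansion.Rd d → ℝ) (U : ℕ → ℝ → FDExpansion.Rd d → ℝ)
        (r : ℝ → ℝ → FDExpansion.Rd d → ℝ),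
        -- `u h = u_h` is the unique bounded solution of the finite difference equation
        (∀ h ∈ Set.Ioc 0 h₀, S.IsFDSolution T h f g (u h) ∧
          ∀ v, S.IsFDSolution T h f g v → ∀ t ∈ Set.Icc 0 T, ∀ x, v t x = u h t x) ∧
        -- `U j = u^{(j)}`, `j ≤ k`, are the unique solutions of the limit equations
        (S.IsCoefficientSystem T f g m a k U ∧
          ∀ V, S.IsCoefficientSystem T f g m a k V →
            ∀ j ≤ k, ∀ t ∈ Set.Icc 0 T, ∀ x, V j t x = U j t x) ∧
        -- all derivatives of order at most `l` below are classical
        (∀ t ∈ Set.Icc 0 T, (∀ j ≤ k, ContDiff ℝ l (U j t)) ∧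
          ∀ h ∈ Set.Ioc 0 h₀, ContDiff ℝ l (u h t) ∧ ContDiff ℝ l (r h t)) ∧
        (∀ α : Fin d → ℕ, FDExpansion.order α ≤ l → ∀ h ∈ Set.Ioc 0 h₀,
          ContinuousOn (fun z : ℝ × FDExpansion.Rd d => FDExpansion.multiDeriv α (u h z.1) z.2)
            (Set.Icc 0 T ×ˢ Set.univ) ∧
          ∀ t ∈ Set.Icc 0 T, ∀ x,
            FDExpansion.multiDeriv α (u h t) x =
              FDExpansion.multiDeriv α (U 0 t) x
              + ∑ j ∈ Finset.Icc 1 k, h ^ j / (j.factorial : ℝ) * FDExpansion.multiDeriv α (U j t) x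
              + h ^ (k + 1) * FDExpansion.multiDeriv α (r h t) x ∧
            |FDExpansion.multiDeriv α (r h t) x| ≤
              N * (FDExpansion.normB T m f + FDExpansion.normB T m (fun _ => g))) ∧
        -- in case (iii) the coefficients with odd index vanish
        (Odd k → 2 * k + 2 + l ≤ m → S.Symm T → S.POdd T →
          ∀ j ≤ k, Odd j → ∀ t ∈ Set.Icc 0 T, ∀ x, U j t x = 0) := by
  set Mb : ℝ := ∑ k, |M k| with hMbdef
  have hMb : 0 ≤ Mb := Finset.sum_nonneg fun _ _ => abs_nonneg _
  obtain ⟨N, hest⟩ := FDExpansion.exists_estimate d m A B Mb hδ hδ1 (zero_le_one.trans hK) hc₀ hτ₀ hMb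
  have hop : 0 ≤ FDExpansion.opBound d m A Mb := FDExpansion.opBound_nonneg hMb
  set X : ℝ := max 1 (max N (N * FDExpansion.opBound d m A Mb)) with hXdef
  have hX : 1 ≤ X := le_max_left _ _
  have hNX : N ≤ X := (le_max_left _ _).trans (le_max_right _ _)
  have hNX' : N * FDExpansion.opBound d m A Mb ≤ X := (le_max_right _ _).trans (le_max_right _ _)
  refine ⟨max N (1 / c₀) * ((m + 1) * (FDExpansion.opBound d m A Mb * FDExpansion.coefBound X m)), ?_⟩
  intro T h₀ S τ f g hT hh₀ _ hA hB _ _ hR hχ hq hc h₁ h₂ k l a hcases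
  have H := hR.roughHyp_clamp (h₀ := h₀) (by omega) hT.le hδ1 (zero_le_one.trans hK) hc₀ hA hB hχ hq hc
    h₁ h₂
  obtain ⟨hpq, -, hfB, hgB, -⟩ := hR
  set D : ℝ := FDExpansion.normB T m f + FDExpansion.normB T m (fun _ => g) with hD
  have hf0 := FDExpansion.normB_nonneg T m f
  have hg0 := FDExpansion.normB_nonneg T m fun _ => g
  have hf : FDExpansion.TB m D fun t => f (FDExpansion.clampT T t) :=
    (hfB.tb_clampT (by omega) hT.le).mono le_rfl (by linarith)
  have hg : FDExpansion.LB m D g :=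
    (hgB.lb (by omega) (Set.left_mem_Icc.2 hT.le)).mono le_rfl (by linarith)
  have hstep : FDExpansion.StepLoss (S.clamp T) a := by
    rcases hcases with ⟨h, -⟩ | ⟨h, -, hS⟩ | ⟨h, -, -, hS, -⟩
    · exact Or.inl h
    · exact Or.inr ⟨h, hS.qEven_clamp hT.le⟩
    · exact Or.inr ⟨h, hS.qEven_clamp hT.le⟩
  have hlm : l + 1 ≤ m := by omega
  have hkm : k ≤ m := by omega
  have hakm : a * k + 1 ≤ m := by
    rcases hcases with ⟨rfl, _⟩ | ⟨rfl, _⟩ | ⟨rfl, _⟩ <;> omega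
  have hord : ∀ j ≤ k, a * j + (l + (k - j + 3)) ≤ m ∨
      (Odd j ∧ (S.clamp T).QEven ∧ (S.clamp T).PAnti) := fun j hj => by
    rcases hcases with ⟨rfl, h⟩ | ⟨rfl, h, -⟩ | ⟨rfl, hk, h, hS, hp⟩
    · left; omega
    · left; omega
    · rcases Nat.lt_or_eq_of_le hj with hlt | rfl
      · left; omega
      · exact Or.inr ⟨hk, hS.qEven_clamp hT.le, hp.pAnti_clamp hT.le⟩
  obtain ⟨U, hU⟩ := H.exists_coef hm hc₀ hh₀ hest hX hNX hNX' hT.le hf hg hstep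
    fun j hj => (hord j hj).imp_left fun h => by omega
  have hsol : ∀ h, ∃ u : ℝ → FDExpansion.Rd d → ℝ, h ∈ Set.Ioc 0 h₀ → FDExpansion.TB m (N * D) u ∧
      ∀ t x, u t x = g x + FDExpansion.tint T (fun s x => (S.clamp T).Lh h s (u s) x
        + f (FDExpansion.clampT T s) x) t x := fun h => by
    by_cases hh : h ∈ Set.Ioc 0 h₀
    · obtain ⟨u, hu⟩ := H.exists_solution hm hc₀ (by omega) (hest m le_rfl) hh hT.le hf hg
      exact ⟨u, fun _ => hu⟩
    · exact ⟨0, fun h => absurd h hh⟩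
  choose u hu using hsol
  have hexp := fun h (hh : h ∈ Set.Ioc 0 h₀) => H.expRem_bound hm hc₀ hest hX hT.le hh hf (hu h hh).1
    (hu h hh).2 hU hlm fun j hj => (hord j hj).imp_right fun h' => (hU j hj).odd h'.2.1 h'.2.2 h'.1
  have hfd := fun h (hh : h ∈ Set.Ioc 0 h₀) =>
    (H.isFDSolution hh.1 hf (hu h hh).1 (hu h hh).2).of_clamp
  have hbd : ∀ ψ : FDExpansion.Rd d → ℝ → FDExpansion.Rd d → ℝ,
      (∀ v ∈ S.Λ₁, FDExpansion.MemB T m (ψ v)) → ∀ v ∈ S.Λ₁, ∀ t ∈ Set.Icc 0 T, ∀ x,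
        |ψ v t x| ≤ ∑ v ∈ S.Λ₁, FDExpansion.normB T m (ψ v) := fun ψ hψ v hv t ht x =>
    (((hψ v hv).lb (by omega) ht).bound x).trans (Finset.single_le_sum
      (f := fun v => FDExpansion.normB T m (ψ v)) (fun _ _ => FDExpansion.normB_nonneg _ _ _) hv)
  refine ⟨u, U, fun h => FDExpansion.expRem U k h (u h), fun h hh => ⟨hfd h hh, fun v hv => ?_⟩,
    FDExpansion.isCoefficientSystem_of_isCoef H (by omega) hc₀ hh₀ hT.le hg hstep hakm hU,
    fun t ht => ⟨fun j hj => (hexp h₀ ⟨hh₀, le_rfl⟩).2.1 j hj t, fun h hh =>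
      ⟨(hexp h hh).1 t, (hexp h hh).2.2.1 t⟩⟩, fun α hα h hh => ⟨?_, fun t ht x => ⟨?_, ?_⟩⟩,
    fun _ _ hS hp j hj hjo t _ x => ?_⟩
  · exact FDExpansion.fd_unique hh.1 hc₀
      (fun v hv t ht x => (hbd S.q (fun v hv => (hpq v hv).2) v hv t ht x).trans (le_max_left _
        (∑ v ∈ S.Λ₁, FDExpansion.normB T m (S.p v))))
      (fun v hv t ht x => (hbd S.p (fun v hv => (hpq v hv).1) v hv t ht x).trans (le_max_right _ _))
      (fun v hv t ht x => hχ v hv h hh t ht x) hc (hfd h hh) hv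
  · obtain ⟨L, hL⟩ := H.abs_sub_le hh.1 hf (hu h hh).1 (hu h hh).2
    simp_rw [FDExpansion.multiDeriv_eq_pds]
    exact ((hu h hh).1.continuous_pds hL _ (by
      rw [FDExpansion.length_wordOf]; omega)).continuousOn
  · exact FDExpansion.multiDeriv_eq_expansion hh.1.ne' (fun j hj => (hexp h hh).2.1 j hj t)
      ((hexp h hh).2.2.1 t) hα x
  · rw [FDExpansion.multiDeriv_eq_pds]
    refine ((hexp h hh).2.2.2 t ht _ (by rwa [FDExpansion.length_wordOf]) x).trans ?_
    have hkm' : (k : ℝ) ≤ m := by exact_mod_cast hkm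
    have hcoef := FDExpansion.coefBound_mono hX hkm
    have hc1 := zero_le_one.trans (FDExpansion.one_le_coefBound hX k)
    have hN0 : 0 ≤ max N (1 / c₀) := le_max_of_le_right (by positivity)
    gcongr
  · rw [(hU j hj).odd (hS.qEven_clamp hT.le) (hp.pAnti_clamp hT.le) hjo]
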